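/- Let $k,M,N$ be positive integers. For $q\ge 1$ let $\sum^{\flat}_{\chi \bmod q}$ denote the sum over the even primitive Dirichlet characters modulo $q$ (the character modulo $1$ counts as primitive), and for $s=(s_1,\dots,s_k)$, $z=(z_1,\dots,z_k)\in\mathbb C^k$ put $$A_{M,N}(s;z;w)=\sum_{q\ge1}\ \sideset{}{^\flat}\sum_{\chi \bmod q}\frac{\overline\chi(M)\chi(N)\prod_{j=1}^k L(s_j,\chi)L(z_j,\overline\chi)}{q^{w}} .$$ For $J,H\subseteq\{1,\dots,k\}$ with $|J|=|H|$ let $\sigma_{J,H}(w)=w+\sum_{j\in J}s_j+\sum_{h\in H}z_h-\frac{|J|}2-\frac{|H|}2$ and let $w_{J,H}=2+|J|-\sum_{j\in J}s_j-\sum_{h\in H}z_h$ be the solution of $\sigma_{J,H}(w)=2$. Let $\mathcal X(s)=\pi^{s-1/2}\,\Gamma(\frac{1-s}2)/\Gamma(\frac s2)$. For $\mathrm{Re}(s_i),\mathrm{Re}(z_j)>1$ let $$B_{M,N}(s;z)=\frac1{2\zeta(2)^2}\sum_{\substack{n_1,\dots,n_k,m_1,\dots,m_k\ge1\\ Nn_1\cdots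 n_k=Mm_1\cdots m_k}}\frac{1}{n_1^{s_1}\cdots n_k^{s_k}m_1^{z_1}\cdots m_k^{z_k}}\prod_{p\mid MNn_1\cdots n_km_1\cdots m_k}\Big(1-\frac1{p^2}\Big)^{-2}\Big(1-\frac1p\Big).$$ Assume that the function $$\prod_{|J|=|H|}\big(\sigma_{J,H}(w)-2\big)\cdot\Big(A_{M,N}(s;z;w)-\prod_{j=1}^k\zeta(s_j)\zeta(z_j)\Big)$$ has a holomorphic continuation $F$, from the domain of absolute convergence of $A_{M,N}$, to a tube domain $V+i\mathbb R^{2k+1}$ ($V\subseteq\mathbb R^{2k+1}$ open and connected) that contains the point $(s,z,w)=(\frac12,\dots,\frac12,2)$, and that $F$ is polynomially bounded in vertical strips there: for every closed box contained in $V$, $|F|$ is bounded, at all points whose real parts lie in the box, by a polynomial in the imaginary parts. By means of $F$, $A_{M,N}$ is continued meromorphically to this tube domain. Then $B_{M,N}$ has a meromorphic continuation to $\mathrm{Re}(s_i),\mathrm{Re}(z_j)>\frac14$ with at most simple poles along the hyperplanes $s_i+z_j=1$, and there are $\eta,\delta>0$ such that the following holds for every smooth compactly supported $g:\mathbb R\to\mathbb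 C$ with Mellin transform $\tilde g(w)=\int_0^\infty g(x)x^{w-1}\,dx$. For $Q>0$ and $|J|=|H|$ write $$\mathcal R_{J,H}(Q;s,z)=Q^{w_{J,H}}\,\tilde g(w_{J,H})\prod_{j\in J}\mathcal X(s_j)\prod_{h\in H}\mathcal X(z_h)\; B_{M,N}\big((S\setminus S_J)\cup Z_H^-;\,(Z\setminus Z_H)\cup S_J^-\big),$$ where $S=\{s_1,\dots,s_k\}$, $Z=\{z_1,\dots,z_k\}$ (multisets), $S_J=\{s_j:j\in J\}$, $S_J^-=\{1-s_j:j\in J\}$, $Z_H=\{z_h:h\in H\}$ and $Z_H^-=\{1-z_h:h\in H\}$. 1. (Residues.) Let $Q>0$ and $|\mathrm{Re}(s_j)-\frac12|,|\mathrm{Re}(z_j)-\frac12|<\eta$ for all $j$. If $|J|=|H|$ and $w_{J,H}\neq w_{J',H'}$ for every other pair with $|J'|=|H'|$, then $$\lim_{w\to w_{J,H}}(w-w_{J,H})\,A_{M,N}(s;z;w)\,\tilde g(w)\,Q^w=\mathcal R_{J,H}(Q;s,z).$$ 2. (Moments.) For every $Q>0$ the sum $\sum_{|J|=|H|}\mathcal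 R_{J,H}(Q;s,z)$, at first defined where $s_i+z_j\ne1$ for all $i,j$ and both the $s_i$ and the $z_j$ are pairwise distinct, extends to a holomorphic function $\mathcal R(Q;s,z)$ of $(s,z)$ on the domain $|\mathrm{Re}(s_j)-\frac12|,|\mathrm{Re}(z_j)-\frac12|<\eta$. For any fixed real $t_1,\dots,t_k,u_1,\dots,u_k$ and $C$, $$\sum_{q\ge1}g\Big(\frac qQ\Big)\ \sideset{}{^\flat}\sum_{\chi \bmod q}\overline\chi(M)\chi(N)\prod_{j=1}^kL(s_j,\chi)L(z_j,\overline\chi)=\mathcal R(Q;s,z)+O\big(Q^{2-\delta}\big)\qquad(Q\to\infty),$$ uniformly over all $s,z$ with $\mathrm{Im}(s_j)=t_j$, $\mathrm{Im}(z_j)=u_j$ and $|\mathrm{Re}(s_j)-\frac12|,|\mathrm{Re}(z_j)-\frac12|\le C/\log Q$; the implied constant may depend on $k,M,N,F,g,t,u,C$, while $\delta$ does not depend on $g,t,u,C$. -/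

import Mathlib

open scoped ContDiff

noncomputable section

namespace UnitaryMDS

/-- Points `(s₁,…,s_k; z₁,…,z_k; w)` of `ℂ^(2k+1)`. -/
abbrev CPoint (k : ℕ) : Type := (Fin k → ℂ) × (Fin k → ℂ) × ℂ

/-- Points of `ℝ^(2k+1)`: real or imaginary parts of a `CPoint`. -/
abbrev RPoint (k : ℕ) : Type := (Fin k → ℝ) × (Fin k → ℝ) × ℝ

def rePt {k : ℕ} (P : CPoint k) : RPoint k :=
  (fun j => (P.1 j).re, fun j => (P.2.1 j).re, P.2.2.re)

def imPt {k : ℕ} (P : CPoint k) : RPoint k :=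
  (fun j => (P.1 j).im, fun j => (P.2.1 j).im, P.2.2.im)

/-- The tube `V + iℝ^(2k+1)`. -/
def tube {k : ℕ} (V : Set (RPoint k)) : Set (CPoint k) := {P | rePt P ∈ V}

/-- The point `(1/2,…,1/2; 1/2,…,1/2; 2)`. -/
def centralPt (k : ℕ) : RPoint k := (fun _ => 1 / 2, fun _ => 1 / 2, 2)

/-- Polynomial boundedness in vertical strips inside the tube over `V`: over every closed box
contained in `V`, the function is bounded by a polynomial in the imaginary parts. -/
def PolyBoundedInStrips {k : ℕ} (V : Set (RPoint k)) (F : CPoint k → ℂ) : Prop :=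
  ∀ a b : RPoint k, Set.Icc a b ⊆ V →
    ∃ (C : ℝ) (n : ℕ), ∀ P : CPoint k, rePt P ∈ Set.Icc a b → ‖F P‖ ≤ C * (1 + ‖imPt P‖) ^ n

/-- The even primitive Dirichlet characters modulo `q` (the trivial character modulo `1` is
primitive). -/
def evenPrimitive (q : ℕ) [NeZero q] : Finset (DirichletCharacter ℂ q) :=
  (Set.toFinite {χ : DirichletCharacter ℂ q | χ.IsPrimitive ∧ χ.Even}).toFinset

/-- `χ̄(M) χ(N) L(s₁,χ)⋯L(s_k,χ) L(z₁,χ̄)⋯L(z_k,χ̄)`; the conjugate character is `χ⁻¹`. -/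
def twistedProduct {k : ℕ} (M N : ℕ) (s z : Fin k → ℂ) {q : ℕ} [NeZero q]
    (χ : DirichletCharacter ℂ q) : ℂ :=
  χ⁻¹ (M : ZMod q) * χ (N : ZMod q) *
    ((∏ j, DirichletCharacter.LFunction χ (s j)) * ∏ j, DirichletCharacter.LFunction χ⁻¹ (z j))

/-- The twisted shifted moment `U_k(Q; S, Z; M, N)`. -/
def moment {k : ℕ} (M N : ℕ) (g : ℝ → ℂ) (Q : ℝ) (s z : Fin k → ℂ) : ℂ :=
  ∑' q : ℕ+, g ((q : ℝ) / Q) * ∑ χ ∈ evenPrimitive q, twistedProduct M N s z χ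

/-- The multiple Dirichlet series `A_{M,N}(s; z; w)`. -/
def mds {k : ℕ} (M N : ℕ) (P : CPoint k) : ℂ :=
  ∑' q : ℕ+, ∑ χ ∈ evenPrimitive q, twistedProduct M N P.1 P.2.1 χ / (q : ℂ) ^ P.2.2

/-- Real points over which the series `A_{M,N}` converges absolutely, whatever the imaginary
parts. -/
def absConvBase (k M N : ℕ) : Set (RPoint k) :=
  {x | ∀ P : CPoint k, rePt P = x → Summable fun q : ℕ+ =>
    ∑ χ ∈ evenPrimitive q, ‖twistedProduct M N P.1 P.2.1 χ / (q : ℂ) ^ P.2.2‖}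

/-- Pairs `(J, H)` of subsets of the index set with `|J| = |H|`. -/
abbrev EqPair (k : ℕ) : Type :=
  {p : Finset (Fin k) × Finset (Fin k) // p.1.card = p.2.card}

/-- `σ_{J,H}(w) = w + ∑_{j∈J} s_j + ∑_{h∈H} z_h - |J|/2 - |H|/2`. -/
def sigma {k : ℕ} (p : EqPair k) (s z : Fin k → ℂ) (w : ℂ) : ℂ :=
  w + ∑ j ∈ p.1.1, s j + ∑ h ∈ p.1.2, z h - (p.1.1.card : ℂ) / 2 - (p.1.2.card : ℂ) / 2

/-- `∏_{|J|=|H|} (σ_{J,H}(w) - 2)`. -/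
def polarFactor {k : ℕ} (s z : Fin k → ℂ) (w : ℂ) : ℂ :=
  ∏ p : EqPair k, (sigma p s z w - 2)

/-- `∏_j ζ(s_j) ζ(z_j)`. -/
def zetaProduct {k : ℕ} (s z : Fin k → ℂ) : ℂ :=
  ∏ j, riemannZeta (s j) * riemannZeta (z j)

/-- `F` is a holomorphic continuation of
`∏_{|J|=|H|} (σ_{J,H}(w) - 2) · (A_{M,N}(s; z; w) - ∏ ζ(s_j) ζ(z_j))`
from the domain of absolute convergence of `A_{M,N}` to the tube domain over `V`, which contains
`(1/2,…,1/2,2)`, and `F` is polynomially bounded in vertical strips there. -/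
structure IsMDSContinuation (k M N : ℕ) (V : Set (RPoint k)) (F : CPoint k → ℂ) : Prop where
  isOpen : IsOpen V
  isConnected : IsConnected V
  central_mem : centralPt k ∈ V
  holomorphic : DifferentiableOn ℂ F (tube V)
  meets : (V ∩ interior (absConvBase k M N)).Nonempty
  agrees : ∀ P ∈ tube (V ∩ interior (absConvBase k M N)),
    F P = polarFactor P.1 P.2.1 P.2.2 * (mds M N P - zetaProduct P.1 P.2.1)
  polyBounded : PolyBoundedInStrips V F

/-- `𝒳(s) = π^(s-1/2) Γ((1-s)/2) / Γ(s/2)`. -/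
def chiFactor (s : ℂ) : ℂ :=
  (Real.pi : ℂ) ^ (s - 1 / 2) * Complex.Gamma ((1 - s) / 2) / Complex.Gamma (s / 2)

/-- The series `B_{M,N}(S, Z)`. -/
def bSeries {k : ℕ} (M N : ℕ) (s z : Fin k → ℂ) : ℂ :=
  1 / (2 * riemannZeta 2 ^ 2) *
    ∑' x : {x : (Fin k → ℕ+) × (Fin k → ℕ+) // N * ∏ j, (x.1 j : ℕ) = M * ∏ j, (x.2 j : ℕ)},
      (∏ j, 1 / ((x.1.1 j : ℂ) ^ s j * (x.1.2 j : ℂ) ^ z j)) *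
        ∏ p ∈ (M * N * (∏ j, (x.1.1 j : ℕ)) * ∏ j, (x.1.2 j : ℕ)).primeFactors,
          ((1 - 1 / (p : ℂ) ^ 2) ^ 2)⁻¹ * (1 - 1 / (p : ℂ))

/-- `B` is the meromorphic continuation of the series `B_{M,N}` to `Re s_i, Re z_j > 1/4`, with
at most simple poles along the hyperplanes `s_i + z_j = 1`. Outside these hyperplanes, the values of
`B` are determined by this property. -/
def IsBContinuation (k M N : ℕ) (B : (Fin k → ℂ) → (Fin k → ℂ) → ℂ) : Prop :=
  (∃ G : (Fin k → ℂ) × (Fin k → ℂ) → ℂ,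
    DifferentiableOn ℂ G {x | (∀ i, 1 / 4 < (x.1 i).re) ∧ ∀ j, 1 / 4 < (x.2 j).re} ∧
    ∀ s z : Fin k → ℂ, (∀ i, 1 / 4 < (s i).re) → (∀ j, 1 / 4 < (z j).re) →
      (∀ i j, s i + z j ≠ 1) → B s z = G (s, z) / ∏ i, ∏ j, (s i + z j - 1)) ∧
  ∀ s z : Fin k → ℂ, (∀ i, 1 < (s i).re) → (∀ j, 1 < (z j).re) → B s z = bSeries M N s z

/-- The increasing bijection from `J` to `H`. It only serves to write the multisets below as
`k`-tuples; `B_{M,N}` is symmetric in each of its two groups of variables. -/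
def pairing {k : ℕ} (p : EqPair k) : p.1.1 ≃ p.1.2 :=
  (p.1.1.orderIsoOfFin rfl).symm.toEquiv.trans (p.1.2.orderIsoOfFin p.2.symm).toEquiv

/-- `(S \ S_J) ∪ Z_H⁻` as a `k`-tuple. -/
def swapS {k : ℕ} (p : EqPair k) (s z : Fin k → ℂ) : Fin k → ℂ :=
  fun i => if hi : i ∈ p.1.1 then 1 - z (pairing p ⟨i, hi⟩) else s i

/-- `(Z \ Z_H) ∪ S_J⁻` as a `k`-tuple. -/
def swapZ {k : ℕ} (p : EqPair k) (s z : Fin k → ℂ) : Fin k → ℂ :=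
  fun i => if hi : i ∈ p.1.2 then 1 - s ((pairing p).symm ⟨i, hi⟩) else z i

/-- The solution `w = 2 + ℓ - ∑_{j∈J} s_j - ∑_{h∈H} z_h` of `σ_{J,H}(w) = 2`, `ℓ = |J| = |H|`. -/
def polePt {k : ℕ} (p : EqPair k) (s z : Fin k → ℂ) : ℂ :=
  2 + (p.1.1.card : ℂ) - ∑ j ∈ p.1.1, s j - ∑ h ∈ p.1.2, z h

/-- The term of the recipe prediction that belongs to `(J, H)`. -/
def recipeTerm {k : ℕ} (B : (Fin k → ℂ) → (Fin k → ℂ) → ℂ) (g : ℝ → ℂ) (Q : ℝ)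
    (s z : Fin k → ℂ) (p : EqPair k) : ℂ :=
  (Q : ℂ) ^ polePt p s z * mellin g (polePt p s z) *
    ((∏ j ∈ p.1.1, chiFactor (s j)) * ∏ h ∈ p.1.2, chiFactor (z h)) *
    B (swapS p s z) (swapZ p s z)

/-- The integrand `A_{M,N}(s; z; w) g̃(w) Q^w`, with `A_{M,N}` continued through `F`. -/
def continuedIntegrand {k : ℕ} (F : CPoint k → ℂ) (g : ℝ → ℂ) (Q : ℝ) (s z : Fin k → ℂ)
    (w : ℂ) : ℂ :=
  (F (s, z, w) / polarFactor s z w + zetaProduct s z) * mellin g w * (Q : ℂ) ^ w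

/-- The tube `|Re s_j - 1/2| < η`, `|Re z_j - 1/2| < η`. -/
def centralTube (k : ℕ) (η : ℝ) : Set ((Fin k → ℂ) × (Fin k → ℂ)) :=
  {x | (∀ j, |(x.1 j).re - 1 / 2| < η) ∧ ∀ j, |(x.2 j).re - 1 / 2| < η}

/-- No term of the recipe prediction has a pole at `(s, z)`. -/
def NoPolarTerm {k : ℕ} (s z : Fin k → ℂ) : Prop :=
  (∀ i j, s i + z j ≠ 1) ∧ Function.Injective s ∧ Function.Injective z

/-- `R Q` is, for each `Q > 0`, the holomorphic function on the tube
`|Re s_j - 1/2|, |Re z_j - 1/2| < η` given by the sum of all recipe terms. The single terms have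
poles that cancel in the sum. -/
def IsRecipeSum {k : ℕ} (B : (Fin k → ℂ) → (Fin k → ℂ) → ℂ) (g : ℝ → ℂ) (η : ℝ)
    (R : ℝ → (Fin k → ℂ) × (Fin k → ℂ) → ℂ) : Prop :=
  ∀ Q : ℝ, 0 < Q → DifferentiableOn ℂ (R Q) (centralTube k η) ∧
    ∀ s z : Fin k → ℂ, (s, z) ∈ centralTube k η → NoPolarTerm s z →
      R Q (s, z) = ∑ p : EqPair k, recipeTerm B g Q s z p

end UnitaryMDS

end

open scoped ContDiff

noncomputable section

namespace UnitaryMDS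

open MeasureTheory Filter Topology Set Metric

section

/-! ### Holomorphic functions on normed spaces -/

section Holomorphic

variable {E : Type*} [NormedAddCommGroup E] [NormedSpace ℂ E]

/-- Cauchy's estimate for the Fréchet derivative. -/
lemma norm_fderiv_le_of_norm_le_on_ball {f : E → ℂ} {x : E} {r C : ℝ} (hr : 0 < r)
    (hf : DifferentiableOn ℂ f (ball x r)) (hC : ∀ y ∈ ball x r, ‖f y‖ ≤ C) :
    ‖fderiv ℂ f x‖ ≤ 2 * C / r := by
  refine Complex.norm_fderiv_le_div_of_mapsTo_ball hf (fun y hy => ?_) hr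
  rw [mem_closedBall, dist_eq_norm]
  calc ‖f y - f x‖ ≤ ‖f y‖ + ‖f x‖ := norm_sub_le _ _
    _ ≤ C + C := add_le_add (hC y hy) (hC x (mem_ball_self hr))
    _ = 2 * C := by ring

/-- A uniform limit of holomorphic functions on a ball of a normed space is differentiable at the
centre. -/
lemma differentiableAt_of_tendstoUniformlyOn_ball {ι : Type*} {l : Filter ι} [l.NeBot]
    {f : ι → E → ℂ} {g : E → ℂ} {x : E} {r : ℝ} (hr : 0 < r)
    (hf : ∀ n, DifferentiableOn ℂ (f n) (ball x r))
    (hlim : TendstoUniformlyOn f g l (ball x r)) : DifferentiableAt ℂ g x := by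
  have hr2 : 0 < r / 2 := by positivity
  have hsub : ∀ y ∈ ball x (r / 2), ball y (r / 2) ⊆ ball x r := fun y hy =>
    ball_subset_ball' (by rw [mem_ball] at hy; linarith)
  have hmem : ∀ y ∈ ball x (r / 2), y ∈ ball x r := fun y hy =>
    ball_subset_ball (by linarith) hy
  have hd : ∀ n, ∀ y ∈ ball x (r / 2), DifferentiableAt ℂ (f n) y := fun n y hy =>
    (hf n y (hmem y hy)).differentiableAt (isOpen_ball.mem_nhds (hmem y hy))
  have hC : UniformCauchySeqOn (fun n => fderiv ℂ (f n)) l (ball x (r / 2)) := by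
    have h1 := hlim.uniformCauchySeqOn
    intro u hu
    obtain ⟨ε, hε, hεu⟩ := Metric.mem_uniformity_dist.1 hu
    filter_upwards [h1 _ (Metric.dist_mem_uniformity (ε := ε * r / 8) (by positivity))]
      with m hm y hy
    refine hεu ?_
    have : ‖fderiv ℂ (f m.1 - f m.2) y‖ ≤ 2 * (ε * r / 8) / (r / 2) := by
      refine norm_fderiv_le_of_norm_le_on_ball hr2
        (((hf m.1).sub (hf m.2)).mono (hsub y hy)) fun v hv => ?_
      have := hm v (hsub y hy hv)
      rw [dist_eq_norm] at this
      exact this.le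
    rw [fderiv_sub (hd m.1 y hy) (hd m.2 y hy)] at this
    rw [dist_eq_norm]
    calc _ ≤ _ := this
      _ = ε / 2 := by field_simp; ring
      _ < ε := by linarith
  have hlim' : ∀ y ∈ ball x (r / 2), ∃ v, Tendsto (fun n => fderiv ℂ (f n) y) l (𝓝 v) :=
    fun y hy => CompleteSpace.complete (hC.cauchy_map hy)
  choose! g' hg' using hlim'
  have hU := hC.tendstoUniformlyOn_of_tendsto hg'
  exact (hasFDerivAt_of_tendstoUniformlyOn isOpen_ball hU (fun n y hy => (hd n y hy).hasFDerivAt)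
    (fun y hy => hlim.tendsto_at (hmem y hy)) (mem_ball_self hr2)).differentiableAt

/-- Holomorphic dependence of an integral on a parameter. -/
lemma differentiableAt_integral_of_dominated [FiniteDimensional ℂ E] {α : Type*}
    [MeasurableSpace α] {μ : Measure α} {f : E → α → ℂ} {x : E} {r : ℝ} {bound : α → ℝ}
    (hr : 0 < r) (hmeas : ∀ y ∈ ball x r, AEStronglyMeasurable (f y) μ)
    (hf : ∀ a, DifferentiableOn ℂ (fun y => f y a) (ball x r))
    (hb : ∀ y ∈ ball x r, ∀ a, ‖f y a‖ ≤ bound a) (hbi : Integrable bound μ) :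
    DifferentiableAt ℂ (fun y => ∫ a, f y a ∂μ) x := by
  have hr2 : 0 < r / 2 := by positivity
  have hmem : ∀ y ∈ ball x (r / 2), y ∈ ball x r := fun y hy =>
    ball_subset_ball (by linarith) hy
  have hd : ∀ a, ∀ y ∈ ball x (r / 2), DifferentiableAt ℂ (fun y => f y a) y := fun a y hy =>
    (hf a y (hmem y hy)).differentiableAt (isOpen_ball.mem_nhds (hmem y hy))
  have hx2 : x ∈ ball x (r / 2) := mem_ball_self hr2
  have hdir : ∀ v : E, AEStronglyMeasurable (fun a => fderiv ℂ (fun y => f y a) x v) μ := by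
    intro v
    set K : ℝ := ‖v‖ / r + 1 with hK
    have hK0 : 0 < K := by positivity
    have hpos : ∀ n : ℕ, 0 < (n : ℝ) + K := fun n => by positivity
    have hnorm : ∀ n : ℕ, ‖((n + K : ℝ) : ℂ)‖ = n + K := fun n => by
      rw [Complex.norm_real, Real.norm_of_nonneg (hpos n).le]
    refine aestronglyMeasurable_of_tendsto_ae atTop
      (f := fun (n : ℕ) a => ((n + K : ℝ) : ℂ) • (f (x + ((n + K : ℝ) : ℂ)⁻¹ • v) a - f x a))
      (fun n => ?_) (ae_of_all _ fun a => ?_)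
    · refine ((hmeas _ ?_).sub (hmeas x (mem_ball_self hr))).const_smul ((n + K : ℝ) : ℂ)
      rw [mem_ball, dist_eq_norm, add_sub_cancel_left, norm_smul, norm_inv, hnorm,
        inv_mul_lt_iff₀ (hpos n)]
      have h1 : ‖v‖ = (‖v‖ / r) * r := by field_simp
      have h2 : (0 : ℝ) ≤ n := by positivity
      nlinarith
    · refine (hd a x hx2).hasFDerivAt.lim v (c := fun n : ℕ => ((n + K : ℝ) : ℂ)) ?_
      simp_rw [hnorm]
      exact tendsto_atTop_add_const_right _ _ tendsto_natCast_atTop_atTop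
  have hsum : ∀ a, fderiv ℂ (fun y => f y a) x = ∑ i, (fderiv ℂ (fun y => f y a) x
      (Module.finBasis ℂ E i)) • (LinearMap.toContinuousLinearMap ((Module.finBasis ℂ E).coord i)) := by
    intro a
    ext v
    conv_lhs => rw [← (Module.finBasis ℂ E).sum_repr v, map_sum]
    simp [mul_comm]
  have hm' : AEStronglyMeasurable (fun a => fderiv ℂ (fun y => f y a) x) μ := by
    rw [funext hsum]
    exact Finset.aestronglyMeasurable_fun_sum _ fun i _ => (hdir _).smul_const _
  refine (hasFDerivAt_integral_of_dominated_of_fderiv_le (𝕜 := ℂ) (s := ball x (r / 2))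
    (F' := fun y a => fderiv ℂ (fun y => f y a) y) (bound := fun a => 2 * bound a / (r / 2))
    (isOpen_ball.mem_nhds hx2) ?_ ?_ hm' ?_ ?_ ?_).differentiableAt
  · filter_upwards [isOpen_ball.mem_nhds (mem_ball_self hr)] with y hy using hmeas y hy
  · exact hbi.mono' (hmeas x (mem_ball_self hr)) (ae_of_all _ (hb x (mem_ball_self hr)))
  · refine ae_of_all _ fun a y hy => ?_
    have hsub : ball y (r / 2) ⊆ ball x r :=
      ball_subset_ball' (by rw [mem_ball] at hy; linarith)
    exact norm_fderiv_le_of_norm_le_on_ball hr2 ((hf a).mono hsub)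
      fun v hv => hb v (hsub hv) a
  · exact (hbi.const_mul 2).div_const _
  · exact ae_of_all _ fun a y hy => (hd a y hy).hasFDerivAt

end Holomorphic

end

section

/-! ### The two-sided Laplace transform and vertical line integrals -/

/-- The two-sided Laplace transform `∫ h(u) e^(wu) du`. -/
def laplace (h : ℝ → ℂ) (w : ℂ) : ℂ := ∫ u : ℝ, h u * Complex.exp (w * u)

/-- The normalized integral `(1/2π) ∫ f(c + it) dt` over a vertical line. -/
def vline (c : ℝ) (f : ℂ → ℂ) : ℂ := (1 / (2 * Real.pi) : ℂ) * ∫ t : ℝ, f (c + t * Complex.I)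

/-- Smooth functions on `ℝ` that vanish for large arguments and all of whose derivatives are
`O(e^(-bu))`. -/
structure Tame (b : ℝ) (h : ℝ → ℂ) : Prop where
  smooth : ContDiff ℝ ∞ h
  vanish : ∃ U : ℝ, ∀ u, U < u → h u = 0
  bound : ∀ j : ℕ, ∃ C : ℝ, ∀ u, ‖iteratedDeriv j h u‖ ≤ C * Real.exp (-b * u)

namespace Tame

variable {b : ℝ} {h h₁ h₂ : ℝ → ℂ}

lemma iteratedDeriv_eq_zero {U : ℝ} (hU : ∀ u, U < u → h u = 0) (j : ℕ) {u : ℝ} (hu : U < u) :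
    iteratedDeriv j h u = 0 := by
  have : h =ᶠ[𝓝 u] fun _ => 0 := by
    filter_upwards [isOpen_Ioi.mem_nhds hu] with v hv using hU v hv
  rw [this.iteratedDeriv_eq j]
  simp

lemma contDiff_nat (hh : Tame b h) (n : ℕ) : ContDiff ℝ n h := contDiff_infty.1 hh.smooth n

lemma deriv (hh : Tame b h) : Tame b (deriv h) where
  smooth := (contDiff_infty_iff_deriv.1 hh.smooth).2
  vanish := by
    obtain ⟨U, hU⟩ := hh.vanish
    exact ⟨U, fun u hu => by simpa using iteratedDeriv_eq_zero hU 1 hu⟩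
  bound j := by
    obtain ⟨C, hC⟩ := hh.bound (j + 1)
    exact ⟨C, fun u => by simpa [iteratedDeriv_succ'] using hC u⟩

lemma iteratedDeriv (hh : Tame b h) (j : ℕ) : Tame b (iteratedDeriv j h) := by
  induction j with
  | zero => simpa using hh
  | succ n ih => rw [iteratedDeriv_succ]; exact ih.deriv

lemma add (hh₁ : Tame b h₁) (hh₂ : Tame b h₂) : Tame b (h₁ + h₂) where
  smooth := hh₁.smooth.add hh₂.smooth
  vanish := by
    obtain ⟨U, hU⟩ := hh₁.vanish
    obtain ⟨U', hU'⟩ := hh₂.vanish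
    exact ⟨max U U', fun u hu => by
      simp [hU u ((le_max_left _ _).trans_lt hu), hU' u ((le_max_right _ _).trans_lt hu)]⟩
  bound j := by
    obtain ⟨C, hC⟩ := hh₁.bound j
    obtain ⟨C', hC'⟩ := hh₂.bound j
    refine ⟨C + C', fun u => ?_⟩
    rw [iteratedDeriv_add (hh₁.contDiff_nat j).contDiffAt (hh₂.contDiff_nat j).contDiffAt]
    calc _ ≤ _ := norm_add_le _ _
      _ ≤ _ := add_le_add (hC u) (hC' u)
      _ = _ := by ring

lemma const_smul (hh : Tame b h) (a : ℂ) : Tame b (a • h) where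
  smooth := hh.smooth.const_smul a
  vanish := by
    obtain ⟨U, hU⟩ := hh.vanish
    exact ⟨U, fun u hu => by simp [hU u hu]⟩
  bound j := by
    obtain ⟨C, hC⟩ := hh.bound j
    refine ⟨‖a‖ * C, fun u => ?_⟩
    rw [iteratedDeriv_const_smul (hh.contDiff_nat j).contDiffAt, norm_smul, mul_assoc]
    exact mul_le_mul_of_nonneg_left (hC u) (norm_nonneg _)

lemma zero : Tame b 0 where
  smooth := contDiff_const
  vanish := ⟨0, fun _ _ => rfl⟩
  bound j := ⟨0, fun u => by
    simp [iteratedDeriv_const_zero]⟩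

lemma sum {ι : Type*} (s : Finset ι) {h : ι → ℝ → ℂ} (hh : ∀ i ∈ s, Tame b (h i)) :
    Tame b (∑ i ∈ s, h i) :=
  Finset.sum_induction _ (Tame b) (fun _ _ => Tame.add) zero hh

lemma mono {b' : ℝ} (hb : b ≤ b') (hh : Tame b h) : Tame b' h where
  smooth := hh.smooth
  vanish := hh.vanish
  bound j := by
    obtain ⟨U, hU⟩ := hh.vanish
    obtain ⟨C, hC⟩ := hh.bound j
    have hC0 : 0 ≤ C := by
      have := (norm_nonneg _).trans (hC 0)
      simpa using this
    refine ⟨C * Real.exp ((b' - b) * U), fun u => ?_⟩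
    rcases lt_or_ge U u with hu | hu
    · rw [iteratedDeriv_eq_zero hU j hu, norm_zero]; positivity
    · refine (hC u).trans ?_
      rw [mul_assoc, ← Real.exp_add]
      gcongr
      nlinarith

/-- Smooth functions with compact support are tame for every exponent. -/
lemma of_hasCompactSupport (hs : ContDiff ℝ ∞ h) (hc : HasCompactSupport h) (b : ℝ) : Tame b h where
  smooth := hs
  vanish := by
    obtain ⟨U, hU⟩ := hc.isCompact.bddAbove
    refine ⟨U, fun u hu => ?_⟩
    by_contra hne
    exact absurd (hU (subset_tsupport h hne)) (not_le.2 hu)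
  bound j := by
    have hcont : Continuous fun u => _root_.iteratedDeriv j h u * Complex.exp (b * u) := by
      have := hs.continuous_iteratedDeriv j (by exact_mod_cast le_top)
      fun_prop
    have hcs : HasCompactSupport fun u => _root_.iteratedDeriv j h u * Complex.exp (b * u) := by
      refine HasCompactSupport.mul_right ?_
      clear hcont
      induction j with
      | zero => simpa using hc
      | succ n ih => rw [iteratedDeriv_succ]; exact ih.deriv
    obtain ⟨C, hC⟩ := hcont.bounded_above_of_compact_support hcs
    refine ⟨C, fun u => ?_⟩
    have := hC u
    rw [norm_mul, Complex.norm_exp] at this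
    rw [neg_mul, Real.exp_neg, ← div_eq_mul_inv, le_div_iff₀ (Real.exp_pos _)]
    simpa using this

lemma continuous (hh : Tame b h) : Continuous h := hh.smooth.continuous

lemma norm_mul_exp_le (hh : Tame b h) {c : ℝ} (hc : b < c) (c' : ℝ) :
    ∃ bd : ℝ → ℝ, Integrable bd ∧ ∀ w : ℂ, c ≤ w.re → w.re ≤ c' → ∀ u : ℝ,
      ‖h u * Complex.exp (w * u)‖ ≤ bd u := by
  obtain ⟨U, hU⟩ := hh.vanish
  obtain ⟨C, hC⟩ := hh.bound 0
  have hC0 : 0 ≤ C := by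
    have := (norm_nonneg _).trans (hC 0)
    simpa using this
  refine ⟨(Iic U).indicator fun u => C * Real.exp ((c' - c) * |U|) * Real.exp ((c - b) * u), ?_,
    fun w hw hw' u => ?_⟩
  · rw [integrable_indicator_iff measurableSet_Iic]
    exact (integrableOn_exp_mul_Iic (by linarith) U).const_mul _
  · rcases lt_or_ge U u with hu | hu
    · rw [hU u hu, zero_mul, norm_zero]
      exact indicator_nonneg (fun _ _ => by positivity) _
    · rw [indicator_of_mem (show u ∈ Iic U from hu), norm_mul, Complex.norm_exp]
      have h1 := hC u
      rw [iteratedDeriv_zero] at h1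
      calc ‖h u‖ * Real.exp (w * u).re ≤ C * Real.exp (-b * u) * Real.exp (w * u).re := by gcongr
        _ = C * Real.exp ((w.re - c) * u + (c - b) * u) := by
          rw [mul_assoc, ← Real.exp_add]; congr 2; simp; ring
        _ ≤ C * Real.exp ((c' - c) * |U| + (c - b) * u) := by
          have : (w.re - c) * u ≤ (c' - c) * |U| := calc
            (w.re - c) * u ≤ (w.re - c) * |U| := by
                have : u ≤ |U| := hu.trans (le_abs_self U)
                exact mul_le_mul_of_nonneg_left this (by linarith)
            _ ≤ (c' - c) * |U| := by
                exact mul_le_mul_of_nonneg_right (by linarith) (abs_nonneg _)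
          gcongr
        _ = _ := by rw [Real.exp_add]; ring

lemma integrable (hh : Tame b h) {w : ℂ} (hw : b < w.re) :
    Integrable fun u : ℝ => h u * Complex.exp (w * u) := by
  obtain ⟨bd, hbd, hle⟩ := hh.norm_mul_exp_le hw w.re
  refine hbd.mono' ?_ (ae_of_all _ (hle w le_rfl le_rfl))
  have := hh.continuous
  exact (by fun_prop : Continuous _).aestronglyMeasurable

lemma laplace_deriv (hh : Tame b h) {w : ℂ} (hw : b < w.re) :
    laplace (_root_.deriv h) w = -w * laplace h w := by
  have hd : ∀ u, HasDerivAt h (_root_.deriv h u) u := fun u =>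
    ((hh.contDiff_nat 1).differentiable (by simp) u).hasDerivAt
  have he : ∀ u : ℝ, HasDerivAt (fun u : ℝ => Complex.exp (w * u)) (w * Complex.exp (w * u)) u := by
    intro u
    have := ((Complex.ofRealCLM.hasDerivAt (x := u)).const_mul w).cexp
    simpa [mul_comm] using this
  have h1 := hh.deriv.integrable hw
  have h2 := hh.integrable hw
  have := integral_mul_deriv_eq_deriv_mul_of_integrable (u := h)
    (v := fun u : ℝ => Complex.exp (w * u)) (fun x _ => hd x) (fun x _ => he x)
    ?_ (by simpa [Pi.mul_def] using h1) (by simpa [Pi.mul_def] using h2)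
  · unfold laplace
    rw [eq_neg_iff_add_eq_zero, add_comm, ← eq_neg_iff_add_eq_zero] at this
    rw [this, neg_mul, ← integral_const_mul]
    congr 1
    refine integral_congr_ae (ae_of_all _ fun u => ?_)
    simp only []
    ring
  · refine (h2.const_mul w).congr (ae_of_all _ fun u => ?_)
    simp only [Pi.mul_apply]
    ring

lemma laplace_iteratedDeriv (hh : Tame b h) {w : ℂ} (hw : b < w.re) (j : ℕ) :
    laplace (_root_.iteratedDeriv j h) w = (-w) ^ j * laplace h w := by
  induction j with
  | zero => simp
  | succ n ih => rw [iteratedDeriv_succ, (hh.iteratedDeriv n).laplace_deriv hw, ih]; ring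

lemma norm_laplace_le (hh : Tame b h) {c : ℝ} (hc : b < c) (c' : ℝ) :
    ∃ C : ℝ, 0 ≤ C ∧ ∀ w : ℂ, c ≤ w.re → w.re ≤ c' → ‖laplace h w‖ ≤ C := by
  obtain ⟨bd, hbd, hle⟩ := hh.norm_mul_exp_le hc c'
  refine ⟨|∫ u, bd u|, abs_nonneg _, fun w hw hw' => ?_⟩
  exact (norm_integral_le_of_norm_le hbd (ae_of_all _ (hle w hw hw'))).trans (le_abs_self _)

lemma one_add_pow_le (x : ℝ) (hx : 0 ≤ x) (n : ℕ) : (1 + x) ^ n ≤ 2 ^ n * (1 + x ^ n) := by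
  rcases le_total x 1 with h | h
  · calc (1 + x) ^ n ≤ 2 ^ n := by gcongr; linarith
      _ ≤ 2 ^ n * (1 + x ^ n) := le_mul_of_one_le_right (by positivity) (by
          have : 0 ≤ x ^ n := by positivity
          linarith)
  · calc (1 + x) ^ n ≤ (2 * x) ^ n := by gcongr; linarith
      _ = 2 ^ n * x ^ n := mul_pow _ _ _
      _ ≤ _ := by gcongr; linarith

/-- Laplace transforms of tame functions decay faster than any polynomial in vertical strips. -/
lemma laplace_decay (hh : Tame b h) {c : ℝ} (hc : b < c) (c' : ℝ) (n : ℕ) :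
    ∃ C : ℝ, 0 ≤ C ∧ ∀ w : ℂ, c ≤ w.re → w.re ≤ c' →
      (1 + |w.im|) ^ n * ‖laplace h w‖ ≤ C := by
  obtain ⟨C₀, hC₀, h₀⟩ := hh.norm_laplace_le hc c'
  obtain ⟨C₁, hC₁, h₁⟩ := (hh.iteratedDeriv n).norm_laplace_le hc c'
  refine ⟨2 ^ n * (C₀ + C₁), by positivity, fun w hw hw' => ?_⟩
  have h2 : |w.im| ^ n * ‖laplace h w‖ ≤ C₁ := by
    refine le_trans ?_ (h₁ w hw hw')
    rw [hh.laplace_iteratedDeriv (hc.trans_le hw), norm_mul, norm_pow, norm_neg]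
    gcongr
    exact Complex.abs_im_le_norm w
  calc _ ≤ 2 ^ n * (1 + |w.im| ^ n) * ‖laplace h w‖ := by
        gcongr; exact one_add_pow_le _ (abs_nonneg _) n
    _ = 2 ^ n * (‖laplace h w‖ + |w.im| ^ n * ‖laplace h w‖) := by ring
    _ ≤ _ := by gcongr; exact h₀ w hw hw'

lemma differentiableAt_laplace (hh : Tame b h) {w : ℂ} (hw : b < w.re) :
    DifferentiableAt ℂ (laplace h) w := by
  set r := (w.re - b) / 2 with hr
  have hr0 : 0 < r := by rw [hr]; linarith
  obtain ⟨bd, hbd, hle⟩ := hh.norm_mul_exp_le (c := b + r) (by linarith) (w.re + r)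
  have hre : ∀ y ∈ ball w r, b + r ≤ y.re ∧ y.re ≤ w.re + r := by
    intro y hy
    rw [mem_ball, dist_eq_norm] at hy
    have := (Complex.abs_re_le_norm (y - w)).trans_lt hy
    rw [Complex.sub_re, abs_lt] at this
    constructor <;> linarith
  refine differentiableAt_integral_of_dominated hr0 (fun y hy => ?_) (fun u => ?_)
    (fun y hy u => hle y (hre y hy).1 (hre y hy).2 u) hbd
  · exact (hh.integrable (by linarith [(hre y hy).1])).aestronglyMeasurable
  · fun_prop

end Tame

end

section

/-- `f` is `O(1/(1 + t²))` on the closed vertical strip `c₁ ≤ Re w ≤ c₂`. -/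
def StripDecay (c₁ c₂ : ℝ) (f : ℂ → ℂ) : Prop :=
  ∃ C : ℝ, ∀ w : ℂ, c₁ ≤ w.re → w.re ≤ c₂ → ‖f w‖ ≤ C * (1 + w.im ^ 2)⁻¹

/-- `f` is holomorphic at every point of the closed vertical strip `c₁ ≤ Re w ≤ c₂`. -/
def StripHolo (c₁ c₂ : ℝ) (f : ℂ → ℂ) : Prop :=
  ∀ w : ℂ, c₁ ≤ w.re → w.re ≤ c₂ → DifferentiableAt ℂ f w

section Strip

variable {c₁ c₂ : ℝ} {f : ℂ → ℂ}

lemma StripHolo.continuous_line (hf : StripHolo c₁ c₂ f) {c : ℝ} (h₁ : c₁ ≤ c) (h₂ : c ≤ c₂) :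
    Continuous fun t : ℝ => f (c + t * Complex.I) := by
  rw [continuous_iff_continuousAt]
  intro t
  have : ContinuousAt f (c + t * Complex.I) := (hf _ (by simpa) (by simpa)).continuousAt
  exact ContinuousAt.comp (f := fun t : ℝ => (c + t * Complex.I : ℂ)) this (by fun_prop)

lemma StripDecay.integrable_line (hd : StripDecay c₁ c₂ f) (hf : StripHolo c₁ c₂ f) {c : ℝ}
    (h₁ : c₁ ≤ c) (h₂ : c ≤ c₂) : Integrable fun t : ℝ => f (c + t * Complex.I) := by
  obtain ⟨C, hC⟩ := hd
  refine (integrable_inv_one_add_sq.const_mul C).mono'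
    (hf.continuous_line h₁ h₂).aestronglyMeasurable (ae_of_all _ fun t => ?_)
  simpa using hC (c + t * Complex.I) (by simpa) (by simpa)

/-- Vertical contours may be moved inside a strip of holomorphy and decay. -/
lemma vline_eq_vline (hc : c₁ ≤ c₂) (hf : StripHolo c₁ c₂ f) (hd : StripDecay c₁ c₂ f) :
    vline c₁ f = vline c₂ f := by
  have hi₁ := hd.integrable_line hf le_rfl hc
  have hi₂ := hd.integrable_line hf hc le_rfl
  obtain ⟨C, hC⟩ := hd
  have hv : ∀ {c : ℝ}, Integrable (fun t : ℝ => f (c + t * Complex.I)) →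
      Tendsto (fun T : ℝ => ∫ y in (-T)..T, f (c + y * Complex.I)) atTop
        (𝓝 (∫ t : ℝ, f (c + t * Complex.I))) := fun hi =>
    intervalIntegral_tendsto_integral hi tendsto_neg_atTop_atBot tendsto_id
  have hC0 : Tendsto (fun T : ℝ => C * (1 + T ^ 2)⁻¹ * |c₂ - c₁|) atTop (𝓝 0) := by
    have : Tendsto (fun T : ℝ => (1 + T ^ 2)⁻¹) atTop (𝓝 0) :=
      tendsto_inv_atTop_zero.comp
        (tendsto_atTop_add_const_left _ _ (tendsto_pow_atTop two_ne_zero))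
    simpa using (this.const_mul C).mul_const |c₂ - c₁|
  have hh : ∀ σ : ℝ, (σ = 1 ∨ σ = -1) →
      Tendsto (fun T : ℝ => ∫ x in c₁..c₂, f (x + (σ * T : ℝ) * Complex.I)) atTop (𝓝 0) := by
    intro σ hσ
    refine squeeze_zero_norm (fun T => ?_) hC0
    refine intervalIntegral.norm_integral_le_of_norm_le_const fun x hx => ?_
    rw [uIoc_of_le hc] at hx
    have := hC (x + (σ * T : ℝ) * Complex.I) (by simpa using hx.1.le) (by simpa using hx.2)
    rcases hσ with rfl | rfl <;> simpa using this
  have hzero : ∀ T : ℝ, ((∫ x in c₁..c₂, f (x + (-1 * T : ℝ) * Complex.I)) -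
      ∫ x in c₁..c₂, f (x + (1 * T : ℝ) * Complex.I)) +
      Complex.I * (∫ y in (-T)..T, f (c₂ + y * Complex.I)) -
      Complex.I * (∫ y in (-T)..T, f (c₁ + y * Complex.I)) = 0 := by
    intro T
    have := Complex.integral_boundary_rect_eq_zero_of_differentiableOn f
      (c₁ - T * Complex.I) (c₂ + T * Complex.I) ?_
    · simpa using this
    · intro w hw
      rw [Complex.mem_reProdIm] at hw
      have h1 := hw.1
      simp only [Complex.sub_re, Complex.ofReal_re, Complex.mul_re, Complex.I_re, mul_zero,
        Complex.ofReal_im, Complex.I_im, mul_one, sub_self, sub_zero, Complex.add_re,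
        add_zero, uIcc_of_le hc] at h1
      exact (hf w h1.1 h1.2).differentiableWithinAt
  have hlim := (((hh (-1) (.inr rfl)).sub (hh 1 (.inl rfl))).add ((hv hi₂).const_mul Complex.I)).sub
    ((hv hi₁).const_mul Complex.I)
  simp_rw [hzero] at hlim
  have h0 := tendsto_nhds_unique hlim tendsto_const_nhds
  rw [sub_zero, zero_add, ← mul_sub, mul_eq_zero, or_iff_right Complex.I_ne_zero,
    sub_eq_zero] at h0
  rw [vline, vline, h0]

lemma fourier_line (c u : ℝ) (f : ℂ → ℂ) :
    vline c (fun w => f w * Complex.exp (-(w * u))) = (1 / (2 * Real.pi) : ℂ) *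
      (Complex.exp (-(c * u)) *
        FourierTransform.fourier (fun t : ℝ => f (c + t * Complex.I)) (u / (2 * Real.pi))) := by
  rw [vline, Real.fourier_eq', ← integral_const_mul (Complex.exp (-(c * u)))]
  congr 1
  refine integral_congr_ae (ae_of_all _ fun t => ?_)
  simp only []
  have hpi : (Real.pi : ℂ) ≠ 0 := by exact_mod_cast Real.pi_ne_zero
  have : -((c + t * Complex.I) * u : ℂ) = -(c * u) +
      ((-2 * Real.pi * inner ℝ t (u / (2 * Real.pi)) : ℝ) : ℂ) * Complex.I := by
    simp
    field_simp
    ring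
  rw [this, Complex.exp_add, smul_eq_mul]
  ring

/-- Inversion of the vertical line transform. -/
lemma laplace_vline {c : ℝ} (hcont : Continuous fun t : ℝ => f (c + t * Complex.I))
    (hint : Integrable fun t : ℝ => f (c + t * Complex.I))
    (hint' : Integrable fun u : ℝ =>
      vline c (fun w => f w * Complex.exp (-(w * u))) * Complex.exp (c * u)) (t : ℝ) :
    laplace (fun u => vline c fun w => f w * Complex.exp (-(w * u))) (c + t * Complex.I) =
      f (c + t * Complex.I) := by
  set φ : ℝ → ℂ := fun t => f (c + t * Complex.I) with hφ
  have hpi : (Real.pi : ℂ) ≠ 0 := by exact_mod_cast Real.pi_ne_zero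
  have h2pi : (2 * Real.pi : ℝ) ≠ 0 := by positivity
  have hτ : ∀ u : ℝ, vline c (fun w => f w * Complex.exp (-(w * u))) * Complex.exp (c * u) =
      (1 / (2 * Real.pi) : ℂ) * FourierTransform.fourier φ (u / (2 * Real.pi)) := by
    intro u
    rw [fourier_line, mul_assoc, mul_right_comm, ← Complex.exp_add, neg_add_cancel,
      Complex.exp_zero, one_mul]
  simp_rw [hτ] at hint'
  have hF : Integrable (FourierTransform.fourier φ) := by
    have h1 := (hint'.const_mul (2 * Real.pi : ℂ))
    have h2 : Integrable fun u : ℝ => FourierTransform.fourier φ (u / (2 * Real.pi)) := by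
      refine h1.congr (ae_of_all _ fun u => ?_)
      simp only []
      field_simp
    simpa [mul_div_cancel_right₀ _ h2pi] using h2.comp_mul_right' h2pi
  have hinv := congrFun (hcont.fourierInv_fourier_eq hint hF) t
  rw [Real.fourierInv_eq'] at hinv
  rw [show f (c + t * Complex.I) = φ t from rfl, laplace]
  have hsub := Measure.integral_comp_mul_left (fun v : ℝ =>
    Complex.exp ((2 * Real.pi * inner ℝ v t : ℝ) * Complex.I) • FourierTransform.fourier φ v)
    ((2 * Real.pi)⁻¹)
  rw [inv_inv, abs_of_pos (by positivity : (0 : ℝ) < 2 * Real.pi), hinv] at hsub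
  have h3 : φ t = (1 / (2 * Real.pi) : ℂ) *
      ∫ x : ℝ, Complex.exp ((2 * Real.pi * inner ℝ ((2 * Real.pi)⁻¹ * x) t : ℝ) * Complex.I) •
        FourierTransform.fourier φ ((2 * Real.pi)⁻¹ * x) := by
    rw [hsub, Complex.real_smul]
    push_cast
    field_simp
  rw [h3, ← integral_const_mul]
  congr 1
  ext u
  rw [show (c + t * Complex.I : ℂ) * u = c * u + t * u * Complex.I by ring, Complex.exp_add,
    ← mul_assoc, hτ, smul_eq_mul, inv_mul_eq_div]
  have : ((2 * Real.pi * inner ℝ (u / (2 * Real.pi)) t : ℝ) : ℂ) = t * u := by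
    simp
    field_simp
  rw [this]
  ring

/-- Laplace inversion for tame functions. -/
lemma Tame.vline_laplace {b c : ℝ} {h : ℝ → ℂ} (hh : Tame b h) (hc : b < c) (u : ℝ) :
    vline c (fun w => laplace h w * Complex.exp (-(w * u))) = h u := by
  have hpi : (Real.pi : ℂ) ≠ 0 := by exact_mod_cast Real.pi_ne_zero
  have h2pi : (2 * Real.pi : ℝ) ≠ 0 := by positivity
  set ψ : ℝ → ℂ := fun v => h v * Complex.exp (c * v) with hψ
  have hψi : Integrable ψ := hh.integrable (w := (c : ℂ)) (by simpa)
  have hψc : Continuous ψ := by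
    have := hh.continuous
    fun_prop
  have hline : ∀ t : ℝ, laplace h (c + t * Complex.I) =
      FourierTransformInv.fourierInv ψ (t / (2 * Real.pi)) := by
    intro t
    rw [Real.fourierInv_eq', laplace]
    congr 1
    ext v
    have : ((2 * Real.pi * inner ℝ v (t / (2 * Real.pi)) : ℝ) : ℂ) = v * t := by
      simp
      field_simp
    rw [this, show (c + t * Complex.I : ℂ) * v = c * v + v * t * Complex.I by ring,
      Complex.exp_add, hψ, smul_eq_mul]
    ring
  have hholo : StripHolo c c (laplace h) := fun w hw _ =>
    hh.differentiableAt_laplace (hc.trans_le hw)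
  have hdec : StripDecay c c (laplace h) := by
    obtain ⟨C, hC0, hC⟩ := hh.laplace_decay hc c 2
    refine ⟨C, fun w hw hw' => ?_⟩
    rw [← div_eq_mul_inv, le_div_iff₀ (by positivity), mul_comm]
    refine le_trans ?_ (hC w hw hw')
    gcongr
    nlinarith [abs_nonneg w.im, sq_abs w.im]
  have hint := hdec.integrable_line hholo le_rfl le_rfl
  have hF : Integrable (FourierTransformInv.fourierInv ψ) := by
    simp_rw [hline] at hint
    simpa [mul_div_cancel_right₀ _ h2pi] using hint.comp_mul_right' h2pi
  have hF' : Integrable (FourierTransform.fourier ψ) := by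
    refine hF.comp_neg.congr (ae_of_all _ fun x => ?_)
    simp [Real.fourierInv_eq_fourier_neg]
  have hinv := congrFun (hψc.fourier_fourierInv_eq hψi hF') u
  rw [vline]
  rw [Real.fourier_eq'] at hinv
  have hsub := Measure.integral_comp_mul_left (fun v : ℝ =>
    Complex.exp ((-2 * Real.pi * inner ℝ v u : ℝ) * Complex.I) •
      FourierTransformInv.fourierInv ψ v) ((2 * Real.pi)⁻¹)
  rw [inv_inv, abs_of_pos (by positivity : (0 : ℝ) < 2 * Real.pi), hinv] at hsub
  have hψu : h u = Complex.exp (-(c * u)) * ψ u := by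
    rw [hψ, mul_left_comm, ← Complex.exp_add, neg_add_cancel, Complex.exp_zero, mul_one]
  rw [hψu]
  have h3 : ψ u = (1 / (2 * Real.pi) : ℂ) *
      ∫ x : ℝ, Complex.exp ((-2 * Real.pi * inner ℝ ((2 * Real.pi)⁻¹ * x) u : ℝ) * Complex.I) •
        FourierTransformInv.fourierInv ψ ((2 * Real.pi)⁻¹ * x) := by
    rw [hsub, Complex.real_smul]
    push_cast
    field_simp
  rw [h3, mul_left_comm, ← integral_const_mul (Complex.exp (-(c * u)))]
  congr 1
  refine integral_congr_ae (ae_of_all _ fun t => ?_)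
  simp only []
  rw [hline, inv_mul_eq_div, smul_eq_mul]
  have : ((-2 * Real.pi * inner ℝ (t / (2 * Real.pi)) u : ℝ) : ℂ) = -(t * u) := by
    simp
    field_simp
  rw [this, show -((c + t * Complex.I : ℂ) * u) = -(c * u) + -(t * u) * Complex.I by ring,
    Complex.exp_add]
  ring

lemma StripHolo.mono {c₁' c₂' : ℝ} (hf : StripHolo c₁ c₂ f) (h₁ : c₁ ≤ c₁') (h₂ : c₂' ≤ c₂) :
    StripHolo c₁' c₂' f := fun w hw hw' => hf w (h₁.trans hw) (hw'.trans h₂)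

lemma StripDecay.mono {c₁' c₂' : ℝ} (hf : StripDecay c₁ c₂ f) (h₁ : c₁ ≤ c₁') (h₂ : c₂' ≤ c₂) :
    StripDecay c₁' c₂' f :=
  let ⟨C, hC⟩ := hf
  ⟨C, fun w hw hw' => hC w (h₁.trans hw) (hw'.trans h₂)⟩

lemma StripHolo.mul_exp (hf : StripHolo c₁ c₂ f) (v : ℂ) :
    StripHolo c₁ c₂ fun w => f w * Complex.exp (-(w * v)) := fun w hw hw' =>
  (hf w hw hw').mul (by fun_prop)

lemma StripDecay.mul_exp (hf : StripDecay c₁ c₂ f) (v : ℝ) :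
    StripDecay c₁ c₂ fun w => f w * Complex.exp (-(w * v)) := by
  obtain ⟨C, hC⟩ := hf
  refine ⟨C * Real.exp ((|c₁| + |c₂|) * |v|), fun w hw hw' => ?_⟩
  have h1 := hC w hw hw'
  have hC0 : 0 ≤ C * (1 + w.im ^ 2)⁻¹ := (norm_nonneg _).trans h1
  rw [norm_mul, Complex.norm_exp, mul_right_comm]
  refine mul_le_mul h1 ?_ (Real.exp_pos _).le hC0
  rw [Real.exp_le_exp]
  have : |w.re| ≤ |c₁| + |c₂| := by
    rw [abs_le]
    constructor
    · linarith [neg_abs_le c₁, abs_nonneg c₂]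
    · linarith [le_abs_self c₂, abs_nonneg c₁]
  calc (-(w * v)).re = -(w.re * v) := by simp
    _ ≤ |w.re * v| := neg_le_abs _
    _ = |w.re| * |v| := abs_mul _ _
    _ ≤ _ := by gcongr

/-- The transform of a function that decays in a strip, as a function independent of the line. -/
lemma vline_exp_eq (hf : StripHolo c₁ c₂ f) (hd : StripDecay c₁ c₂ f) {c : ℝ} (h₁ : c₁ ≤ c)
    (h₂ : c ≤ c₂) (v : ℝ) : vline c₁ (fun w => f w * Complex.exp (-(w * v))) =
      vline c (fun w => f w * Complex.exp (-(w * v))) :=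
  vline_eq_vline h₁ ((hf.mul_exp v).mono le_rfl h₂) ((hd.mul_exp v).mono le_rfl h₂)

/-- The total mass `(1/2π) ∫ |f(c + it)| dt`. -/
def vmass (c : ℝ) (f : ℂ → ℂ) : ℝ := 1 / (2 * Real.pi) * ∫ t : ℝ, ‖f (c + t * Complex.I)‖

lemma norm_vline_le (c : ℝ) (f : ℂ → ℂ) : ‖vline c f‖ ≤ vmass c f := by
  rw [vline, vmass, norm_mul]
  gcongr
  · simp [abs_of_pos Real.pi_pos]
  · exact norm_integral_le_integral_norm _

lemma norm_vline_exp_le (c v : ℝ) (f : ℂ → ℂ) :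
    ‖vline c fun w => f w * Complex.exp (-(w * v))‖ ≤ Real.exp (-(c * v)) * vmass c f := by
  refine (norm_vline_le _ _).trans (le_of_eq ?_)
  rw [vmass, vmass, mul_left_comm, ← integral_const_mul (Real.exp (-(c * v)))]
  congr 1
  refine integral_congr_ae (ae_of_all _ fun t => ?_)
  simp only [norm_mul, Complex.norm_exp]
  rw [mul_comm]
  congr 2
  simp

lemma continuous_vline_exp {c : ℝ} (hint : Integrable fun t : ℝ => f (c + t * Complex.I)) :
    Continuous fun u : ℝ => vline c fun w => f w * Complex.exp (-(w * u)) := by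
  have h1 : ∀ u : ℝ, vline c (fun w => f w * Complex.exp (-(w * u))) = (1 / (2 * Real.pi) : ℂ) *
      (Complex.exp (-(c * u)) *
        FourierTransform.fourier (fun t : ℝ => f (c + t * Complex.I)) (u / (2 * Real.pi))) :=
    fun u => fourier_line c u f
  have h2 : Continuous (FourierTransform.fourier (fun t : ℝ => f (c + t * Complex.I))) :=
    VectorFourier.fourierIntegral_continuous Real.continuous_fourierChar
      (by exact continuous_inner) hint
  rw [funext h1]
  fun_prop

/-- Inversion inside a strip of holomorphy and decay. -/
lemma laplace_vline_of_strip (hf : StripHolo c₁ c₂ f) (hd : StripDecay c₁ c₂ f) {w₀ : ℂ}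
    (h₁ : c₁ < w₀.re) (h₂ : w₀.re < c₂) :
    Integrable (fun u : ℝ =>
      vline c₁ (fun w => f w * Complex.exp (-(w * u))) * Complex.exp (w₀ * u)) ∧
    laplace (fun u => vline c₁ fun w => f w * Complex.exp (-(w * u))) w₀ = f w₀ := by
  set τ : ℝ → ℂ := fun u => vline c₁ fun w => f w * Complex.exp (-(w * u)) with hτ
  have hτc : ∀ c, c₁ ≤ c → c ≤ c₂ → ∀ u : ℝ, τ u = vline c fun w => f w * Complex.exp (-(w * u)) :=
    fun c h h' u => vline_exp_eq hf hd h h' u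
  have hcont : Continuous τ :=
    continuous_vline_exp (hd.integrable_line hf le_rfl (h₁.le.trans h₂.le))
  have hint : ∀ w : ℂ, w.re = w₀.re → Integrable fun u : ℝ => τ u * Complex.exp (w * u) := by
    intro w hw
    have hc : Continuous fun u : ℝ => τ u * Complex.exp (w * u) := by fun_prop
    rw [← integrableOn_univ, ← Iic_union_Ioi (a := (0 : ℝ))]
    refine IntegrableOn.union ?_ ?_
    · refine ((integrableOn_exp_mul_Iic (a := w₀.re - c₁) (by linarith) 0).const_mul
        (vmass c₁ f)).mono' hc.aestronglyMeasurable (ae_of_all _ fun u => ?_)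
      rw [norm_mul, Complex.norm_exp]
      calc ‖τ u‖ * Real.exp (w * u).re ≤ Real.exp (-(c₁ * u)) * vmass c₁ f * Real.exp (w * u).re :=
            by gcongr; exact norm_vline_exp_le _ _ _
        _ = vmass c₁ f * Real.exp ((w₀.re - c₁) * u) := by
            rw [mul_right_comm, ← Real.exp_add, mul_comm]; congr 2; simp [hw]; ring
    · refine ((integrableOn_exp_mul_Ioi (a := w₀.re - c₂) (by linarith) 0).const_mul
        (vmass c₂ f)).mono' hc.aestronglyMeasurable (ae_of_all _ fun u => ?_)
      rw [norm_mul, Complex.norm_exp]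
      calc ‖τ u‖ * Real.exp (w * u).re ≤ Real.exp (-(c₂ * u)) * vmass c₂ f * Real.exp (w * u).re :=
            by
              rw [hτc c₂ (h₁.le.trans h₂.le) le_rfl]
              gcongr; exact norm_vline_exp_le _ _ _
        _ = vmass c₂ f * Real.exp ((w₀.re - c₂) * u) := by
            rw [mul_right_comm, ← Real.exp_add, mul_comm]; congr 2; simp [hw]; ring
  refine ⟨hint w₀ rfl, ?_⟩
  have h3 := laplace_vline (f := f) (c := w₀.re) (hf.continuous_line h₁.le h₂.le)
    (hd.integrable_line hf h₁.le h₂.le) ?_ w₀.im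
  · rw [Complex.re_add_im] at h3
    rw [← h3]
    congr 1
    ext u
    exact hτc _ h₁.le h₂.le u
  · have := hint (w₀.re : ℂ) (by simp)
    simpa only [hτc _ h₁.le h₂.le] using this

/-- Cauchy's formula for a simple pole between two vertical lines. -/
lemma vline_sub_vline_eq (hf : StripHolo c₁ c₂ f) (hd : StripDecay c₁ c₂ f) {w₀ : ℂ}
    (h₁ : c₁ < w₀.re) (h₂ : w₀.re < c₂) :
    vline c₂ (fun w => f w / (w - w₀)) - vline c₁ (fun w => f w / (w - w₀)) = f w₀ := by
  have h₁₂ := h₁.le.trans h₂.le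
  obtain ⟨hτi, hτ⟩ := laplace_vline_of_strip hf hd h₁ h₂
  have hfub : ∀ c, c₁ ≤ c → c ≤ c₂ → ∀ S : Set ℝ, MeasurableSet S →
      IntegrableOn (fun u : ℝ => Real.exp ((w₀.re - c) * u)) S →
      ∫ u in S, vline c₁ (fun w => f w * Complex.exp (-(w * u))) * Complex.exp (w₀ * u) =
        vline c fun w => f w * ∫ u in S, Complex.exp ((w₀ - w) * u) := by
    intro c hc hc' S hS hint
    have hli := hd.integrable_line hf hc hc'
    have hswap := integral_integral_swap (μ := volume.restrict S) (ν := volume)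
      (f := fun (u t : ℝ) => f (c + t * Complex.I) *
        Complex.exp ((w₀ - (c + t * Complex.I)) * u)) ?_
    · simp_rw [vline_exp_eq hf hd hc hc', vline, mul_assoc, integral_const_mul,
        ← integral_mul_const]
      congr 1
      calc _ = _ := ?_
        _ = _ := hswap
        _ = _ := ?_
      · refine integral_congr_ae (ae_of_all _ fun u => ?_)
        refine integral_congr_ae (ae_of_all _ fun t => ?_)
        simp only []
        rw [mul_assoc, ← Complex.exp_add]
        congr 2
        ring
      · refine integral_congr_ae (ae_of_all _ fun t => ?_)
        simp only []
        rw [integral_const_mul]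
    · have hprod : Integrable (fun p : ℝ × ℝ => Real.exp ((w₀.re - c) * p.1) *
          ‖f (c + p.2 * Complex.I)‖) ((volume.restrict S).prod volume) :=
        Integrable.mul_prod hint hli.norm
      refine hprod.mono' ?_ (ae_of_all _ fun p => ?_)
      · have := hf.continuous_line hc hc'
        refine Continuous.aestronglyMeasurable ?_
        have h2 : Continuous fun p : ℝ × ℝ => f (c + p.2 * Complex.I) := this.comp continuous_snd
        exact h2.mul (by fun_prop)
      · simp only [Function.uncurry, norm_mul, Complex.norm_exp]
        rw [mul_comm]
        refine le_of_eq ?_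
        congr 2
        simp
  rw [laplace, ← integral_add_compl (measurableSet_Ioi (a := (0 : ℝ))) hτi, compl_Ioi,
    hfub c₂ h₁₂ le_rfl _ measurableSet_Ioi (integrableOn_exp_mul_Ioi (by linarith) 0),
    hfub c₁ le_rfl h₁₂ _ measurableSet_Iic (integrableOn_exp_mul_Iic (by linarith) 0)] at hτ
  rw [← hτ, sub_eq_add_neg]
  congr 1
  · rw [vline, vline]
    congr 1
    refine integral_congr_ae (ae_of_all _ fun t => ?_)
    simp only []
    rw [integral_exp_mul_complex_Ioi (by simpa using h₂)]
    simp only [Complex.ofReal_zero, mul_zero, Complex.exp_zero]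
    rw [div_eq_mul_inv, neg_div, one_div, ← inv_neg, neg_sub]
  · rw [vline, vline, ← mul_neg, ← integral_neg]
    congr 1
    refine integral_congr_ae (ae_of_all _ fun t => ?_)
    simp only []
    rw [integral_exp_mul_complex_Iic (by simpa using h₁)]
    simp only [Complex.ofReal_zero, mul_zero, Complex.exp_zero]
    rw [div_eq_mul_inv, one_div, ← mul_neg, ← inv_neg, neg_sub]

end Strip

end

section

open Polynomial

/-! ### Constant coefficient differential operators -/

/-- The operator `P(-d/du)`; on Laplace transforms it is multiplication by `P`. -/
def diffOp (P : ℂ[X]) (h : ℝ → ℂ) : ℝ → ℂ :=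
  ∑ j ∈ P.support, (P.coeff j * (-1) ^ j) • iteratedDeriv j h

lemma diffOp_apply (P : ℂ[X]) (h : ℝ → ℂ) (u : ℝ) :
    diffOp P h u = ∑ j ∈ P.support, P.coeff j * (-1) ^ j * iteratedDeriv j h u := by
  simp [diffOp, Finset.sum_apply]

lemma diffOp_eventuallyEq {P : ℂ[X]} {h₁ h₂ : ℝ → ℂ} {u : ℝ} (he : h₁ =ᶠ[𝓝 u] h₂) :
    diffOp P h₁ u = diffOp P h₂ u := by
  simp_rw [diffOp_apply, he.iteratedDeriv_eq]

lemma diffOp_eq_zero {P : ℂ[X]} {h : ℝ → ℂ} {U : ℝ} (hU : ∀ u, U < u → h u = 0) {u : ℝ}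
    (hu : U < u) : diffOp P h u = 0 := by
  rw [diffOp_apply]
  exact Finset.sum_eq_zero fun j _ => by rw [Tame.iteratedDeriv_eq_zero hU j hu, mul_zero]

section

variable {b : ℝ} {h : ℝ → ℂ}

lemma Tame.diffOp (hh : Tame b h) (P : ℂ[X]) : Tame b (diffOp P h) :=
  Tame.sum _ fun j _ => (hh.iteratedDeriv j).const_smul _

lemma laplace_sum {ι : Type*} (s : Finset ι) {h : ι → ℝ → ℂ} {w : ℂ} (hw : b < w.re)
    (hh : ∀ i ∈ s, Tame b (h i)) : laplace (∑ i ∈ s, h i) w = ∑ i ∈ s, laplace (h i) w := by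
  simp only [laplace, Finset.sum_apply, Finset.sum_mul]
  exact integral_finsetSum _ fun i hi => (hh i hi).integrable hw

lemma laplace_smul (a : ℂ) (h : ℝ → ℂ) (w : ℂ) : laplace (a • h) w = a * laplace h w := by
  simp only [laplace, Pi.smul_apply, smul_eq_mul, mul_assoc, integral_const_mul]

lemma Tame.laplace_diffOp (hh : Tame b h) (P : ℂ[X]) {w : ℂ} (hw : b < w.re) :
    laplace (UnitaryMDS.diffOp P h) w = P.eval w * laplace h w := by
  rw [UnitaryMDS.diffOp, laplace_sum _ hw fun j _ => (hh.iteratedDeriv j).const_smul _,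
    Polynomial.eval_eq_sum, Polynomial.sum, Finset.sum_mul]
  refine Finset.sum_congr rfl fun j _ => ?_
  rw [laplace_smul, hh.laplace_iteratedDeriv hw, neg_pow w]
  have : ((-1 : ℂ) ^ j) * (-1) ^ j = 1 := by rw [← mul_pow]; simp
  linear_combination (P.coeff j * w ^ j * laplace h w) * this

/-- A tame function is determined by its Laplace transform. -/
lemma Tame.ext_laplace {h₁ h₂ : ℝ → ℂ} (hh₁ : Tame b h₁) (hh₂ : Tame b h₂)
    (he : ∀ w : ℂ, b < w.re → laplace h₁ w = laplace h₂ w) : h₁ = h₂ := by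
  ext u
  rw [← hh₁.vline_laplace (lt_add_one b) u, ← hh₂.vline_laplace (lt_add_one b) u, vline, vline]
  congr 1
  refine integral_congr_ae (ae_of_all _ fun t => ?_)
  simp only []
  rw [he _ (by simp)]

/-- The equation `-h' - w₀ h = g` is solvable in the class of tame functions. -/
lemma Tame.exists_first_order {g : ℝ → ℂ} (hg : Tame b g) {w₀ : ℂ} (hw₀ : w₀.re < b) :
    ∃ h, Tame b h ∧ ∀ w : ℂ, b < w.re → (w - w₀) * laplace h w = laplace g w := by
  obtain ⟨U, hU⟩ := hg.vanish
  obtain ⟨C, hC⟩ := hg.bound 0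
  have hC0 : 0 ≤ C := by
    have := (norm_nonneg _).trans (hC 0)
    simpa using this
  have hgc := hg.continuous
  set G : ℝ → ℂ := fun y => g y * Complex.exp (w₀ * y) with hG
  have hGc : Continuous G := by fun_prop
  set h : ℝ → ℂ := fun u => Complex.exp (-(w₀ * u)) * ∫ y in u..(U + 1), G y with hh
  have hd : ∀ u, HasDerivAt h (-w₀ * h u - g u) u := by
    intro u
    have h1 : HasDerivAt (fun u : ℝ => Complex.exp (-(w₀ * u))) (-w₀ * Complex.exp (-(w₀ * u))) u := by
      have := (((Complex.ofRealCLM.hasDerivAt (x := u)).const_mul w₀).neg).cexp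
      simpa [mul_comm] using this
    have h2 : HasDerivAt (fun u : ℝ => ∫ y in u..(U + 1), G y) (-G u) u :=
      intervalIntegral.integral_hasDerivAt_left (hGc.intervalIntegrable _ _)
        hGc.stronglyMeasurable.stronglyMeasurableAtFilter hGc.continuousAt
    have h3 : HasDerivAt h _ u := h1.mul h2
    have he : Complex.exp (-(w₀ * u)) * Complex.exp (w₀ * u) = 1 := by
      rw [← Complex.exp_add]; simp
    refine h3.congr_deriv ?_
    change -w₀ * Complex.exp (-(w₀ * u)) * (∫ y in u..(U + 1), G y) + Complex.exp (-(w₀ * u)) *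
      -(g u * Complex.exp (w₀ * u)) = -w₀ * (Complex.exp (-(w₀ * u)) * ∫ y in u..(U + 1), G y) - g u
    linear_combination (-g u) * he
  have hderiv : _root_.deriv h = (-w₀) • h - g := by
    ext u
    rw [(hd u).deriv]; simp
  have hsm : ∀ n : ℕ, ContDiff ℝ n h := by
    intro n
    induction n with
    | zero => exact contDiff_zero.2 (continuous_iff_continuousAt.2 fun u => (hd u).continuousAt)
    | succ n ih =>
      rw [show ((n + 1 : ℕ) : WithTop ℕ∞) = (n : WithTop ℕ∞) + 1 by push_cast; rfl,
        contDiff_succ_iff_deriv]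
      refine ⟨fun u => (hd u).differentiableAt, by simp, ?_⟩
      rw [hderiv]
      exact (ih.const_smul (-w₀)).sub (hg.contDiff_nat n)
  have hvan : ∀ u, U < u → h u = 0 := by
    intro u hu
    have : ∫ y in u..(U + 1), G y = 0 := by
      rw [intervalIntegral.integral_congr (g := fun _ => 0) (fun y hy => ?_)]
      · simp
      · have : U < y := lt_of_lt_of_le (lt_min hu (by linarith)) hy.1
        simp [hG, hU y this]
    simp [hh, this]
  have hbd0 : ∀ u, ‖h u‖ ≤ C / (b - w₀.re) * Real.exp (-b * u) := by
    intro u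
    have hpos : 0 < b - w₀.re := by linarith
    rcases lt_or_ge U u with hu | hu
    · rw [hvan u hu, norm_zero]; positivity
    · have hu1 : u ≤ U + 1 := by linarith
      have h1 : ‖∫ y in u..(U + 1), G y‖ ≤ C * (Real.exp ((w₀.re - b) * u) / (b - w₀.re)) := by
        have hint : IntegrableOn (fun y => C * Real.exp ((w₀.re - b) * y)) (Ioi u) :=
          (integrableOn_exp_mul_Ioi (by linarith) u).const_mul C
        calc ‖∫ y in u..(U + 1), G y‖ ≤ ∫ y in Ioc u (U + 1), C * Real.exp ((w₀.re - b) * y) := by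
              rw [intervalIntegral.integral_of_le hu1]
              refine norm_integral_le_of_norm_le (hint.mono_set Ioc_subset_Ioi_self)
                (ae_of_all _ fun y => ?_)
              have := hC y
              rw [iteratedDeriv_zero] at this
              rw [hG, norm_mul, Complex.norm_exp]
              calc _ ≤ C * Real.exp (-b * y) * Real.exp (w₀ * y).re := by gcongr
                _ = _ := by rw [mul_assoc, ← Real.exp_add]; congr 2; simp; ring
          _ ≤ ∫ y in Ioi u, C * Real.exp ((w₀.re - b) * y) :=
              setIntegral_mono_set hint (ae_of_all _ fun y => by positivity)
                Ioc_subset_Ioi_self.eventuallyLE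
          _ = _ := by
              rw [integral_const_mul, integral_exp_mul_Ioi (by linarith)]
              congr 1
              rw [neg_div, ← div_neg, neg_sub]
      rw [hh, norm_mul, Complex.norm_exp]
      calc _ ≤ Real.exp (-(w₀ * u)).re * (C * (Real.exp ((w₀.re - b) * u) / (b - w₀.re))) := by
            gcongr
        _ = C / (b - w₀.re) * (Real.exp (-(w₀ * u)).re * Real.exp ((w₀.re - b) * u)) := by ring
        _ = _ := by
            rw [← Real.exp_add]
            congr 2
            simp
            ring
  have hT : Tame b h :=
    { smooth := contDiff_infty.2 hsm
      vanish := ⟨U, hvan⟩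
      bound := by
        intro j
        induction j with
        | zero => exact ⟨_, fun u => by simpa using hbd0 u⟩
        | succ n ih =>
          obtain ⟨C₁, h₁⟩ := ih
          obtain ⟨C₂, h₂⟩ := hg.bound n
          refine ⟨‖w₀‖ * C₁ + C₂, fun u => ?_⟩
          have hs : ContDiff ℝ n ((-w₀) • h) := (hsm n).const_smul (-w₀)
          rw [iteratedDeriv_succ', hderiv, iteratedDeriv_sub hs.contDiffAt (hg.contDiff_nat n).contDiffAt,
            iteratedDeriv_const_smul (hsm n).contDiffAt]
          calc _ ≤ ‖w₀‖ * ‖_root_.iteratedDeriv n h u‖ + ‖_root_.iteratedDeriv n g u‖ := by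
                refine (norm_sub_le _ _).trans (le_of_eq ?_)
                rw [norm_smul, norm_neg]
            _ ≤ ‖w₀‖ * (C₁ * Real.exp (-b * u)) + C₂ * Real.exp (-b * u) := by
                gcongr
                · exact h₁ u
                · exact h₂ u
            _ = _ := by ring }
  refine ⟨h, hT, fun w hw => ?_⟩
  have h1 := hT.laplace_deriv hw
  have h2 : laplace (_root_.deriv h) w = -w₀ * laplace h w - laplace g w := by
    have i1 := hT.integrable hw
    have i2 := hg.integrable hw
    rw [hderiv]
    simp only [laplace, Pi.sub_apply, Pi.smul_apply, smul_eq_mul, sub_mul, mul_assoc]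
    rw [integral_sub (i1.const_mul _) i2, integral_const_mul]
  linear_combination h1 - h2

/-- Division of Laplace transforms by a polynomial with small zeros. -/
lemma Tame.exists_diffOp_eq {ι : Type*} (s : Finset ι) (r : ι → ℂ) (hr : ∀ i ∈ s, (r i).re < b)
    {g : ℝ → ℂ} (hg : Tame b g) :
    ∃ h, Tame b h ∧ UnitaryMDS.diffOp (∏ i ∈ s, (X - C (r i))) h = g ∧
      ∀ w : ℂ, b < w.re → (∏ i ∈ s, (w - r i)) * laplace h w = laplace g w := by
  suffices ∃ h, Tame b h ∧ ∀ w : ℂ, b < w.re → (∏ i ∈ s, (w - r i)) * laplace h w = laplace g w by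
    obtain ⟨h, hh, he⟩ := this
    refine ⟨h, hh, (hh.diffOp _).ext_laplace hg fun w hw => ?_, he⟩
    rw [hh.laplace_diffOp _ hw, ← he w hw, eval_prod]
    simp
  classical
  induction s using Finset.induction_on with
  | empty => exact ⟨g, hg, fun w _ => by simp⟩
  | insert i s hi ih =>
    obtain ⟨h, hh, he⟩ := ih fun j hj => hr j (Finset.mem_insert_of_mem hj)
    obtain ⟨h', hh', he'⟩ := hh.exists_first_order (hr i (Finset.mem_insert_self i s))
    refine ⟨h', hh', fun w hw => ?_⟩
    rw [Finset.prod_insert hi, ← he w hw, ← he' w hw]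
    ring

end

end

section

open Polynomial

/-! ### Dirichlet series against test functions -/

/-- `∑ a_q h(log q)`. -/
def coeffSum (a : ℕ+ → ℂ) (h : ℝ → ℂ) : ℂ := ∑' q : ℕ+, a q * h (Real.log q)

lemma coeffSum_eq_sum (a : ℕ+ → ℂ) {h : ℝ → ℂ} {n : ℕ} (hn : ∀ u, Real.log n < u → h u = 0) :
    coeffSum a h = ∑ q ∈ Finset.Icc (1 : ℕ+) (n.toPNat'), a q * h (Real.log q) := by
  refine tsum_eq_sum fun q hq => ?_
  rw [hn, mul_zero]
  rw [Finset.mem_Icc, not_and] at hq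
  have hq' : n.toPNat' < q := not_le.1 (hq one_le)
  have h1 : n < (q : ℕ) := by
    rcases Nat.eq_zero_or_pos n with rfl | h0
    · exact q.pos
    · have : (n.toPNat' : ℕ) < q := hq'
      rwa [Nat.toPNat'_coe, if_pos h0] at this
  rcases Nat.eq_zero_or_pos n with rfl | h0
  · have : (1 : ℕ) < q := hq'
    simpa using Real.log_pos (by exact_mod_cast this)
  · exact Real.log_lt_log (by exact_mod_cast h0) (by exact_mod_cast h1)

lemma exists_log_natCast_ge (U : ℝ) : ∃ n : ℕ, U ≤ Real.log n := by
  have := (Real.tendsto_log_atTop.comp tendsto_natCast_atTop_atTop).eventually_ge_atTop U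
  exact this.exists

/-- If the Dirichlet series converges absolutely on the line `Re w = c`, then sums of its
coefficients against test functions are line integrals. -/
lemma coeffSum_diffOp_eq_vline {a : ℕ+ → ℂ} {b c : ℝ} {h : ℝ → ℂ} (hh : Tame b h) (hc : b < c)
    (P : ℂ[X]) (ha : Summable fun q : ℕ+ => ‖a q‖ * (q : ℝ) ^ (-c)) :
    coeffSum a (diffOp P h) =
      vline c fun w => P.eval w * (∑' q : ℕ+, a q / (q : ℂ) ^ w) * laplace h w := by
  have hP := hh.diffOp P
  have hholo : StripHolo c c (laplace (diffOp P h)) := fun w hw _ =>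
    hP.differentiableAt_laplace (hc.trans_le hw)
  have hdec : StripDecay c c (laplace (diffOp P h)) := by
    obtain ⟨C, hC0, hC⟩ := hP.laplace_decay hc c 2
    refine ⟨C, fun w hw hw' => ?_⟩
    rw [← div_eq_mul_inv, le_div_iff₀ (by positivity), mul_comm]
    refine le_trans ?_ (hC w hw hw')
    gcongr
    nlinarith [abs_nonneg w.im, sq_abs w.im]
  have hint := hdec.integrable_line hholo le_rfl le_rfl
  have hpow : ∀ (q : ℕ+) (w : ℂ), Complex.exp (-(w * (Real.log q : ℝ))) = ((q : ℂ) ^ w)⁻¹ := by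
    intro q w
    rw [← Complex.cpow_neg, Complex.cpow_def_of_ne_zero (by exact_mod_cast q.ne_zero),
      ← Complex.natCast_log]
    congr 1
    ring
  have hnorm : ∀ (q : ℕ+) (t : ℝ), ‖((q : ℂ) ^ (c + t * Complex.I : ℂ))⁻¹‖ = (q : ℝ) ^ (-c) := by
    intro q t
    rw [norm_inv, Complex.norm_natCast_cpow_of_pos q.pos, Real.rpow_neg (by positivity)]
    simp
  set f : ℕ+ → ℝ → ℂ := fun q t => a q * (laplace (diffOp P h) (c + t * Complex.I) *
    ((q : ℂ) ^ (c + t * Complex.I : ℂ))⁻¹) with hf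
  have hfi : ∀ q, Integrable (f q) := by
    intro q
    refine Integrable.const_mul ?_ _
    have h2 := ((hdec.mul_exp (Real.log q)).integrable_line (hholo.mul_exp _) le_rfl le_rfl)
    simpa only [hpow] using h2
  have hnf : ∀ q t, ‖f q t‖ = ‖a q‖ * (q : ℝ) ^ (-c) * ‖laplace (diffOp P h) (c + t * Complex.I)‖ := by
    intro q t
    rw [hf, norm_mul, norm_mul, hnorm]
    ring
  have hsum := hasSum_integral_of_summable_integral_norm hfi (by
    simp_rw [hnf, integral_const_mul]
    exact ha.mul_right _)
  have h3 : coeffSum a (diffOp P h) = (1 / (2 * Real.pi) : ℂ) * ∑' q, ∫ t, f q t := by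
    rw [coeffSum, ← tsum_mul_left]
    refine tsum_congr fun q => ?_
    rw [← hP.vline_laplace hc (Real.log q), vline, mul_left_comm]
    congr 1
    rw [← integral_const_mul]
    simp_rw [hpow, hf]
  rw [h3, hsum.tsum_eq, vline]
  congr 1
  refine integral_congr_ae (ae_of_all _ fun t => ?_)
  simp only [hf]
  rw [mul_right_comm, ← hh.laplace_diffOp P (by simpa), ← tsum_mul_left]
  refine tsum_congr fun q => ?_
  rw [div_eq_mul_inv]
  ring

lemma Tame.norm_laplace_le_of_bound {b : ℝ} {h : ℝ → ℂ} {C U : ℝ} (hC : ∀ u, ‖h u‖ ≤ C * Real.exp (-b * u))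
    (hU : ∀ u, U < u → h u = 0) {w : ℂ} (hw : b < w.re) :
    ‖laplace h w‖ ≤ C * (Real.exp ((w.re - b) * U) / (w.re - b)) := by
  have hint : Integrable ((Iic U).indicator fun u => C * Real.exp ((w.re - b) * u)) := by
    rw [integrable_indicator_iff measurableSet_Iic]
    exact (integrableOn_exp_mul_Iic (by linarith) U).const_mul _
  refine (norm_integral_le_of_norm_le hint (ae_of_all _ fun u => ?_)).trans (le_of_eq ?_)
  · rcases lt_or_ge U u with hu | hu
    · rw [hU u hu, zero_mul, norm_zero, indicator_of_notMem (by simpa using hu)]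
    · rw [indicator_of_mem (show u ∈ Iic U from hu), norm_mul, Complex.norm_exp]
      calc ‖h u‖ * Real.exp (w * u).re ≤ C * Real.exp (-b * u) * Real.exp (w * u).re := by
            gcongr; exact hC u
        _ = _ := by rw [mul_assoc, ← Real.exp_add]; congr 2; simp; ring
  · rw [integral_indicator measurableSet_Iic, integral_const_mul, integral_exp_mul_Iic (by linarith)]

/-- A smooth cutoff that vanishes for `u ≤ -2` and equals `1` for `u ≥ -1`. -/
def cutoff (u : ℝ) : ℂ := (Real.smoothTransition (u + 2) : ℝ)

lemma contDiff_cutoff : ContDiff ℝ ∞ cutoff :=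
  Complex.ofRealCLM.contDiff.comp
    (Real.smoothTransition.contDiff.comp (contDiff_id.add contDiff_const))

lemma cutoff_of_ge {u : ℝ} (hu : -1 ≤ u) : cutoff u = 1 := by
  simp [cutoff, Real.smoothTransition.one_of_one_le (show 1 ≤ u + 2 by linarith)]

lemma cutoff_of_le {u : ℝ} (hu : u ≤ -2) : cutoff u = 0 := by
  simp [cutoff, Real.smoothTransition.zero_of_nonpos (show u + 2 ≤ 0 by linarith)]

lemma norm_cutoff_le (u : ℝ) : ‖cutoff u‖ ≤ 1 := by
  rw [cutoff, Complex.norm_real, Real.norm_of_nonneg (Real.smoothTransition.nonneg _)]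
  exact Real.smoothTransition.le_one _

lemma exists_bound_iteratedDeriv_cutoff (j : ℕ) :
    ∃ C : ℝ, 0 ≤ C ∧ ∀ u, ‖iteratedDeriv j cutoff u‖ ≤ C := by
  rcases Nat.eq_zero_or_pos j with rfl | hj
  · exact ⟨1, zero_le_one, fun u => by simpa using norm_cutoff_le u⟩
  have hc : Continuous (iteratedDeriv j cutoff) :=
    contDiff_cutoff.continuous_iteratedDeriv j (by exact_mod_cast le_top)
  have hz : ∀ u, (u < -2 ∨ -1 < u) → iteratedDeriv j cutoff u = 0 := by
    rintro u (hu | hu)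
    · have : cutoff =ᶠ[𝓝 u] fun _ => 0 := by
        filter_upwards [isOpen_Iio.mem_nhds hu] with v hv using cutoff_of_le (le_of_lt hv)
      rw [this.iteratedDeriv_eq]; simp
    · have : cutoff =ᶠ[𝓝 u] fun _ => 1 := by
        filter_upwards [isOpen_Ioi.mem_nhds hu] with v hv using cutoff_of_ge (le_of_lt hv)
      rw [this.iteratedDeriv_eq]; simp [iteratedDeriv_const, hj.ne']
  have hcs : HasCompactSupport (iteratedDeriv j cutoff) :=
    HasCompactSupport.of_support_subset_isCompact (isCompact_Icc (a := (-2 : ℝ)) (b := -1))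
      fun u hu => by
        by_contra hcon
        rw [mem_Icc, not_and_or, not_le, not_le] at hcon
        exact hu (hz u hcon)
  obtain ⟨C, hC⟩ := hc.bounded_above_of_compact_support hcs
  exact ⟨C, (norm_nonneg _).trans (hC 0), hC⟩

/-- An identity between coefficient sums and line integrals extends from test functions with
compact support to tame functions. -/
lemma coeffSum_eq_vline_of_tame {a : ℕ+ → ℂ} {b c : ℝ} (hc : b < c) {P : ℂ[X]} {f : ℂ → ℂ}
    (hfc : Continuous fun t : ℝ => f (c + t * Complex.I)) {K : ℝ} {n : ℕ}
    (hfb : ∀ t : ℝ, ‖f (c + t * Complex.I)‖ ≤ K * (1 + |t|) ^ n)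
    (H : ∀ h : ℝ → ℂ, ContDiff ℝ ∞ h → HasCompactSupport h →
      coeffSum a (diffOp P h) = vline c fun w => f w * laplace h w)
    {h : ℝ → ℂ} (hh : Tame b h) :
    coeffSum a (diffOp P h) = vline c fun w => f w * laplace h w := by
  have hK : 0 ≤ K := by
    have := (norm_nonneg _).trans (hfb 0)
    simpa using this
  obtain ⟨U, hU⟩ := hh.vanish
  set g : ℕ → ℝ → ℂ := fun m u => h u * cutoff (u + m) with hg
  have hcm : ∀ m : ℕ, ContDiff ℝ ∞ fun u : ℝ => cutoff (u + m) := fun m =>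
    contDiff_cutoff.comp (contDiff_id.add contDiff_const)
  have hgs : ∀ m, ContDiff ℝ ∞ (g m) := fun m => hh.smooth.mul (hcm m)
  have hgU : ∀ m u, U < u → g m u = 0 := fun m u hu => by simp [hg, hU u hu]
  have hgc : ∀ m, HasCompactSupport (g m) := fun m =>
    HasCompactSupport.of_support_subset_isCompact (isCompact_Icc (a := (-2 - m : ℝ)) (b := U))
      fun u hu => by
        by_contra hcon
        rw [mem_Icc, not_and_or, not_le, not_le] at hcon
        rcases hcon with h1 | h1
        · exact hu (by simp [hg, cutoff_of_le (show u + m ≤ -2 by linarith)])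
        · exact hu (hgU m u h1)
  have hgT : ∀ m, Tame b (g m) := fun m => Tame.of_hasCompactSupport (hgs m) (hgc m) b
  have hgb : ∀ j : ℕ, ∃ C : ℝ, 0 ≤ C ∧ ∀ m u, ‖iteratedDeriv j (g m) u‖ ≤ C * Real.exp (-b * u) := by
    intro j
    choose A hA using hh.bound
    choose B hB0 hB using exists_bound_iteratedDeriv_cutoff
    refine ⟨∑ i ∈ Finset.range (j + 1), (j.choose i : ℝ) * |A i| * B (j - i),
      Finset.sum_nonneg fun i _ => mul_nonneg (by positivity) (hB0 _), fun m u => ?_⟩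
    rw [← norm_iteratedFDeriv_eq_norm_iteratedDeriv, Finset.sum_mul]
    refine (norm_iteratedFDeriv_mul_le (hh.contDiff_nat j) (contDiff_infty.1 (hcm m) j) u
      le_rfl).trans (Finset.sum_le_sum fun i _ => ?_)
    rw [norm_iteratedFDeriv_eq_norm_iteratedDeriv, norm_iteratedFDeriv_eq_norm_iteratedDeriv,
      iteratedDeriv_comp_add_const]
    calc _ ≤ (j.choose i : ℝ) * (|A i| * Real.exp (-b * u)) * B (j - i) := by
          gcongr
          · exact (hA i u).trans (by gcongr; exact le_abs_self _)
          · exact hB _ _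
      _ = _ := by ring
  obtain ⟨C₀, hC₀0, hC₀⟩ := hgb 0
  obtain ⟨C₁, hC₁0, hC₁⟩ := hgb (n + 2)
  set L : ℝ := Real.exp ((c - b) * U) / (c - b) with hL
  have hL0 : 0 ≤ L := div_nonneg (Real.exp_pos _).le (by linarith)
  have hdec : ∀ m (t : ℝ), ‖laplace (g m) (c + t * Complex.I)‖ ≤
      2 ^ (n + 2) * (C₀ * L + C₁ * L) / (1 + |t|) ^ (n + 2) := by
    intro m t
    have hre : (c + t * Complex.I : ℂ).re = c := by simp
    have h0 : ‖laplace (g m) (c + t * Complex.I)‖ ≤ C₀ * L := by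
      have := Tame.norm_laplace_le_of_bound (w := c + t * Complex.I) (fun u => by simpa using hC₀ m u)
        (hgU m) (by simpa)
      rwa [hre] at this
    have h1 : |t| ^ (n + 2) * ‖laplace (g m) (c + t * Complex.I)‖ ≤ C₁ * L := by
      have := Tame.norm_laplace_le_of_bound (w := c + t * Complex.I) (hC₁ m)
        (fun u hu => Tame.iteratedDeriv_eq_zero (hgU m) (n + 2) hu) (by simpa)
      rw [hre, (hgT m).laplace_iteratedDeriv (by simpa), norm_mul, norm_pow, norm_neg] at this
      refine le_trans ?_ this
      gcongr
      simpa using Complex.abs_im_le_norm (c + t * Complex.I)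
    rw [le_div_iff₀ (by positivity)]
    calc _ ≤ ‖laplace (g m) (c + t * Complex.I)‖ * (2 ^ (n + 2) * (1 + |t| ^ (n + 2))) := by
          gcongr; exact Tame.one_add_pow_le _ (abs_nonneg _) _
      _ = 2 ^ (n + 2) * (‖laplace (g m) (c + t * Complex.I)‖ +
            |t| ^ (n + 2) * ‖laplace (g m) (c + t * Complex.I)‖) := by ring
      _ ≤ _ := by gcongr
  have hptw : ∀ w : ℂ, b < w.re → Tendsto (fun m => laplace (g m) w) atTop (𝓝 (laplace h w)) := by
    intro w hw
    refine tendsto_integral_of_dominated_convergence (fun u => ‖h u * Complex.exp (w * u)‖)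
      (fun m => ((hgT m).integrable hw).aestronglyMeasurable) (hh.integrable hw).norm
      (fun m => ae_of_all _ fun u => ?_) (ae_of_all _ fun u => ?_)
    · rw [norm_mul, norm_mul, norm_mul]
      gcongr
      exact mul_le_of_le_one_right (norm_nonneg _) (norm_cutoff_le _)
    · refine tendsto_const_nhds.congr' ?_
      obtain ⟨m₀, hm₀⟩ := exists_nat_ge (-1 - u)
      filter_upwards [eventually_ge_atTop m₀] with m hm
      have : (m₀ : ℝ) ≤ m := by exact_mod_cast hm
      simp only [hg, cutoff_of_ge (show -1 ≤ u + m by linarith), mul_one]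
  have hlhs : ∀ m, coeffSum a (diffOp P (g m)) = coeffSum a (diffOp P h) := by
    intro m
    refine tsum_congr fun q => ?_
    congr 1
    refine diffOp_eventuallyEq ?_
    have hq : -1 < Real.log q := by
      have : 0 ≤ Real.log q := Real.log_natCast_nonneg _
      linarith
    filter_upwards [isOpen_Ioi.mem_nhds hq] with v hv
    have hv' : (-1 : ℝ) < v := hv
    have hm : (0 : ℝ) ≤ m := by positivity
    simp [hg, cutoff_of_ge (show -1 ≤ v + m by linarith)]
  have hrhs : Tendsto (fun m => vline c fun w => f w * laplace (g m) w) atTop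
      (𝓝 (vline c fun w => f w * laplace h w)) := by
    refine Tendsto.const_mul _ (tendsto_integral_of_dominated_convergence
      (fun t => K * (2 ^ (n + 2) * (C₀ * L + C₁ * L)) * (1 + t ^ 2)⁻¹) (fun m => ?_)
      (integrable_inv_one_add_sq.const_mul _)
      (fun m => ae_of_all _ fun t => ?_) (ae_of_all _ fun t => ?_))
    · have : StripHolo c c (laplace (g m)) := fun w hw _ =>
        (hgT m).differentiableAt_laplace (hc.trans_le hw)
      exact (hfc.mul (this.continuous_line le_rfl le_rfl)).aestronglyMeasurable
    · rw [norm_mul]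
      calc _ ≤ K * (1 + |t|) ^ n * (2 ^ (n + 2) * (C₀ * L + C₁ * L) / (1 + |t|) ^ (n + 2)) := by
            gcongr
            · exact hfb t
            · exact hdec m t
        _ = K * (2 ^ (n + 2) * (C₀ * L + C₁ * L)) * ((1 + |t|) ^ 2)⁻¹ := by
            rw [pow_add (1 + |t|)]
            field_simp
        _ ≤ _ := by
            gcongr
            nlinarith [abs_nonneg t, sq_abs t]
    · exact (hptw _ (by simpa)).const_mul _
  simp_rw [← H _ (hgs _) (hgc _), hlhs] at hrhs
  exact tendsto_nhds_unique tendsto_const_nhds hrhs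

end

section

open Polynomial

/-! ### The coefficients of the multiple Dirichlet series and its polar polynomial -/

/-- Points `(s, z)` of `ℂ^(2k)`. -/
abbrev EPoint (k : ℕ) : Type := (Fin k → ℂ) × (Fin k → ℂ)

/-- The `q`-th coefficient of `A_{M,N}(s; z; w) - ∏ ζ(s_j) ζ(z_j)` as a Dirichlet series in `w`. -/
def coeffA {k : ℕ} (M N : ℕ) (e : EPoint k) (q : ℕ+) : ℂ :=
  if q = 1 then 0 else ∑ χ ∈ evenPrimitive q, twistedProduct M N e.1 e.2 χ

/-- `∏_{|J|=|H|} (X - w_{J,H})`. -/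
def polarPoly {k : ℕ} (e : EPoint k) : ℂ[X] := ∏ p : EqPair k, (X - C (polePt p e.1 e.2))

variable {k : ℕ}

lemma sigma_sub_two (p : EqPair k) (s z : Fin k → ℂ) (w : ℂ) :
    sigma p s z w - 2 = w - polePt p s z := by
  have : (p.1.2.card : ℂ) = p.1.1.card := by rw [p.2]
  rw [sigma, polePt, this]
  ring

lemma polarFactor_eq (s z : Fin k → ℂ) (w : ℂ) :
    polarFactor s z w = ∏ p : EqPair k, (w - polePt p s z) :=
  Finset.prod_congr rfl fun p _ => sigma_sub_two p s z w

lemma eval_polarPoly (e : EPoint k) (w : ℂ) : (polarPoly e).eval w = polarFactor e.1 e.2 w := by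
  rw [polarPoly, eval_prod, polarFactor_eq]
  simp

lemma differentiable_coord_fst (j : Fin k) : Differentiable ℂ fun e : EPoint k => e.1 j := by
  fun_prop

lemma differentiable_coord_snd (j : Fin k) : Differentiable ℂ fun e : EPoint k => e.2 j := by
  fun_prop

lemma differentiable_polePt (p : EqPair k) :
    Differentiable ℂ fun e : EPoint k => polePt p e.1 e.2 := by
  unfold polePt
  fun_prop

lemma differentiableAt_prod {ι E : Type*} [NormedAddCommGroup E] [NormedSpace ℂ E] {e : E}
    (s : Finset ι) {f : ι → E → ℂ} (hf : ∀ i ∈ s, DifferentiableAt ℂ (f i) e) :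
    DifferentiableAt ℂ (fun e => ∏ i ∈ s, f i e) e := by
  classical
  induction s using Finset.induction_on with
  | empty => simp
  | insert i s hi ih =>
    simp only [Finset.prod_insert hi]
    exact (hf i (Finset.mem_insert_self i s)).mul
      (ih fun j hj => hf j (Finset.mem_insert_of_mem hj))

lemma differentiable_coeff_prod {ι E : Type*} [NormedAddCommGroup E] [NormedSpace ℂ E]
    (s : Finset ι) {r : ι → E → ℂ} (hr : ∀ i, Differentiable ℂ (r i)) (j : ℕ) :
    Differentiable ℂ fun e => (∏ i ∈ s, (X - C (r i e)) : ℂ[X]).coeff j := by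
  classical
  induction s using Finset.induction_on generalizing j with
  | empty => simp only [Finset.prod_empty]; exact differentiable_const _
  | insert i s hi ih =>
    simp only [Finset.prod_insert hi, sub_mul, coeff_sub, coeff_C_mul]
    refine Differentiable.sub ?_ ((hr i).mul (ih j))
    cases j with
    | zero => simp
    | succ n => simpa only [coeff_X_mul] using ih n

lemma natDegree_polarPoly (e : EPoint k) : (polarPoly e).natDegree = Fintype.card (EqPair k) := by
  rw [polarPoly, natDegree_prod _ _ fun p _ => X_sub_C_ne_zero _]
  simp

lemma diffOp_polarPoly_apply (e : EPoint k) (h : ℝ → ℂ) (u : ℝ) :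
    diffOp (polarPoly e) h u = ∑ j ∈ Finset.range (Fintype.card (EqPair k) + 1),
      (polarPoly e).coeff j * (-1) ^ j * iteratedDeriv j h u := by
  rw [diffOp_apply]
  refine Finset.sum_subset (fun j hj => ?_) fun j _ hj => ?_
  · rw [Finset.mem_range, Nat.lt_succ_iff, ← natDegree_polarPoly e]
    exact le_natDegree_of_mem_supp j hj
  · rw [notMem_support_iff.1 hj]; ring

lemma differentiable_diffOp_polarPoly (h : ℝ → ℂ) (u : ℝ) :
    Differentiable ℂ fun e : EPoint k => diffOp (polarPoly e) h u := by
  simp_rw [diffOp_polarPoly_apply]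
  refine Differentiable.fun_sum fun j _ => ?_
  have := differentiable_coeff_prod Finset.univ (fun p : EqPair k => differentiable_polePt p) j
  exact (this.mul_const _).mul_const _

lemma mem_evenPrimitive {q : ℕ} [NeZero q] {χ : DirichletCharacter ℂ q} :
    χ ∈ evenPrimitive q ↔ χ.IsPrimitive ∧ χ.Even := by
  simp [evenPrimitive]

lemma ne_one_of_isPrimitive {q : ℕ} (hq : q ≠ 1) {χ : DirichletCharacter ℂ q}
    (hχ : χ.IsPrimitive) (hq0 : q ≠ 0) : χ ≠ 1 := by
  rintro rfl
  have : NeZero q := ⟨hq0⟩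
  have h := DirichletCharacter.conductor_one (R := ℂ) (n := q)
  rw [DirichletCharacter.isPrimitive_def] at hχ
  exact hq (hχ.symm.trans h)

lemma differentiable_twistedProduct (M N : ℕ) {q : ℕ} [NeZero q] (hq : q ≠ 1)
    {χ : DirichletCharacter ℂ q} (hχ : χ.IsPrimitive) :
    Differentiable ℂ fun e : EPoint k => twistedProduct M N e.1 e.2 χ := by
  have h1 : χ ≠ 1 := ne_one_of_isPrimitive hq hχ (NeZero.ne q)
  have h2 : χ⁻¹ ≠ 1 := fun h => h1 (inv_eq_one.1 h)
  have d1 := DirichletCharacter.differentiable_LFunction h1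
  have d2 := DirichletCharacter.differentiable_LFunction h2
  unfold twistedProduct
  refine (Differentiable.mul ?_ ?_).const_mul _
  · exact fun e => differentiableAt_prod _ fun j _ =>
      (d1 (e.1 j)).comp e (differentiable_coord_fst j e)
  · exact fun e => differentiableAt_prod _ fun j _ =>
      (d2 (e.2 j)).comp e (differentiable_coord_snd j e)

lemma differentiable_coeffA (M N : ℕ) (q : ℕ+) :
    Differentiable ℂ fun e : EPoint k => coeffA M N e q := by
  unfold coeffA
  split_ifs with h
  · exact differentiable_const _
  · refine Differentiable.fun_sum fun χ hχ => ?_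
    exact differentiable_twistedProduct M N (fun hq => h (PNat.coe_eq_one_iff.1 hq))
      (mem_evenPrimitive.1 hχ).1

lemma sum_evenPrimitive_one (M N : ℕ) (e : EPoint k) :
    ∑ χ ∈ evenPrimitive ((1 : ℕ+) : ℕ), twistedProduct M N e.1 e.2 χ = zetaProduct e.1 e.2 := by
  have : Subsingleton (ZMod ((1 : ℕ+) : ℕ)) := inferInstanceAs (Subsingleton (ZMod 1))
  have h1 : evenPrimitive ((1 : ℕ+) : ℕ) = {1} := by
    ext χ
    rw [mem_evenPrimitive, Finset.mem_singleton]
    have hχ : χ = 1 := DirichletCharacter.level_one χ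
    subst hχ
    refine ⟨fun _ => rfl, fun _ => ⟨?_, ?_⟩⟩
    · exact DirichletCharacter.isPrimitive_one_level_one
    · rw [DirichletCharacter.Even, MulChar.one_apply (isUnit_of_subsingleton _)]
  rw [h1, Finset.sum_singleton, twistedProduct, inv_one,
    MulChar.one_apply (isUnit_of_subsingleton _), MulChar.one_apply (isUnit_of_subsingleton _)]
  have : ∀ s, DirichletCharacter.LFunction (1 : DirichletCharacter ℂ ((1 : ℕ+) : ℕ)) s =
      riemannZeta s := fun s => congrFun DirichletCharacter.LFunction_modOne_eq s
  simp only [this, zetaProduct, Finset.prod_mul_distrib, one_mul]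

/-- `S(h; s, z) = ∑_{q ≥ 2} a_q(s, z) h(log q)` after removal of the polar factor depends
holomorphically on `(s, z)`. -/
lemma differentiable_coeffSum (M N : ℕ) {h : ℝ → ℂ} {U : ℝ} (hU : ∀ u, U < u → h u = 0) :
    Differentiable ℂ fun e : EPoint k => coeffSum (coeffA M N e) h := by
  obtain ⟨n, hn⟩ := exists_log_natCast_ge U
  simp_rw [fun e : EPoint k => coeffSum_eq_sum (coeffA M N e) (n := n)
    (fun u hu => hU u (hn.trans_lt hu))]
  exact Differentiable.fun_sum fun q _ => (differentiable_coeffA M N q).mul_const _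

lemma differentiable_coeffSum_diffOp (M N : ℕ) {h : ℝ → ℂ} {U : ℝ} (hU : ∀ u, U < u → h u = 0) :
    Differentiable ℂ fun e : EPoint k => coeffSum (coeffA M N e) (diffOp (polarPoly e) h) := by
  obtain ⟨n, hn⟩ := exists_log_natCast_ge U
  simp_rw [fun e : EPoint k => coeffSum_eq_sum (coeffA M N e) (n := n)
    (fun u hu => diffOp_eq_zero (P := polarPoly e) hU (hn.trans_lt hu))]
  exact Differentiable.fun_sum fun q _ =>
    (differentiable_coeffA M N q).mul (differentiable_diffOp_polarPoly h _)

/-- In the domain of absolute convergence, the series minus its first term. -/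
lemma mds_sub_zetaProduct {M N : ℕ} {e : EPoint k} {w : ℂ}
    (hs : Summable fun q : ℕ+ => ∑ χ ∈ evenPrimitive q,
      ‖twistedProduct M N e.1 e.2 χ / (q : ℂ) ^ w‖) :
    (Summable fun q : ℕ+ => ‖coeffA M N e q‖ * (q : ℝ) ^ (-w.re)) ∧
      mds M N (e.1, e.2, w) - zetaProduct e.1 e.2 = ∑' q : ℕ+, coeffA M N e q / (q : ℂ) ^ w := by
  have hterm : ∀ q : ℕ+, ‖∑ χ ∈ evenPrimitive q, twistedProduct M N e.1 e.2 χ / (q : ℂ) ^ w‖ ≤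
      ∑ χ ∈ evenPrimitive q, ‖twistedProduct M N e.1 e.2 χ / (q : ℂ) ^ w‖ :=
    fun q => norm_sum_le _ _
  have hsum : Summable fun q : ℕ+ =>
      ∑ χ ∈ evenPrimitive q, twistedProduct M N e.1 e.2 χ / (q : ℂ) ^ w :=
    Summable.of_norm_bounded hs hterm
  refine ⟨Summable.of_nonneg_of_le (fun q => by positivity) (fun q => ?_) hs, ?_⟩
  · refine le_trans ?_ (hterm q)
    rw [← Finset.sum_div, norm_div, Complex.norm_natCast_cpow_of_pos q.pos, div_eq_mul_inv,
      Real.rpow_neg (by positivity)]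
    gcongr
    unfold coeffA
    split_ifs
    · simp
    · rfl
  · have h1 : ∑ χ ∈ evenPrimitive ((1 : ℕ+) : ℕ),
        twistedProduct M N e.1 e.2 χ / (((1 : ℕ+) : ℕ) : ℂ) ^ w = zetaProduct e.1 e.2 := by
      rw [← Finset.sum_div, sum_evenPrimitive_one]
      simp
    simp only [mds]
    rw [hsum.tsum_eq_add_tsum_ite 1, h1, add_sub_cancel_left]
    refine tsum_congr fun q => ?_
    unfold coeffA
    split_ifs
    · simp
    · rw [Finset.sum_div]

end

section

open Polynomial

variable {k : ℕ}

/-! ### Transport of the line integral representation through the tube -/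

/-- The point of `ℝ^(2k+1)` all of whose coordinates are `r`. -/
def constPt (k : ℕ) (r : ℝ) : RPoint k := (fun _ => r, fun _ => r, r)

/-- The closed box around `x` with side length `2r`. -/
def box (x : RPoint k) (r : ℝ) : Set (RPoint k) := Icc (x - constPt k r) (x + constPt k r)

lemma mem_box {x y : RPoint k} {r : ℝ} : y ∈ box x r ↔
    (∀ j, |y.1 j - x.1 j| ≤ r) ∧ (∀ j, |y.2.1 j - x.2.1 j| ≤ r) ∧ |y.2.2 - x.2.2| ≤ r := by
  simp only [box, constPt, mem_Icc, Prod.le_def, Pi.le_def, Prod.fst_sub, Prod.snd_sub,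
    Prod.fst_add, Prod.snd_add, Pi.sub_apply, Pi.add_apply, abs_le]
  constructor
  · rintro ⟨⟨h1, h2, h3⟩, h4, h5, h6⟩
    exact ⟨fun j => ⟨by linarith [h1 j], by linarith [h4 j]⟩,
      fun j => ⟨by linarith [h2 j], by linarith [h5 j]⟩, by linarith, by linarith⟩
  · rintro ⟨h1, h2, h3⟩
    exact ⟨⟨fun j => by linarith [(h1 j).1], fun j => by linarith [(h2 j).1], by linarith [h3.1]⟩,
      fun j => by linarith [(h1 j).2], fun j => by linarith [(h2 j).2], by linarith [h3.2]⟩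

lemma mem_box_iff_dist {x y : RPoint k} {r : ℝ} (hr : 0 ≤ r) : y ∈ box x r ↔ dist y x ≤ r := by
  rw [mem_box, Prod.dist_eq, Prod.dist_eq, max_le_iff, max_le_iff, dist_pi_le_iff hr,
    dist_pi_le_iff hr]
  simp only [Real.dist_eq]

lemma exists_box_subset {V : Set (RPoint k)} (hV : IsOpen V) {x : RPoint k} (hx : x ∈ V) :
    ∃ r > 0, box x r ⊆ V := by
  obtain ⟨r, hr, hrV⟩ := Metric.isOpen_iff.1 hV x hx
  refine ⟨r / 2, by positivity, fun y hy => hrV ?_⟩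
  rw [mem_box_iff_dist (by positivity)] at hy
  rw [mem_ball]
  linarith

lemma norm_imPt_le (e : EPoint k) (w : ℂ) : ‖imPt ((e.1, e.2, w) : CPoint k)‖ ≤ ‖e‖ + |w.im| := by
  have h0 : 0 ≤ ‖e‖ + |w.im| := by positivity
  rw [imPt, Prod.norm_def, Prod.norm_def, max_le_iff, max_le_iff, pi_norm_le_iff_of_nonneg h0,
    pi_norm_le_iff_of_nonneg h0]
  refine ⟨fun j => ?_, fun j => ?_, ?_⟩
  · calc ‖(e.1 j).im‖ ≤ ‖e.1 j‖ := Complex.abs_im_le_norm _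
      _ ≤ ‖e.1‖ := norm_le_pi_norm _ _
      _ ≤ ‖e‖ := norm_fst_le e
      _ ≤ _ := by linarith [abs_nonneg w.im]
  · calc ‖(e.2 j).im‖ ≤ ‖e.2 j‖ := Complex.abs_im_le_norm _
      _ ≤ ‖e.2‖ := norm_le_pi_norm _ _
      _ ≤ ‖e‖ := norm_snd_le e
      _ ≤ _ := by linarith [abs_nonneg w.im]
  · simp

/-- Polynomial bound over a closed box. -/
lemma PolyBoundedInStrips.exists_bound {V : Set (RPoint k)} {F : CPoint k → ℂ}
    (hF : PolyBoundedInStrips V F) {x : RPoint k} {r : ℝ} (hb : box x r ⊆ V) :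
    ∃ (C : ℝ) (n : ℕ), 0 ≤ C ∧ ∀ (e : EPoint k) (w : ℂ), rePt ((e.1, e.2, w) : CPoint k) ∈ box x r →
      ‖F (e.1, e.2, w)‖ ≤ C * (1 + ‖e‖) ^ n * (1 + |w.im|) ^ n := by
  obtain ⟨C, n, hC⟩ := hF _ _ hb
  refine ⟨|C|, n, abs_nonneg _, fun e w hw => (hC _ hw).trans ?_⟩
  rw [mul_assoc, ← mul_pow]
  gcongr
  · exact le_abs_self C
  · nlinarith [norm_imPt_le e w, norm_nonneg e, abs_nonneg w.im,
      mul_nonneg (norm_nonneg e) (abs_nonneg w.im)]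

lemma rePt_mk (e : EPoint k) (w : ℂ) : rePt ((e.1, e.2, w) : CPoint k) =
    (fun j => (e.1 j).re, fun j => (e.2 j).re, w.re) := rfl

lemma continuous_rePt : Continuous (rePt : CPoint k → RPoint k) := by
  unfold rePt
  fun_prop

lemma isOpen_tube {V : Set (RPoint k)} (hV : IsOpen V) : IsOpen (tube V) :=
  hV.preimage continuous_rePt

section Section

variable {V : Set (RPoint k)} {F : CPoint k → ℂ}

lemma differentiableAt_of_mem (hV : IsOpen V) (hF : DifferentiableOn ℂ F (tube V)) {P : CPoint k}
    (hP : rePt P ∈ V) : DifferentiableAt ℂ F P :=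
  (hF P hP).differentiableAt ((isOpen_tube hV).mem_nhds hP)

lemma differentiableAt_snd (hV : IsOpen V) (hF : DifferentiableOn ℂ F (tube V)) {e : EPoint k}
    {w : ℂ} (hP : rePt ((e.1, e.2, w) : CPoint k) ∈ V) :
    DifferentiableAt ℂ (fun w => F (e.1, e.2, w)) w :=
  DifferentiableAt.comp (f := fun w => ((e.1, e.2, w) : CPoint k)) w
    (differentiableAt_of_mem hV hF hP) (by fun_prop)

lemma differentiableAt_fst (hV : IsOpen V) (hF : DifferentiableOn ℂ F (tube V)) {e : EPoint k}
    {w : ℂ} (hP : rePt ((e.1, e.2, w) : CPoint k) ∈ V) :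
    DifferentiableAt ℂ (fun e : EPoint k => F (e.1, e.2, w)) e :=
  DifferentiableAt.comp (f := fun e : EPoint k => ((e.1, e.2, w) : CPoint k)) e
    (differentiableAt_of_mem hV hF hP) (by fun_prop)

/-- Polynomial growth times rapid decay. -/
lemma mul_laplace_le {C : ℝ} (hC : 0 ≤ C) {n : ℕ} {D : ℝ} {y l : ℂ} {t : ℝ}
    (hy : ‖y‖ ≤ C * (1 + |t|) ^ n) (hl : (1 + |t|) ^ (n + 2) * ‖l‖ ≤ D) :
    ‖y * l‖ ≤ C * D * (1 + t ^ 2)⁻¹ := by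
  rw [norm_mul, ← div_eq_mul_inv, le_div_iff₀ (by positivity)]
  calc ‖y‖ * ‖l‖ * (1 + t ^ 2) ≤ C * (1 + |t|) ^ n * ‖l‖ * (1 + |t|) ^ 2 := by
        gcongr
        nlinarith [abs_nonneg t, sq_abs t]
    _ = C * ((1 + |t|) ^ (n + 2) * ‖l‖) := by ring
    _ ≤ C * D := by gcongr

lemma differentiableAt_vline {E : Type*} [NormedAddCommGroup E] [NormedSpace ℂ E]
    [FiniteDimensional ℂ E] {Φ : E → ℂ → ℂ} {c : ℝ} {e₀ : E} {r : ℝ} (hr : 0 < r)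
    (hd : ∀ w : ℂ, w.re = c → DifferentiableOn ℂ (fun e => Φ e w) (ball e₀ r))
    (hc : ∀ e ∈ ball e₀ r, Continuous fun t : ℝ => Φ e (c + t * Complex.I)) {C : ℝ}
    (hb : ∀ e ∈ ball e₀ r, ∀ t : ℝ, ‖Φ e (c + t * Complex.I)‖ ≤ C * (1 + t ^ 2)⁻¹) :
    DifferentiableAt ℂ (fun e => vline c (Φ e)) e₀ := by
  unfold vline
  refine DifferentiableAt.const_mul (differentiableAt_integral_of_dominated hr
    (fun e he => (hc e he).aestronglyMeasurable) (fun t => hd _ (by simp)) hb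
    (integrable_inv_one_add_sq.const_mul C)) _

/-- Over a box, `F(e, w) · laplace h w` decays in vertical strips. -/
lemma strip_of_box (hV : IsOpen V) (hF : DifferentiableOn ℂ F (tube V))
    (hP : PolyBoundedInStrips V F) {x : RPoint k} {r : ℝ} (hb : box x r ⊆ V)
    {b : ℝ} {h : ℝ → ℂ} (hh : Tame b h) {e : EPoint k} {c₁ c₂ : ℝ} (hbc : b < c₁)
    (hc₁ : x.2.2 - r ≤ c₁) (hc₂ : c₂ ≤ x.2.2 + r)
    (he : (∀ j, |(e.1 j).re - x.1 j| ≤ r) ∧ ∀ j, |(e.2 j).re - x.2.1 j| ≤ r) :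
    StripHolo c₁ c₂ (fun w => F (e.1, e.2, w) * laplace h w) ∧
      StripDecay c₁ c₂ (fun w => F (e.1, e.2, w) * laplace h w) := by
  have hmem : ∀ w : ℂ, c₁ ≤ w.re → w.re ≤ c₂ → rePt ((e.1, e.2, w) : CPoint k) ∈ box x r := by
    intro w hw hw'
    rw [mem_box]
    refine ⟨he.1, he.2, ?_⟩
    rw [abs_le]
    exact ⟨by simp only [rePt_mk]; linarith, by simp only [rePt_mk]; linarith⟩
  refine ⟨fun w hw hw' => ?_, ?_⟩
  · exact (differentiableAt_snd hV hF (hb (hmem w hw hw'))).mul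
      (hh.differentiableAt_laplace (hbc.trans_le hw))
  · obtain ⟨C, n, hC0, hC⟩ := hP.exists_bound hb
    obtain ⟨D, hD0, hD⟩ := hh.laplace_decay hbc c₂ (n + 2)
    exact ⟨_, fun w hw hw' => mul_laplace_le (by positivity) (hC e w (hmem w hw hw')) (hD w hw hw')⟩

/-- Holomorphic dependence of the line integral on `(s, z)`. -/
lemma differentiableAt_vline_of_box (hV : IsOpen V) (hF : DifferentiableOn ℂ F (tube V))
    (hP : PolyBoundedInStrips V F) {x : RPoint k} {r : ℝ} (hb : box x r ⊆ V)
    {b : ℝ} {h : ℝ → ℂ} (hh : Tame b h) {c : ℝ} (hbc : b < c) (hc : |c - x.2.2| ≤ r)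
    {e : EPoint k} (he : (∀ j, |(e.1 j).re - x.1 j| < r) ∧ ∀ j, |(e.2 j).re - x.2.1 j| < r) :
    DifferentiableAt ℂ (fun e : EPoint k => vline c fun w => F (e.1, e.2, w) * laplace h w) e := by
  have hopen : IsOpen {e : EPoint k | (∀ j, |(e.1 j).re - x.1 j| < r) ∧
      ∀ j, |(e.2 j).re - x.2.1 j| < r} := by
    simp only [ofPred_and, ofPred_forall]
    refine IsOpen.inter (isOpen_iInter_of_finite fun j => ?_) (isOpen_iInter_of_finite fun j => ?_)
    · exact isOpen_lt (by fun_prop) continuous_const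
    · exact isOpen_lt (by fun_prop) continuous_const
  obtain ⟨ρ, hρ, hρs⟩ := Metric.isOpen_iff.1 hopen e he
  have hρs' : ∀ y ∈ ball e ρ, (∀ j, |(y.1 j).re - x.1 j| ≤ r) ∧ ∀ j, |(y.2 j).re - x.2.1 j| ≤ r :=
    fun y hy => ⟨fun j => ((hρs hy).1 j).le, fun j => ((hρs hy).2 j).le⟩
  rw [abs_le] at hc
  have hmem : ∀ y ∈ ball e ρ, ∀ w : ℂ, w.re = c → rePt ((y.1, y.2, w) : CPoint k) ∈ box x r := by
    intro y hy w hw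
    rw [mem_box]
    exact ⟨(hρs' y hy).1, (hρs' y hy).2, by simp only [rePt_mk, hw, abs_le]; exact hc⟩
  obtain ⟨C, n, hC0, hC⟩ := hP.exists_bound hb
  obtain ⟨D, hD0, hD⟩ := hh.laplace_decay hbc c (n + 2)
  refine differentiableAt_vline hρ (fun w hw y hy => ?_) (fun y hy => ?_)
    (C := C * (1 + (‖e‖ + ρ)) ^ n * D) fun y hy t => ?_
  · exact ((differentiableAt_fst hV hF (hb (hmem y hy w hw))).mul_const _).differentiableWithinAt
  · exact (strip_of_box hV hF hP hb hh hbc (by linarith) (by linarith)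
      (hρs' y hy)).1.continuous_line le_rfl le_rfl
  · have h1 := hC y (c + t * Complex.I) (hmem y hy _ (by simp))
    have h2 := hD (c + t * Complex.I) (by simp) (by simp)
    have him : (c + t * Complex.I : ℂ).im = t := by simp
    rw [him] at h1 h2
    refine mul_laplace_le (by positivity) (h1.trans ?_) h2
    gcongr
    rw [mem_ball, dist_eq_norm] at hy
    have := norm_le_norm_add_norm_sub' y e
    linarith

end Section

end

section

open Polynomial

variable {k : ℕ}

/-- Over the real point `x`, the coefficient sums are line integrals of `F`. -/
def Represents (M N : ℕ) (F : CPoint k → ℂ) (x : RPoint k) : Prop :=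
  ∀ (e : EPoint k) (c : ℝ), rePt ((e.1, e.2, (c : ℂ)) : CPoint k) = x →
    ∀ h : ℝ → ℂ, ContDiff ℝ ∞ h → HasCompactSupport h →
      coeffSum (coeffA M N e) (diffOp (polarPoly e) h) =
        vline c fun w => F (e.1, e.2, w) * laplace h w

lemma represents_of_agrees {M N : ℕ} {V : Set (RPoint k)} {F : CPoint k → ℂ}
    (hF : IsMDSContinuation k M N V F) {x : RPoint k}
    (hx : x ∈ V ∩ interior (absConvBase k M N)) : Represents M N F x := by
  intro e c hec h hs hc
  have hT := Tame.of_hasCompactSupport hs hc (c - 1)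
  have hx' : x ∈ absConvBase k M N := interior_subset hx.2
  have hre : ∀ w : ℂ, w.re = c → rePt ((e.1, e.2, w) : CPoint k) = x := by
    intro w hw
    rw [← hec, rePt_mk, rePt_mk, hw, Complex.ofReal_re]
  have hsum : ∀ w : ℂ, w.re = c → _ := fun w hw =>
    mds_sub_zetaProduct (M := M) (N := N) (e := e) (hx' ((e.1, e.2, w) : CPoint k) (hre w hw))
  have h1 := (hsum c (Complex.ofReal_re c)).1
  rw [Complex.ofReal_re] at h1
  rw [coeffSum_diffOp_eq_vline hT (by linarith) (polarPoly e) h1, vline, vline]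
  congr 1
  refine integral_congr_ae (ae_of_all _ fun t => ?_)
  have hw : (c + t * Complex.I : ℂ).re = c := by simp
  simp only []
  rw [hF.agrees (e.1, e.2, (c + t * Complex.I : ℂ)) (by
    change rePt _ ∈ V ∩ interior (absConvBase k M N)
    rw [hre _ hw]
    exact hx), (hsum _ hw).2, eval_polarPoly]

lemma represents_of_box {M N : ℕ} {V : Set (RPoint k)} {F : CPoint k → ℂ}
    (hF : IsMDSContinuation k M N V F) {x x₁ : RPoint k} {r : ℝ} (hb : box x r ⊆ V)
    (hx₁ : x₁ ∈ ball x r) (hrep : ∀ᶠ y in 𝓝 x₁, Represents M N F y) {y : RPoint k}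
    (hy : y ∈ ball x r) : Represents M N F y := by
  intro e c hec h hs hc
  have hr : 0 < r := pos_of_mem_ball hy
  have hball : ∀ v : RPoint k, v ∈ ball x r → (∀ j, |v.1 j - x.1 j| < r) ∧
      (∀ j, |v.2.1 j - x.2.1 j| < r) ∧ |v.2.2 - x.2.2| < r := by
    intro v hv
    rw [mem_ball, Prod.dist_eq, Prod.dist_eq, max_lt_iff, max_lt_iff, dist_pi_lt_iff hr,
      dist_pi_lt_iff hr] at hv
    exact hv
  obtain ⟨hy1, hy2, hy3⟩ := hball y hy
  obtain ⟨hx1, hx2, hx3⟩ := hball x₁ hx₁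
  subst hec
  simp only [rePt_mk, Complex.ofReal_re] at hy1 hy2 hy3
  set c₁ := x₁.2.2 with hc₁
  set b : ℝ := x.2.2 - r - 1 with hbdef
  have hT := Tame.of_hasCompactSupport hs hc b
  obtain ⟨U, hU⟩ := hT.vanish
  -- the line integral at `e` does not depend on the abscissa
  have hshift : vline c (fun w => F (e.1, e.2, w) * laplace h w) =
      vline c₁ (fun w => F (e.1, e.2, w) * laplace h w) := by
    have hy3' := abs_lt.1 hy3
    have hx3' := abs_lt.1 hx3
    rcases le_total c c₁ with hle | hle
    · obtain ⟨s1, s2⟩ := strip_of_box hF.isOpen hF.holomorphic hF.polyBounded hb hT (e := e)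
        (c₁ := c) (c₂ := c₁) (by linarith) (by linarith) (by linarith)
        ⟨fun j => (hy1 j).le, fun j => (hy2 j).le⟩
      exact vline_eq_vline hle s1 s2
    · obtain ⟨s1, s2⟩ := strip_of_box hF.isOpen hF.holomorphic hF.polyBounded hb hT (e := e)
        (c₁ := c₁) (c₂ := c) (by linarith) (by linarith) (by linarith)
        ⟨fun j => (hy1 j).le, fun j => (hy2 j).le⟩
      exact (vline_eq_vline hle s1 s2).symm
  rw [hshift]
  -- move from `x₁` to `y` along a complex line
  set e₁ : EPoint k := (fun j => (x₁.1 j : ℂ), fun j => (x₁.2.1 j : ℂ)) with he₁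
  set ℓ : ℂ → EPoint k := fun μ => e₁ + μ • (e - e₁) with hℓ
  have hℓd : Differentiable ℂ ℓ := by
    rw [hℓ]
    fun_prop
  set Λ : Set ℂ := {μ | (∀ j, |((ℓ μ).1 j).re - x.1 j| < r) ∧ ∀ j, |((ℓ μ).2 j).re - x.2.1 j| < r}
    with hΛ
  have hΛo : IsOpen Λ := by
    have hcont := hℓd.continuous
    simp only [hΛ, ofPred_and, ofPred_forall]
    refine IsOpen.inter (isOpen_iInter_of_finite fun j => ?_) (isOpen_iInter_of_finite fun j => ?_)
    · exact isOpen_lt (by fun_prop) continuous_const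
    · exact isOpen_lt (by fun_prop) continuous_const
  have hΛc : Convex ℝ Λ := by
    have hre : ∀ (a b : ℝ) (μ ν : ℂ), a + b = 1 → ℓ (a • μ + b • ν) = a • ℓ μ + b • ℓ ν := by
      intro a b μ ν hab
      have hab' : (a : ℂ) + b = 1 := by exact_mod_cast hab
      ext j
      · simp [hℓ]
        linear_combination (-(e₁.1 j)) * hab'
      · simp [hℓ]
        linear_combination (-(e₁.2 j)) * hab'
    intro μ hμ ν hν a b ha hb' hab
    have key : ∀ p q t : ℝ, |p - t| < r → |q - t| < r → |a * p + b * q - t| < r := by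
      intro p q t hp hq
      have : p ∈ ball t r := by rwa [mem_ball, Real.dist_eq]
      have h2 : q ∈ ball t r := by rwa [mem_ball, Real.dist_eq]
      have h3 := convex_ball t r this h2 ha hb' hab
      rw [mem_ball, Real.dist_eq] at h3
      simpa using h3
    refine ⟨fun j => ?_, fun j => ?_⟩
    · rw [hre a b μ ν hab]
      simpa using key _ _ _ (hμ.1 j) (hν.1 j)
    · rw [hre a b μ ν hab]
      simpa using key _ _ _ (hμ.2 j) (hν.2 j)
  have h0 : (0 : ℂ) ∈ Λ := ⟨fun j => by simpa [hℓ, he₁] using hx1 j,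
    fun j => by simpa [hℓ, he₁] using hx2 j⟩
  have h1 : (1 : ℂ) ∈ Λ := ⟨fun j => by simpa [hℓ] using hy1 j, fun j => by simpa [hℓ] using hy2 j⟩
  have hA : AnalyticOnNhd ℂ (fun μ => coeffSum (coeffA M N (ℓ μ)) (diffOp (polarPoly (ℓ μ)) h)) Λ :=
    DifferentiableOn.analyticOnNhd (fun μ _ =>
      ((differentiable_coeffSum_diffOp M N hU).comp hℓd μ).differentiableWithinAt) hΛo
  have hB : AnalyticOnNhd ℂ (fun μ => vline c₁ fun w => F ((ℓ μ).1, (ℓ μ).2, w) * laplace h w) Λ := by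
    refine DifferentiableOn.analyticOnNhd (fun μ hμ => ?_) hΛo
    refine DifferentiableAt.differentiableWithinAt ?_
    exact DifferentiableAt.comp (f := ℓ) μ (differentiableAt_vline_of_box hF.isOpen hF.holomorphic
      hF.polyBounded hb hT (by linarith [(abs_lt.1 hx3).1]) hx3.le hμ) (hℓd μ)
  have hev : (fun μ => coeffSum (coeffA M N (ℓ μ)) (diffOp (polarPoly (ℓ μ)) h)) =ᶠ[𝓝 0]
      fun μ => vline c₁ fun w => F ((ℓ μ).1, (ℓ μ).2, w) * laplace h w := by
    have hcont : Continuous fun μ : ℂ => rePt (((ℓ μ).1, (ℓ μ).2, (c₁ : ℂ)) : CPoint k) := by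
      have := hℓd.continuous
      exact continuous_rePt.comp (by fun_prop)
    have hx₁' : rePt (((ℓ 0).1, (ℓ 0).2, (c₁ : ℂ)) : CPoint k) = x₁ := by
      simp [rePt, hℓ, he₁, hc₁]
    have htend := hcont.tendsto 0
    rw [hx₁'] at htend
    filter_upwards [htend.eventually hrep] with μ hμ
    exact hμ (ℓ μ) c₁ rfl h hs hc
  have := hA.eqOn_of_preconnected_of_eventuallyEq hB hΛc.isPreconnected h0 hev h1
  simpa [hℓ] using this

/-- The line integral representation of the coefficient sums, over the whole tube. -/
theorem IsMDSContinuation.represents {M N : ℕ} {V : Set (RPoint k)} {F : CPoint k → ℂ}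
    (hF : IsMDSContinuation k M N V F) {x : RPoint k} (hx : x ∈ V) : Represents M N F x := by
  have hsub : V ⊆ interior {x | Represents M N F x} := by
    refine hF.isConnected.isPreconnected.subset_of_closure_inter_subset isOpen_interior ?_ ?_
    · obtain ⟨y, hy⟩ := hF.meets
      refine ⟨y, hy.1, mem_interior.2 ⟨V ∩ interior (absConvBase k M N),
        fun v hv => represents_of_agrees hF hv, hF.isOpen.inter isOpen_interior, hy⟩⟩
    · rintro y ⟨hy, hyV⟩
      obtain ⟨r, hr, hb⟩ := exists_box_subset hF.isOpen hyV
      obtain ⟨v, hv, hvr⟩ := Metric.mem_closure_iff.1 hy r hr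
      have hv' : v ∈ ball y r := by rwa [mem_ball, dist_comm]
      refine mem_interior.2 ⟨ball y r, fun u hu => ?_, isOpen_ball, mem_ball_self hr⟩
      exact represents_of_box hF hb hv' (mem_interior_iff_mem_nhds.1 hv) hu
  exact interior_subset (hsub hx)

end

section

open Polynomial

variable {k : ℕ}

/-! ### The moment as a line integral near the central point -/

lemma StripDecay.div_sub {c₁ c₂ : ℝ} {f : ℂ → ℂ} {c : ℝ} (hd : StripDecay c₁ c₂ f)
    (h₁ : c₁ ≤ c) (h₂ : c ≤ c₂) {w₀ : ℂ} (hne : w₀.re ≠ c) :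
    StripDecay c c fun w => f w / (w - w₀) := by
  obtain ⟨C, hC⟩ := hd
  have hpos : 0 < |c - w₀.re| := abs_pos.2 (sub_ne_zero.2 hne.symm)
  refine ⟨C / |c - w₀.re|, fun w hw hw' => ?_⟩
  have hwc : w.re = c := le_antisymm hw' hw
  have h3 := hC w (h₁.trans hw) (hw'.trans h₂)
  rw [norm_div, div_mul_eq_mul_div]
  have h4 : |c - w₀.re| ≤ ‖w - w₀‖ := by
    rw [← hwc, ← Complex.sub_re]
    exact Complex.abs_re_le_norm _
  gcongr
  exact (norm_nonneg _).trans h3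

lemma StripHolo.div_sub {c₁ c₂ : ℝ} {f : ℂ → ℂ} {c : ℝ} (hf : StripHolo c₁ c₂ f)
    (h₁ : c₁ ≤ c) (h₂ : c ≤ c₂) {w₀ : ℂ} (hne : w₀.re ≠ c) :
    StripHolo c c fun w => f w / (w - w₀) := by
  intro w hw hw'
  have hwc : w.re = c := le_antisymm hw' hw
  refine (hf w (h₁.trans hw) (hw'.trans h₂)).div (by fun_prop) fun h => hne ?_
  rw [← hwc, sub_eq_zero.1 h]

/-- The residue theorem for simple poles between two vertical lines. -/
lemma vline_sub_vline_prod {ι : Type*} [Fintype ι] [DecidableEq ι] [Nonempty ι] {c₁ c₂ : ℝ}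
    {f : ℂ → ℂ} (hf : StripHolo c₁ c₂ f) (hd : StripDecay c₁ c₂ f) {r : ι → ℂ}
    (hr : Function.Injective r) (h₁ : ∀ i, c₁ < (r i).re) (h₂ : ∀ i, (r i).re < c₂) :
    vline c₂ (fun w => f w / ∏ i, (w - r i)) - vline c₁ (fun w => f w / ∏ i, (w - r i)) =
      ∑ i, f (r i) / ∏ j ∈ Finset.univ.erase i, (r i - r j) := by
  have h₁₂ : c₁ ≤ c₂ := by
    obtain ⟨i⟩ := ‹Nonempty ι›
    exact (h₁ i).le.trans (h₂ i).le
  set α : ι → ℂ := fun i => (∏ j ∈ Finset.univ.erase i, (r i - r j))⁻¹ with hα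
  have hpf : ∀ w : ℂ, (∀ i, w ≠ r i) → f w / ∏ i, (w - r i) = ∑ i, α i * (f w / (w - r i)) := by
    intro w hw
    have hne : ∀ i, w - r i ≠ 0 := fun i => sub_ne_zero.2 (hw i)
    have hbasis := congrArg (Polynomial.eval w) (Lagrange.sum_basis (s := Finset.univ) (v := r)
      hr.injOn Finset.univ_nonempty)
    rw [eval_finsetSum, eval_one] at hbasis
    have hterm : ∀ i, (Lagrange.basis Finset.univ r i).eval w =
        α i * ((∏ j, (w - r j)) / (w - r i)) := by
      intro i
      rw [Lagrange.basis, eval_prod]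
      simp only [Lagrange.basisDivisor, eval_mul, eval_C, eval_sub, eval_X]
      rw [Finset.prod_mul_distrib, Finset.prod_inv_distrib, ← Finset.mul_prod_erase Finset.univ
        (fun j => w - r j) (Finset.mem_univ i), mul_div_cancel_left₀ _ (hne i)]
    simp_rw [hterm] at hbasis
    have hprod : ∏ j, (w - r j) ≠ 0 := Finset.prod_ne_zero_iff.2 fun i _ => hne i
    rw [div_eq_iff hprod, Finset.sum_mul]
    calc f w = f w * 1 := (mul_one _).symm
      _ = _ := by
        rw [← hbasis, Finset.mul_sum]
        refine Finset.sum_congr rfl fun i _ => ?_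
        ring
  have hline : ∀ c, c₁ ≤ c → c ≤ c₂ → (∀ i, (r i).re ≠ c) →
      vline c (fun w => f w / ∏ i, (w - r i)) = ∑ i, α i * vline c fun w => f w / (w - r i) := by
    intro c hc hc' hne
    have hint : ∀ i, Integrable fun t : ℝ => f (c + t * Complex.I) / (c + t * Complex.I - r i) :=
      fun i => (hd.div_sub hc hc' (hne i)).integrable_line (hf.div_sub hc hc' (hne i)) le_rfl le_rfl
    simp only [vline]
    have : ∀ t : ℝ, f (c + t * Complex.I) / ∏ i, (c + t * Complex.I - r i) =
        ∑ i, α i * (f (c + t * Complex.I) / (c + t * Complex.I - r i)) := fun t =>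
      hpf _ fun i h => hne i (by rw [← h]; simp)
    simp_rw [this]
    rw [integral_finsetSum _ fun i _ => (hint i).const_mul _, Finset.mul_sum]
    refine Finset.sum_congr rfl fun i _ => ?_
    rw [integral_const_mul]
    ring
  rw [hline c₂ h₁₂ le_rfl fun i => (h₂ i).ne, hline c₁ le_rfl h₁₂ fun i => (h₁ i).ne',
    ← Finset.sum_sub_distrib]
  refine Finset.sum_congr rfl fun i _ => ?_
  rw [← mul_sub, vline_sub_vline_eq hf hd (h₁ i) (h₂ i), hα, div_eq_inv_mul]

/-- For `(s, z)` in the central tube, all poles are close to `2`. -/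
lemma abs_polePt_re_sub_two_le {η : ℝ} (hη : 0 ≤ η) {e : EPoint k} (he : e ∈ centralTube k η)
    (p : EqPair k) : |(polePt p e.1 e.2).re - 2| ≤ 2 * k * η := by
  have h1 : (polePt p e.1 e.2).re - 2 =
      -(∑ j ∈ p.1.1, ((e.1 j).re - 1 / 2)) - ∑ h ∈ p.1.2, ((e.2 h).re - 1 / 2) := by
    have hc : (p.1.2.card : ℝ) = p.1.1.card := by rw [p.2]
    simp only [polePt, Complex.sub_re, Complex.add_re, Complex.re_sum, Finset.sum_sub_distrib,
      Finset.sum_const, nsmul_eq_mul, hc]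
    simp
    ring
  have hb : ∀ (s : Finset (Fin k)) (f : Fin k → ℝ), (∀ j, |f j| < η) → |∑ j ∈ s, f j| ≤ k * η := by
    intro s f hf
    calc |∑ j ∈ s, f j| ≤ ∑ j ∈ s, |f j| := Finset.abs_sum_le_sum_abs _ _
      _ ≤ ∑ j ∈ s, η := Finset.sum_le_sum fun j _ => (hf j).le
      _ = s.card * η := by simp
      _ ≤ k * η := by
        gcongr
        simpa using Finset.card_le_univ s
  rw [h1]
  have a1 := abs_le.1 (hb p.1.1 (fun j => (e.1 j).re - 1 / 2) he.1)
  have a2 := abs_le.1 (hb p.1.2 (fun j => (e.2 j).re - 1 / 2) he.2)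
  rw [abs_le]
  constructor <;> linarith [a1.1, a1.2, a2.1, a2.2]

/-- A closed box in `V` around the central point. -/
structure CentralBox (V : Set (RPoint k)) (r : ℝ) : Prop where
  pos : 0 < r
  le : r ≤ 1 / 8
  subset : box (centralPt k) r ⊆ V

lemma exists_centralBox {V : Set (RPoint k)} (hV : IsOpen V) (hc : centralPt k ∈ V) :
    ∃ r, CentralBox V r := by
  obtain ⟨r, hr, hb⟩ := exists_box_subset hV hc
  refine ⟨min r (1 / 8), by positivity, min_le_right _ _, fun y hy => hb ?_⟩
  rw [mem_box_iff_dist (by positivity)] at hy ⊢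
  exact hy.trans (min_le_left _ _)

/-- The width of the central tube that belongs to a central box. -/
def etaOf (k : ℕ) (r : ℝ) : ℝ := r / (4 * (k + 1))

section Central

variable {M N : ℕ} {V : Set (RPoint k)} {F : CPoint k → ℂ} {r : ℝ}

lemma CentralBox.etaOf_pos (hr : CentralBox V r) : 0 < etaOf k r := by
  have := hr.pos
  unfold etaOf
  positivity

lemma CentralBox.etaOf_le (hr : CentralBox V r) : etaOf k r ≤ r / 4 := by
  have := hr.pos
  unfold etaOf
  gcongr
  have : (0 : ℝ) ≤ k := by positivity
  linarith

lemma CentralBox.polePt_bounds (hr : CentralBox V r) {e : EPoint k}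
    (he : e ∈ centralTube k (etaOf k r)) (p : EqPair k) :
    2 - r / 2 < (polePt p e.1 e.2).re ∧ (polePt p e.1 e.2).re < 2 + r / 2 := by
  have h1 := abs_polePt_re_sub_two_le hr.etaOf_pos.le he p
  have h2 : 2 * k * etaOf k r < r / 2 := by
    have := hr.pos
    unfold etaOf
    rw [mul_div_assoc', div_lt_iff₀ (by positivity)]
    nlinarith [(by positivity : (0 : ℝ) ≤ k)]
  have := abs_le.1 (h1.trans h2.le)
  have h3 := abs_lt.1 (h1.trans_lt h2)
  constructor <;> linarith [h3.1, h3.2]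

lemma CentralBox.mem_box (hr : CentralBox V r) {e : EPoint k}
    (he : e ∈ centralTube k (etaOf k r)) :
    (∀ j, |(e.1 j).re - (centralPt k).1 j| < r) ∧ ∀ j, |(e.2 j).re - (centralPt k).2.1 j| < r := by
  have h1 := hr.etaOf_le
  have h2 := hr.pos
  exact ⟨fun j => (he.1 j).trans_le (by linarith), fun j => (he.2 j).trans_le (by linarith)⟩

lemma CentralBox.strip (hr : CentralBox V r) (hF : IsMDSContinuation k M N V F) {e : EPoint k}
    (he : e ∈ centralTube k (etaOf k r)) {b : ℝ} {h : ℝ → ℂ} (hh : Tame b h) (hb : b < 2 - r) :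
    StripHolo (2 - r) (2 + r) (fun w => F (e.1, e.2, w) * laplace h w) ∧
      StripDecay (2 - r) (2 + r) (fun w => F (e.1, e.2, w) * laplace h w) :=
  strip_of_box hF.isOpen hF.holomorphic hF.polyBounded hr.subset hh hb le_rfl le_rfl
    ⟨fun j => ((hr.mem_box he).1 j).le, fun j => ((hr.mem_box he).2 j).le⟩

lemma CentralBox.rePt_mem (hr : CentralBox V r) {e : EPoint k}
    (he : e ∈ centralTube k (etaOf k r)) {w : ℂ} (h₁ : 2 - r ≤ w.re) (h₂ : w.re ≤ 2 + r) :
    rePt ((e.1, e.2, w) : CPoint k) ∈ box (centralPt k) r := by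
  rw [UnitaryMDS.mem_box]
  refine ⟨fun j => ((hr.mem_box he).1 j).le, fun j => ((hr.mem_box he).2 j).le, ?_⟩
  rw [abs_le]
  simp only [rePt_mk, centralPt]
  constructor <;> linarith

lemma prod_sub_polePt_ne_zero (hr : CentralBox V r) {e : EPoint k}
    (he : e ∈ centralTube k (etaOf k r)) {w : ℂ} (hw : w.re ≤ 2 - r / 2 ∨ 2 + r / 2 ≤ w.re) :
    polarFactor e.1 e.2 w ≠ 0 := by
  rw [polarFactor_eq]
  refine Finset.prod_ne_zero_iff.2 fun p _ h => ?_
  have := hr.polePt_bounds he p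
  rw [← sub_eq_zero.1 h] at this
  rcases hw with h | h <;> linarith [this.1, this.2]

/-- The coefficient sum as a line integral of `F / ∏ (w - w_{J,H})` to the right of all poles. -/
theorem coeffSum_eq_vline_div (hF : IsMDSContinuation k M N V F) (hr : CentralBox V r)
    {e : EPoint k} (he : e ∈ centralTube k (etaOf k r)) {b : ℝ} {g : ℝ → ℂ} (hg : Tame b g)
    (hb : b ≤ 2 + r / 2) :
    coeffSum (coeffA M N e) g =
      vline (2 + r) fun w => F (e.1, e.2, w) * laplace g w / polarFactor e.1 e.2 w := by
  have hr0 := hr.pos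
  obtain ⟨h, hh, hdiff, hlap⟩ := (hg.mono hb).exists_diffOp_eq Finset.univ
    (fun p : EqPair k => polePt p e.1 e.2) fun p _ => (hr.polePt_bounds he p).2
  have hmem : ∀ w : ℂ, w.re = 2 + r → rePt ((e.1, e.2, w) : CPoint k) ∈ box (centralPt k) r :=
    fun w hw => hr.rePt_mem he (by linarith) hw.le
  obtain ⟨C, n, hC0, hC⟩ := hF.polyBounded.exists_bound hr.subset
  have hrep : ∀ h : ℝ → ℂ, ContDiff ℝ ∞ h → HasCompactSupport h →
      coeffSum (coeffA M N e) (diffOp (polarPoly e) h) =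
        vline (2 + r) fun w => F (e.1, e.2, w) * laplace h w := by
    have := hF.represents (hr.subset (hmem ((2 + r : ℝ) : ℂ) (Complex.ofReal_re _)))
    exact this e (2 + r) rfl
  have key := coeffSum_eq_vline_of_tame (a := coeffA M N e) (b := 2 + r / 2) (c := 2 + r)
    (by linarith) (P := polarPoly e) (f := fun w => F (e.1, e.2, w)) (K := C * (1 + ‖e‖) ^ n) (n := n)
    ?_ ?_ hrep hh
  · rw [show diffOp (polarPoly e) h = g from hdiff] at key
    rw [key, vline, vline]
    congr 1
    refine integral_congr_ae (ae_of_all _ fun t => ?_)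
    have hre : (((2 + r : ℝ) : ℂ) + t * Complex.I).re = 2 + r := by simp
    simp only []
    rw [← hlap _ (by rw [hre]; linarith), ← polarFactor_eq]
    have := prod_sub_polePt_ne_zero hr he (w := ((2 + r : ℝ) : ℂ) + t * Complex.I)
      (by rw [hre]; right; linarith)
    field_simp
  · have hs : StripHolo (2 + r) (2 + r) fun w => F (e.1, e.2, w) := fun w hw hw' =>
      differentiableAt_snd hF.isOpen hF.holomorphic (hr.subset (hmem w (le_antisymm hw' hw)))
    exact hs.continuous_line le_rfl le_rfl
  · intro t
    have := hC e (((2 + r : ℝ) : ℂ) + t * Complex.I) (hmem _ (by simp))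
    simpa using this

/-- Residue expansion of the coefficient sum when all poles are distinct. -/
theorem coeffSum_eq_sum_residues (hF : IsMDSContinuation k M N V F) (hr : CentralBox V r)
    {e : EPoint k} (he : e ∈ centralTube k (etaOf k r)) {b : ℝ} {g : ℝ → ℂ} (hg : Tame b g)
    (hb : b < 2 - r) (hinj : Function.Injective fun p : EqPair k => polePt p e.1 e.2) :
    coeffSum (coeffA M N e) g -
      vline (2 - r) (fun w => F (e.1, e.2, w) * laplace g w / polarFactor e.1 e.2 w) =
      ∑ p : EqPair k, F (e.1, e.2, polePt p e.1 e.2) * laplace g (polePt p e.1 e.2) /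
        ∏ p' ∈ Finset.univ.erase p, (polePt p e.1 e.2 - polePt p' e.1 e.2) := by
  have hr0 := hr.pos
  obtain ⟨s1, s2⟩ := hr.strip hF he hg hb
  have : Nonempty (EqPair k) := ⟨⟨(∅, ∅), rfl⟩⟩
  have := vline_sub_vline_prod s1 s2 hinj (fun p => by linarith [(hr.polePt_bounds he p).1])
    (fun p => by linarith [(hr.polePt_bounds he p).2])
  rw [coeffSum_eq_vline_div hF hr he hg (by linarith), ← this]
  simp only [polarFactor_eq]

end Central

end

section

open Polynomial

variable {k : ℕ}

/-! ### The swap of variables and the polar factor -/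

/-- `((S \ S_J) ∪ Z_H⁻, (Z \ Z_H) ∪ S_J⁻)`. -/
def swapE (p : EqPair k) (e : EPoint k) : EPoint k := (swapS p e.1 e.2, swapZ p e.1 e.2)

lemma sum_pairing {A : Type*} [AddCommMonoid A] (p : EqPair k) (f g : Fin k → A) :
    ∑ i, (if hi : i ∈ p.1.1 then f (pairing p ⟨i, hi⟩) else g i) =
      ∑ h ∈ p.1.2, f h + ∑ i ∈ p.1.1ᶜ, g i := by
  have h1 : ∑ h ∈ p.1.2, f h = ∑ i : p.1.1, f (pairing p i) := by
    rw [Equiv.sum_comp (pairing p) (fun h => f h), Finset.sum_coe_sort]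
  rw [Finset.sum_dite, h1]
  congr 1
  · refine Finset.sum_bij' (fun i _ => ⟨i.1, by simpa using i.2⟩)
      (fun i _ => ⟨i.1, by simp⟩) ?_ ?_ ?_ ?_ ?_ <;> simp
  · rw [Finset.sum_coe_sort (Finset.univ.filter fun i => i ∉ p.1.1) g]
    exact Finset.sum_congr (by ext; simp) fun _ _ => rfl

lemma sum_pairing_symm {A : Type*} [AddCommMonoid A] (p : EqPair k) (f g : Fin k → A) :
    ∑ i, (if hi : i ∈ p.1.2 then f ((pairing p).symm ⟨i, hi⟩) else g i) =
      ∑ h ∈ p.1.1, f h + ∑ i ∈ p.1.2ᶜ, g i := by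
  have h1 : ∑ h ∈ p.1.1, f h = ∑ i : p.1.2, f ((pairing p).symm i) := by
    rw [Equiv.sum_comp (pairing p).symm (fun h => f h), Finset.sum_coe_sort]
  rw [Finset.sum_dite, h1]
  congr 1
  · refine Finset.sum_bij' (fun i _ => ⟨i.1, by simpa using i.2⟩)
      (fun i _ => ⟨i.1, by simp⟩) ?_ ?_ ?_ ?_ ?_ <;> simp
  · rw [Finset.sum_coe_sort (Finset.univ.filter fun i => i ∉ p.1.2) g]
    exact Finset.sum_congr (by ext; simp) fun _ _ => rfl

/-- The first index set of the pair that corresponds to `(J, H)` after the swap. -/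
def swapJ (p : EqPair k) (J H : Finset (Fin k)) : Finset (Fin k) :=
  Finset.univ.filter fun i => if hi : i ∈ p.1.1 then (pairing p ⟨i, hi⟩ : Fin k) ∉ H else i ∈ J

/-- The second index set of the pair that corresponds to `(J, H)` after the swap. -/
def swapH (p : EqPair k) (J H : Finset (Fin k)) : Finset (Fin k) :=
  Finset.univ.filter fun i =>
    if hi : i ∈ p.1.2 then ((pairing p).symm ⟨i, hi⟩ : Fin k) ∉ J else i ∈ H

lemma swapJ_swap (p : EqPair k) (J H : Finset (Fin k)) :
    swapJ p (swapJ p J H) (swapH p J H) = J := by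
  ext i
  by_cases hi : i ∈ p.1.1 <;> simp [swapJ, swapH, hi]

lemma swapH_swap (p : EqPair k) (J H : Finset (Fin k)) :
    swapH p (swapJ p J H) (swapH p J H) = H := by
  ext i
  by_cases hi : i ∈ p.1.2 <;> simp [swapJ, swapH, hi]

lemma sum_swapJ_add_sum_swapH {A : Type*} [AddCommGroup A] (p : EqPair k) (J H : Finset (Fin k))
    (x y : Fin k → A) :
    ∑ i ∈ swapJ p J H, x i + ∑ i ∈ swapH p J H, y i =
      ∑ i ∈ J, (if hi : i ∈ p.1.1 then -y (pairing p ⟨i, hi⟩) else x i) +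
      ∑ i ∈ H, (if hi : i ∈ p.1.2 then -x ((pairing p).symm ⟨i, hi⟩) else y i) +
      (∑ i ∈ p.1.1, x i + ∑ i ∈ p.1.2, y i) := by
  classical
  have hind : ∀ (s : Finset (Fin k)) (f : Fin k → A), ∑ i ∈ s, f i = ∑ i, if i ∈ s then f i else 0 := by
    intro s f
    simp
  have hJ : ∑ i ∈ swapJ p J H, x i = ∑ i ∈ p.1.1, x i -
      ∑ h ∈ p.1.2, (if hh : h ∈ p.1.2 then
        (if h ∈ H then x ((pairing p).symm ⟨h, hh⟩) else 0) else 0) +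
      ∑ i ∈ p.1.1ᶜ, if i ∈ J then x i else 0 := by
    have h1 := sum_pairing p (fun h => if hh : h ∈ p.1.2 then
        (if h ∈ H then x ((pairing p).symm ⟨h, hh⟩) else 0) else 0) (fun i => 0)
    rw [Finset.sum_const_zero, add_zero] at h1
    rw [← h1, swapJ, Finset.sum_filter, ← Finset.sum_add_sum_compl p.1.1]
    congr 1
    · rw [← Finset.sum_add_sum_compl p.1.1 (fun i => if hi : i ∈ p.1.1 then _ else _),
        Finset.sum_eq_zero (s := p.1.1ᶜ) (fun i hi => by simp [Finset.mem_compl.1 hi]), add_zero,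
        ← Finset.sum_sub_distrib]
      refine Finset.sum_congr rfl fun i hi => ?_
      by_cases h : (pairing p ⟨i, hi⟩ : Fin k) ∈ H <;> simp [hi, h]
    · refine Finset.sum_congr rfl fun i hi => ?_
      simp [Finset.mem_compl.1 hi]
  have hH : ∑ i ∈ swapH p J H, y i = ∑ i ∈ p.1.2, y i -
      ∑ h ∈ p.1.1, (if hh : h ∈ p.1.1 then
        (if h ∈ J then y (pairing p ⟨h, hh⟩) else 0) else 0) +
      ∑ i ∈ p.1.2ᶜ, if i ∈ H then y i else 0 := by
    have h1 := sum_pairing_symm p (fun h => if hh : h ∈ p.1.1 then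
        (if h ∈ J then y (pairing p ⟨h, hh⟩) else 0) else 0) (fun i => 0)
    rw [Finset.sum_const_zero, add_zero] at h1
    rw [← h1, swapH, Finset.sum_filter, ← Finset.sum_add_sum_compl p.1.2]
    congr 1
    · rw [← Finset.sum_add_sum_compl p.1.2 (fun i => if hi : i ∈ p.1.2 then _ else _),
        Finset.sum_eq_zero (s := p.1.2ᶜ) (fun i hi => by simp [Finset.mem_compl.1 hi]), add_zero,
        ← Finset.sum_sub_distrib]
      refine Finset.sum_congr rfl fun i hi => ?_
      by_cases h : ((pairing p).symm ⟨i, hi⟩ : Fin k) ∈ J <;> simp [hi, h]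
    · refine Finset.sum_congr rfl fun i hi => ?_
      simp [Finset.mem_compl.1 hi]
  have hJ' : ∑ i ∈ J, (if hi : i ∈ p.1.1 then -y (pairing p ⟨i, hi⟩) else x i) =
      -∑ h ∈ p.1.1, (if hh : h ∈ p.1.1 then
        (if h ∈ J then y (pairing p ⟨h, hh⟩) else 0) else 0) +
      ∑ i ∈ p.1.1ᶜ, if i ∈ J then x i else 0 := by
    rw [hind, ← Finset.sum_add_sum_compl p.1.1,
      ← Finset.sum_neg_distrib]
    congr 1
    · refine Finset.sum_congr rfl fun i hi => ?_
      by_cases h : i ∈ J <;> simp [hi, h]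
    · refine Finset.sum_congr rfl fun i hi => ?_
      simp [Finset.mem_compl.1 hi]
  have hH' : ∑ i ∈ H, (if hi : i ∈ p.1.2 then -x ((pairing p).symm ⟨i, hi⟩) else y i) =
      -∑ h ∈ p.1.2, (if hh : h ∈ p.1.2 then
        (if h ∈ H then x ((pairing p).symm ⟨h, hh⟩) else 0) else 0) +
      ∑ i ∈ p.1.2ᶜ, if i ∈ H then y i else 0 := by
    rw [hind, ← Finset.sum_add_sum_compl p.1.2,
      ← Finset.sum_neg_distrib]
    congr 1
    · refine Finset.sum_congr rfl fun i hi => ?_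
      by_cases h : i ∈ H <;> simp [hi, h]
    · refine Finset.sum_congr rfl fun i hi => ?_
      simp [Finset.mem_compl.1 hi]
  rw [hJ, hH, hJ', hH']
  abel

lemma card_swapJ (p p' : EqPair k) :
    (swapJ p p'.1.1 p'.1.2).card = (swapH p p'.1.1 p'.1.2).card := by
  have h := sum_swapJ_add_sum_swapH p p'.1.1 p'.1.2 (fun _ => (1 : ℤ)) (fun _ => -1)
  simp [p.2, p'.2] at h
  omega

/-- The pair of index sets that corresponds to `p'` after the swap along `p`. -/
def swapPair (p p' : EqPair k) : EqPair k :=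
  ⟨(swapJ p p'.1.1 p'.1.2, swapH p p'.1.1 p'.1.2), card_swapJ p p'⟩

lemma swapPair_involutive (p : EqPair k) : Function.Involutive (swapPair p) := fun _ =>
  Subtype.ext (Prod.ext (swapJ_swap p _ _) (swapH_swap p _ _))

/-- The pair `(∅, ∅)`. -/
def emptyPair (k : ℕ) : EqPair k := ⟨(∅, ∅), rfl⟩

lemma swapPair_empty (p : EqPair k) : swapPair p (emptyPair k) = p := by
  refine Subtype.ext (Prod.ext ?_ ?_)
  · ext i
    by_cases hi : i ∈ p.1.1 <;> simp [swapPair, swapJ, emptyPair, hi]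
  · ext i
    by_cases hi : i ∈ p.1.2 <;> simp [swapPair, swapH, emptyPair, hi]

lemma polePt_empty (s z : Fin k → ℂ) : polePt (emptyPair k) s z = 2 := by
  simp [polePt, emptyPair]

lemma polePt_eq_sub (p : EqPair k) (s z : Fin k → ℂ) :
    polePt p s z = 2 - (∑ j ∈ p.1.1, (s j - 1 / 2) + ∑ h ∈ p.1.2, (z h - 1 / 2)) := by
  have hc : (p.1.2.card : ℂ) = p.1.1.card := by rw [p.2]
  simp only [polePt, Finset.sum_sub_distrib, Finset.sum_const, nsmul_eq_mul, hc]
  ring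

lemma polePt_swapPair (p p' : EqPair k) (e : EPoint k) :
    polePt (swapPair p p') e.1 e.2 =
      polePt p' (swapE p e).1 (swapE p e).2 + (polePt p e.1 e.2 - 2) := by
  have h := sum_swapJ_add_sum_swapH p p'.1.1 p'.1.2 (fun j => e.1 j - 1 / 2) (fun j => e.2 j - 1 / 2)
  have h1 : ∀ i, (if hi : i ∈ p.1.1 then -(e.2 (pairing p ⟨i, hi⟩) - 1 / 2) else e.1 i - 1 / 2) =
      (swapE p e).1 i - 1 / 2 := by
    intro i
    by_cases hi : i ∈ p.1.1
    · simp only [swapE, swapS, hi, dif_pos]; ring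
    · simp [swapE, swapS, hi]
  have h2 : ∀ i, (if hi : i ∈ p.1.2 then -(e.1 ((pairing p).symm ⟨i, hi⟩) - 1 / 2)
      else e.2 i - 1 / 2) = (swapE p e).2 i - 1 / 2 := by
    intro i
    by_cases hi : i ∈ p.1.2
    · simp only [swapE, swapZ, hi, dif_pos]; ring
    · simp [swapE, swapZ, hi]
  simp_rw [h1, h2] at h
  rw [polePt_eq_sub, polePt_eq_sub p', polePt_eq_sub p]
  simp only [swapPair]
  rw [h]
  ring

lemma polarFactor_swapE (p : EqPair k) (e : EPoint k) (w : ℂ) :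
    polarFactor (swapE p e).1 (swapE p e).2 w = polarFactor e.1 e.2 (w + (polePt p e.1 e.2 - 2)) := by
  rw [polarFactor_eq, polarFactor_eq, ← Equiv.prod_comp (swapPair_involutive p).toPerm
    fun p' => w + (polePt p e.1 e.2 - 2) - polePt p' e.1 e.2]
  refine Finset.prod_congr rfl fun p' _ => ?_
  rw [Function.Involutive.coe_toPerm, polePt_swapPair p p' e]
  ring

lemma prod_erase_polePt_swapE (p : EqPair k) (e : EPoint k) :
    ∏ p' ∈ Finset.univ.erase (emptyPair k), (2 - polePt p' (swapE p e).1 (swapE p e).2) =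
      ∏ p' ∈ Finset.univ.erase p, (polePt p e.1 e.2 - polePt p' e.1 e.2) := by
  refine Finset.prod_equiv (swapPair_involutive p).toPerm (fun p' => ?_) fun p' _ => ?_
  · simp only [Function.Involutive.coe_toPerm, Finset.mem_erase, Finset.mem_univ, and_true]
    rw [← (swapPair_involutive p).injective.ne_iff, swapPair_empty]
  · rw [Function.Involutive.coe_toPerm, polePt_swapPair p p' e]
    ring

lemma swapE_mem_centralTube {η : ℝ} {e : EPoint k} (he : e ∈ centralTube k η) (p : EqPair k) :
    swapE p e ∈ centralTube k η := by
  constructor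
  · intro i
    by_cases hi : i ∈ p.1.1
    · have := he.2 (pairing p ⟨i, hi⟩)
      simp only [swapE, swapS, hi, dif_pos, Complex.sub_re, Complex.one_re]
      rw [abs_lt] at this ⊢
      constructor <;> linarith [this.1, this.2]
    · simpa [swapE, swapS, hi] using he.1 i
  · intro i
    by_cases hi : i ∈ p.1.2
    · have := he.1 ((pairing p).symm ⟨i, hi⟩)
      simp only [swapE, swapZ, hi, dif_pos, Complex.sub_re, Complex.one_re]
      rw [abs_lt] at this ⊢
      constructor <;> linarith [this.1, this.2]
    · simpa [swapE, swapZ, hi] using he.2 i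

end

section

open Polynomial

variable {k : ℕ}

/-! ### The functional equation -/

lemma isPrimitive_inv {q : ℕ} {χ : DirichletCharacter ℂ q} (hχ : χ.IsPrimitive) :
    χ⁻¹.IsPrimitive := by
  rw [DirichletCharacter.isPrimitive_def] at hχ ⊢
  rw [DirichletCharacter.conductor_inv, hχ]

lemma even_inv {q : ℕ} {χ : DirichletCharacter ℂ q} (hχ : χ.Even) : χ⁻¹.Even := by
  have h : χ (-1) = 1 := hχ
  show χ⁻¹ (-1) = 1
  rw [MulChar.inv_apply_eq_inv', h, inv_one]

lemma rootNumber_mul_rootNumber_inv {q : ℕ} [NeZero q] {χ : DirichletCharacter ℂ q}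
    (hχ : χ.IsPrimitive) :
    DirichletCharacter.rootNumber χ * DirichletCharacter.rootNumber χ⁻¹ = 1 := by
  have h1 := hχ.completedLFunction_one_sub (-1)
  have h2 := (isPrimitive_inv hχ).completedLFunction_one_sub 2
  rw [inv_inv, show (1 - 2 : ℂ) = -1 by norm_num] at h2
  rw [h2, show (1 - -1 : ℂ) = 2 by norm_num] at h1
  have hne : DirichletCharacter.completedLFunction χ 2 ≠ 0 := by
    have h3 := DirichletCharacter.LFunction_eq_completed_div_gammaFactor χ 2 (Or.inl two_ne_zero)
    intro h0
    rw [h0, zero_div] at h3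
    exact DirichletCharacter.LFunction_ne_zero_of_one_le_re χ (s := 2)
      (Or.inr (by norm_num)) (by norm_num) h3
  have hq0 : (q : ℂ) ≠ 0 := Nat.cast_ne_zero.2 (NeZero.ne q)
  have h4 : (q : ℂ) ^ ((-1 : ℂ) - 1 / 2) * (q : ℂ) ^ ((2 : ℂ) - 1 / 2) = 1 := by
    rw [← Complex.cpow_add _ _ hq0, show (-1 : ℂ) - 1 / 2 + (2 - 1 / 2) = 0 by norm_num,
      Complex.cpow_zero]
  have h5 : DirichletCharacter.completedLFunction χ 2 * 1 = DirichletCharacter.completedLFunction χ 2 *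
      (DirichletCharacter.rootNumber χ * DirichletCharacter.rootNumber χ⁻¹) := by
    rw [mul_one]
    nth_rw 1 [h1]
    linear_combination DirichletCharacter.rootNumber χ * DirichletCharacter.rootNumber χ⁻¹ *
      DirichletCharacter.completedLFunction χ 2 * h4
  exact (mul_left_cancel₀ hne h5).symm

lemma chiFactor_eq (s : ℂ) :
    chiFactor s = Complex.Gammaℝ (1 - s) / Complex.Gammaℝ s := by
  have hpi : (Real.pi : ℂ) ≠ 0 := Complex.ofReal_ne_zero.2 Real.pi_ne_zero
  rw [chiFactor, Complex.Gammaℝ_def, Complex.Gammaℝ_def, mul_div_mul_comm,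
    ← Complex.cpow_sub _ _ hpi, mul_div_assoc]
  congr 2
  ring

/-- The asymmetric functional equation of an even primitive character. -/
lemma LFunction_eq_chiFactor {q : ℕ} [NeZero q] {χ : DirichletCharacter ℂ q}
    (hχ : χ.IsPrimitive) (he : χ.Even) {s : ℂ} (h₀ : 0 < s.re) (h₁ : s.re < 1) :
    DirichletCharacter.LFunction χ s = DirichletCharacter.rootNumber χ * (q : ℂ) ^ (1 / 2 - s) *
      chiFactor s * DirichletCharacter.LFunction χ⁻¹ (1 - s) := by
  have hs0 : s ≠ 0 := by rintro rfl; simp at h₀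
  have hs1 : (1 - s) ≠ 0 := by
    intro h
    rw [← sub_eq_zero.1 h] at h₁
    simp at h₁
  have h := hχ.completedLFunction_one_sub (1 - s)
  rw [sub_sub_cancel] at h
  rw [DirichletCharacter.LFunction_eq_completed_div_gammaFactor χ s (Or.inl hs0),
    DirichletCharacter.LFunction_eq_completed_div_gammaFactor χ⁻¹ (1 - s) (Or.inl hs1),
    he.gammaFactor_def, (even_inv he).gammaFactor_def, chiFactor_eq, h,
    show 1 - s - 1 / 2 = 1 / 2 - s by ring]
  have g1 : Complex.Gammaℝ s ≠ 0 := Complex.Gammaℝ_ne_zero_of_re_pos h₀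
  have g2 : Complex.Gammaℝ (1 - s) ≠ 0 :=
    Complex.Gammaℝ_ne_zero_of_re_pos (by simpa using h₁)
  field_simp

/-- `∏_{j∈J} 𝒳(s_j) ∏_{h∈H} 𝒳(z_h)`. -/
def chiProd (p : EqPair k) (e : EPoint k) : ℂ :=
  (∏ j ∈ p.1.1, chiFactor (e.1 j)) * ∏ h ∈ p.1.2, chiFactor (e.2 h)

lemma prod_pairing (p : EqPair k) (f g : Fin k → ℂ) :
    ∏ i, (if hi : i ∈ p.1.1 then f (pairing p ⟨i, hi⟩) else g i) =
      (∏ h ∈ p.1.2, f h) * ∏ i ∈ p.1.1ᶜ, g i := by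
  have := sum_pairing (A := Additive ℂ) p f g
  exact this

lemma prod_pairing_symm (p : EqPair k) (f g : Fin k → ℂ) :
    ∏ i, (if hi : i ∈ p.1.2 then f ((pairing p).symm ⟨i, hi⟩) else g i) =
      (∏ h ∈ p.1.1, f h) * ∏ i ∈ p.1.2ᶜ, g i := by
  have := sum_pairing_symm (A := Additive ℂ) p f g
  exact this

lemma twistedProduct_swapE {M N q : ℕ} [NeZero q] {χ : DirichletCharacter ℂ q}
    (hχ : χ.IsPrimitive) (hev : χ.Even) (p : EqPair k) {η : ℝ} (hη : η ≤ 1 / 2) {e : EPoint k}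
    (he : e ∈ centralTube k η) :
    twistedProduct M N e.1 e.2 χ = chiProd p e * (q : ℂ) ^ (polePt p e.1 e.2 - 2) *
      twistedProduct M N (swapE p e).1 (swapE p e).2 χ := by
  have hq0 : (q : ℂ) ≠ 0 := Nat.cast_ne_zero.2 (NeZero.ne q)
  set ε := DirichletCharacter.rootNumber χ
  set ε' := DirichletCharacter.rootNumber χ⁻¹
  have hεε : ε * ε' = 1 := rootNumber_mul_rootNumber_inv hχ
  have b1 : ∀ j, 0 < (e.1 j).re ∧ (e.1 j).re < 1 := fun j => by
    have := abs_lt.1 (he.1 j)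
    constructor <;> linarith [this.1, this.2]
  have b2 : ∀ j, 0 < (e.2 j).re ∧ (e.2 j).re < 1 := fun j => by
    have := abs_lt.1 (he.2 j)
    constructor <;> linarith [this.1, this.2]
  have hJ : ∏ j ∈ p.1.1, DirichletCharacter.LFunction χ (e.1 j) =
      ε ^ p.1.1.card * (∏ j ∈ p.1.1, (q : ℂ) ^ (1 / 2 - e.1 j)) *
        (∏ j ∈ p.1.1, chiFactor (e.1 j)) *
        ∏ j ∈ p.1.1, DirichletCharacter.LFunction χ⁻¹ (1 - e.1 j) := by
    rw [← Finset.prod_const, ← Finset.prod_mul_distrib, ← Finset.prod_mul_distrib,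
      ← Finset.prod_mul_distrib]
    exact Finset.prod_congr rfl fun j _ => LFunction_eq_chiFactor hχ hev (b1 j).1 (b1 j).2
  have hH : ∏ j ∈ p.1.2, DirichletCharacter.LFunction χ⁻¹ (e.2 j) =
      ε' ^ p.1.1.card * (∏ j ∈ p.1.2, (q : ℂ) ^ (1 / 2 - e.2 j)) *
        (∏ j ∈ p.1.2, chiFactor (e.2 j)) *
        ∏ j ∈ p.1.2, DirichletCharacter.LFunction χ (1 - e.2 j) := by
    rw [p.2, ← Finset.prod_const, ← Finset.prod_mul_distrib, ← Finset.prod_mul_distrib,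
      ← Finset.prod_mul_distrib]
    refine Finset.prod_congr rfl fun j _ => ?_
    have := LFunction_eq_chiFactor (isPrimitive_inv hχ) (even_inv hev) (b2 j).1 (b2 j).2
    rwa [inv_inv] at this
  have hpow : ∀ (t : Finset (Fin k)) (f : Fin k → ℂ),
      ∏ j ∈ t, (q : ℂ) ^ f j = (q : ℂ) ^ ∑ j ∈ t, f j := by
    intro t f
    induction t using Finset.induction_on with
    | empty => simp
    | insert a t ha ih => rw [Finset.prod_insert ha, Finset.sum_insert ha, ih, Complex.cpow_add _ _ hq0]
  have hqp : (∏ j ∈ p.1.1, (q : ℂ) ^ (1 / 2 - e.1 j)) * (∏ j ∈ p.1.2, (q : ℂ) ^ (1 / 2 - e.2 j)) =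
      (q : ℂ) ^ (polePt p e.1 e.2 - 2) := by
    rw [hpow, hpow, ← Complex.cpow_add _ _ hq0, polePt_eq_sub]
    congr 1
    simp only [Finset.sum_sub_distrib]
    ring
  have hS : ∏ j, DirichletCharacter.LFunction χ ((swapE p e).1 j) =
      (∏ h ∈ p.1.2, DirichletCharacter.LFunction χ (1 - e.2 h)) *
        ∏ i ∈ p.1.1ᶜ, DirichletCharacter.LFunction χ (e.1 i) := by
    rw [← prod_pairing p]
    refine Finset.prod_congr rfl fun i _ => ?_
    by_cases hi : i ∈ p.1.1 <;> simp [swapE, swapS, hi]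
  have hZ : ∏ j, DirichletCharacter.LFunction χ⁻¹ ((swapE p e).2 j) =
      (∏ h ∈ p.1.1, DirichletCharacter.LFunction χ⁻¹ (1 - e.1 h)) *
        ∏ i ∈ p.1.2ᶜ, DirichletCharacter.LFunction χ⁻¹ (e.2 i) := by
    rw [← prod_pairing_symm p]
    refine Finset.prod_congr rfl fun i _ => ?_
    by_cases hi : i ∈ p.1.2 <;> simp [swapE, swapZ, hi]
  rw [twistedProduct, twistedProduct, hS, hZ, ← Finset.prod_mul_prod_compl p.1.1 fun j =>
    DirichletCharacter.LFunction χ (e.1 j), ← Finset.prod_mul_prod_compl p.1.2 fun j =>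
    DirichletCharacter.LFunction χ⁻¹ (e.2 j), hJ, hH, ← hqp, chiProd]
  have hpw : ε ^ p.1.1.card * ε' ^ p.1.1.card = 1 := by rw [← mul_pow, hεε, one_pow]
  linear_combination (χ⁻¹ (M : ZMod q) * χ (N : ZMod q) *
    (∏ j ∈ p.1.1, (q : ℂ) ^ (1 / 2 - e.1 j)) * (∏ j ∈ p.1.2, (q : ℂ) ^ (1 / 2 - e.2 j)) *
    (∏ j ∈ p.1.1, chiFactor (e.1 j)) * (∏ j ∈ p.1.2, chiFactor (e.2 j)) *
    (∏ h ∈ p.1.1, DirichletCharacter.LFunction χ⁻¹ (1 - e.1 h)) *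
    (∏ i ∈ p.1.2ᶜ, DirichletCharacter.LFunction χ⁻¹ (e.2 i)) *
    (∏ h ∈ p.1.2, DirichletCharacter.LFunction χ (1 - e.2 h)) *
    ∏ i ∈ p.1.1ᶜ, DirichletCharacter.LFunction χ (e.1 i)) * hpw

lemma coeffA_swapE (M N : ℕ) (p : EqPair k) {η : ℝ} (hη : η ≤ 1 / 2) {e : EPoint k}
    (he : e ∈ centralTube k η) (q : ℕ+) :
    coeffA M N e q = chiProd p e * (q : ℂ) ^ (polePt p e.1 e.2 - 2) *
      coeffA M N (swapE p e) q := by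
  unfold coeffA
  split_ifs with h
  · simp
  · rw [Finset.mul_sum]
    refine Finset.sum_congr rfl fun χ hχ => ?_
    rw [mem_evenPrimitive] at hχ
    exact twistedProduct_swapE hχ.1 hχ.2 p hη he

lemma laplace_exp_mul (h : ℝ → ℂ) (a w : ℂ) :
    laplace (fun u => Complex.exp (a * u) * h u) w = laplace h (w + a) := by
  unfold laplace
  congr 1
  ext u
  rw [add_mul, Complex.exp_add]
  ring

lemma vline_comp_add (c : ℝ) (f : ℂ → ℂ) (a : ℂ) :
    vline c (fun w => f (w + a)) = vline (c + a.re) f := by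
  unfold vline
  congr 1
  rw [← integral_add_right_eq_self (fun t : ℝ => f (((c + a.re : ℝ) : ℂ) + t * Complex.I)) a.im]
  congr 1
  ext t
  beta_reduce
  rw [show (c : ℂ) + t * Complex.I + a =
    ((c + a.re : ℝ) : ℂ) + ((t + a.im : ℝ) : ℂ) * Complex.I by apply Complex.ext <;> simp]

lemma laplace_comp_add (h : ℝ → ℂ) (v : ℝ) (w : ℂ) :
    laplace (fun u => h (u + v)) w = laplace h w * Complex.exp (-(w * v)) := by
  unfold laplace
  rw [← integral_mul_const, ← integral_add_right_eq_self (fun u : ℝ => h u * _ * _) v]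
  congr 1
  ext u
  rw [mul_assoc, ← Complex.exp_add]
  push_cast
  ring_nf

lemma StripDecay.comp_sub {c₁ c₂ : ℝ} {f : ℂ → ℂ} (hf : StripDecay c₁ c₂ f) (a : ℂ) :
    StripDecay (c₁ + a.re) (c₂ + a.re) fun w => f (w - a) := by
  obtain ⟨C, hC⟩ := hf
  refine ⟨C * (2 * (1 + a.im ^ 2)), fun w hw hw' => ?_⟩
  have h1 := hC (w - a) (by rw [Complex.sub_re]; linarith) (by rw [Complex.sub_re]; linarith)
  have hC0 : 0 ≤ C := by
    by_contra hneg
    have : C * (1 + (w - a).im ^ 2)⁻¹ < 0 := mul_neg_of_neg_of_pos (not_le.1 hneg) (by positivity)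
    linarith [norm_nonneg (f (w - a))]
  refine h1.trans ?_
  rw [mul_assoc]
  gcongr
  rw [Complex.sub_im, inv_le_iff_one_le_mul₀ (by positivity), mul_assoc, mul_left_comm,
    inv_mul_eq_div, le_div_iff₀ (by positivity)]
  nlinarith [sq_nonneg (w.im - 2 * a.im), sq_nonneg (a.im * (w.im - a.im))]

lemma StripHolo.comp_sub {c₁ c₂ : ℝ} {f : ℂ → ℂ} (hf : StripHolo c₁ c₂ f) (a : ℂ) :
    StripHolo (c₁ + a.re) (c₂ + a.re) fun w => f (w - a) := by
  intro w hw hw'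
  have h := hf (w - a) (by rw [Complex.sub_re]; linarith) (by rw [Complex.sub_re]; linarith)
  exact h.comp (f := fun w => w - a) w (by fun_prop)

lemma Tame.exp_mul_of_hasCompactSupport {h : ℝ → ℂ} (hs : ContDiff ℝ ∞ h)
    (hc : HasCompactSupport h) (a : ℂ) :
    ContDiff ℝ ∞ (fun u : ℝ => Complex.exp (a * u) * h u) ∧
      HasCompactSupport (fun u : ℝ => Complex.exp (a * u) * h u) := by
  refine ⟨ContDiff.mul ?_ hs, hc.mul_left⟩
  exact (contDiff_const.mul Complex.ofRealCLM.contDiff).cexp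

lemma diffOp_polarPoly_exp (p : EqPair k) (e : EPoint k) {h : ℝ → ℂ} (hs : ContDiff ℝ ∞ h)
    (hc : HasCompactSupport h) (u : ℝ) :
    diffOp (polarPoly (swapE p e))
        (fun u => Complex.exp ((polePt p e.1 e.2 - 2 : ℂ) * u) * h u) u =
      Complex.exp ((polePt p e.1 e.2 - 2 : ℂ) * u) * diffOp (polarPoly e) h u := by
  set a := polePt p e.1 e.2 - 2 with ha
  obtain ⟨hs', hc'⟩ := Tame.exp_mul_of_hasCompactSupport hs hc a
  have hD : ContDiff ℝ ∞ (diffOp (polarPoly e) h) ∧ HasCompactSupport (diffOp (polarPoly e) h) := by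
    refine ⟨((Tame.of_hasCompactSupport hs hc 0).diffOp _).smooth, ?_⟩
    refine HasCompactSupport.intro' (K := tsupport h) hc (isClosed_tsupport h) fun u hu => ?_
    have h0 : h =ᶠ[𝓝 u] fun _ => 0 := notMem_tsupport_iff_eventuallyEq.1 hu
    rw [diffOp_eventuallyEq h0]
    simp [diffOp_apply]
  obtain ⟨hs₂, hc₂⟩ := Tame.exp_mul_of_hasCompactSupport hD.1 hD.2 a
  have hT := Tame.of_hasCompactSupport hs hc (a.re)
  have hT₁ := Tame.of_hasCompactSupport hs' hc' 0
  have hT₂ := Tame.of_hasCompactSupport hs₂ hc₂ 0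
  refine congrFun ((hT₁.diffOp (polarPoly (swapE p e))).ext_laplace hT₂ fun w hw => ?_) u
  rw [hT₁.laplace_diffOp _ hw, laplace_exp_mul, laplace_exp_mul, hT.laplace_diffOp _ (by simpa using hw),
    eval_polarPoly, eval_polarPoly, polarFactor_swapE]

section

variable {M N : ℕ} {V : Set (RPoint k)} {F : CPoint k → ℂ} {r : ℝ}

lemma exists_laplace_ne_zero (w : ℂ) :
    ∃ h : ℝ → ℂ, ContDiff ℝ ∞ h ∧ HasCompactSupport h ∧ laplace h w ≠ 0 := by
  let φ : ContDiffBump (0 : ℝ) := ⟨1, 2, one_pos, one_lt_two⟩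
  have hs : ContDiff ℝ ∞ fun u : ℝ => ((φ u : ℝ) : ℂ) :=
    Complex.ofRealCLM.contDiff.comp φ.contDiff
  have hc : HasCompactSupport fun u : ℝ => ((φ u : ℝ) : ℂ) :=
    φ.hasCompactSupport.comp_left (g := Complex.ofReal) Complex.ofReal_zero
  obtain ⟨h1, h2⟩ := Tame.exp_mul_of_hasCompactSupport hs hc (-w)
  refine ⟨_, h1, h2, ?_⟩
  rw [laplace_exp_mul, add_neg_cancel]
  simp only [laplace, zero_mul, Complex.exp_zero, mul_one]
  rw [integral_complex_ofReal, Complex.ofReal_ne_zero]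
  exact (φ.integral_pos (μ := volume)).ne'

/-- The functional equation of `F` at the poles. -/
theorem apply_polePt_eq (hF : IsMDSContinuation k M N V F) (hr : CentralBox V r)
    {e : EPoint k} (he : e ∈ centralTube k (etaOf k r)) (p : EqPair k) :
    F (e.1, e.2, polePt p e.1 e.2) =
      chiProd p e * F ((swapE p e).1, (swapE p e).2, 2) := by
  have hr0 := hr.pos
  set e' := swapE p e
  set w₀ := polePt p e.1 e.2 with hw₀
  have he' : e' ∈ centralTube k (etaOf k r) := swapE_mem_centralTube he p
  obtain ⟨b1, b2⟩ := hr.polePt_bounds he p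
  rw [← hw₀] at b1 b2
  obtain ⟨h, hs, hc, hne⟩ := exists_laplace_ne_zero w₀
  have key : ∀ h : ℝ → ℂ, ContDiff ℝ ∞ h → HasCompactSupport h →
      vline 2 (fun w => F (e.1, e.2, w) * laplace h w) =
        chiProd p e * vline 2 fun w => F (e'.1, e'.2, w - (w₀ - 2)) * laplace h w := by
    intro h hs hc
    have c1 : rePt ((e.1, e.2, ((2 : ℝ) : ℂ)) : CPoint k) ∈ V :=
      hr.subset (hr.rePt_mem he (by simp; linarith) (by simp; linarith))
    have c2 : rePt ((e'.1, e'.2, ((2 - (w₀ - 2).re : ℝ) : ℂ)) : CPoint k) ∈ V :=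
      hr.subset (hr.rePt_mem he' (by simp; linarith) (by simp; linarith))
    obtain ⟨hs', hc'⟩ := Tame.exp_mul_of_hasCompactSupport hs hc (w₀ - 2)
    have r1 := hF.represents c1 e 2 rfl h hs hc
    have r2 := hF.represents c2 e' _ rfl _ hs' hc'
    have hsum : coeffSum (coeffA M N e) (diffOp (polarPoly e) h) = chiProd p e *
        coeffSum (coeffA M N e') (diffOp (polarPoly e')
          fun u => Complex.exp ((w₀ - 2) * u) * h u) := by
      unfold coeffSum
      rw [← tsum_mul_left]
      refine tsum_congr fun q => ?_
      have hη : etaOf k r ≤ 1 / 2 := by linarith [hr.etaOf_le, hr.le]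
      have hq : (q : ℂ) ≠ 0 := by exact_mod_cast q.ne_zero
      rw [coeffA_swapE M N p hη he q, diffOp_polarPoly_exp p e hs hc, Complex.cpow_def_of_ne_zero hq,
        Complex.ofReal_log (by positivity)]
      simp only [Complex.ofReal_natCast]
      rw [mul_comm (Complex.log _)]
      ring
    rw [← r1, hsum, r2]
    congr 1
    have := vline_comp_add (2 - (w₀ - 2).re) (fun w => F (e'.1, e'.2, w - (w₀ - 2)) * laplace h w)
      (w₀ - 2)
    rw [sub_add_cancel] at this
    rw [← this]
    congr 1
    ext w
    rw [laplace_exp_mul, add_sub_cancel_right]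
  have hT := Tame.of_hasCompactSupport hs hc 1
  obtain ⟨s1, s2⟩ := hr.strip hF he hT (by linarith [hr.le])
  have hT' := Tame.of_hasCompactSupport (Tame.exp_mul_of_hasCompactSupport hs hc (w₀ - 2)).1
    (Tame.exp_mul_of_hasCompactSupport hs hc (w₀ - 2)).2 1
  obtain ⟨s3, s4⟩ := hr.strip hF he' hT' (by linarith [hr.le])
  have hre : (w₀ - 2).re = w₀.re - 2 := by simp
  have hfun : (fun w => F (e'.1, e'.2, w - (w₀ - 2)) *
      laplace (fun u : ℝ => Complex.exp ((w₀ - 2) * u) * h u) (w - (w₀ - 2))) =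
      fun w => F (e'.1, e'.2, w - (w₀ - 2)) * laplace h w := by
    ext w
    rw [laplace_exp_mul, sub_add_cancel]
  have s5 := (s3.comp_sub (w₀ - 2)).mono (c₁' := 2 - r / 2) (c₂' := 2 + r / 2)
    (by rw [hre]; linarith) (by rw [hre]; linarith)
  have s6 := (s4.comp_sub (w₀ - 2)).mono (c₁' := 2 - r / 2) (c₂' := 2 + r / 2)
    (by rw [hre]; linarith) (by rw [hre]; linarith)
  rw [hfun] at s5 s6
  have s1' := s1.mono (c₁' := 2 - r / 2) (c₂' := 2 + r / 2) (by linarith) (by linarith)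
  have s2' := s2.mono (c₁' := 2 - r / 2) (c₂' := 2 + r / 2) (by linarith) (by linarith)
  have l1 := (laplace_vline_of_strip s1' s2' b1 b2).2
  have l2 := (laplace_vline_of_strip s5 s6 b1 b2).2
  have hτ : ∀ u : ℝ, vline (2 - r / 2) (fun w => F (e.1, e.2, w) * laplace h w *
      Complex.exp (-(w * u))) = chiProd p e * vline (2 - r / 2) (fun w =>
        F (e'.1, e'.2, w - (w₀ - 2)) * laplace h w * Complex.exp (-(w * u))) := by
    intro u
    rw [vline_exp_eq s1' s2' (c := 2) (by linarith) (by linarith),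
      vline_exp_eq s5 s6 (c := 2) (by linarith) (by linarith)]
    have := key (fun x => h (x + u)) (hs.comp (contDiff_id.add contDiff_const))
      (hc.comp_homeomorph (Homeomorph.addRight u))
    simp_rw [laplace_comp_add, ← mul_assoc] at this
    exact this
  have l3 : F (e.1, e.2, w₀) * laplace h w₀ =
      chiProd p e * (F (e'.1, e'.2, w₀ - (w₀ - 2)) * laplace h w₀) := by
    rw [← l1, ← l2]
    simp_rw [hτ]
    simp only [laplace]
    rw [← integral_const_mul]
    congr 1
    ext u
    ring
  rw [sub_sub_cancel, ← mul_assoc] at l3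
  exact mul_right_cancel₀ hne l3

end

end

section

/-! ### Growth of `L`-functions to the right of the line `Re s = 0` -/

/-- `∫_1^∞ P(t) t^(-s-1) dt`. -/
def abelInt (P : ℝ → ℂ) (s : ℂ) : ℂ := ∫ t in Ioi (1 : ℝ), P t * (t : ℂ) ^ (-(s + 1))

section AbelInt

variable {P : ℝ → ℂ} {B : ℝ}

lemma norm_abelInt_integrand_le (hB : ∀ t, ‖P t‖ ≤ B) {s : ℂ} {σ : ℝ} (hs : σ ≤ s.re) {t : ℝ}
    (ht : 1 < t) : ‖P t * (t : ℂ) ^ (-(s + 1))‖ ≤ B * t ^ (-(σ + 1)) := by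
  have hB0 : 0 ≤ B := (norm_nonneg _).trans (hB 0)
  rw [norm_mul, Complex.norm_cpow_eq_rpow_re_of_pos (by linarith)]
  gcongr
  · exact hB t
  · exact ht.le
  · simp only [Complex.neg_re, Complex.add_re, Complex.one_re]
    linarith

lemma integrableOn_rpow_neg_add_one {σ : ℝ} (hσ : 0 < σ) :
    IntegrableOn (fun t : ℝ => t ^ (-(σ + 1))) (Ioi 1) :=
  integrableOn_Ioi_rpow_of_lt (by linarith) one_pos

lemma norm_abelInt_le (hB : ∀ t, ‖P t‖ ≤ B) {s : ℂ} {σ : ℝ} (hσ : 0 < σ) (hs : σ ≤ s.re) :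
    ‖abelInt P s‖ ≤ B / σ := by
  refine (norm_integral_le_of_norm_le ((integrableOn_rpow_neg_add_one hσ).const_mul B) ?_).trans
    (le_of_eq ?_)
  · exact (ae_restrict_iff' measurableSet_Ioi).2
      (ae_of_all _ fun t ht => norm_abelInt_integrand_le hB hs ht)
  · rw [integral_const_mul, integral_Ioi_rpow_of_lt (by linarith) one_pos, Real.one_rpow,
      show -(σ + 1) + 1 = -σ by ring, neg_div_neg_eq, mul_one_div]

lemma aestronglyMeasurable_abelInt (hP : Measurable P) (s : ℂ) :
    AEStronglyMeasurable (fun t : ℝ => P t * (t : ℂ) ^ (-(s + 1))) (volume.restrict (Ioi 1)) := by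
  refine hP.aestronglyMeasurable.mul (ContinuousOn.aestronglyMeasurable ?_ measurableSet_Ioi)
  intro t ht
  exact (Complex.continuousAt_ofReal_cpow_const t _ (Or.inr (by
    have : (1 : ℝ) < t := ht
    positivity))).continuousWithinAt

lemma integrable_abelInt (hP : Measurable P) (hB : ∀ t, ‖P t‖ ≤ B) {s : ℂ} (hs : 0 < s.re) :
    IntegrableOn (fun t : ℝ => P t * (t : ℂ) ^ (-(s + 1))) (Ioi 1) := by
  refine ((integrableOn_rpow_neg_add_one hs).const_mul B).mono' (aestronglyMeasurable_abelInt hP s) ?_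
  exact (ae_restrict_iff' measurableSet_Ioi).2
      (ae_of_all _ fun t ht => norm_abelInt_integrand_le hB le_rfl ht)

lemma differentiableAt_abelInt (hP : Measurable P) (hB : ∀ t, ‖P t‖ ≤ B) {s : ℂ} (hs : 0 < s.re) :
    DifferentiableAt ℂ (abelInt P) s := by
  have hpos : ∀ y ∈ ball s (s.re / 2), s.re / 2 ≤ y.re := fun y hy => by
    have h1 := (Complex.abs_re_le_norm (y - s)).trans_lt (mem_ball_iff_norm.1 hy)
    rw [Complex.sub_re, abs_lt] at h1
    linarith [h1.1]
  have := differentiableAt_integral_of_dominated (E := ℂ) (μ := volume.restrict (Ioi (1 : ℝ)))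
    (f := fun y t => (Ioi (1 : ℝ)).indicator (fun t => P t * (t : ℂ) ^ (-(y + 1))) t)
    (x := s) (r := s.re / 2)
    (bound := (Ioi (1 : ℝ)).indicator fun t => B * t ^ (-(s.re / 2 + 1))) (by positivity) ?_ ?_ ?_ ?_
  · refine this.congr_of_eventuallyEq (Eventually.of_forall fun y => ?_)
    exact (setIntegral_congr_fun measurableSet_Ioi fun t ht => by
      rw [indicator_of_mem ht]).symm
  · exact fun y _ => (aestronglyMeasurable_abelInt hP y).indicator measurableSet_Ioi
  · intro t
    by_cases ht : t ∈ Ioi (1 : ℝ)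
    · simp only [indicator_of_mem ht]
      have h0 : (t : ℂ) ≠ 0 := by
        have : (1 : ℝ) < t := ht
        exact_mod_cast (by positivity : t ≠ 0)
      exact fun y _ => (DifferentiableAt.const_mul
        (DifferentiableAt.const_cpow (by fun_prop) (Or.inl h0)) _).differentiableWithinAt
    · simp only [indicator_of_notMem ht]
      exact differentiableOn_const _
  · intro y hy t
    by_cases ht : t ∈ Ioi (1 : ℝ)
    · rw [indicator_of_mem ht, indicator_of_mem ht]
      exact norm_abelInt_integrand_le hB (hpos y hy) ht
    · rw [indicator_of_notMem ht, indicator_of_notMem ht, norm_zero]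
  · have := (integrableOn_rpow_neg_add_one (show 0 < s.re / 2 by positivity)).const_mul B
    exact Integrable.indicator this measurableSet_Ioi

end AbelInt

lemma norm_sum_character_le {q : ℕ} [NeZero q] {χ : DirichletCharacter ℂ q} (hχ : χ ≠ 1) (n : ℕ) :
    ‖∑ j ∈ Finset.Icc 1 n, χ (j : ZMod q)‖ ≤ q := by
  have hIcc : ∀ n : ℕ, ∑ j ∈ Finset.Icc 1 n, χ (j : ZMod q) =
      ∑ j ∈ Finset.range n, χ ((j + 1 : ℕ) : ZMod q) := by
    intro n
    rw [Finset.range_eq_Ico, Finset.sum_Ico_add' (fun j : ℕ => χ (j : ZMod q)) 0 n 1, zero_add]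
    rfl
  have h0 : ∑ j ∈ Finset.range q, χ ((j + 1 : ℕ) : ZMod q) = 0 := by
    rw [← χ.sum_eq_zero_of_ne_one hχ, ← Equiv.sum_comp (Equiv.addRight (1 : ZMod q))]
    refine Finset.sum_nbij' (fun j => (j : ZMod q)) ZMod.val (by simp)
      (fun a _ => Finset.mem_range.2 (ZMod.val_lt a))
      (fun j hj => ZMod.val_cast_of_lt (Finset.mem_range.1 hj)) (fun a _ => ZMod.natCast_zmod_val a)
      fun j _ => by simp
  have hper : ∀ n : ℕ, ∑ j ∈ Finset.range (q + n), χ ((j + 1 : ℕ) : ZMod q) =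
      ∑ j ∈ Finset.range n, χ ((j + 1 : ℕ) : ZMod q) := by
    intro n
    rw [Finset.sum_range_add, h0, zero_add]
    simp
  rw [hIcc]
  induction n using Nat.strong_induction_on with
  | _ n ih =>
    rcases lt_or_ge n q with h | h
    · refine (norm_sum_le _ _).trans ((Finset.sum_le_sum fun j _ => χ.norm_le_one _).trans ?_)
      simpa using h.le
    · obtain ⟨m, rfl⟩ := Nat.exists_eq_add_of_le h
      rw [hper]
      exact ih m (by have := NeZero.pos q; omega)

lemma LFunction_eq_abelInt {q : ℕ} [NeZero q] {χ : DirichletCharacter ℂ q} (hχ : χ ≠ 1) {s : ℂ}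
    (hs : 0 < s.re) : DirichletCharacter.LFunction χ s =
      s * abelInt (fun t => ∑ j ∈ Finset.Icc 1 ⌊t⌋₊, χ (j : ZMod q)) s := by
  have hmeas : Measurable fun t : ℝ => ∑ j ∈ Finset.Icc 1 ⌊t⌋₊, χ (j : ZMod q) :=
    (measurable_from_nat (f := fun n => ∑ j ∈ Finset.Icc 1 n, χ (j : ZMod q))).comp
      Nat.measurable_floor
  have hopen : IsOpen {s : ℂ | 0 < s.re} := isOpen_lt continuous_const Complex.continuous_re
  have h1 : AnalyticOnNhd ℂ (DirichletCharacter.LFunction χ) {s : ℂ | 0 < s.re} :=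
    (DirichletCharacter.differentiable_LFunction hχ).differentiableOn.analyticOnNhd hopen
  have h2 : AnalyticOnNhd ℂ (fun s =>
      s * abelInt (fun t => ∑ j ∈ Finset.Icc 1 ⌊t⌋₊, χ (j : ZMod q)) s) {s : ℂ | 0 < s.re} :=
    DifferentiableOn.analyticOnNhd (fun s hs => (differentiableAt_id.mul
      (differentiableAt_abelInt hmeas (fun t => norm_sum_character_le hχ _) hs)).differentiableWithinAt)
      hopen
  have hconn : IsPreconnected {s : ℂ | 0 < s.re} :=
    (convex_halfSpace_re_gt 0).isPreconnected
  refine h1.eqOn_of_preconnected_of_eventuallyEq h2 hconn (z₀ := 2) (by simp) ?_ hs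
  filter_upwards [(isOpen_lt continuous_const Complex.continuous_re).mem_nhds
    (show (1 : ℝ) < (2 : ℂ).re by norm_num)] with w hw
  have hw : 1 < w.re := hw
  rw [DirichletCharacter.LFunction_eq_LSeries χ hw, LSeries_eq_mul_integral (r := 0) _ le_rfl
    (by linarith) (DirichletCharacter.LSeriesSummable_of_one_lt_re χ hw)]
  · rfl
  · refine Asymptotics.IsBigO.of_bound q (Eventually.of_forall fun n => ?_)
    simpa using norm_sum_character_le hχ n

/-- Nontrivial `L`-functions grow at most linearly to the right of `Re s = 1/4`. -/
lemma norm_LFunction_le {q : ℕ} [NeZero q] {χ : DirichletCharacter ℂ q} (hχ : χ ≠ 1) {s : ℂ}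
    (hs : 1 / 4 ≤ s.re) : ‖DirichletCharacter.LFunction χ s‖ ≤ 4 * q * ‖s‖ := by
  rw [LFunction_eq_abelInt hχ (by linarith), norm_mul]
  have := norm_abelInt_le (P := fun t => ∑ j ∈ Finset.Icc 1 ⌊t⌋₊, χ (j : ZMod q))
    (fun t => norm_sum_character_le hχ _) (by norm_num : (0 : ℝ) < 1 / 4) hs
  calc _ ≤ ‖s‖ * (q / (1 / 4)) := by gcongr
    _ = _ := by ring

/-- The entire function `(s - 1) ζ(s)`. -/
def zetaOne (s : ℂ) : ℂ := DirichletCharacter.LFunctionTrivChar₁ 1 s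

lemma differentiable_zetaOne : Differentiable ℂ zetaOne :=
  DirichletCharacter.differentiable_LFunctionTrivChar₁ 1

lemma zetaOne_of_ne {s : ℂ} (hs : s ≠ 1) : zetaOne s = (s - 1) * riemannZeta s := by
  rw [zetaOne, DirichletCharacter.LFunctionTrivChar₁, Function.update_of_ne hs,
    DirichletCharacter.LFunctionTrivChar_eq_mul_riemannZeta hs]
  simp

lemma zetaOne_one : zetaOne 1 = 1 := by
  simp [zetaOne, DirichletCharacter.LFunctionTrivChar₁]

lemma zetaOne_eq {s : ℂ} (hs : 0 < s.re) :
    zetaOne s = s - s * (s - 1) * abelInt (fun t => (Int.fract t : ℝ)) s := by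
  have hmeas : Measurable fun t : ℝ => ((Int.fract t : ℝ) : ℂ) :=
    Complex.measurable_ofReal.comp measurable_fract
  have hbd : ∀ t : ℝ, ‖((Int.fract t : ℝ) : ℂ)‖ ≤ 1 := fun t => by
    rw [Complex.norm_real, Real.norm_of_nonneg (Int.fract_nonneg t)]
    exact (Int.fract_lt_one t).le
  have hopen : IsOpen {s : ℂ | 0 < s.re} := isOpen_lt continuous_const Complex.continuous_re
  have h2 : AnalyticOnNhd ℂ (fun s : ℂ =>
      s - s * (s - 1) * abelInt (fun t => (Int.fract t : ℝ)) s) {s : ℂ | 0 < s.re} :=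
    DifferentiableOn.analyticOnNhd (fun s hs => (differentiableAt_id.sub
      (DifferentiableAt.mul (by fun_prop)
        (differentiableAt_abelInt hmeas hbd hs))).differentiableWithinAt) hopen
  refine (differentiable_zetaOne.differentiableOn.analyticOnNhd
    hopen).eqOn_of_preconnected_of_eventuallyEq h2
    (convex_halfSpace_re_gt 0).isPreconnected (z₀ := 2) (by simp) ?_ hs
  filter_upwards [(isOpen_lt continuous_const Complex.continuous_re).mem_nhds
    (show (1 : ℝ) < (2 : ℂ).re by norm_num)] with w hw
  have hw : 1 < w.re := hw
  have hne : w ≠ 1 := by rintro rfl; simp at hw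
  have hL := LSeries_eq_mul_integral (r := 1) (fun _ => 1) zero_le_one hw
    (LSeriesSummable_one_iff.2 hw) (Asymptotics.IsBigO.of_bound 1 (Eventually.of_forall fun n => by
      simp))
  have h1 : IntegrableOn (fun t : ℝ => (t : ℂ) ^ (-w)) (Ioi 1) :=
    integrableOn_Ioi_cpow_of_lt (by simpa using hw) one_pos
  have h3 : ∫ t in Ioi (1 : ℝ), (∑ j ∈ Finset.Icc 1 ⌊t⌋₊, (1 : ℂ)) * (t : ℂ) ^ (-(w + 1)) =
      (∫ t in Ioi (1 : ℝ), (t : ℂ) ^ (-w)) - abelInt (fun t => (Int.fract t : ℝ)) w := by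
    rw [abelInt, ← integral_sub h1 (integrable_abelInt hmeas hbd (by linarith))]
    refine setIntegral_congr_fun measurableSet_Ioi fun t ht => ?_
    have ht : (1 : ℝ) < t := ht
    have h0 : (t : ℂ) ≠ 0 := by exact_mod_cast (by positivity : t ≠ 0)
    have hfl : ((⌊t⌋₊ : ℕ) : ℂ) = t - (Int.fract t : ℝ) := by
      have : ((⌊t⌋₊ : ℕ) : ℝ) = t - Int.fract t := by
        rw [natCast_floor_eq_intCast_floor (by linarith), Int.self_sub_fract]
      rw [← Complex.ofReal_natCast, this, Complex.ofReal_sub]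
    simp only [Finset.sum_const, Nat.card_Icc, add_tsub_cancel_right, nsmul_eq_mul, mul_one]
    rw [hfl, sub_mul, show -w = 1 + -(w + 1) by ring, Complex.cpow_add _ _ h0, Complex.cpow_one]
  have h4 : ∫ t in Ioi (1 : ℝ), (t : ℂ) ^ (-w) = 1 / (w - 1) := by
    rw [integral_Ioi_cpow_of_lt (by simpa using hw) one_pos]
    simp only [Complex.ofReal_one, Complex.one_cpow]
    rw [show -w + 1 = -(w - 1) by ring, neg_div_neg_eq]
  have hz : riemannZeta w = LSeries (fun _ => 1) w := (LSeries_one_eq_riemannZeta hw).symm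
  rw [zetaOne_of_ne hne, hz, hL, h3, h4]
  have := sub_ne_zero.2 hne
  field_simp

/-- Polynomial growth of `(s - 1) ζ(s)` to the right of `Re s = 1/2`. -/
lemma norm_zetaOne_le {s : ℂ} (hs : 1 / 2 ≤ s.re) : ‖zetaOne s‖ ≤ 3 * (1 + ‖s‖) ^ 2 := by
  have h := norm_abelInt_le (P := fun t => ((Int.fract t : ℝ) : ℂ)) (B := 1) (fun t => by
    rw [Complex.norm_real, Real.norm_of_nonneg (Int.fract_nonneg t)]
    exact (Int.fract_lt_one t).le) (by norm_num : (0 : ℝ) < 1 / 2) hs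
  rw [zetaOne_eq (by linarith)]
  have h1 : ‖s - 1‖ ≤ 1 + ‖s‖ := (norm_sub_le _ _).trans (by rw [norm_one, add_comm])
  calc _ ≤ ‖s‖ + ‖s * (s - 1) * _‖ := norm_sub_le _ _
    _ ≤ ‖s‖ + ‖s‖ * (1 + ‖s‖) * (1 / (1 / 2)) := by
      rw [norm_mul, norm_mul]
      gcongr
    _ ≤ _ := by nlinarith [norm_nonneg s]

end

section

/-! ### Sums over even primitive characters -/

open DirichletCharacter in
lemma changeLevel_natCast {d q : ℕ} (h : d ∣ q) (χ : DirichletCharacter ℂ d) {a : ℕ}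
    (ha : a.Coprime q) : changeLevel h χ (a : ZMod q) = χ (a : ZMod d) := by
  have := changeLevel_eq_cast_of_dvd' χ h (a := a) (Nat.isCoprime_iff_coprime.2 ha)
  simpa using this

open DirichletCharacter in
lemma changeLevel_even_iff {d q : ℕ} (h : d ∣ q) (χ : DirichletCharacter ℂ d) :
    (changeLevel h χ).Even ↔ χ.Even := by
  have := changeLevel_eq_cast_of_dvd' χ h (a := -1) isCoprime_one_left.neg_left
  simp only [Int.cast_neg, Int.cast_one] at this
  rw [DirichletCharacter.Even, DirichletCharacter.Even, this]

/-- `∑ χ̄(b) χ(a)` over the even primitive characters modulo `d`. -/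
def charSum (a b d : ℕ) : ℂ :=
  if h : d = 0 then 0 else
    have : NeZero d := ⟨h⟩
    ∑ χ ∈ evenPrimitive d, χ⁻¹ (b : ZMod d) * χ (a : ZMod d)

lemma charSum_of_neZero (a b d : ℕ) [h : NeZero d] :
    charSum a b d = ∑ χ ∈ evenPrimitive d, χ⁻¹ (b : ZMod d) * χ (a : ZMod d) := by
  rw [charSum, dif_neg h.out]

lemma charSum_one (a b : ℕ) : charSum a b 1 = 1 := by
  have h := sum_evenPrimitive_one (k := 0) b a (0, 0)
  simp only [twistedProduct, zetaProduct, Finset.univ_eq_empty, Finset.prod_empty, mul_one] at h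
  rw [charSum_of_neZero]
  exact h

lemma charSum_eq_zero {a b d : ℕ} (h : ¬ d.Coprime (a * b)) : charSum a b d = 0 := by
  rcases Nat.eq_zero_or_pos d with rfl | hd
  · simp [charSum]
  have : NeZero d := ⟨hd.ne'⟩
  rw [charSum_of_neZero]
  refine Finset.sum_eq_zero fun χ _ => ?_
  rw [Nat.coprime_mul_iff_right, not_and_or] at h
  rcases h with h | h
  · rw [χ.map_nonunit (a := (a : ZMod d)) fun hu => h ((ZMod.isUnit_iff_coprime a d).1 hu).symm,
      mul_zero]
  · rw [χ⁻¹.map_nonunit (a := (b : ZMod d)) fun hu => h ((ZMod.isUnit_iff_coprime b d).1 hu).symm,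
      zero_mul]

lemma norm_charSum_le (a b d : ℕ) : ‖charSum a b d‖ ≤ d := by
  rcases Nat.eq_zero_or_pos d with rfl | hd
  · simp [charSum]
  have : NeZero d := ⟨hd.ne'⟩
  rw [charSum_of_neZero]
  refine (norm_sum_le _ _).trans ?_
  calc ∑ χ ∈ evenPrimitive d, ‖χ⁻¹ (b : ZMod d) * χ (a : ZMod d)‖
      ≤ ∑ χ ∈ evenPrimitive d, 1 := Finset.sum_le_sum fun χ _ => by
        rw [norm_mul]
        exact mul_le_one₀ (χ⁻¹.norm_le_one _) (norm_nonneg _) (χ.norm_le_one _)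
    _ = (evenPrimitive d).card := by simp
    _ ≤ Nat.card (DirichletCharacter ℂ d) := by
      rw [Nat.card_eq_fintype_card]
      exact_mod_cast Finset.card_le_univ _
    _ ≤ d := by
      rw [DirichletCharacter.card_eq_totient_of_hasEnoughRootsOfUnity]
      exact_mod_cast Nat.totient_le d

open DirichletCharacter Classical in
lemma sum_divisors_charSum {a b q : ℕ} [NeZero q] (h : q.Coprime (a * b)) :
    ∑ d ∈ q.divisors, charSum a b d =
      ∑ ψ : DirichletCharacter ℂ q with ψ.Even, ψ⁻¹ (b : ZMod q) * ψ (a : ZMod q) := by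
  rw [Nat.coprime_mul_iff_right] at h
  rw [← Finset.sum_fiberwise_of_maps_to (g := fun ψ : DirichletCharacter ℂ q => ψ.conductor)
    (t := q.divisors) fun ψ _ => Nat.mem_divisors.2 ⟨ψ.conductor_dvd_level, NeZero.ne q⟩]
  refine Finset.sum_congr rfl fun d hd => ?_
  have hdq := (Nat.mem_divisors.1 hd).1
  have : NeZero d := ⟨fun h0 => NeZero.ne q (Nat.eq_zero_of_zero_dvd (h0 ▸ hdq))⟩
  rw [charSum_of_neZero]
  refine Finset.sum_bij (fun χ _ => changeLevel hdq χ) (fun χ hχ => ?_)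
    (fun χ _ χ' _ h => changeLevel_injective hdq h) (fun ψ hψ => ?_) fun χ hχ => ?_
  · rw [mem_evenPrimitive] at hχ
    simp only [Finset.mem_filter, Finset.mem_univ, true_and]
    exact ⟨(changeLevel_even_iff hdq χ).2 hχ.2, (χ.conductor_changeLevel hdq).trans hχ.1⟩
  · simp only [Finset.mem_filter, Finset.mem_univ, true_and] at hψ
    obtain ⟨hev, hcond⟩ := hψ
    subst hcond
    refine ⟨ψ.primitiveCharacter, mem_evenPrimitive.2 ⟨ψ.primitiveCharacter_isPrimitive, ?_⟩,
      ψ.changeLevel_primitiveCharacter⟩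
    rw [← changeLevel_even_iff hdq]
    rwa [ψ.changeLevel_primitiveCharacter]
  · rw [← map_inv, changeLevel_natCast _ _ h.1.symm, changeLevel_natCast _ _ h.2.symm]

lemma sum_characters_inv_mul {q : ℕ} [NeZero q] {x y : ZMod q} (hy : IsUnit y) :
    ∑ ψ : DirichletCharacter ℂ q, ψ⁻¹ y * ψ x = if y = x then (q.totient : ℂ) else 0 := by
  rw [← DirichletCharacter.sum_char_inv_mul_char_eq ℂ hy x]
  refine Finset.sum_congr rfl fun ψ _ => ?_
  congr 1
  obtain ⟨u, rfl⟩ := hy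
  rw [ZMod.inv_coe_unit, MulChar.inv_apply, Ring.inverse_unit]

open Classical in
lemma sum_even_characters {a b q : ℕ} [NeZero q] (h : q.Coprime (a * b)) :
    ∑ ψ : DirichletCharacter ℂ q with ψ.Even, ψ⁻¹ (b : ZMod q) * ψ (a : ZMod q) =
      q.totient * ((if (q : ℤ) ∣ a - b then 1 else 0) + if q ∣ a + b then 1 else 0) / 2 := by
  rw [Nat.coprime_mul_iff_right] at h
  have hb : IsUnit (b : ZMod q) := (ZMod.isUnit_iff_coprime b q).2 h.2.symm
  have h1 : ∀ ψ : DirichletCharacter ℂ q, (if ψ.Even then ψ⁻¹ (b : ZMod q) * ψ (a : ZMod q) else 0) =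
      (ψ⁻¹ (b : ZMod q) * ψ (a : ZMod q) + ψ⁻¹ (b : ZMod q) * ψ (-a : ZMod q)) / 2 := by
    intro ψ
    have hneg : ψ (-a : ZMod q) = ψ (-1) * ψ a := by rw [← map_mul, neg_one_mul]
    rw [hneg]
    split_ifs with hψ
    · rw [show ψ (-1) = 1 from hψ]; ring
    · rw [(ψ.even_or_odd.resolve_left hψ : ψ (-1) = -1)]; ring
  rw [Finset.sum_filter, Finset.sum_congr rfl fun ψ _ => h1 ψ, ← Finset.sum_div,
    Finset.sum_add_distrib, sum_characters_inv_mul hb, sum_characters_inv_mul hb]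
  have e1 : ((b : ZMod q) = a) ↔ (q : ℤ) ∣ a - b := by
    rw [← ZMod.intCast_zmod_eq_zero_iff_dvd]
    push_cast
    rw [sub_eq_zero, eq_comm]
  have e2 : ((b : ZMod q) = -a) ↔ q ∣ a + b := by
    rw [← ZMod.natCast_eq_zero_iff, eq_neg_iff_add_eq_zero, add_comm]
    push_cast
    rfl
  simp only [e1, e2]
  split_ifs <;> ring

/-- The indicator function of the integers coprime to `m`. -/
def copr (m n : ℕ) : ℂ := (1 : DirichletCharacter ℂ m) (n : ZMod m)

lemma copr_eq (m n : ℕ) : copr m n = if n.Coprime m then 1 else 0 := by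
  rw [copr]
  split_ifs with h
  · exact MulChar.one_apply ((ZMod.isUnit_iff_coprime n m).2 h)
  · exact MulChar.map_nonunit _ fun hu => h ((ZMod.isUnit_iff_coprime n m).1 hu)

/-- The convolution of the primitive character sums with the principal character. -/
def charConv (a b q : ℕ) : ℂ := copr (a * b) q *
  (q.totient * ((if (q : ℤ) ∣ a - b then 1 else 0) + if q ∣ a + b then 1 else 0) / 2)

open scoped LSeries.notation in
lemma charSum_convolution (a b : ℕ) : charSum a b ⍟ copr (a * b) = charConv a b := by
  rw [LSeries.convolution_def]
  ext q
  rcases Nat.eq_zero_or_pos q with rfl | hq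
  · simp [charConv]
  have : NeZero q := ⟨hq.ne'⟩
  rw [charConv, copr_eq (a * b) q]
  by_cases h : q.Coprime (a * b)
  · rw [if_pos h, ← sum_even_characters h, ← sum_divisors_charSum h, one_mul,
      ← Nat.sum_divisorsAntidiagonal fun d _ => charSum a b d]
    refine Finset.sum_congr rfl fun x hx => ?_
    have hx2 : x.2 ∣ q := ⟨x.1, by rw [mul_comm]; exact (Nat.mem_divisorsAntidiagonal.1 hx).1.symm⟩
    rw [copr_eq, if_pos (h.coprime_dvd_left hx2), mul_one]
  · rw [if_neg h, zero_mul]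
    refine Finset.sum_eq_zero fun x hx => ?_
    by_cases h1 : x.1.Coprime (a * b)
    · rw [copr_eq, if_neg, mul_zero]
      intro h2
      rw [← (Nat.mem_divisorsAntidiagonal.1 hx).1] at h
      exact h (Nat.Coprime.mul_left h1 h2)
    · rw [charSum_eq_zero h1, zero_mul]

end

section

/-! ### The Dirichlet series of the primitive character sums -/

/-- `∑ n^(-3/2)`. -/
def zetaThreeHalves : ℝ := ∑' n : ℕ, 1 / (n : ℝ) ^ (3 / 2 : ℝ)

lemma summable_three_halves : Summable fun n : ℕ => 1 / (n : ℝ) ^ (3 / 2 : ℝ) :=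
  Real.summable_one_div_nat_rpow.2 (by norm_num)

lemma zetaThreeHalves_nonneg : 0 ≤ zetaThreeHalves := tsum_nonneg fun n => by positivity

/-- The Möbius function as a complex sequence. -/
def moebiusC (n : ℕ) : ℂ := ((ArithmeticFunction.moebius n : ℤ) : ℂ)

/-- The inverse of the `L`-series of the principal character modulo `m`. -/
def invL (m : ℕ) (w : ℂ) : ℂ := LSeries (copr m * moebiusC) w

lemma LSeriesSummable_copr_mul_moebius (m : ℕ) {w : ℂ} (hw : 1 < w.re) :
    LSeriesSummable (copr m * moebiusC) w :=
  DirichletCharacter.LSeriesSummable_mul (1 : DirichletCharacter ℂ m)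
    (ArithmeticFunction.LSeriesSummable_moebius_iff.2 hw)

lemma LSeriesSummable_copr (m : ℕ) {w : ℂ} (hw : 1 < w.re) : LSeriesSummable (copr m) w :=
  DirichletCharacter.LSeriesSummable_of_one_lt_re (1 : DirichletCharacter ℂ m) hw

lemma LSeries_copr_mul_invL (m : ℕ) {w : ℂ} (hw : 1 < w.re) : LSeries (copr m) w * invL m w = 1 :=
  DirichletCharacter.LSeries.mul_mu_eq_one (1 : DirichletCharacter ℂ m) hw

lemma norm_copr_le (m n : ℕ) : ‖copr m n‖ ≤ 1 :=
  DirichletCharacter.norm_le_one (1 : DirichletCharacter ℂ m) _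

lemma norm_invL_le (m : ℕ) {w : ℂ} (hw : 3 / 2 ≤ w.re) : ‖invL m w‖ ≤ zetaThreeHalves := by
  refine tsum_of_norm_bounded summable_three_halves.hasSum fun n => ?_
  rw [LSeries.norm_term_eq]
  split_ifs with hn
  · positivity
  · have h1 : (1 : ℝ) ≤ n := by exact_mod_cast Nat.one_le_iff_ne_zero.2 hn
    have h2 : ‖(copr m * moebiusC) n‖ ≤ 1 := by
      rw [Pi.mul_apply, norm_mul]
      refine mul_le_one₀ (norm_copr_le m n) (norm_nonneg _) ?_
      rw [moebiusC, Complex.norm_intCast]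
      exact_mod_cast ArithmeticFunction.abs_moebius_le_one
    gcongr

lemma differentiableAt_invL (m : ℕ) {w : ℂ} (hw : 1 < w.re) : DifferentiableAt ℂ (invL m) w := by
  have h : LSeries.abscissaOfAbsConv (copr m * moebiusC) < w.re := by
    refine lt_of_le_of_lt (LSeries.abscissaOfAbsConv_le_of_forall_lt_LSeriesSummable (x := 1)
      fun y hy => LSeriesSummable_copr_mul_moebius m (by simpa using hy)) ?_
    exact_mod_cast hw
  exact (LSeries_analyticOnNhd (copr m * moebiusC) w h).differentiableAt

/-- `∑ φ(q) q^(-w)` over the divisors `q` of `D` that are coprime to `m`. -/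
def finSum (m D : ℕ) (w : ℂ) : ℂ := ∑ q ∈ D.divisors, copr m q * q.totient / (q : ℂ) ^ w

lemma norm_finSum_le (m D : ℕ) {w : ℂ} (hw : 1 ≤ w.re) : ‖finSum m D w‖ ≤ D := by
  refine (norm_sum_le _ _).trans ?_
  calc ∑ q ∈ D.divisors, ‖copr m q * q.totient / (q : ℂ) ^ w‖ ≤ ∑ q ∈ D.divisors, 1 := by
        refine Finset.sum_le_sum fun q hq => ?_
        have hq0 : 0 < q := Nat.pos_of_mem_divisors hq
        have h1 : (1 : ℝ) ≤ q := by exact_mod_cast hq0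
        rw [norm_div, norm_mul, Complex.norm_natCast, Complex.norm_natCast_cpow_of_pos hq0,
          div_le_one (by positivity)]
        calc ‖copr m q‖ * (q.totient : ℝ) ≤ 1 * q := by
              gcongr
              · exact norm_copr_le m q
              · exact Nat.totient_le q
          _ = (q : ℝ) ^ (1 : ℝ) := by rw [one_mul, Real.rpow_one]
          _ ≤ _ := Real.rpow_le_rpow_of_exponent_le h1 hw
    _ = (D.divisors.card : ℝ) := by simp
    _ ≤ D := by exact_mod_cast Nat.card_divisors_le_self D

lemma differentiable_finSum (m D : ℕ) : Differentiable ℂ (finSum m D) := by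
  unfold finSum
  refine Differentiable.fun_sum fun q hq => ?_
  have hq0 : (q : ℂ) ≠ 0 := Nat.cast_ne_zero.2 (Nat.pos_of_mem_divisors hq).ne'
  exact (differentiable_const _).div (fun w => (differentiableAt_id.const_cpow (Or.inl hq0)))
    fun w => by simp [Complex.cpow_eq_zero_iff, hq0]

lemma LSeriesHasSum_finSum (m : ℕ) {D : ℕ} (hD : D ≠ 0) (w : ℂ) :
    LSeriesHasSum (fun q => copr m q * q.totient * if q ∣ D then 1 else 0) w (finSum m D w) := by
  have h : ∀ q ∉ D.divisors, LSeries.term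
      (fun q => copr m q * q.totient * if q ∣ D then 1 else 0) w q = 0 := by
    intro q hq
    have : ¬ q ∣ D := fun h => hq (Nat.mem_divisors.2 ⟨h, hD⟩)
    simp [LSeries.term, this]
  have h2 := hasSum_sum_of_ne_finset_zero (L := SummationFilter.unconditional ℕ) h
  rw [LSeriesHasSum]
  convert h2 using 1
  refine Finset.sum_congr rfl fun q hq => ?_
  rw [LSeries.term_of_ne_zero (Nat.pos_of_mem_divisors hq).ne', if_pos (Nat.dvd_of_mem_divisors hq),
    mul_one]

/-- `∏_{p ∣ m} (1 - p^(-s))`. -/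
def eulerCut (m : ℕ) (s : ℂ) : ℂ := ∏ p ∈ m.primeFactors, (1 - (p : ℂ) ^ (-s))

lemma norm_eulerCut_le {m : ℕ} (hm : m ≠ 0) {s : ℂ} (hs : 0 ≤ s.re) : ‖eulerCut m s‖ ≤ m := by
  rw [eulerCut, norm_prod]
  calc ∏ p ∈ m.primeFactors, ‖1 - (p : ℂ) ^ (-s)‖ ≤ ∏ p ∈ m.primeFactors, (p : ℝ) := by
        refine Finset.prod_le_prod (fun _ _ => norm_nonneg _) fun p hp => ?_
        have hp := Nat.prime_of_mem_primeFactors hp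
        have h2 : (2 : ℝ) ≤ p := by exact_mod_cast hp.two_le
        refine (norm_sub_le _ _).trans ?_
        rw [norm_one, Complex.norm_natCast_cpow_of_pos hp.pos]
        have : (p : ℝ) ^ (-s).re ≤ 1 :=
          Real.rpow_le_one_of_one_le_of_nonpos (by linarith) (by simpa using hs)
        linarith
    _ = ((∏ p ∈ m.primeFactors, p : ℕ) : ℝ) := by push_cast; rfl
    _ ≤ m := by exact_mod_cast Nat.le_of_dvd (Nat.pos_of_ne_zero hm) (Nat.prod_primeFactors_dvd m)

lemma differentiable_eulerCut (m : ℕ) : Differentiable ℂ (eulerCut m) := fun s =>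
  differentiableAt_prod _ fun p hp => by
    have : (p : ℂ) ≠ 0 := Nat.cast_ne_zero.2 (Nat.prime_of_mem_primeFactors hp).ne_zero
    exact (differentiableAt_const _).sub
      (DifferentiableAt.const_cpow (by fun_prop) (Or.inl this))

lemma LSeries_copr {m : ℕ} (hm : m ≠ 0) {s : ℂ} (hs : 1 < s.re) :
    LSeries (copr m) s = eulerCut m s * riemannZeta s := by
  have : NeZero m := ⟨hm⟩
  have hs1 : s ≠ 1 := by rintro rfl; simp at hs
  rw [eulerCut, ← DirichletCharacter.LFunctionTrivChar_eq_mul_riemannZeta hs1]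
  exact (DirichletCharacter.LFunction_eq_LSeries (1 : DirichletCharacter ℂ m) hs).symm

open scoped LSeries.notation in
lemma LSeries_totient (m : ℕ) {w : ℂ} (hw : 2 < w.re) :
    LSeriesSummable (fun q => copr m q * q.totient) w ∧
    LSeries (fun q => copr m q * q.totient) w * LSeries (copr m) w = LSeries (copr m) (w - 1) := by
  have hid : (fun q : ℕ => (q.totient : ℂ)) ⍟ (1 : ℕ → ℂ) = fun n : ℕ => (n : ℂ) := by
    rw [LSeries.convolution_def]
    ext n
    simp only [Pi.one_apply, mul_one]
    rw [Nat.sum_divisorsAntidiagonal fun d _ => (d.totient : ℂ)]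
    exact_mod_cast Nat.sum_totient n
  have hconv : (fun q => copr m q * q.totient) ⍟ copr m = fun n => copr m n * n := by
    have := DirichletCharacter.mul_convolution_distrib (1 : DirichletCharacter ℂ m)
      (fun q : ℕ => (q.totient : ℂ)) 1
    rw [hid, mul_one] at this
    exact this
  have hterm : ∀ n, LSeries.term (fun n => copr m n * n) w n = LSeries.term (copr m) (w - 1) n := by
    intro n
    rcases eq_or_ne n 0 with rfl | hn
    · simp
    · have hn' : (n : ℂ) ≠ 0 := Nat.cast_ne_zero.2 hn
      rw [LSeries.term_of_ne_zero hn, LSeries.term_of_ne_zero hn, Complex.cpow_sub _ _ hn',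
        Complex.cpow_one]
      field_simp
  have hsum : LSeriesSummable (fun q => copr m q * q.totient) w := by
    have h1 : LSeriesSummable (fun n => copr m n * n) w := by
      rw [LSeriesSummable, funext hterm]
      exact LSeriesSummable_copr m (by rw [Complex.sub_re, Complex.one_re]; linarith)
    refine .of_norm <| h1.norm.of_nonneg_of_le (fun _ ↦ norm_nonneg _) fun n ↦
      LSeries.norm_term_le w ?_
    rw [norm_mul, norm_mul, Complex.norm_natCast, Complex.norm_natCast]
    gcongr
    exact Nat.totient_le n
  refine ⟨hsum, ?_⟩
  rw [← LSeries_convolution' hsum (LSeriesSummable_copr m (by linarith)), hconv, LSeries,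
    funext hterm, LSeries]

/-- The continuation of `(w - 2) ∑ charSum a b q q^(-w)` to `Re w > 1`. -/
def charCont (a b : ℕ) (w : ℂ) : ℂ :=
  invL (a * b) w / 2 *
    ((if a = b then invL (a * b) w * zetaOne (w - 1) * eulerCut (a * b) (w - 1)
      else (w - 2) * finSum (a * b) (a - b : ℤ).natAbs w) + (w - 2) * finSum (a * b) (a + b) w)

lemma LSeriesSummable_charSum (a b : ℕ) {w : ℂ} (hw : 2 < w.re) : LSeriesSummable (charSum a b) w := by
  refine LSeriesSummable_of_le_const_mul_rpow (x := 2) hw ⟨1, fun n _ => ?_⟩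
  rw [one_mul, show (2 : ℝ) - 1 = 1 by norm_num, Real.rpow_one]
  exact norm_charSum_le a b n

lemma charCont_eq {a b : ℕ} (ha : a ≠ 0) (hb : b ≠ 0) {w : ℂ} (hw : 2 < w.re) :
    (w - 2) * LSeries (charSum a b) w = charCont a b w := by
  have hw1 : 1 < w.re := by linarith
  have hinv := LSeries_copr_mul_invL (a * b) hw1
  have hC : LSeries (charSum a b) w = LSeries (charConv a b) w * invL (a * b) w := by
    rw [← charSum_convolution, LSeries_convolution' (LSeriesSummable_charSum a b hw)
      (LSeriesSummable_copr _ hw1), mul_assoc, hinv, mul_one]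
  have hplus := LSeriesHasSum_finSum (a * b) (D := a + b) (by omega) w
  have hconv : ∀ S, LSeriesHasSum
      (fun q => copr (a * b) q * q.totient * if (q : ℤ) ∣ a - b then 1 else 0) w S →
      LSeries (charConv a b) w = (S + finSum (a * b) (a + b) w) / 2 := by
    intro S hS
    have h := (hS.add hplus).smul (1 / 2 : ℂ)
    have hf : charConv a b = (1 / 2 : ℂ) •
        ((fun q : ℕ => copr (a * b) q * q.totient * if (q : ℤ) ∣ a - b then (1 : ℂ) else 0) +
          fun q : ℕ => copr (a * b) q * q.totient * if q ∣ a + b then (1 : ℂ) else 0) := by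
      ext q
      simp only [charConv, Pi.smul_apply, Pi.add_apply, smul_eq_mul]
      ring
    rw [hf, h.LSeries_eq]
    ring
  rw [hC, charCont]
  split_ifs with hab
  · subst hab
    obtain ⟨h1, h2⟩ := LSeries_totient (a * a) hw
    have h3 : LSeries (fun q => copr (a * a) q * q.totient) w =
        LSeries (copr (a * a)) (w - 1) * invL (a * a) w := by
      rw [← h2, mul_assoc, hinv, mul_one]
    rw [hconv _ (by simpa using h1.LSeriesHasSum), h3, LSeries_copr (by positivity)
      (by rw [Complex.sub_re, Complex.one_re]; linarith), zetaOne_of_ne fun h => ?_]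
    · ring
    · have := congrArg Complex.re h
      rw [Complex.sub_re, Complex.one_re] at this
      linarith
  · have hD : (a - b : ℤ).natAbs ≠ 0 := by omega
    have h1 := LSeriesHasSum_finSum (a * b) hD w
    simp_rw [← Int.natCast_dvd] at h1
    rw [hconv _ h1]
    ring

lemma differentiableAt_charCont (a b : ℕ) {w : ℂ} (hw : 1 < w.re) :
    DifferentiableAt ℂ (charCont a b) w := by
  have h1 := differentiableAt_invL (a * b) hw
  have h2 : DifferentiableAt ℂ (fun w => zetaOne (w - 1)) w :=
    (differentiable_zetaOne _).comp w (by fun_prop)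
  have h3 : DifferentiableAt ℂ (fun w => eulerCut (a * b) (w - 1)) w :=
    (differentiable_eulerCut _ _).comp w (by fun_prop)
  have h4 := fun D => differentiable_finSum (a * b) D w
  unfold charCont
  refine (h1.div_const 2).mul (DifferentiableAt.add ?_ ?_)
  · split_ifs
    · exact (h1.mul h2).mul h3
    · exact DifferentiableAt.mul (by fun_prop) (h4 _)
  · exact DifferentiableAt.mul (by fun_prop) (h4 _)

/-- The constant in the bound for `charCont`. -/
def charContConst : ℝ := zetaThreeHalves / 2 * (3 * zetaThreeHalves + 3)

lemma charContConst_nonneg : 0 ≤ charContConst := by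
  have := zetaThreeHalves_nonneg
  unfold charContConst
  positivity

lemma norm_charCont_le {a b : ℕ} (ha : a ≠ 0) (hb : b ≠ 0) {w : ℂ} (hw : 3 / 2 ≤ w.re) :
    ‖charCont a b w‖ ≤ charContConst * (a * b) * (2 + ‖w‖) ^ 2 := by
  set Z := zetaThreeHalves
  have hZ : 0 ≤ Z := zetaThreeHalves_nonneg
  set T : ℝ := 2 + ‖w‖
  have hT : 1 ≤ T := by have := norm_nonneg w; simp only [T]; linarith
  have ha1 : (1 : ℝ) ≤ a := by exact_mod_cast Nat.one_le_iff_ne_zero.2 ha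
  have hb1 : (1 : ℝ) ≤ b := by exact_mod_cast Nat.one_le_iff_ne_zero.2 hb
  have hI := norm_invL_le (a * b) hw
  have hw2 : ‖w - 2‖ ≤ T := (norm_sub_le _ _).trans (by simp [T, add_comm])
  have hT2 : T ≤ T ^ 2 := by nlinarith
  have hsum : ‖(w - 2) * finSum (a * b) (a + b) w‖ ≤ 2 * (a * b) * T ^ 2 := by
    rw [norm_mul]
    calc ‖w - 2‖ * ‖finSum (a * b) (a + b) w‖ ≤ T * ((a + b : ℕ) : ℝ) := by
          gcongr
          exact norm_finSum_le _ _ (by linarith)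
      _ ≤ T ^ 2 * (2 * (a * b)) := by
          push_cast
          gcongr
          nlinarith
      _ = _ := by ring
  have hfirst : ‖(if a = b then invL (a * b) w * zetaOne (w - 1) * eulerCut (a * b) (w - 1)
      else (w - 2) * finSum (a * b) (a - b : ℤ).natAbs w)‖ ≤ (3 * Z + 1) * (a * b) * T ^ 2 := by
    split_ifs with hab
    · rw [norm_mul, norm_mul]
      have h1 : ‖zetaOne (w - 1)‖ ≤ 3 * T ^ 2 := by
        refine (norm_zetaOne_le (by rw [Complex.sub_re, Complex.one_re]; linarith)).trans ?_
        gcongr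
        have := norm_sub_le w 1
        rw [norm_one] at this
        simp only [T]
        linarith
      have h2 : ‖eulerCut (a * b) (w - 1)‖ ≤ a * b := by
        have := norm_eulerCut_le (m := a * b) (by positivity) (s := w - 1)
          (by rw [Complex.sub_re, Complex.one_re]; linarith)
        exact_mod_cast this
      calc ‖invL (a * b) w‖ * ‖zetaOne (w - 1)‖ * ‖eulerCut (a * b) (w - 1)‖
          ≤ Z * (3 * T ^ 2) * (a * b) := by gcongr
        _ ≤ _ := by
          have : 0 ≤ (a * b : ℝ) * T ^ 2 := by positivity
          nlinarith
    · rw [norm_mul]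
      have h1 : (((a - b : ℤ).natAbs : ℕ) : ℝ) ≤ a * b := by
        rw [Nat.cast_natAbs]
        push_cast
        rw [abs_le]
        constructor <;> nlinarith
      calc ‖w - 2‖ * ‖finSum (a * b) (a - b : ℤ).natAbs w‖ ≤ T * (a * b) := by
            gcongr
            exact (norm_finSum_le _ _ (by linarith)).trans h1
        _ ≤ T ^ 2 * (a * b) := by gcongr
        _ ≤ _ := by
          have : 0 ≤ Z * ((a * b : ℝ) * T ^ 2) := by positivity
          nlinarith
  rw [charCont, norm_mul, norm_div]
  calc _ ≤ Z / 2 * ((3 * Z + 1) * (a * b) * T ^ 2 + 2 * (a * b) * T ^ 2) := by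
        rw [show ‖(2 : ℂ)‖ = 2 by simp]
        gcongr
        exact (norm_add_le _ _).trans (add_le_add hfirst hsum)
    _ = _ := by
      simp only [charContConst, Z]
      ring

lemma charCont_two {a b : ℕ} (ha : a ≠ 0) (hb : b ≠ 0) :
    charCont a b 2 = if a = b then 1 / (2 * riemannZeta 2 ^ 2) *
      ∏ p ∈ (a * b).primeFactors, ((1 - 1 / (p : ℂ) ^ 2) ^ 2)⁻¹ * (1 - 1 / (p : ℂ)) else 0 := by
  rw [charCont]
  split_ifs with hab
  · have hinv := LSeries_copr_mul_invL (a * b) (w := 2) (by norm_num)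
    rw [LSeries_copr (by positivity) (by norm_num)] at hinv
    have h1 : invL (a * b) 2 = (eulerCut (a * b) 2 * riemannZeta 2)⁻¹ := eq_inv_of_mul_eq_one_right hinv
    have h2 : eulerCut (a * b) 2 = ∏ p ∈ (a * b).primeFactors, (1 - 1 / (p : ℂ) ^ 2) := by
      refine Finset.prod_congr rfl fun p _ => ?_
      rw [Complex.cpow_neg, one_div]
      norm_num
    have h3 : eulerCut (a * b) (2 - 1) = ∏ p ∈ (a * b).primeFactors, (1 - 1 / (p : ℂ)) := by
      refine Finset.prod_congr rfl fun p _ => ?_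
      rw [Complex.cpow_neg, one_div]
      norm_num
    rw [h1, h3, show (2 - 1 : ℂ) = 1 by norm_num, zetaOne_one, h2, Finset.prod_mul_distrib,
      Finset.prod_inv_distrib, Finset.prod_pow]
    field_simp
    ring
  · ring

end

section

variable {k : ℕ}

/-! ### Sums over tuples -/

/-- Distributivity of finite products over absolutely convergent series. -/
lemma hasSum_pi_prod {ι : Type*} {f : Fin k → ι → ℂ} (hf : ∀ i, Summable fun n => ‖f i n‖) :
    (Summable fun x : Fin k → ι => ‖∏ i, f i (x i)‖) ∧
      ∑' x : Fin k → ι, ∏ i, f i (x i) = ∏ i, ∑' n, f i n := by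
  induction k with
  | zero => exact ⟨Summable.of_finite, by simp⟩
  | succ k ih =>
    obtain ⟨h1, h2⟩ := ih (f := fun i => f i.succ) fun i => hf i.succ
    obtain ⟨φ, hφ⟩ : ∃ φ : ι × (Fin k → ι) ≃ (Fin (k + 1) → ι), ∀ y, φ y = Fin.cons y.1 y.2 :=
      ⟨Fin.consEquiv fun _ => ι, fun _ => rfl⟩
    have he : ∀ y, ∏ i, f i (φ y i) = f 0 y.1 * ∏ i, f i.succ (y.2 i) := by
      intro y
      rw [Fin.prod_univ_succ, hφ]
      simp
    obtain ⟨g, hg⟩ : ∃ g : (Fin k → ι) → ℂ, g = fun x => ∏ i, f i.succ (x i) := ⟨_, rfl⟩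
    have he' : ∀ y, ∏ i, f i (φ y i) = f 0 y.1 * g y.2 := fun y => by rw [he, hg]
    have h1' : Summable fun x => ‖g x‖ := by rw [hg]; exact h1
    constructor
    · rw [← φ.summable_iff]
      exact ((hf 0).mul_norm h1').congr fun y => by rw [Function.comp_apply, he']
    · rw [← φ.tsum_eq, tsum_congr he', ← tsum_mul_tsum_of_summable_norm (hf 0) h1', hg, h2,
        Fin.prod_univ_succ]

/-- Pairs of `k`-tuples of positive integers. -/
abbrev TPoint (k : ℕ) : Type := (Fin k → ℕ+) × (Fin k → ℕ+)

/-- `∏ n_j^(-s_j) m_j^(-z_j)`. -/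
def wt (e : EPoint k) (x : TPoint k) : ℂ := ∏ j, 1 / ((x.1 j : ℂ) ^ e.1 j * (x.2 j : ℂ) ^ e.2 j)

/-- `N n_1 ⋯ n_k`. -/
def tupleNum (N : ℕ) (x : Fin k → ℕ+) : ℕ := N * ∏ j, (x j : ℕ)

lemma tupleNum_ne_zero {N : ℕ} (hN : N ≠ 0) (x : Fin k → ℕ+) : tupleNum N x ≠ 0 :=
  mul_ne_zero hN (Finset.prod_ne_zero_iff.2 fun j _ => (x j).ne_zero)

lemma wt_eq (e : EPoint k) (x : TPoint k) :
    wt e x = (∏ j, 1 / (x.1 j : ℂ) ^ e.1 j) * ∏ j, 1 / (x.2 j : ℂ) ^ e.2 j := by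
  rw [wt, ← Finset.prod_mul_distrib]
  exact Finset.prod_congr rfl fun j _ => by rw [one_div_mul_one_div]

lemma norm_one_div_cpow (n : ℕ+) (s : ℂ) : ‖1 / (n : ℂ) ^ s‖ = (n : ℝ) ^ (-s.re) := by
  rw [norm_div, norm_one, Complex.norm_natCast_cpow_of_pos n.pos, Real.rpow_neg (by positivity),
    one_div]

/-- The total weight `∏ n_j^(-σ) m_j^(-σ)`. -/
def absWt (σ : ℝ) (x : TPoint k) : ℝ := (∏ j, (x.1 j : ℝ) ^ (-σ)) * ∏ j, (x.2 j : ℝ) ^ (-σ)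

lemma absWt_pos (σ : ℝ) (x : TPoint k) : 0 < absWt σ x :=
  mul_pos (Finset.prod_pos fun j _ => Real.rpow_pos_of_pos (by exact_mod_cast (x.1 j).pos) _)
    (Finset.prod_pos fun j _ => Real.rpow_pos_of_pos (by exact_mod_cast (x.2 j).pos) _)

lemma norm_wt_le {e : EPoint k} {σ : ℝ} (he : (∀ j, σ ≤ (e.1 j).re) ∧ ∀ j, σ ≤ (e.2 j).re)
    (x : TPoint k) : ‖wt e x‖ ≤ absWt σ x := by
  rw [wt_eq, norm_mul, norm_prod, norm_prod, absWt]
  have h : ∀ (n : ℕ+) (s : ℂ), σ ≤ s.re → ‖1 / (n : ℂ) ^ s‖ ≤ (n : ℝ) ^ (-σ) := by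
    intro n s hs
    rw [norm_one_div_cpow]
    exact Real.rpow_le_rpow_of_exponent_le (by exact_mod_cast n.pos) (by linarith)
  exact mul_le_mul (Finset.prod_le_prod (fun _ _ => norm_nonneg _) fun j _ => h _ _ (he.1 j))
    (Finset.prod_le_prod (fun _ _ => norm_nonneg _) fun j _ => h _ _ (he.2 j))
    (Finset.prod_nonneg fun _ _ => norm_nonneg _) (Finset.prod_nonneg fun _ _ => by positivity)

lemma summable_pnat_rpow {σ : ℝ} (hσ : 1 < σ) : Summable fun n : ℕ+ => (n : ℝ) ^ (-σ) :=
  (Real.summable_nat_rpow.2 (by linarith : -σ < -1)).comp_injective PNat.coe_injective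

lemma summable_absWt {σ : ℝ} (hσ : 1 < σ) : Summable (absWt σ : TPoint k → ℝ) := by
  have h := (hasSum_pi_prod (k := k) (f := fun _ (n : ℕ+) => (((n : ℝ) ^ (-σ) : ℝ) : ℂ))
    fun _ => by simpa [abs_of_nonneg, Real.rpow_nonneg] using summable_pnat_rpow hσ).1
  have h' : Summable fun x : Fin k → ℕ+ => ∏ j, (x j : ℝ) ^ (-σ) := by
    refine h.congr fun x => ?_
    rw [← Complex.ofReal_prod, Complex.norm_real, Real.norm_of_nonneg]
    exact Finset.prod_nonneg fun _ _ => by positivity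
  have h0 : ∀ x : Fin k → ℕ+, 0 ≤ ∏ j, (x j : ℝ) ^ (-σ) := fun x =>
    Finset.prod_nonneg fun _ _ => by positivity
  exact Summable.mul_of_nonneg (f := fun x : Fin k → ℕ+ => ∏ j, (x j : ℝ) ^ (-σ))
    (g := fun x : Fin k → ℕ+ => ∏ j, (x j : ℝ) ^ (-σ)) h' h' h0 h0

lemma tupleNum_mul_absWt (M N : ℕ) (σ : ℝ) (x : TPoint k) :
    (tupleNum N x.1 : ℝ) * tupleNum M x.2 * absWt σ x = N * M * absWt (σ - 1) x := by
  have h : ∀ y : Fin k → ℕ+, (∏ j, (y j : ℝ)) * ∏ j, (y j : ℝ) ^ (-σ) =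
      ∏ j, (y j : ℝ) ^ (-(σ - 1)) := by
    intro y
    rw [← Finset.prod_mul_distrib]
    refine Finset.prod_congr rfl fun j _ => ?_
    have : (0 : ℝ) < y j := by exact_mod_cast (y j).pos
    rw [show -(σ - 1) = 1 + -σ by ring, Real.rpow_add this, Real.rpow_one]
  simp only [tupleNum, absWt, ← h]
  push_cast
  ring

/-! ### Expansion of the coefficients in the domain of absolute convergence -/

lemma LFunction_eq_tsum_pnat {q : ℕ} [NeZero q] (χ : DirichletCharacter ℂ q) {s : ℂ}
    (hs : 1 < s.re) :
    (Summable fun n : ℕ+ => ‖χ ((n : ℕ) : ZMod q) * (1 / (n : ℂ) ^ s)‖) ∧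
    DirichletCharacter.LFunction χ s = ∑' n : ℕ+, χ ((n : ℕ) : ZMod q) * (1 / (n : ℂ) ^ s) := by
  have hterm : ∀ n : ℕ+, LSeries.term (χ ·) s n = χ ((n : ℕ) : ZMod q) * (1 / (n : ℂ) ^ s) := by
    intro n
    rw [LSeries.term_of_ne_zero n.ne_zero, mul_one_div]
  have hsum := DirichletCharacter.LSeriesSummable_of_one_lt_re χ hs
  constructor
  · simp_rw [← hterm]
    exact hsum.norm.comp_injective PNat.coe_injective
  · rw [DirichletCharacter.LFunction_eq_LSeries χ hs, LSeries]
    simp_rw [← hterm]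
    refine (PNat.coe_injective.tsum_eq ?_).symm
    intro n hn
    rw [Function.mem_support] at hn
    have : n ≠ 0 := by rintro rfl; simp at hn
    exact ⟨⟨n, Nat.pos_of_ne_zero this⟩, rfl⟩

lemma twistedProduct_eq_tsum (M N : ℕ) {q : ℕ} [NeZero q] (χ : DirichletCharacter ℂ q)
    {e : EPoint k} (he : (∀ j, 1 < (e.1 j).re) ∧ ∀ j, 1 < (e.2 j).re) :
    HasSum (fun x : TPoint k => wt e x *
      (χ⁻¹ (tupleNum M x.2 : ZMod q) * χ (tupleNum N x.1 : ZMod q))) (twistedProduct M N e.1 e.2 χ) := by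
  have h1 := fun j => LFunction_eq_tsum_pnat χ (he.1 j)
  have h2 := fun j => LFunction_eq_tsum_pnat χ⁻¹ (he.2 j)
  obtain ⟨a1, a2⟩ := hasSum_pi_prod fun j => (h1 j).1
  obtain ⟨b1, b2⟩ := hasSum_pi_prod fun j => (h2 j).1
  have hsum := summable_mul_of_summable_norm a1 b1
  have htot := tsum_mul_tsum_of_summable_norm a1 b1
  rw [twistedProduct, Finset.prod_congr rfl fun j _ => (h1 j).2, Finset.prod_congr rfl fun j _ =>
    (h2 j).2, ← a2, ← b2, htot]
  refine (hsum.hasSum.mul_left (χ⁻¹ (M : ZMod q) * χ (N : ZMod q))).congr_fun ?_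
  intro x
  simp only [tupleNum, wt_eq, Nat.cast_mul, Nat.cast_prod, map_mul, map_prod,
    Finset.prod_mul_distrib]
  ring

lemma coeffA_eq_tsum (M N : ℕ) {e : EPoint k} (he : (∀ j, 1 < (e.1 j).re) ∧ ∀ j, 1 < (e.2 j).re)
    (q : ℕ+) :
    HasSum (fun x : TPoint k => wt e x *
      (charSum (tupleNum N x.1) (tupleNum M x.2) q - if q = 1 then 1 else 0)) (coeffA M N e q) := by
  unfold coeffA
  split_ifs with h
  · subst h
    simp only [PNat.one_coe, charSum_one, sub_self, mul_zero]
    exact hasSum_zero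
  · simp only [sub_zero, charSum_of_neZero, Finset.mul_sum]
    exact hasSum_sum fun χ _ => twistedProduct_eq_tsum M N χ he

end

section

variable {k : ℕ}

/-! ### Continuation in `w` for large `Re s_j`, `Re z_j` -/

lemma LSeries_eq_tsum_pnat (f : ℕ → ℂ) (w : ℂ) : LSeries f w = ∑' q : ℕ+, f q / (q : ℂ) ^ w := by
  have hterm : ∀ n : ℕ+, f n / (n : ℂ) ^ w = LSeries.term f w n := fun n => by
    rw [LSeries.term_of_ne_zero n.ne_zero]
  simp_rw [hterm]
  refine (PNat.coe_injective.tsum_eq ?_).symm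
  intro n hn
  rw [Function.mem_support] at hn
  have : n ≠ 0 := by rintro rfl; simp at hn
  exact ⟨⟨n, Nat.pos_of_ne_zero this⟩, rfl⟩

/-- The set of `(s, z)` with all real parts at least `σ`. -/
def rightRegion (k : ℕ) (σ : ℝ) : Set (EPoint k) :=
  {e | (∀ j, σ ≤ (e.1 j).re) ∧ ∀ j, σ ≤ (e.2 j).re}

/-- The continuation of `(w - 2) (A - ∏ ζ ζ)` to `Re w > 3/2`. -/
def rightCont (M N : ℕ) (e : EPoint k) (w : ℂ) : ℂ :=
  ∑' x : TPoint k, wt e x * (charCont (tupleNum N x.1) (tupleNum M x.2) w - (w - 2))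

section

variable {M N : ℕ} {e : EPoint k}

lemma summable_coeff_right (he : e ∈ rightRegion k 3) {c : ℝ} (hc : 2 < c) :
    Summable fun y : TPoint k × ℕ+ => ‖wt e y.1 *
      (charSum (tupleNum N y.1.1) (tupleNum M y.1.2) y.2 - if y.2 = 1 then 1 else 0)‖ *
        (y.2 : ℝ) ^ (-c) := by
  have h1 := (summable_absWt (k := k) (σ := 3) (by norm_num))
  have h2 := summable_pnat_rpow (σ := c - 1) (by linarith)
  refine Summable.of_nonneg_of_le (fun y => by positivity) (fun y => ?_)
    (h1.mul_of_nonneg h2 (fun x => (absWt_pos 3 x).le) fun n => by positivity)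
  have hq : (0 : ℝ) < y.2 := by exact_mod_cast y.2.pos
  have h3 : ‖charSum (tupleNum N y.1.1) (tupleNum M y.1.2) y.2 - if y.2 = 1 then 1 else 0‖ ≤ y.2 := by
    split_ifs with h
    · rw [h, PNat.one_coe, charSum_one, sub_self, norm_zero]
      positivity
    · rw [sub_zero]
      exact norm_charSum_le _ _ _
  rw [norm_mul, mul_assoc, show -(c - 1) = 1 + -c by ring, Real.rpow_add hq, Real.rpow_one]
  exact mul_le_mul (norm_wt_le he y.1) (by gcongr) (by positivity) (absWt_pos 3 y.1).le

lemma one_lt_of_mem_rightRegion (he : e ∈ rightRegion k 3) :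
    (∀ j, 1 < (e.1 j).re) ∧ ∀ j, 1 < (e.2 j).re :=
  ⟨fun j => by linarith [he.1 j], fun j => by linarith [he.2 j]⟩

lemma summable_coeffA_right (he : e ∈ rightRegion k 3) {c : ℝ} (hc : 2 < c) :
    Summable fun q : ℕ+ => ‖coeffA M N e q‖ * (q : ℝ) ^ (-c) := by
  have h := summable_coeff_right (M := M) (N := N) he hc
  have h2 := h.prod_symm.prod
  refine Summable.of_nonneg_of_le (fun q => by positivity) (fun q => ?_) h2
  have h3 : Summable _ := h.prod_symm.prod_factor q
  rw [← (coeffA_eq_tsum M N (one_lt_of_mem_rightRegion he) q).tsum_eq]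
  simp only [Prod.swap_prod_mk] at h3 ⊢
  rw [tsum_mul_right]
  gcongr
  refine norm_tsum_le_tsum_norm ?_
  have hq : (q : ℝ) ^ (-c) ≠ 0 := (Real.rpow_pos_of_pos (by exact_mod_cast q.pos) _).ne'
  exact (summable_mul_right_iff hq).1 h3

lemma rightCont_eq (hM : M ≠ 0) (hN : N ≠ 0) (he : e ∈ rightRegion k 3) {w : ℂ} (hw : 2 < w.re) :
    (w - 2) * ∑' q : ℕ+, coeffA M N e q / (q : ℂ) ^ w = rightCont M N e w := by
  have h := summable_coeff_right (M := M) (N := N) he hw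
  set G : TPoint k × ℕ+ → ℂ := fun y => wt e y.1 *
    (charSum (tupleNum N y.1.1) (tupleNum M y.1.2) y.2 - if y.2 = 1 then 1 else 0) /
      (y.2 : ℂ) ^ w with hG
  have hGs : Summable G := by
    refine Summable.of_norm (h.congr fun y => ?_)
    rw [hG]
    simp only [norm_div]
    rw [Complex.norm_natCast_cpow_of_pos y.2.pos, Real.rpow_neg (by positivity), div_eq_mul_inv]
  have h1 : ∑' q : ℕ+, coeffA M N e q / (q : ℂ) ^ w = ∑' q : ℕ+, ∑' x : TPoint k, G (x, q) := by
    refine tsum_congr fun q => ?_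
    rw [← (coeffA_eq_tsum M N (one_lt_of_mem_rightRegion he) q).tsum_eq, ← tsum_div_const]
  rw [h1, hGs.tsum_comm' (fun x => hGs.prod_factor x) (fun q => hGs.prod_symm.prod_factor q),
    ← tsum_mul_left, rightCont]
  refine tsum_congr fun x => ?_
  have hL := LSeriesSummable_charSum (tupleNum N x.1) (tupleNum M x.2) hw
  have hs1 : Summable fun q : ℕ+ => charSum (tupleNum N x.1) (tupleNum M x.2) q / (q : ℂ) ^ w := by
    refine (hL.comp_injective PNat.coe_injective).congr fun q => ?_
    rw [Function.comp_apply, LSeries.term_of_ne_zero q.ne_zero]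
  have hs2 : HasSum (fun q : ℕ+ => (if q = 1 then 1 else 0 : ℂ) / (q : ℂ) ^ w) 1 := by
    convert hasSum_ite_eq (1 : ℕ+) (1 : ℂ) using 2 with q
    split_ifs with hq
    · simp [hq]
    · simp
  have h2 : ∑' q : ℕ+, G (x, q) =
      wt e x * (LSeries (charSum (tupleNum N x.1) (tupleNum M x.2)) w - 1) := by
    rw [LSeries_eq_tsum_pnat, ← hs2.tsum_eq, ← hs1.tsum_sub hs2.summable, ← tsum_mul_left]
    refine tsum_congr fun q => ?_
    simp only [hG]
    ring
  rw [h2, ← charCont_eq (tupleNum_ne_zero hN _) (tupleNum_ne_zero hM _) hw]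
  ring

/-- The constant in the bound for `rightCont`. -/
def rightConst (k M N : ℕ) : ℝ := (charContConst + 1) * (N * M) * ∑' x : TPoint k, absWt 2 x

lemma norm_rightCont_term_le (hM : M ≠ 0) (hN : N ≠ 0) (he : e ∈ rightRegion k 3) {w : ℂ}
    (hw : 3 / 2 ≤ w.re) (x : TPoint k) :
    ‖wt e x * (charCont (tupleNum N x.1) (tupleNum M x.2) w - (w - 2))‖ ≤
      (charContConst + 1) * (N * M) * (2 + ‖w‖) ^ 2 * absWt 2 x := by
  have ha := tupleNum_ne_zero hN x.1
  have hb := tupleNum_ne_zero hM x.2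
  have ha1 : (1 : ℝ) ≤ tupleNum N x.1 := by exact_mod_cast Nat.one_le_iff_ne_zero.2 ha
  have hb1 : (1 : ℝ) ≤ tupleNum M x.2 := by exact_mod_cast Nat.one_le_iff_ne_zero.2 hb
  have h1 := norm_charCont_le ha hb hw
  have h2 : ‖w - 2‖ ≤ (tupleNum N x.1 * tupleNum M x.2) * (2 + ‖w‖) ^ 2 := by
    have h3 : ‖w - 2‖ ≤ 2 + ‖w‖ := (norm_sub_le _ _).trans (by simp [add_comm])
    have h4 : (1 : ℝ) ≤ tupleNum N x.1 * tupleNum M x.2 := one_le_mul_of_one_le_of_one_le ha1 hb1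
    have h5 : 2 + ‖w‖ ≤ (2 + ‖w‖) ^ 2 := by nlinarith [norm_nonneg w]
    nlinarith [sq_nonneg (2 + ‖w‖)]
  have h6 := tupleNum_mul_absWt M N 3 x
  rw [show (3 : ℝ) - 1 = 2 by norm_num] at h6
  calc _ ≤ absWt 3 x * (charContConst * (tupleNum N x.1 * tupleNum M x.2) * (2 + ‖w‖) ^ 2 +
        (tupleNum N x.1 * tupleNum M x.2) * (2 + ‖w‖) ^ 2) := by
        rw [norm_mul]
        exact mul_le_mul (norm_wt_le he x) ((norm_sub_le _ _).trans (add_le_add h1 h2))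
          (norm_nonneg _) (absWt_pos 3 x).le
    _ = (charContConst + 1) * (2 + ‖w‖) ^ 2 *
        (tupleNum N x.1 * tupleNum M x.2 * absWt 3 x) := by ring
    _ = _ := by rw [h6]; ring

lemma norm_rightCont_le (hM : M ≠ 0) (hN : N ≠ 0) (he : e ∈ rightRegion k 3) {w : ℂ}
    (hw : 3 / 2 ≤ w.re) : ‖rightCont M N e w‖ ≤ rightConst k M N * (2 + ‖w‖) ^ 2 := by
  have h := ((summable_absWt (k := k) (σ := 2) (by norm_num)).hasSum.mul_left
    ((charContConst + 1) * (N * M) * (2 + ‖w‖) ^ 2))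
  refine (tsum_of_norm_bounded h (norm_rightCont_term_le hM hN he hw)).trans (le_of_eq ?_)
  rw [rightConst]
  ring

lemma differentiableAt_rightCont (hM : M ≠ 0) (hN : N ≠ 0) (he : e ∈ rightRegion k 3) {w : ℂ}
    (hw : 3 / 2 < w.re) : DifferentiableAt ℂ (rightCont M N e) w := by
  set U : Set ℂ := {v | 3 / 2 < v.re} ∩ ball 0 (‖w‖ + 1)
  have hU : IsOpen U := (isOpen_lt continuous_const Complex.continuous_re).inter isOpen_ball
  have hwU : w ∈ U := ⟨hw, by simp⟩
  have h := (summable_absWt (k := k) (σ := 2) (by norm_num)).mul_left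
    ((charContConst + 1) * (N * M) * (2 + (‖w‖ + 1)) ^ 2)
  refine DifferentiableOn.differentiableAt (s := U) ?_ (hU.mem_nhds hwU)
  refine Complex.differentiableOn_tsum_of_summable_norm h (fun x => ?_) hU fun x v hv => ?_
  · intro v hv
    have hv' : 3 / 2 < v.re := hv.1
    refine (DifferentiableAt.const_mul ((differentiableAt_charCont _ _ (by linarith)).sub
      (by fun_prop)) _).differentiableWithinAt
  · have hv' : (3 : ℝ) / 2 < v.re := hv.1
    have hv2 : ‖v‖ < ‖w‖ + 1 := by simpa using hv.2
    refine (norm_rightCont_term_le hM hN he hv'.le x).trans ?_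
    have := charContConst_nonneg
    have := (absWt_pos 2 x).le
    gcongr

lemma rightCont_two (hM : M ≠ 0) (hN : N ≠ 0) (e : EPoint k) :
    rightCont M N e 2 = bSeries M N e.1 e.2 := by
  have hset : ∀ x : TPoint k, (tupleNum N x.1 = tupleNum M x.2) ↔
      x ∈ {x : TPoint k | N * ∏ j, (x.1 j : ℕ) = M * ∏ j, (x.2 j : ℕ)} := fun x => Iff.rfl
  rw [rightCont, bSeries, ← tsum_mul_left]
  rw [show (∑' x : {x : (Fin k → ℕ+) × (Fin k → ℕ+) // N * ∏ j, (x.1 j : ℕ) = M * ∏ j, (x.2 j : ℕ)},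
      1 / (2 * riemannZeta 2 ^ 2) * ((∏ j, 1 / ((x.1.1 j : ℂ) ^ e.1 j * (x.1.2 j : ℂ) ^ e.2 j)) *
        ∏ p ∈ (M * N * (∏ j, (x.1.1 j : ℕ)) * ∏ j, (x.1.2 j : ℕ)).primeFactors,
          ((1 - 1 / (p : ℂ) ^ 2) ^ 2)⁻¹ * (1 - 1 / (p : ℂ)))) = _ from
    tsum_subtype {x : TPoint k | N * ∏ j, (x.1 j : ℕ) = M * ∏ j, (x.2 j : ℕ)}
      (fun x => 1 / (2 * riemannZeta 2 ^ 2) * (wt e x *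
        ∏ p ∈ (M * N * (∏ j, (x.1 j : ℕ)) * ∏ j, (x.2 j : ℕ)).primeFactors,
          ((1 - 1 / (p : ℂ) ^ 2) ^ 2)⁻¹ * (1 - 1 / (p : ℂ))))]
  refine tsum_congr fun x => ?_
  rw [charCont_two (tupleNum_ne_zero hN _) (tupleNum_ne_zero hM _), sub_self, sub_zero]
  rw [indicator_apply]
  simp only [← hset]
  split_ifs
  · have : tupleNum N x.1 * tupleNum M x.2 = M * N * (∏ j, (x.1 j : ℕ)) * ∏ j, (x.2 j : ℕ) := by
      rw [tupleNum, tupleNum]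
      ring
    rw [this]
    ring
  · rw [mul_zero]

end

end

section

open Polynomial

variable {k : ℕ}

/-! ### Smoothed coefficient sums along the diagonal -/

/-- The coefficient sum of the translated test function, freed of its polar part. -/
def tau (M N : ℕ) (h : ℝ → ℂ) (e : EPoint k) (x : ℝ) : ℂ :=
  coeffSum (coeffA M N e) fun u => diffOp (polarPoly e) h (u + x)

lemma diffOp_comp_add (P : ℂ[X]) (h : ℝ → ℂ) (x : ℝ) :
    diffOp P (fun u => h (u + x)) = fun u => diffOp P h (u + x) := by
  ext u
  rw [diffOp_apply, diffOp_apply]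
  refine Finset.sum_congr rfl fun j _ => ?_
  rw [iteratedDeriv_comp_add_const]

section

variable {M N : ℕ} {h : ℝ → ℂ} {U : ℝ}

lemma tau_eq_zero (hU : ∀ u, U < u → h u = 0) (e : EPoint k) {x : ℝ} (hx : U < x) :
    tau M N h e x = 0 := by
  refine (tsum_congr fun q => ?_).trans tsum_zero
  have : 0 ≤ Real.log q := Real.log_nonneg (by exact_mod_cast q.pos)
  exact mul_eq_zero_of_right _ (diffOp_eq_zero hU (by linarith))

lemma tau_eq_sum (hU : ∀ u, U < u → h u = 0) {x₀ : ℝ} {n : ℕ} (hn : U - x₀ ≤ Real.log n)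
    (e : EPoint k) {x : ℝ} (hx : x₀ ≤ x) :
    tau M N h e x = ∑ q ∈ Finset.Icc (1 : ℕ+) n.toPNat',
      coeffA M N e q * diffOp (polarPoly e) h (Real.log q + x) :=
  coeffSum_eq_sum _ fun u hu => diffOp_eq_zero hU (by linarith)

lemma continuous_tau (hs : ContDiff ℝ ∞ h) (hc : HasCompactSupport h)
    (hU : ∀ u, U < u → h u = 0) (e : EPoint k) : Continuous (tau M N h e) := by
  rw [continuous_iff_continuousAt]
  intro x
  obtain ⟨n, hn⟩ := exists_log_natCast_ge (U - (x - 1))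
  have hD : Continuous (diffOp (polarPoly e) h) :=
    ((Tame.of_hasCompactSupport hs hc 0).diffOp _).continuous
  have hcont : Continuous fun x => ∑ q ∈ Finset.Icc (1 : ℕ+) n.toPNat',
      coeffA M N e q * diffOp (polarPoly e) h (Real.log q + x) := by fun_prop
  refine hcont.continuousAt.congr ?_
  filter_upwards [isOpen_Ioi.mem_nhds (show x - 1 < x by linarith)] with y hy
  exact (tau_eq_sum hU hn e (le_of_lt hy)).symm

lemma differentiable_tau (hU : ∀ u, U < u → h u = 0) (x : ℝ) :
    Differentiable ℂ fun e : EPoint k => tau M N h e x := by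
  have h1 := differentiable_coeffSum_diffOp (k := k) M N (h := fun u => h (u + x)) (U := U - x)
    fun u hu => hU _ (by linarith)
  simpa only [tau, ← diffOp_comp_add] using h1

/-- Polynomial growth on a set. -/
def PolyGrowthOn {E : Type*} [NormedAddCommGroup E] (S : Set E) (f : E → ℂ) : Prop :=
  ∃ (C : ℝ) (n : ℕ), 0 ≤ C ∧ ∀ e ∈ S, ‖f e‖ ≤ C * (1 + ‖e‖) ^ n

namespace PolyGrowthOn

variable {E : Type*} [NormedAddCommGroup E] {S : Set E} {f g : E → ℂ}

lemma const (S : Set E) (c : ℂ) : PolyGrowthOn S fun _ => c :=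
  ⟨‖c‖, 0, norm_nonneg _, fun e _ => by simp⟩

lemma mul (hf : PolyGrowthOn S f) (hg : PolyGrowthOn S g) : PolyGrowthOn S fun e => f e * g e := by
  obtain ⟨C, n, hC, h1⟩ := hf
  obtain ⟨D, m, hD, h2⟩ := hg
  refine ⟨C * D, n + m, by positivity, fun e he => ?_⟩
  rw [norm_mul, pow_add]
  calc ‖f e‖ * ‖g e‖ ≤ (C * (1 + ‖e‖) ^ n) * (D * (1 + ‖e‖) ^ m) := by
        gcongr
        exacts [h1 e he, h2 e he]
    _ = _ := by ring

lemma add (hf : PolyGrowthOn S f) (hg : PolyGrowthOn S g) : PolyGrowthOn S fun e => f e + g e := by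
  obtain ⟨C, n, hC, h1⟩ := hf
  obtain ⟨D, m, hD, h2⟩ := hg
  refine ⟨C + D, n + m, by positivity, fun e he => ?_⟩
  have h0 : 1 ≤ 1 + ‖e‖ := by linarith [norm_nonneg e]
  calc ‖f e + g e‖ ≤ C * (1 + ‖e‖) ^ n + D * (1 + ‖e‖) ^ m :=
        (norm_add_le _ _).trans (add_le_add (h1 e he) (h2 e he))
    _ ≤ C * (1 + ‖e‖) ^ (n + m) + D * (1 + ‖e‖) ^ (n + m) := by
        gcongr <;> first | exact h0 | omega
    _ = _ := by ring

lemma sum {ι : Type*} (t : Finset ι) {f : ι → E → ℂ} (hf : ∀ i ∈ t, PolyGrowthOn S (f i)) :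
    PolyGrowthOn S fun e => ∑ i ∈ t, f i e := by
  classical
  induction t using Finset.induction_on with
  | empty => simpa using const S 0
  | insert a t ha ih =>
    simp only [Finset.sum_insert ha]
    exact (hf a (Finset.mem_insert_self a t)).add
      (ih fun i hi => hf i (Finset.mem_insert_of_mem hi))

lemma prod {ι : Type*} (t : Finset ι) {f : ι → E → ℂ} (hf : ∀ i ∈ t, PolyGrowthOn S (f i)) :
    PolyGrowthOn S fun e => ∏ i ∈ t, f i e := by
  classical
  induction t using Finset.induction_on with
  | empty => simpa using const S 1
  | insert a t ha ih =>
    simp only [Finset.prod_insert ha]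
    exact (hf a (Finset.mem_insert_self a t)).mul
      (ih fun i hi => hf i (Finset.mem_insert_of_mem hi))

end PolyGrowthOn

lemma norm_polePt_le (p : EqPair k) (e : EPoint k) :
    ‖polePt p e.1 e.2‖ ≤ (2 + 2 * k) * (1 + ‖e‖) := by
  have hc : ∀ s : Finset (Fin k), (s.card : ℝ) ≤ k := fun s => by
    simpa using Finset.card_le_univ s
  have hb : ∀ (s : Finset (Fin k)) (f : Fin k → ℂ), ‖f‖ ≤ ‖e‖ → ‖∑ j ∈ s, f j‖ ≤ k * ‖e‖ := by
    intro s f hf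
    calc ‖∑ j ∈ s, f j‖ ≤ ∑ j ∈ s, ‖e‖ :=
          norm_sum_le_of_le _ fun j _ => (norm_le_pi_norm f j).trans hf
      _ = s.card * ‖e‖ := by simp
      _ ≤ k * ‖e‖ := mul_le_mul_of_nonneg_right (hc s) (norm_nonneg e)
  have h1 := hb p.1.1 e.1 (norm_fst_le e)
  have h2 := hb p.1.2 e.2 (norm_snd_le e)
  have h3 := hc p.1.1
  have h4 : ‖polePt p e.1 e.2‖ ≤ 2 + p.1.1.card + k * ‖e‖ + k * ‖e‖ := by
    refine (norm_sub_le _ _).trans (add_le_add ((norm_sub_le _ _).trans (add_le_add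
      ((norm_add_le _ _).trans (by simp)) h1)) h2)
  have : (0 : ℝ) ≤ k := Nat.cast_nonneg k
  nlinarith [norm_nonneg e]

lemma polyGrowthOn_coeff_prod {ι : Type*} (S : Set (EPoint k)) (s : Finset ι)
    {r : ι → EPoint k → ℂ} (hr : ∀ i, PolyGrowthOn S (r i)) (j : ℕ) :
    PolyGrowthOn S fun e => (∏ i ∈ s, (X - C (r i e)) : ℂ[X]).coeff j := by
  classical
  induction s using Finset.induction_on generalizing j with
  | empty => simp only [Finset.prod_empty]; exact .const _ _
  | insert i s hi ih =>
    simp only [Finset.prod_insert hi, sub_mul, coeff_sub, coeff_C_mul]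
    have h1 : PolyGrowthOn S fun e => (X * ∏ i ∈ s, (X - C (r i e)) : ℂ[X]).coeff j := by
      cases j with
      | zero => simpa using PolyGrowthOn.const S 0
      | succ j => simpa [coeff_X_mul] using ih j
    have h2 := (PolyGrowthOn.const S (-1)).mul ((hr i).mul (ih j))
    simpa [sub_eq_add_neg] using h1.add h2

lemma polyGrowthOn_tau (hU : ∀ u, U < u → h u = 0) (x : ℝ) :
    PolyGrowthOn (rightRegion k (1 / 4)) fun e : EPoint k => tau M N h e x := by
  obtain ⟨n, hn⟩ := exists_log_natCast_ge (U - x)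
  simp_rw [fun e : EPoint k => tau_eq_sum (M := M) (N := N) hU hn e le_rfl]
  refine .sum _ fun q _ => .mul ?_ ?_
  · unfold coeffA
    split_ifs with hq
    · exact .const _ _
    · refine .sum _ fun χ hχ => ?_
      have hp := (mem_evenPrimitive.1 hχ).1
      have h1 : χ ≠ 1 := ne_one_of_isPrimitive (fun h => hq (PNat.coe_eq_one_iff.1 h)) hp q.ne_zero
      have h2 : χ⁻¹ ≠ 1 := fun h => h1 (inv_eq_one.1 h)
      refine (PolyGrowthOn.const _ _).mul (.mul (.prod _ fun j _ => ?_) (.prod _ fun j _ => ?_))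
      · refine ⟨4 * q, 1, by positivity, fun e he => (norm_LFunction_le h1 (he.1 j)).trans ?_⟩
        have : ‖e.1 j‖ ≤ ‖e‖ := (norm_le_pi_norm e.1 j).trans (norm_fst_le e)
        rw [pow_one]
        gcongr
        linarith
      · refine ⟨4 * q, 1, by positivity, fun e he => (norm_LFunction_le h2 (he.2 j)).trans ?_⟩
        have : ‖e.2 j‖ ≤ ‖e‖ := (norm_le_pi_norm e.2 j).trans (norm_snd_le e)
        rw [pow_one]
        gcongr
        linarith
  · simp_rw [diffOp_polarPoly_apply]
    refine .sum _ fun j _ => .mul (.mul ?_ (.const _ _)) (.const _ _)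
    exact polyGrowthOn_coeff_prod _ _ (fun p : EqPair k =>
      ⟨2 + 2 * k, 1, by positivity, fun e _ => by simpa using norm_polePt_le p e⟩) j

end

/-! ### Line integral models -/

lemma vmass_le {f : ℂ → ℂ} {c K : ℝ} (hf : ∀ t : ℝ, ‖f (c + t * Complex.I)‖ ≤ K * (1 + t ^ 2)⁻¹) :
    vmass c f ≤ K := by
  have h0 : 0 ≤ K := by
    have := (norm_nonneg _).trans (hf 0)
    simpa using this
  have h1 : ∫ t : ℝ, ‖f (c + t * Complex.I)‖ ≤ ∫ t : ℝ, K * (1 + t ^ 2)⁻¹ :=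
    integral_mono_of_nonneg (ae_of_all _ fun _ => norm_nonneg _)
      (integrable_inv_one_add_sq.const_mul K) (ae_of_all _ hf)
  rw [integral_const_mul, integral_univ_inv_one_add_sq] at h1
  rw [vmass]
  have hpi := Real.pi_pos
  calc _ ≤ 1 / (2 * Real.pi) * (K * Real.pi) := by gcongr
    _ = K / 2 := by field_simp
    _ ≤ K := by linarith

/-- If `T e` is the line integral of `f e · ĥ` with `f` of polynomial growth, then `T e x` is
`O(e^(-c₁ x))`, and its Laplace transform is `f e · ĥ`. -/
lemma exists_bound_of_model {S : Set (EPoint k)} {f : EPoint k → ℂ → ℂ} {c₁ c₂ : ℝ} {C : ℝ} {n : ℕ}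
    (hC : 0 ≤ C) (hf : ∀ e ∈ S, ∀ w : ℂ, c₁ ≤ w.re → w.re ≤ c₂ →
      DifferentiableAt ℂ (f e) w ∧ ‖f e w‖ ≤ C * (1 + ‖e‖) ^ n * (1 + |w.im|) ^ n)
    {b : ℝ} {h : ℝ → ℂ} (hh : Tame b h) (hb : b < c₁) (h₁ : c₁ < 2) (h₂ : 2 < c₂)
    {T : EPoint k → ℝ → ℂ} (hT : ∀ e ∈ S, ∀ x : ℝ,
      T e x = vline c₂ fun w => f e w * laplace h w * Complex.exp (-(w * x))) :
    (∃ K, 0 ≤ K ∧ ∀ e ∈ S, ∀ x, ‖T e x‖ ≤ K * (1 + ‖e‖) ^ n * Real.exp (-(c₁ * x))) ∧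
      ∀ e ∈ S, laplace (T e) 2 = f e 2 * laplace h 2 := by
  obtain ⟨D, hD0, hD⟩ := hh.laplace_decay hb c₂ (n + 2)
  have hle : ∀ e ∈ S, ∀ w : ℂ, c₁ ≤ w.re → w.re ≤ c₂ →
      ‖f e w * laplace h w‖ ≤ C * (1 + ‖e‖) ^ n * D * (1 + w.im ^ 2)⁻¹ := fun e he w hw hw' =>
    mul_laplace_le (by positivity) (hf e he w hw hw').2 (hD w hw hw')
  have hdec : ∀ e ∈ S, StripDecay c₁ c₂ fun w => f e w * laplace h w := fun e he =>
    ⟨_, hle e he⟩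
  have hholo : ∀ e ∈ S, StripHolo c₁ c₂ fun w => f e w * laplace h w := fun e he w hw hw' =>
    (hf e he w hw hw').1.mul (hh.differentiableAt_laplace (hb.trans_le hw))
  have hT' : ∀ e ∈ S, ∀ x : ℝ,
      T e x = vline c₁ fun w => f e w * laplace h w * Complex.exp (-(w * x)) := fun e he x =>
    (hT e he x).trans (vline_exp_eq (hholo e he) (hdec e he) (h₁.le.trans h₂.le) le_rfl x).symm
  refine ⟨⟨C * D, by positivity, fun e he x => ?_⟩, fun e he => ?_⟩
  · rw [hT' e he x]
    refine (norm_vline_exp_le c₁ x _).trans ?_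
    have : vmass c₁ (fun w => f e w * laplace h w) ≤ C * (1 + ‖e‖) ^ n * D :=
      vmass_le fun t => by
        have := hle e he (c₁ + t * Complex.I) (by simp) (by simp; linarith)
        simpa using this
    calc _ ≤ Real.exp (-(c₁ * x)) * (C * (1 + ‖e‖) ^ n * D) := by gcongr
      _ = _ := by ring
  · rw [funext (hT' e he)]
    exact (laplace_vline_of_strip (hholo e he) (hdec e he) (by simpa using h₁)
      (by simpa using h₂)).2

section Models

variable {M N : ℕ} {V : Set (RPoint k)} {F : CPoint k → ℂ} {r : ℝ} {h : ℝ → ℂ}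

lemma tau_central (hF : IsMDSContinuation k M N V F) (hr : CentralBox V r) (hs : ContDiff ℝ ∞ h)
    (hc : HasCompactSupport h) :
    (∃ (K : ℝ) (n : ℕ), 0 ≤ K ∧ ∀ e ∈ centralTube k (etaOf k r), ∀ x,
      ‖tau M N h e x‖ ≤ K * (1 + ‖e‖) ^ n * Real.exp (-((2 - r) * x))) ∧
    ∀ e ∈ centralTube k (etaOf k r),
      laplace (tau M N h e) 2 = F (e.1, e.2, 2) * laplace h 2 := by
  have hr0 := hr.pos
  obtain ⟨C, n, hC0, hC⟩ := hF.polyBounded.exists_bound hr.subset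
  have := exists_bound_of_model (S := centralTube k (etaOf k r)) (f := fun e w => F (e.1, e.2, w))
    (c₁ := 2 - r) (c₂ := 2 + r) hC0 (fun e he w hw hw' => ⟨differentiableAt_snd hF.isOpen
      hF.holomorphic (hr.subset (hr.rePt_mem he hw hw')), hC e w (hr.rePt_mem he hw hw')⟩)
    (Tame.of_hasCompactSupport hs hc 0) (by linarith [hr.le]) (by linarith) (by linarith)
    (T := tau M N h) fun e he x => ?_
  · obtain ⟨⟨K, hK, h1⟩, h2⟩ := this
    exact ⟨⟨K, n, hK, h1⟩, h2⟩
  · have h1 := hF.represents (hr.subset (hr.rePt_mem he (w := ((2 + r : ℝ) : ℂ)) (by simp; linarith)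
      (by simp))) e (2 + r) rfl (fun u => h (u + x)) (hs.comp (contDiff_id.add contDiff_const))
      (hc.comp_homeomorph (Homeomorph.addRight x))
    rw [diffOp_comp_add] at h1
    simp_rw [laplace_comp_add, ← mul_assoc] at h1
    exact h1

/-- `∏_{p ≠ ∅} (w - w_p)`. -/
def reducedPolar (e : EPoint k) (w : ℂ) : ℂ :=
  ∏ p ∈ Finset.univ.erase (emptyPair k), (w - polePt p e.1 e.2)

lemma polarFactor_eq_mul_reducedPolar (e : EPoint k) (w : ℂ) :
    polarFactor e.1 e.2 w = (w - 2) * reducedPolar e w := by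
  rw [polarFactor_eq, reducedPolar, ← Finset.mul_prod_erase _ _ (Finset.mem_univ (emptyPair k)),
    polePt_empty]

lemma tau_right (hM : M ≠ 0) (hN : N ≠ 0) (hs : ContDiff ℝ ∞ h) (hc : HasCompactSupport h) :
    (∃ (K : ℝ) (n : ℕ), 0 ≤ K ∧ ∀ e ∈ rightRegion k 3, ∀ x,
      ‖tau M N h e x‖ ≤ K * (1 + ‖e‖) ^ n * Real.exp (-((7 / 4) * x))) ∧
    ∀ e ∈ rightRegion k 3,
      laplace (tau M N h e) 2 = reducedPolar e 2 * bSeries M N e.1 e.2 * laplace h 2 := by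
  set m := (Finset.univ.erase (emptyPair k)).card
  have hR0 : 0 ≤ rightConst k M N := by
    have := charContConst_nonneg
    exact mul_nonneg (by positivity) (tsum_nonneg fun x => (absWt_pos 2 x).le)
  have hC0 : 0 ≤ rightConst k M N * 25 * (5 + 2 * k) ^ m := by positivity
  have := exists_bound_of_model (S := rightRegion k 3)
    (f := fun e w => reducedPolar e w * rightCont M N e w) (c₁ := 7 / 4) (c₂ := 3) (n := m + 2)
    hC0 (fun e he w hw hw' => ⟨?_, ?_⟩)
    (Tame.of_hasCompactSupport hs hc 0) (by norm_num) (by norm_num) (by norm_num)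
    (T := tau M N h) fun e he x => ?_
  · obtain ⟨⟨K, hK, h1⟩, h2⟩ := this
    refine ⟨⟨K, m + 2, hK, h1⟩, fun e he => ?_⟩
    rw [h2 e he, rightCont_two hM hN]
  · refine DifferentiableAt.mul (differentiableAt_prod _ fun p _ => by fun_prop)
      (differentiableAt_rightCont hM hN he (by linarith))
  · have hw3 : ‖w‖ ≤ 3 * (1 + |w.im|) := by
      refine (Complex.norm_le_abs_re_add_abs_im w).trans ?_
      rw [abs_of_nonneg (by linarith : (0 : ℝ) ≤ w.re)]
      linarith [abs_nonneg w.im]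
    have h1 : ‖reducedPolar e w‖ ≤ ((5 + 2 * k) * (1 + ‖e‖) * (1 + |w.im|)) ^ m := by
      rw [reducedPolar, norm_prod]
      refine (Finset.prod_le_prod (fun _ _ => norm_nonneg _) fun p _ => ?_).trans_eq
        (Finset.prod_const _)
      refine (norm_sub_le _ _).trans ?_
      have h2 := norm_polePt_le p e
      have h3 : 0 ≤ ‖e‖ := norm_nonneg e
      have h4 := abs_nonneg w.im
      have h5 : (0 : ℝ) ≤ k := Nat.cast_nonneg k
      have h6 : 0 ≤ ‖e‖ * |w.im| := by positivity
      have h7 : 0 ≤ (k : ℝ) * (1 + ‖e‖) * |w.im| := by positivity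
      nlinarith
    have h2 : ‖rightCont M N e w‖ ≤ rightConst k M N * 25 * (1 + |w.im|) ^ 2 := by
      refine (norm_rightCont_le hM hN he (by linarith)).trans ?_
      rw [mul_assoc]
      gcongr
      nlinarith [abs_nonneg w.im, norm_nonneg w]
    rw [norm_mul]
    have h3 : 1 ≤ 1 + ‖e‖ := by linarith [norm_nonneg e]
    calc _ ≤ ((5 + 2 * k) * (1 + ‖e‖) * (1 + |w.im|)) ^ m *
          (rightConst k M N * 25 * (1 + |w.im|) ^ 2) := by gcongr
      _ = rightConst k M N * 25 * (5 + 2 * k) ^ m * (1 + ‖e‖) ^ m * (1 + |w.im|) ^ (m + 2) := by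
        rw [mul_pow, mul_pow, pow_add]
        ring
      _ ≤ _ := by
        gcongr
        omega
  · have hT := Tame.of_hasCompactSupport (hs.comp (contDiff_id.add (contDiff_const (c := x))))
      (hc.comp_homeomorph (Homeomorph.addRight x)) 0
    have h1 := coeffSum_diffOp_eq_vline hT (by norm_num : (0 : ℝ) < 3) (polarPoly e)
      (summable_coeffA_right (M := M) (N := N) he (c := 3) (by norm_num))
    have h3 : tau M N h e x = coeffSum (coeffA M N e) (diffOp (polarPoly e) fun u => h (u + x)) := by
      rw [diffOp_comp_add, tau]
    rw [h3]
    refine h1.trans ?_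
    unfold vline
    congr 1
    refine integral_congr_ae (ae_of_all _ fun t => ?_)
    simp only []
    have hre : 2 < (((3 : ℝ) : ℂ) + t * Complex.I).re := by simp; norm_num
    rw [eval_polarPoly, polarFactor_eq_mul_reducedPolar, ← rightCont_eq hM hN he hre]
    have h4 := laplace_comp_add h x (((3 : ℝ) : ℂ) + t * Complex.I)
    rw [show laplace (h ∘ fun u => id u + x) = laplace fun u => h (u + x) from rfl]
    rw [h4]
    ring

end Models

end

section

open Polynomial

variable {k : ℕ}

/-! ### The residue at `w = 2` -/

/-- The point `(s_j + l, z_j + l)`. -/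
def shift (e : EPoint k) (l : ℂ) : EPoint k := (fun j => e.1 j + l, fun j => e.2 j + l)

lemma shift_zero (e : EPoint k) : shift e 0 = e := by simp [shift]

lemma differentiable_shift (e : EPoint k) : Differentiable ℂ (shift e) := by
  unfold shift
  fun_prop

lemma norm_shift_le (e : EPoint k) (l : ℂ) : ‖shift e l‖ ≤ ‖e‖ + ‖l‖ := by
  refine max_le ?_ ?_
  · refine (pi_norm_le_iff_of_nonneg (by positivity)).2 fun j => (norm_add_le _ _).trans ?_
    gcongr
    exact (norm_le_pi_norm e.1 j).trans (norm_fst_le e)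
  · refine (pi_norm_le_iff_of_nonneg (by positivity)).2 fun j => (norm_add_le _ _).trans ?_
    gcongr
    exact (norm_le_pi_norm e.2 j).trans (norm_snd_le e)

lemma isOpen_centralTube (k : ℕ) (η : ℝ) : IsOpen (centralTube k η) := by
  unfold centralTube
  simp only [ofPred_and, ofPred_forall]
  refine IsOpen.inter (isOpen_iInter_of_finite fun j => ?_) (isOpen_iInter_of_finite fun j => ?_)
  · exact isOpen_lt (by fun_prop) continuous_const
  · exact isOpen_lt (by fun_prop) continuous_const

lemma exists_shift_mem_centralTube {η : ℝ} {e : EPoint k} (he : e ∈ centralTube k η) :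
    ∃ l : ℝ, 0 < l ∧ l ≤ 1 ∧ ∀ μ : ℂ, μ.re = -l → shift e μ ∈ centralTube k η := by
  have hcont : ContinuousAt (fun l : ℝ => shift e ((-l : ℝ) : ℂ)) 0 :=
    ((differentiable_shift e).continuous.comp
      (Complex.continuous_ofReal.comp continuous_neg)).continuousAt
  have h0 : centralTube k η ∈ 𝓝 (shift e ((-(0 : ℝ) : ℝ) : ℂ)) := by
    simpa [shift_zero] using (isOpen_centralTube k η).mem_nhds he
  obtain ⟨ε, hε, hb⟩ := Metric.eventually_nhds_iff.1 (hcont.eventually h0)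
  refine ⟨min (ε / 2) 1, by positivity, min_le_right _ _, fun μ hμ => ?_⟩
  have h1 := hb (y := min (ε / 2) 1) (by
    rw [Real.dist_eq, sub_zero, abs_of_pos (by positivity)]
    exact (min_le_left _ _).trans_lt (by linarith))
  have h2 : ∀ a : ℂ, (a + μ).re = (a + ((-(min (ε / 2) 1) : ℝ) : ℂ)).re := fun a => by
    rw [Complex.add_re, Complex.add_re, hμ, Complex.ofReal_re]
  refine ⟨fun j => ?_, fun j => ?_⟩
  · have := h1.1 j
    simp only [shift] at this ⊢
    rwa [h2]
  · have := h1.2 j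
    simp only [shift] at this ⊢
    rwa [h2]

lemma one_le_norm_add_seven {μ : ℂ} (hμ : -1 ≤ μ.re) : 6 ≤ ‖μ + 7‖ := by
  refine le_trans ?_ (Complex.abs_re_le_norm _)
  rw [Complex.add_re]
  refine le_trans ?_ (le_abs_self _)
  simp
  linarith

lemma one_add_norm_shift_le (e : EPoint k) {μ : ℂ} (hμ : -1 ≤ μ.re) :
    1 + ‖shift e μ‖ ≤ (4 + ‖e‖) * ‖μ + 7‖ := by
  have h1 := one_le_norm_add_seven hμ
  have h2 : ‖μ‖ ≤ ‖μ + 7‖ + 7 := by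
    have := norm_sub_le (μ + 7) 7
    rw [add_sub_cancel_right] at this
    simpa using this
  nlinarith [norm_shift_le e μ, norm_nonneg e, mul_nonneg (norm_nonneg e) (by linarith : 0 ≤ ‖μ + 7‖ - 1)]

section

variable {M N : ℕ} {V : Set (RPoint k)} {F : CPoint k → ℂ} {r : ℝ}

/-- A Phragmén–Lindelöf bound for the smoothed sums between the central tube and the domain of
absolute convergence. -/
lemma norm_tau_shift_le (hF : IsMDSContinuation k M N V F) (hr : CentralBox V r) (hM : M ≠ 0)
    (hN : N ≠ 0) {h : ℝ → ℂ} (hs : ContDiff ℝ ∞ h) (hc : HasCompactSupport h) {U : ℝ}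
    (hU : ∀ u, U < u → h u = 0) {e : EPoint k} {l : ℝ} (hl0 : 0 < l) (hl1 : l ≤ 1)
    (hl : ∀ μ : ℂ, μ.re = -l → shift e μ ∈ centralTube k (etaOf k r)) :
    ∃ (K : ℝ) (n : ℕ), 0 ≤ K ∧ ∀ μ : ℂ, -l ≤ μ.re → μ.re ≤ 5 → ∀ x,
      ‖tau M N h (shift e μ) x‖ ≤ K * ‖μ + 7‖ ^ n * Real.exp (-((2 - r) * x)) := by
  obtain ⟨⟨K₁, n₁, hK₁, b₁⟩, -⟩ := tau_central hF hr hs hc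
  obtain ⟨⟨K₂, n₂, hK₂, b₂⟩, -⟩ := tau_right (k := k) hM hN hs hc
  set B := 4 + ‖e‖
  have hB1 : 1 ≤ B := by have := norm_nonneg e; simp only [B]; linarith
  set n := n₁ + n₂
  have hη : etaOf k r ≤ 1 / 4 := by linarith [hr.etaOf_le, hr.le, hr.pos]
  have hre : ∀ μ : ℂ, -l ≤ μ.re → ∀ j, 1 / 4 ≤ (e.1 j + μ).re ∧ 1 / 4 ≤ (e.2 j + μ).re := by
    intro μ hμ j
    have h1 := hl ((-l : ℝ) : ℂ) (Complex.ofReal_re _)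
    have h2 := (abs_lt.1 (h1.1 j)).1
    have h3 := (abs_lt.1 (h1.2 j)).1
    simp only [shift, Complex.add_re, Complex.ofReal_re] at h2 h3 ⊢
    constructor <;> linarith
  have hpow : ∀ μ : ℂ, -l ≤ μ.re → ∀ m ≤ n, (1 + ‖shift e μ‖) ^ m ≤ B ^ n * ‖μ + 7‖ ^ n := by
    intro μ hμ m hm
    have h6 := one_le_norm_add_seven (μ := μ) (by linarith)
    rw [← mul_pow]
    refine (pow_le_pow_left₀ (by positivity) (one_add_norm_shift_le e (by linarith)) m).trans ?_
    exact pow_le_pow_right₀ (by nlinarith) hm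
  refine ⟨(K₁ + K₂ * Real.exp ((1 / 4 - r) * U)) * B ^ n, n, by positivity, fun μ hμ hμ' x => ?_⟩
  rcases lt_or_ge U x with hx | hx
  · rw [tau_eq_zero hU _ hx, norm_zero]
    positivity
  have hne : ∀ μ : ℂ, -l ≤ μ.re → μ + 7 ≠ 0 := fun μ hμ h0 => by
    have := one_le_norm_add_seven (μ := μ) (by linarith)
    rw [h0, norm_zero] at this
    linarith
  have hd : ∀ μ : ℂ, -l ≤ μ.re →
      DifferentiableAt ℂ (fun μ => tau M N h (shift e μ) x / (μ + 7) ^ n) μ := fun μ hμ =>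
    ((differentiable_tau hU x _).comp μ (differentiable_shift e μ)).div (by fun_prop)
      (pow_ne_zero _ (hne μ hμ))
  obtain ⟨K₃, m, hK₃, b₃⟩ := polyGrowthOn_tau (k := k) (M := M) (N := N) hU x
  have key := PhragmenLindelof.vertical_strip
    (f := fun μ => tau M N h (shift e μ) x / (μ + 7) ^ n) (a := -l) (b := 5) (z := μ)
    (C := (K₁ + K₂ * Real.exp ((1 / 4 - r) * U)) * B ^ n * Real.exp (-((2 - r) * x))) ?_ ?_ ?_ ?_ hμ hμ'
  · rw [norm_div, norm_pow, div_le_iff₀ (pow_pos (norm_pos_iff.2 (hne μ hμ)) _)] at key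
    linarith
  · refine DifferentiableOn.diffContOnCl fun μ hμ => (hd μ ?_).differentiableWithinAt
    exact closure_minimal (fun ν hν => le_of_lt hν.1)
      (isClosed_le continuous_const Complex.continuous_re) hμ
  · refine ⟨1 / 2, ?_, 2, ?_⟩
    · rw [lt_div_iff₀ (by linarith)]
      linarith [Real.pi_gt_three]
    · refine Asymptotics.IsBigO.of_bound (K₃ * (m.factorial * Real.exp (6 + ‖e‖))) ?_
      rw [eventually_inf_principal]
      refine Eventually.of_forall fun ν hν => ?_
      have hν1 : -l < ν.re := hν.1
      have hν2 : ν.re < 5 := hν.2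
      have h6 := one_le_norm_add_seven (μ := ν) (by linarith)
      have h7 : ‖ν‖ ≤ 5 + |ν.im| := by
        refine (Complex.norm_le_abs_re_add_abs_im ν).trans ?_
        gcongr
        rw [abs_le]
        constructor <;> linarith
      have h8 : 1 + ‖shift e ν‖ ≤ 6 + ‖e‖ + |ν.im| := by linarith [norm_shift_le e ν]
      have h9 : (6 + ‖e‖ + |ν.im|) ^ m ≤ m.factorial * Real.exp (6 + ‖e‖ + |ν.im|) := by
        have := Real.pow_div_factorial_le_exp (6 + ‖e‖ + |ν.im|) (by positivity) m
        rwa [div_le_iff₀ (by positivity), mul_comm] at this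
      have h10 : |ν.im| ≤ 2 * Real.exp (1 / 2 * |ν.im|) := by
        linarith [Real.add_one_le_exp (1 / 2 * |ν.im|)]
      rw [norm_div, norm_pow, Real.norm_of_nonneg (Real.exp_pos _).le]
      calc _ ≤ ‖tau M N h (shift e ν) x‖ :=
            div_le_self (norm_nonneg _) (one_le_pow₀ (by linarith))
        _ ≤ K₃ * (1 + ‖shift e ν‖) ^ m := b₃ _ ⟨fun j => (hre ν hν1.le j).1, fun j => (hre ν hν1.le j).2⟩
        _ ≤ K₃ * (6 + ‖e‖ + |ν.im|) ^ m := by gcongr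
        _ ≤ K₃ * (m.factorial * Real.exp (6 + ‖e‖ + |ν.im|)) := by gcongr
        _ = K₃ * (m.factorial * Real.exp (6 + ‖e‖)) * Real.exp |ν.im| := by
          rw [Real.exp_add]
          ring
        _ ≤ _ := by gcongr
  · intro ν hν
    have h6 := one_le_norm_add_seven (μ := ν) (by linarith)
    rw [norm_div, norm_pow, div_le_iff₀ (by positivity)]
    calc _ ≤ K₁ * (1 + ‖shift e ν‖) ^ n₁ * Real.exp (-((2 - r) * x)) := b₁ _ (hl ν hν) x
      _ ≤ (K₁ + K₂ * Real.exp ((1 / 4 - r) * U)) * (B ^ n * ‖ν + 7‖ ^ n) *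
          Real.exp (-((2 - r) * x)) := by
        gcongr
        · exact le_add_of_nonneg_right (by positivity)
        · exact hpow ν hν.ge n₁ (by omega)
      _ = _ := by ring
  · intro ν hν
    have h6 := one_le_norm_add_seven (μ := ν) (by linarith)
    have hmem : shift e ν ∈ rightRegion k 3 := by
      have h1 := hl ((-l : ℝ) : ℂ) (Complex.ofReal_re _)
      refine ⟨fun j => ?_, fun j => ?_⟩
      · have h2 := (abs_lt.1 (h1.1 j)).1
        simp only [shift, Complex.add_re, Complex.ofReal_re] at h2 ⊢
        linarith
      · have h2 := (abs_lt.1 (h1.2 j)).1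
        simp only [shift, Complex.add_re, Complex.ofReal_re] at h2 ⊢
        linarith
    have hexp : Real.exp (-(7 / 4 * x)) ≤ Real.exp ((1 / 4 - r) * U) * Real.exp (-((2 - r) * x)) := by
      rw [← Real.exp_add]
      gcongr
      nlinarith [hr.le]
    rw [norm_div, norm_pow, div_le_iff₀ (by positivity)]
    calc _ ≤ K₂ * (1 + ‖shift e ν‖) ^ n₂ * Real.exp (-(7 / 4 * x)) := b₂ _ hmem x
      _ ≤ K₂ * (B ^ n * ‖ν + 7‖ ^ n) *
          (Real.exp ((1 / 4 - r) * U) * Real.exp (-((2 - r) * x))) := by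
        gcongr
        exact hpow ν (by linarith) n₂ (by omega)
      _ ≤ _ := by
        have : 0 ≤ K₁ * (B ^ n * ‖ν + 7‖ ^ n) * Real.exp (-((2 - r) * x)) := by positivity
        nlinarith

/-- The Laplace transform of the smoothed sums at `2` is holomorphic along the diagonal. -/
lemma differentiableAt_laplace_tau (hr : CentralBox V r) {h : ℝ → ℂ}
    (hs : ContDiff ℝ ∞ h) (hc : HasCompactSupport h) {U : ℝ} (hU : ∀ u, U < u → h u = 0)
    {e : EPoint k} {l : ℝ} {K : ℝ} {n : ℕ} (hK : 0 ≤ K)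
    (hb : ∀ μ : ℂ, -l ≤ μ.re → μ.re ≤ 5 → ∀ x,
      ‖tau M N h (shift e μ) x‖ ≤ K * ‖μ + 7‖ ^ n * Real.exp (-((2 - r) * x)))
    {μ : ℂ} (h₁ : -l < μ.re) (h₂ : μ.re < 5) :
    DifferentiableAt ℂ (fun μ => laplace (tau M N h (shift e μ)) 2) μ := by
  have hopen : IsOpen (Complex.re ⁻¹' Ioo (-l) 5) := isOpen_Ioo.preimage Complex.continuous_re
  obtain ⟨ρ, hρ, hsub⟩ := Metric.isOpen_iff.1 hopen μ ⟨h₁, h₂⟩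
  refine differentiableAt_integral_of_dominated (E := ℂ)
    (bound := (Iic U).indicator fun x => K * (‖μ‖ + ρ + 7) ^ n * Real.exp (r * x)) hρ ?_ ?_ ?_ ?_
  · intro ν _
    exact ((continuous_tau hs hc hU _).mul (by fun_prop)).aestronglyMeasurable
  · intro x ν _
    exact (((differentiable_tau hU x _).comp ν (differentiable_shift e ν)).mul_const
      _).differentiableWithinAt
  · intro ν hν x
    obtain ⟨g1, g2⟩ := hsub hν
    rcases lt_or_ge U x with hx | hx
    · rw [tau_eq_zero hU _ hx, zero_mul, norm_zero, indicator_of_notMem (by simpa using hx)]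
    · rw [indicator_of_mem (show x ∈ Iic U from hx), norm_mul, Complex.norm_exp]
      have h3 : ‖ν + 7‖ ≤ ‖μ‖ + ρ + 7 := by
        have h4 := norm_add_le ν 7
        have h5 : ‖ν‖ ≤ ‖μ‖ + ρ := by
          have := norm_add_le (ν - μ) μ
          rw [sub_add_cancel] at this
          linarith [mem_ball_iff_norm.1 hν]
        have h6 : ‖(7 : ℂ)‖ = 7 := by simp
        linarith
      calc _ ≤ K * ‖ν + 7‖ ^ n * Real.exp (-((2 - r) * x)) * Real.exp (2 * x) := by
            gcongr
            · exact hb ν g1.le g2.le x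
            · simp
        _ = K * ‖ν + 7‖ ^ n * Real.exp (r * x) := by
            rw [mul_assoc, ← Real.exp_add]
            ring_nf
        _ ≤ _ := by gcongr
  · rw [integrable_indicator_iff measurableSet_Iic]
    exact (integrableOn_exp_mul_Iic hr.pos U).const_mul _

/-- The product of all `s_i + z_j - 1`. -/
def crossProd (e : EPoint k) : ℂ := ∏ i, ∏ j, (e.1 i + e.2 j - 1)

lemma differentiable_crossProd : Differentiable ℂ (crossProd : EPoint k → ℂ) := fun e =>
  differentiableAt_prod _ fun i _ => differentiableAt_prod _ fun j _ => by fun_prop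

lemma differentiable_reducedPolar (w : ℂ) : Differentiable ℂ fun e : EPoint k => reducedPolar e w :=
  fun e => differentiableAt_prod _ fun p _ => (differentiable_const _ _).sub (differentiable_polePt p e)

/-- The value of `F` at `w = 2` in terms of the continuation of `B`. -/
theorem apply_two_mul_crossProd (hF : IsMDSContinuation k M N V F) (hr : CentralBox V r)
    (hM : M ≠ 0) (hN : N ≠ 0) {G : EPoint k → ℂ}
    (hG : DifferentiableOn ℂ G {x | (∀ i, 1 / 4 < (x.1 i).re) ∧ ∀ j, 1 / 4 < (x.2 j).re})
    (hGB : ∀ e : EPoint k, (∀ i, 1 < (e.1 i).re) → (∀ j, 1 < (e.2 j).re) →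
      G e = bSeries M N e.1 e.2 * crossProd e)
    {e : EPoint k} (he : e ∈ centralTube k (etaOf k r)) :
    F (e.1, e.2, 2) * crossProd e = G e * reducedPolar e 2 := by
  obtain ⟨h, hs, hc, hne⟩ := exists_laplace_ne_zero 2
  obtain ⟨U, hU⟩ := (Tame.of_hasCompactSupport hs hc 0).vanish
  obtain ⟨l, hl0, hl1, hl⟩ := exists_shift_mem_centralTube he
  obtain ⟨K, n, hK, hb⟩ := norm_tau_shift_le hF hr hM hN hs hc hU hl0 hl1 hl
  have hη : etaOf k r ≤ 1 / 4 := by linarith [hr.etaOf_le, hr.le, hr.pos]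
  have hre : ∀ μ : ℂ, -l ≤ μ.re → ∀ j,
      1 / 4 + (μ.re + l) < (e.1 j + μ).re ∧ 1 / 4 + (μ.re + l) < (e.2 j + μ).re := by
    intro μ hμ j
    have h1 := hl ((-l : ℝ) : ℂ) (Complex.ofReal_re _)
    have h2 := (abs_lt.1 (h1.1 j)).1
    have h3 := (abs_lt.1 (h1.2 j)).1
    simp only [shift, Complex.add_re, Complex.ofReal_re] at h2 h3 ⊢
    constructor <;> linarith
  set S : Set ℂ := Complex.re ⁻¹' Ioo (-l) 5
  have hSo : IsOpen S := isOpen_Ioo.preimage Complex.continuous_re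
  have hSc : IsPreconnected S :=
    ((convex_Ioo (-l) 5).linear_preimage Complex.reLm).isPreconnected
  have hreg : IsOpen {x : EPoint k | (∀ i, 1 / 4 < (x.1 i).re) ∧ ∀ j, 1 / 4 < (x.2 j).re} := by
    simp only [ofPred_and, ofPred_forall]
    refine IsOpen.inter (isOpen_iInter_of_finite fun j => ?_) (isOpen_iInter_of_finite fun j => ?_)
    · exact isOpen_lt continuous_const (by fun_prop)
    · exact isOpen_lt continuous_const (by fun_prop)
  have a1 : AnalyticOnNhd ℂ (fun μ => laplace (tau M N h (shift e μ)) 2 * crossProd (shift e μ)) S :=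
    DifferentiableOn.analyticOnNhd (fun μ hμ => ((differentiableAt_laplace_tau hr hs hc hU hK hb
      hμ.1 hμ.2).mul ((differentiable_crossProd _).comp μ
        (differentiable_shift e μ))).differentiableWithinAt) hSo
  have a2 : AnalyticOnNhd ℂ (fun μ => G (shift e μ) * reducedPolar (shift e μ) 2 * laplace h 2) S := by
    refine DifferentiableOn.analyticOnNhd (fun μ hμ => ?_) hSo
    have hmem : shift e μ ∈ {x : EPoint k | (∀ i, 1 / 4 < (x.1 i).re) ∧ ∀ j, 1 / 4 < (x.2 j).re} :=
      ⟨fun j => by have := (hre μ hμ.1.le j).1; simp only [shift]; linarith [hμ.1],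
        fun j => by have := (hre μ hμ.1.le j).2; simp only [shift]; linarith [hμ.1]⟩
    exact ((((hG.differentiableAt (hreg.mem_nhds hmem)).comp μ (differentiable_shift e μ)).mul
      ((differentiable_reducedPolar 2 _).comp μ (differentiable_shift e μ))).mul_const
      _).differentiableWithinAt
  have heq : EqOn _ _ S := a1.eqOn_of_preconnected_of_eventuallyEq a2 hSc (z₀ := 4)
    ⟨by norm_num; linarith, by norm_num⟩ ?_
  · have h0 := heq (show (0 : ℂ) ∈ S from ⟨by simpa using hl0, by norm_num⟩)
    simp only [shift_zero] at h0
    rw [(tau_central hF hr hs hc).2 e he] at h0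
    refine mul_right_cancel₀ hne ?_
    linear_combination h0
  · filter_upwards [(hSo.inter (isOpen_lt continuous_const Complex.continuous_re)).mem_nhds
      (show (4 : ℂ) ∈ S ∩ {μ : ℂ | (3 : ℝ) < μ.re} from
        ⟨⟨by norm_num; linarith, by norm_num⟩, by norm_num⟩)] with μ hμ
    have hμ3 : 3 < μ.re := hμ.2
    have hmem : shift e μ ∈ rightRegion k 3 :=
      ⟨fun j => by have := (hre μ hμ.1.1.le j).1; simp only [shift]; linarith,
        fun j => by have := (hre μ hμ.1.1.le j).2; simp only [shift]; linarith⟩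
    have hone := one_lt_of_mem_rightRegion hmem
    rw [(tau_right hM hN hs hc).2 _ hmem, hGB _ hone.1 hone.2]
    ring

end

end

section

variable {k : ℕ}

/-! ### Divisor functions with complex exponents -/

/-- The arithmetic function `n ↦ n^(-s)`. -/
def powFun (s : ℂ) : ArithmeticFunction ℂ := ⟨fun n => if n = 0 then 0 else 1 / (n : ℂ) ^ s, if_pos rfl⟩

lemma powFun_apply {n : ℕ} (hn : n ≠ 0) (s : ℂ) : powFun s n = 1 / (n : ℂ) ^ s := if_neg hn

lemma powFun_mul (s : ℂ) (m n : ℕ) : powFun s (m * n) = powFun s m * powFun s n := by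
  rcases eq_or_ne m 0 with rfl | hm
  · simp
  rcases eq_or_ne n 0 with rfl | hn
  · simp
  rw [powFun_apply hm, powFun_apply hn, powFun_apply (mul_ne_zero hm hn), Nat.cast_mul,
    Complex.natCast_mul_natCast_cpow, one_div_mul_one_div]

lemma powFun_one (s : ℂ) : powFun s 1 = 1 := by
  rw [powFun_apply one_ne_zero]
  simp

lemma isMultiplicative_powFun (s : ℂ) : (powFun s).IsMultiplicative :=
  ⟨powFun_one s, fun _ => powFun_mul s _ _⟩

lemma norm_powFun_le {σ : ℝ} {s : ℂ} (hs : σ ≤ s.re) (n : ℕ) : ‖powFun s n‖ ≤ (n : ℝ) ^ (-σ) := by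
  rcases eq_or_ne n 0 with rfl | hn
  · simpa using Real.zero_rpow_nonneg _
  rw [powFun_apply hn]
  refine (norm_one_div_cpow ⟨n, Nat.pos_of_ne_zero hn⟩ s).le.trans ?_
  exact Real.rpow_le_rpow_of_exponent_le (by exact_mod_cast Nat.pos_of_ne_zero hn) (by linarith)

lemma differentiable_powFun (n : ℕ) : Differentiable ℂ fun s => powFun s n := by
  intro s
  rcases eq_or_ne n 0 with rfl | hn
  · simp
  simp only [powFun_apply hn]
  have hn' : (n : ℂ) ≠ 0 := by exact_mod_cast hn
  refine (differentiableAt_const _).div ?_ (by simp [Complex.cpow_eq_zero_iff, hn'])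
  exact (differentiableAt_id).const_cpow (Or.inl hn')

/-- The Dirichlet convolution of the functions `n ↦ n^(-s_i)`, for `i ∈ I`. -/
def divFun (I : Finset (Fin k)) (s : Fin k → ℂ) : ArithmeticFunction ℂ := ∏ i ∈ I, powFun (s i)

lemma divFun_insert {I : Finset (Fin k)} {i : Fin k} (hi : i ∉ I) (s : Fin k → ℂ) :
    divFun (insert i I) s = powFun (s i) * divFun I s := by
  rw [divFun, Finset.prod_insert hi, divFun]

lemma isMultiplicative_divFun (I : Finset (Fin k)) (s : Fin k → ℂ) :
    (divFun I s).IsMultiplicative := by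
  induction I using Finset.induction_on with
  | empty => simp [divFun]
  | insert i I hi ih =>
    rw [divFun_insert hi]
    exact (isMultiplicative_powFun _).mul ih

lemma differentiable_divFun (I : Finset (Fin k)) (n : ℕ) :
    Differentiable ℂ fun s : Fin k → ℂ => divFun I s n := by
  induction I using Finset.induction_on generalizing n with
  | empty => simp [divFun]
  | insert i I hi ih =>
    simp only [divFun_insert hi, ArithmeticFunction.mul_apply]
    refine Differentiable.fun_sum fun x _ => ?_
    exact ((differentiable_powFun x.1).comp (differentiable_apply i)).mul (ih x.2)

lemma divFun_apply_prime (I : Finset (Fin k)) (s : Fin k → ℂ) {p : ℕ} (hp : p.Prime) :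
    divFun I s p = ∑ i ∈ I, powFun (s i) p := by
  induction I using Finset.induction_on with
  | empty => simp [divFun, hp.ne_one]
  | insert i I hi ih =>
    have h1 : divFun I s 1 = 1 := (isMultiplicative_divFun I s).1
    rw [divFun_insert hi, ArithmeticFunction.mul_apply, Nat.sum_divisorsAntidiagonal
      (fun a b => powFun (s i) a * divFun I s b), hp.sum_divisors, Finset.sum_insert hi]
    simp [ih, h1, powFun_one, Nat.div_self hp.pos]

/-- The number of factorisations into `m` factors. -/
def tauFun (m : ℕ) : ArithmeticFunction ℕ := ArithmeticFunction.zeta ^ m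

lemma norm_divFun_le (I : Finset (Fin k)) {s : Fin k → ℂ} {σ : ℝ} (hs : ∀ i, σ ≤ (s i).re)
    (n : ℕ) : ‖divFun I s n‖ ≤ tauFun I.card n * (n : ℝ) ^ (-σ) := by
  induction I using Finset.induction_on generalizing n with
  | empty =>
    rcases eq_or_ne n 1 with rfl | hn
    · simp [divFun, tauFun]
    · simp [divFun, tauFun, hn]
  | insert i I hi ih =>
    rw [divFun_insert hi, Finset.card_insert_of_notMem hi, tauFun, pow_succ', ← tauFun,
      ArithmeticFunction.mul_apply, ArithmeticFunction.mul_apply, Nat.cast_sum, Finset.sum_mul]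
    refine (norm_sum_le _ _).trans (Finset.sum_le_sum fun x hx => ?_)
    obtain ⟨h1, h2⟩ := Nat.mem_divisorsAntidiagonal.1 hx
    have h3 : x.1 ≠ 0 := fun h => h2 (by rw [← h1, h, zero_mul])
    rw [norm_mul, ← h1, Nat.cast_mul, Nat.cast_mul, ArithmeticFunction.zeta_apply_ne h3,
      Real.mul_rpow (by positivity) (by positivity), Nat.cast_one, one_mul]
    calc _ ≤ (x.1 : ℝ) ^ (-σ) * (tauFun I.card x.2 * (x.2 : ℝ) ^ (-σ)) :=
          mul_le_mul (norm_powFun_le (hs i) _) (ih _) (norm_nonneg _) (by positivity)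
      _ = _ := by ring

lemma isMultiplicative_tauFun (m : ℕ) : (tauFun m).IsMultiplicative := by
  induction m with
  | zero => simp [tauFun]
  | succ m ih =>
    rw [tauFun, pow_succ', ← tauFun]
    exact ArithmeticFunction.isMultiplicative_zeta.mul ih

lemma tauFun_prime_pow_le (m : ℕ) {p : ℕ} (hp : p.Prime) (ν : ℕ) :
    tauFun m (p ^ ν) ≤ (ν + 1) ^ m := by
  induction m generalizing ν with
  | zero =>
    simp only [tauFun, pow_zero, ArithmeticFunction.one_apply]
    split_ifs <;> simp
  | succ m ih =>
    rw [tauFun, pow_succ', ← tauFun, ArithmeticFunction.zeta_mul_apply,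
      Nat.sum_divisors_prime_pow hp]
    calc _ ≤ ∑ j ∈ Finset.range (ν + 1), (ν + 1) ^ m := by
          refine Finset.sum_le_sum fun j hj => (ih j).trans ?_
          have := Finset.mem_range.1 hj
          gcongr
          omega
      _ = _ := by simp [pow_succ']

lemma norm_divFun_prime_pow_le {s : Fin k → ℂ} {σ : ℝ} (hs : ∀ i, σ ≤ (s i).re) {p : ℕ}
    (hp : p.Prime) (ν : ℕ) :
    ‖divFun Finset.univ s (p ^ ν)‖ ≤ (ν + 1) ^ k * ((p : ℝ) ^ (-σ)) ^ ν := by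
  refine (norm_divFun_le _ hs _).trans ?_
  have h := tauFun_prime_pow_le k hp ν
  have h2 : ((p ^ ν : ℕ) : ℝ) ^ (-σ) = ((p : ℝ) ^ (-σ)) ^ ν := by
    rw [Nat.cast_pow, ← Real.rpow_natCast, ← Real.rpow_natCast, ← Real.rpow_mul (by positivity),
      ← Real.rpow_mul (by positivity), mul_comm]
  rw [h2, Finset.card_univ, Fintype.card_fin]
  gcongr
  exact_mod_cast h

/-! ### Sums over tuples with given product -/

lemma prod_apply_eq_sum_finMulAntidiag (f : Fin k → ArithmeticFunction ℂ) (n : ℕ) :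
    (∏ i, f i) n = ∑ x ∈ Nat.finMulAntidiag k n, ∏ i, f i (x i) := by
  induction k generalizing n with
  | zero =>
    rcases eq_or_ne n 1 with rfl | hn
    · simp [Nat.finMulAntidiag_one]
    · simp [hn, Nat.finMulAntidiag_zero_left hn]
  | succ k ih =>
    rw [Fin.prod_univ_succ, ArithmeticFunction.mul_apply]
    simp_rw [ih, Finset.mul_sum]
    rw [Finset.sum_sigma']
    refine Finset.sum_bij' (fun y _ => Fin.cons y.1.1 y.2)
      (fun x _ => ⟨(x 0, ∏ i : Fin k, x i.succ), Fin.tail x⟩) ?_ ?_ ?_ ?_ ?_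
    · rintro ⟨⟨a, b⟩, y⟩ hy
      simp only [Finset.mem_sigma, Nat.mem_divisorsAntidiagonal, Nat.mem_finMulAntidiag] at hy ⊢
      rw [Fin.prod_univ_succ]
      simp [hy.2.1, hy.1.1, hy.1.2]
    · intro x hx
      simp only [Finset.mem_sigma, Nat.mem_divisorsAntidiagonal, Nat.mem_finMulAntidiag] at hx ⊢
      rw [Fin.prod_univ_succ] at hx
      refine ⟨hx, rfl, ?_⟩
      rintro h
      exact hx.2 (by rw [← hx.1, h, mul_zero])
    · rintro ⟨⟨a, b⟩, y⟩ hy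
      simp only [Finset.mem_sigma, Nat.mem_finMulAntidiag] at hy
      simp [hy.2.1]
    · intro x _
      simp
    · rintro ⟨⟨a, b⟩, y⟩ _
      rw [Fin.prod_univ_succ]
      simp

/-- `∏ n_j^(-s_j)`. -/
def halfWt (s : Fin k → ℂ) (x : Fin k → ℕ+) : ℂ := ∏ j, 1 / (x j : ℂ) ^ s j

/-- `n_1 ⋯ n_k`. -/
def tprodNat (x : Fin k → ℕ+) : ℕ := ∏ j, (x j : ℕ)

lemma tprodNat_ne_zero (x : Fin k → ℕ+) : tprodNat x ≠ 0 :=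
  Finset.prod_ne_zero_iff.2 fun j _ => (x j).ne_zero

lemma hasSum_fiber (s : Fin k → ℂ) (n : ℕ) :
    HasSum (fun x : Fin k → ℕ+ => if tprodNat x = n then halfWt s x else 0)
      (divFun Finset.univ s n) := by
  have hinj : Function.Injective fun (x : Fin k → ℕ+) (j : Fin k) => (x j : ℕ) := fun x y h =>
    funext fun j => PNat.coe_injective (congrFun h j)
  have h1 : HasSum (fun y : Fin k → ℕ => if y ∈ Nat.finMulAntidiag k n then
      ∏ i, powFun (s i) (y i) else 0) (divFun Finset.univ s n) := by
    rw [divFun, prod_apply_eq_sum_finMulAntidiag]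
    have h2 : ∑ x ∈ Nat.finMulAntidiag k n, ∏ i, powFun (s i) (x i) =
        ∑ x ∈ Nat.finMulAntidiag k n, if x ∈ Nat.finMulAntidiag k n then
          ∏ i, powFun (s i) (x i) else 0 := Finset.sum_congr rfl fun x hx => (if_pos hx).symm
    rw [h2]
    exact hasSum_sum_of_ne_finset_zero (L := SummationFilter.unconditional _) fun x hx => if_neg hx
  rw [← hinj.hasSum_iff] at h1
  · refine h1.congr_fun fun x => ?_
    have hx := tprodNat_ne_zero x
    simp only [Function.comp_apply, Nat.mem_finMulAntidiag]
    by_cases h : tprodNat x = n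
    · rw [if_pos h, if_pos ⟨h, h ▸ hx⟩, halfWt]
      exact Finset.prod_congr rfl fun j _ => (powFun_apply (x j).ne_zero _).symm
    · rw [if_neg h, if_neg fun h' => h h'.1]
  · intro y hy
    refine if_neg fun h => hy ?_
    have := Nat.ne_zero_of_mem_finMulAntidiag h
    exact ⟨fun j => ⟨y j, Nat.pos_of_ne_zero (this j)⟩, rfl⟩

lemma tsum_halfWt_mul (s : Fin k → ℂ) {φ : ℕ → ℂ}
    (h : Summable fun x : Fin k → ℕ+ => halfWt s x * φ (tprodNat x)) :
    ∑' x : Fin k → ℕ+, halfWt s x * φ (tprodNat x) = ∑' n, divFun Finset.univ s n * φ n := by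
  have h1 := (Equiv.sigmaFiberEquiv (tprodNat (k := k))).summable_iff.2 h
  rw [← (Equiv.sigmaFiberEquiv (tprodNat (k := k))).tsum_eq]
  refine h1.tsum_sigma.trans ?_
  refine tsum_congr fun n => ?_
  rw [← (hasSum_fiber s n).tsum_eq, ← tsum_mul_right]
  have h2 := tsum_subtype {x : Fin k → ℕ+ | tprodNat x = n} fun x => halfWt s x * φ n
  rw [show (∑' x : Fin k → ℕ+, (if tprodNat x = n then halfWt s x else 0) * φ n) =
      ∑' x, {x : Fin k → ℕ+ | tprodNat x = n}.indicator (fun x => halfWt s x * φ n) x from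
    tsum_congr fun x => by
      by_cases hx : tprodNat x = n
      · rw [if_pos hx, indicator_of_mem (by exact hx)]
      · rw [if_neg hx, zero_mul, indicator_of_notMem (by exact hx)], ← h2]
  refine tsum_congr fun x => ?_
  have hx : tprodNat x.1 = n := x.2
  simp only [Function.comp_apply, Equiv.sigmaFiberEquiv_apply]
  rw [hx]

end

section

variable {k : ℕ}

/-! ### The series `B` as a single Dirichlet series -/

/-- The arithmetic factor of `B` at a prime. -/
def primeTheta (p : ℕ) : ℂ := ((1 - 1 / (p : ℂ) ^ 2) ^ 2)⁻¹ * (1 - 1 / (p : ℂ))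

/-- The arithmetic factor of `B`. -/
def thetaFun (n : ℕ) : ℂ := ∏ p ∈ n.primeFactors, primeTheta p

lemma primeTheta_bounds {p : ℕ} (hp : p.Prime) :
    ‖primeTheta p‖ ≤ 1 ∧ ‖primeTheta p - 1‖ ≤ 1 / (p : ℝ) := by
  have h2 : (2 : ℝ) ≤ p := by exact_mod_cast hp.two_le
  set x : ℝ := 1 / (p : ℝ) with hx
  have hx0 : 0 < x := by positivity
  have hx1 : x ≤ 1 / 2 := by
    rw [hx]
    exact one_div_le_one_div_of_le (by norm_num) h2
  have hy : 1 ≤ (1 - x) * (1 + x) ^ 2 := by nlinarith [mul_pos hx0 hx0]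
  have hy2 : (1 - x) * (1 + x) ^ 2 ≤ 1 + x := by nlinarith [mul_pos hx0 hx0]
  have h1 : primeTheta p = (((1 - x) * (1 + x) ^ 2)⁻¹ : ℝ) := by
    have e1 : primeTheta p = (((1 - x ^ 2) ^ 2)⁻¹ * (1 - x) : ℝ) := by
      rw [primeTheta, hx]
      push_cast
      rw [one_div_pow]
    rw [e1]
    congr 1
    have : 1 - x ≠ 0 := by linarith
    have : 1 + x ≠ 0 := by linarith
    rw [show 1 - x ^ 2 = (1 - x) * (1 + x) by ring]
    field_simp
  have hi1 : ((1 - x) * (1 + x) ^ 2)⁻¹ ≤ 1 := inv_le_one_of_one_le₀ hy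
  have hi0 : 0 < ((1 - x) * (1 + x) ^ 2)⁻¹ := by positivity
  constructor
  · rw [h1, Complex.norm_real, Real.norm_of_nonneg hi0.le]
    exact hi1
  · rw [h1, ← Complex.ofReal_one, ← Complex.ofReal_sub, Complex.norm_real, Real.norm_eq_abs, abs_le]
    have h3 : ((1 - x) * (1 + x) ^ 2)⁻¹ * ((1 - x) * (1 + x) ^ 2) = 1 :=
      inv_mul_cancel₀ (by linarith)
    constructor <;> nlinarith

lemma norm_thetaFun_le (n : ℕ) : ‖thetaFun n‖ ≤ 1 := by
  rw [thetaFun, norm_prod]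
  exact Finset.prod_le_one (fun _ _ => norm_nonneg _) fun p hp =>
    (primeTheta_bounds (Nat.prime_of_mem_primeFactors hp)).1

lemma thetaFun_mul {m n : ℕ} (h : m.Coprime n) : thetaFun (m * n) = thetaFun m * thetaFun n := by
  rw [thetaFun, h.primeFactors_mul, Finset.prod_union h.disjoint_primeFactors, thetaFun, thetaFun]

lemma thetaFun_prime_pow {p : ℕ} (hp : p.Prime) {ν : ℕ} (hν : ν ≠ 0) :
    thetaFun (p ^ ν) = primeTheta p := by
  rw [thetaFun, Nat.primeFactors_prime_pow hν hp, Finset.prod_singleton]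

/-- The divisor function of the `z_j` at `l / M`. -/
def twistDiv (M : ℕ) (z : Fin k → ℂ) (l : ℕ) : ℂ :=
  if M ∣ l then divFun Finset.univ z (l / M) else 0

lemma summable_halfWt {s : Fin k → ℂ} (hs : ∀ j, 1 < (s j).re) :
    Summable fun x : Fin k → ℕ+ => ‖halfWt s x‖ :=
  (hasSum_pi_prod (f := fun j (n : ℕ+) => 1 / (n : ℂ) ^ s j) fun j => by
    simpa only [norm_one_div_cpow] using summable_pnat_rpow (hs j)).1

lemma tsum_fiber_mul {M : ℕ} (hM : M ≠ 0) {z : Fin k → ℂ} (hz : ∀ j, 1 < (z j).re) (l : ℕ) :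
    ∑' y : Fin k → ℕ+, halfWt z y * (if l = M * tprodNat y then 1 else 0) = twistDiv M z l := by
  rw [tsum_halfWt_mul z (φ := fun m => if l = M * m then 1 else 0)]
  · rw [twistDiv]
    split_ifs with h
    · obtain ⟨m, rfl⟩ := h
      rw [tsum_eq_single m, if_pos rfl, mul_one, Nat.mul_div_cancel_left _ (Nat.pos_of_ne_zero hM)]
      intro n hn
      rw [if_neg fun h => hn (Nat.eq_of_mul_eq_mul_left (Nat.pos_of_ne_zero hM) h).symm, mul_zero]
    · refine (tsum_congr fun n => ?_).trans tsum_zero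
      rw [if_neg fun h' => h ⟨n, h'⟩, mul_zero]
  · refine Summable.of_norm_bounded (summable_halfWt hz) fun y => ?_
    rw [norm_mul]
    split_ifs <;> simp

lemma bSeries_eq_tsum {M N : ℕ} (hM : M ≠ 0) {s z : Fin k → ℂ}
    (hs : ∀ j, 1 < (s j).re) (hz : ∀ j, 1 < (z j).re) :
    bSeries M N s z = 1 / (2 * riemannZeta 2 ^ 2) *
      ∑' n, divFun Finset.univ s n * (twistDiv M z (N * n) * thetaFun (N * n)) := by
  rw [bSeries]
  congr 1
  rw [show (∑' x : {x : (Fin k → ℕ+) × (Fin k → ℕ+) // N * ∏ j, (x.1 j : ℕ) = M * ∏ j, (x.2 j : ℕ)},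
      (∏ j, 1 / ((x.1.1 j : ℂ) ^ s j * (x.1.2 j : ℂ) ^ z j)) *
        ∏ p ∈ (M * N * (∏ j, (x.1.1 j : ℕ)) * ∏ j, (x.1.2 j : ℕ)).primeFactors,
          ((1 - 1 / (p : ℂ) ^ 2) ^ 2)⁻¹ * (1 - 1 / (p : ℂ))) = _ from
    tsum_subtype {x : TPoint k | N * ∏ j, (x.1 j : ℕ) = M * ∏ j, (x.2 j : ℕ)}
      (fun x => wt (s, z) x * thetaFun (M * N * (∏ j, (x.1 j : ℕ)) * ∏ j, (x.2 j : ℕ)))]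
  obtain ⟨f, hf⟩ : ∃ f : TPoint k → ℂ, f = fun x => halfWt s x.1 * thetaFun (N * tprodNat x.1) *
    (halfWt z x.2 * if N * tprodNat x.1 = M * tprodNat x.2 then 1 else 0) := ⟨_, rfl⟩
  have hfs : Summable f := by
    have h1 := (summable_halfWt hs).mul_of_nonneg (summable_halfWt hz) (fun _ => norm_nonneg _)
      fun _ => norm_nonneg _
    refine Summable.of_norm_bounded h1 fun x => ?_
    simp only [hf, norm_mul]
    refine mul_le_mul (mul_le_of_le_one_right (norm_nonneg _) (norm_thetaFun_le _))
      (mul_le_of_le_one_right (norm_nonneg _) ?_) (by positivity) (norm_nonneg _)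
    split_ifs <;> simp
  have hterm : ∀ x : TPoint k, {x : TPoint k | N * ∏ j, (x.1 j : ℕ) = M * ∏ j, (x.2 j : ℕ)}.indicator
      (fun x => wt (s, z) x * thetaFun (M * N * (∏ j, (x.1 j : ℕ)) * ∏ j, (x.2 j : ℕ))) x = f x := by
    intro x
    rw [hf, indicator_apply]
    change (if N * tprodNat x.1 = M * tprodNat x.2 then wt (s, z) x *
      thetaFun (M * N * tprodNat x.1 * tprodNat x.2) else 0) = _
    beta_reduce
    split_ifs with h
    · have h1 : thetaFun (M * N * tprodNat x.1 * tprodNat x.2) = thetaFun (N * tprodNat x.1) := by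
        rw [thetaFun, show M * N * tprodNat x.1 * tprodNat x.2 =
          (N * tprodNat x.1) * (M * tprodNat x.2) by ring, ← h, thetaFun]
        rcases eq_or_ne (N * tprodNat x.1) 0 with h0 | h0
        · rw [h0]
        · rw [Nat.primeFactors_mul h0 h0, Finset.union_self]
      rw [h1, wt_eq, halfWt, halfWt]
      ring
    · ring
  rw [tsum_congr hterm, hfs.tsum_prod]
  have hin : ∀ x, ∑' y, f (x, y) = halfWt s x *
      (twistDiv M z (N * tprodNat x) * thetaFun (N * tprodNat x)) := by
    intro x
    simp only [hf]
    rw [tsum_mul_left, tsum_fiber_mul hM hz]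
    ring
  rw [tsum_congr hin]
  exact tsum_halfWt_mul s (φ := fun n => twistDiv M z (N * n) * thetaFun (N * n))
    (hfs.prod.congr hin)

/-! ### Separation of the primes dividing `M N` -/

lemma exists_factored_mul_coprime {L : ℕ} (hL : L ≠ 0) {n : ℕ} (hn : n ≠ 0) :
    ∃ a ∈ Nat.factoredNumbers L.primeFactors, ∃ b, b.Coprime L ∧ a * b = n := by
  induction n using Nat.recOnMul with
  | zero => exact absurd rfl hn
  | one => exact ⟨1, by simp [Nat.mem_factoredNumbers], 1, by simp, rfl⟩
  | prime p hp =>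
    by_cases hpL : p.Coprime L
    · exact ⟨1, by simp [Nat.mem_factoredNumbers], p, hpL, one_mul p⟩
    · refine ⟨p, Nat.mem_factoredNumbers_of_primeFactors_subset hp.ne_zero ?_, 1, by simp, mul_one p⟩
      rw [hp.primeFactors, Finset.singleton_subset_iff]
      exact Nat.mem_primeFactors.2 ⟨hp, by rwa [Nat.Prime.coprime_iff_not_dvd hp, not_not] at hpL, hL⟩
  | mul m n hm hn' =>
    obtain ⟨a, ha, b, hb, rfl⟩ := hm (left_ne_zero_of_mul hn)
    obtain ⟨a', ha', b', hb', rfl⟩ := hn' (right_ne_zero_of_mul hn)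
    exact ⟨a * a', Nat.mul_mem_factoredNumbers ha ha', b * b', hb.mul_left hb', by ring⟩

lemma coprime_of_mem_factoredNumbers {L a b : ℕ} (ha : a ∈ Nat.factoredNumbers L.primeFactors)
    (hb : b.Coprime L) : a.Coprime b := by
  refine Nat.Coprime.symm (Nat.Coprime.coprime_dvd_right (k := b) (dvd_refl a) ?_)
  refine Nat.coprime_of_dvd fun p hp hpb hpa => ?_
  have h1 := Nat.primeFactors_subset_of_mem_factoredNumbers ha
    (Nat.mem_primeFactors.2 ⟨hp, hpa, Nat.ne_zero_of_mem_factoredNumbers ha⟩)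
  have h2 := Nat.dvd_gcd hpb (Nat.dvd_of_mem_primeFactors h1)
  rw [hb] at h2
  exact hp.one_lt.ne' (Nat.dvd_one.1 h2)

lemma tsum_factored_mul_coprime {L : ℕ} (hL : L ≠ 0) {f : ℕ → ℂ} (hf0 : f 0 = 0) :
    ∑' n, f n = ∑' y : Nat.factoredNumbers L.primeFactors × {b : ℕ // b.Coprime L ∧ b ≠ 0},
      f (y.1 * y.2) := by
  have hinj : Function.Injective fun y : Nat.factoredNumbers L.primeFactors ×
      {b : ℕ // b.Coprime L ∧ b ≠ 0} => (y.1 : ℕ) * y.2 := by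
    rintro ⟨⟨a, ha⟩, b, hb⟩ ⟨⟨a', ha'⟩, b', hb'⟩ h
    have h : a * b = a' * b' := h
    have h1 : a ∣ a' := (coprime_of_mem_factoredNumbers ha hb'.1).dvd_of_dvd_mul_right
      (h ▸ dvd_mul_right a b)
    have h2 : a' ∣ a := (coprime_of_mem_factoredNumbers ha' hb.1).dvd_of_dvd_mul_right
      (h ▸ dvd_mul_right a' b')
    have h3 := Nat.dvd_antisymm h1 h2
    subst h3
    have h4 := Nat.eq_of_mul_eq_mul_left
      (Nat.pos_of_ne_zero (Nat.ne_zero_of_mem_factoredNumbers ha)) h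
    subst h4
    rfl
  refine (hinj.tsum_eq (f := f) fun n hn => ?_).symm
  have hn0 : n ≠ 0 := by rintro rfl; exact hn hf0
  obtain ⟨a, ha, b, hb, rfl⟩ := exists_factored_mul_coprime hL hn0
  exact ⟨(⟨a, ha⟩, ⟨b, hb, right_ne_zero_of_mul hn0⟩), rfl⟩

/-- The part of `B` that belongs to the primes not dividing `L`. -/
def coprimePart (L : ℕ) (e : EPoint k) (n : ℕ) : ℂ :=
  if n.Coprime L then divFun Finset.univ e.1 n * divFun Finset.univ e.2 n * thetaFun n else 0

/-- The part of `B` that belongs to the primes dividing `M N`. -/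
def factoredPart (M N : ℕ) (e : EPoint k) (n : ℕ) : ℂ :=
  divFun Finset.univ e.1 n * (twistDiv M e.2 (N * n) * thetaFun (N * n))

lemma factoredPart_mul {M N : ℕ} (hM : M ≠ 0) (e : EPoint k) {a b : ℕ}
    (ha : a ∈ Nat.factoredNumbers (M * N).primeFactors) (hb : b.Coprime (M * N)) :
    factoredPart M N e (a * b) = factoredPart M N e a * coprimePart (M * N) e b := by
  have hab := coprime_of_mem_factoredNumbers ha hb
  have hbM : b.Coprime M := hb.coprime_dvd_right (dvd_mul_right M N)
  have hbN : b.Coprime N := hb.coprime_dvd_right (dvd_mul_left N M)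
  have hc : (N * a).Coprime b := Nat.Coprime.mul_left hbN.symm hab
  have h1 : twistDiv M e.2 (N * (a * b)) = twistDiv M e.2 (N * a) * divFun Finset.univ e.2 b := by
    rw [twistDiv, twistDiv, ← mul_assoc]
    simp only [hbM.symm.dvd_mul_right]
    split_ifs with h
    · obtain ⟨c, hc'⟩ := h
      rw [hc'] at hc ⊢
      rw [mul_assoc, Nat.mul_div_cancel_left _ (Nat.pos_of_ne_zero hM),
        Nat.mul_div_cancel_left _ (Nat.pos_of_ne_zero hM)]
      exact (isMultiplicative_divFun _ _).2 (hc.coprime_dvd_left (dvd_mul_left c M))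
    · rw [zero_mul]
  rw [factoredPart, factoredPart, coprimePart, if_pos hb, h1, (isMultiplicative_divFun _ _).2 hab,
    ← mul_assoc N, thetaFun_mul hc]
  ring

end

section

variable {k : ℕ}

/-! ### Holomorphic series and neighbourhoods -/

/-- A locally dominated series of holomorphic functions is holomorphic. -/
lemma differentiableAt_tsum_of_dominated {E ι : Type*} [NormedAddCommGroup E] [NormedSpace ℂ E]
    {f : ι → E → ℂ} {u : ι → ℝ} {S : Set E} (hS : IsOpen S) (hu : Summable u)
    (hf : ∀ i, Differentiable ℂ (f i)) (hb : ∀ i, ∀ x ∈ S, ‖f i x‖ ≤ u i) {x : E} (hx : x ∈ S) :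
    DifferentiableAt ℂ (fun x => ∑' i, f i x) x := by
  obtain ⟨ρ, hρ, hsub⟩ := Metric.isOpen_iff.1 hS x hx
  refine differentiableAt_of_tendstoUniformlyOn_ball (l := atTop)
    (f := fun (I : Finset ι) x => ∑ i ∈ I, f i x) hρ (fun I => ?_)
    (tendstoUniformlyOn_tsum hu fun i y hy => hb i y (hsub hy))
  exact (Differentiable.fun_sum fun i _ => hf i).differentiableOn

/-- The open region of all `(s, z)` with real parts greater than `σ`. -/
def openRegion (k : ℕ) (σ : ℝ) : Set (EPoint k) :=
  {e | (∀ j, σ < (e.1 j).re) ∧ ∀ j, σ < (e.2 j).re}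

lemma isOpen_openRegion (σ : ℝ) : IsOpen (openRegion k σ) := by
  rw [openRegion]
  simp only [ofPred_and, ofPred_forall]
  refine IsOpen.inter (isOpen_iInter_of_finite fun j => ?_) (isOpen_iInter_of_finite fun j => ?_)
  · exact isOpen_lt continuous_const (by fun_prop)
  · exact isOpen_lt continuous_const (by fun_prop)

lemma exists_mem_openRegion {e : EPoint k} {σ₀ : ℝ} (he : e ∈ openRegion k σ₀) {σ₁ : ℝ}
    (h : σ₀ < σ₁) : ∃ σ, σ₀ < σ ∧ σ ≤ σ₁ ∧ e ∈ openRegion k σ := by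
  have h1 : ∀ᶠ σ in 𝓝[>] σ₀, e ∈ openRegion k σ := by
    simp only [openRegion, mem_ofPred_eq, eventually_and, eventually_all]
    exact ⟨fun j => Eventually.filter_mono nhdsWithin_le_nhds (gt_mem_nhds (he.1 j)),
      fun j => Eventually.filter_mono nhdsWithin_le_nhds (gt_mem_nhds (he.2 j))⟩
  have h2 : ∀ᶠ σ in 𝓝[>] σ₀, σ ∈ Ioc σ₀ σ₁ := Ioc_mem_nhdsGT h
  obtain ⟨σ, h3, h4⟩ := (h1.and h2).exists
  exact ⟨σ, h4.1, h4.2, h3⟩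

/-! ### The finite part -/

/-- The majorant of the divisor functions. -/
def divBound (k : ℕ) (σ : ℝ) (n : ℕ) : ℝ := tauFun k n * (n : ℝ) ^ (-σ)

lemma divBound_nonneg (σ : ℝ) (n : ℕ) : 0 ≤ divBound k σ n := by
  rw [divBound]
  positivity

lemma norm_divFun_le_divBound {s : Fin k → ℂ} {σ : ℝ} (hs : ∀ i, σ ≤ (s i).re) (n : ℕ) :
    ‖divFun Finset.univ s n‖ ≤ divBound k σ n := by
  simpa [divBound] using norm_divFun_le Finset.univ hs n

lemma summable_pow_mul_geometric (m : ℕ) {b : ℝ} (hb0 : 0 ≤ b) (hb : b < 1) :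
    Summable fun ν : ℕ => ((ν : ℝ) + 1) ^ m * b ^ ν := by
  have h := summable_pow_mul_geometric_of_norm_lt_one (R := ℝ) m
    (r := b) (by rwa [Real.norm_of_nonneg hb0])
  rcases hb0.eq_or_lt with rfl | hb0
  · refine summable_of_ne_finset_zero (s := {0}) fun ν hν => ?_
    rw [zero_pow (by simpa using hν), mul_zero]
  have h2 := ((summable_nat_add_iff 1).2 h).mul_left b⁻¹
  refine h2.congr fun ν => ?_
  push_cast
  rw [pow_succ]
  field_simp

lemma prime_rpow_neg_lt_one {p : ℕ} (hp : p.Prime) {σ : ℝ} (hσ : 0 < σ) : (p : ℝ) ^ (-σ) < 1 :=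
  Real.rpow_lt_one_of_one_lt_of_neg (by exact_mod_cast hp.one_lt) (by linarith)

lemma summable_divBound (S : Finset ℕ) {σ : ℝ} (hσ : 0 < σ) :
    Summable fun a : Nat.factoredNumbers S => divBound k σ a := by
  have h := (EulerProduct.summable_and_hasSum_factoredNumbers_prod_filter_prime_tsum
    (f := divBound k σ) ?_ ?_ ?_ S).1
  · simpa only [Real.norm_of_nonneg (divBound_nonneg _ _)] using h
  · simp [divBound, (isMultiplicative_tauFun k).1]
  · intro m n hmn
    rw [divBound, divBound, divBound, (isMultiplicative_tauFun k).2 hmn, Nat.cast_mul, Nat.cast_mul,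
      Real.mul_rpow (by positivity) (by positivity)]
    ring
  · intro p hp
    refine Summable.of_nonneg_of_le (fun _ => norm_nonneg _) (fun ν => ?_)
      (summable_pow_mul_geometric k (b := (p : ℝ) ^ (-σ)) (by positivity)
        (prime_rpow_neg_lt_one hp hσ))
    have h2 : ((p ^ ν : ℕ) : ℝ) ^ (-σ) = ((p : ℝ) ^ (-σ)) ^ ν := by
      rw [Nat.cast_pow, ← Real.rpow_natCast, ← Real.rpow_natCast, ← Real.rpow_mul (by positivity),
        ← Real.rpow_mul (by positivity), mul_comm]
    rw [Real.norm_of_nonneg (divBound_nonneg _ _), divBound, h2]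
    gcongr
    exact_mod_cast tauFun_prime_pow_le k hp ν

lemma dvd_mem_factoredNumbers {n L : ℕ} (hn : n ∣ L) (hL : L ≠ 0) :
    n ∈ Nat.factoredNumbers L.primeFactors :=
  Nat.mem_factoredNumbers_of_primeFactors_subset (ne_zero_of_dvd_ne_zero hL hn)
    (Nat.primeFactors_mono hn hL)

section

variable {M N : ℕ}

lemma differentiable_twistDiv (M l : ℕ) : Differentiable ℂ fun z : Fin k → ℂ => twistDiv M z l := by
  simp only [twistDiv]
  split_ifs
  · exact differentiable_divFun _ _
  · exact differentiable_const 0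

lemma differentiable_factoredPart (M N n : ℕ) :
    Differentiable ℂ fun e : EPoint k => factoredPart M N e n := by
  have h1 := (differentiable_divFun (k := k) Finset.univ n).comp (differentiable_fst (E := Fin k → ℂ)
    (F := Fin k → ℂ) (𝕜 := ℂ))
  have h2 := (differentiable_twistDiv (k := k) M (N * n)).comp (differentiable_snd (E := Fin k → ℂ)
    (F := Fin k → ℂ) (𝕜 := ℂ))
  exact h1.mul (h2.mul_const _)

lemma norm_factoredPart_le (hM : M ≠ 0) (hN : N ≠ 0) {σ : ℝ} (hσ : 0 < σ) {e : EPoint k}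
    (he : e ∈ openRegion k σ) (a : Nat.factoredNumbers (M * N).primeFactors) :
    ‖factoredPart M N e a‖ ≤ divBound k σ a *
      ∑' a : Nat.factoredNumbers (M * N).primeFactors, divBound k σ a := by
  have hL := mul_ne_zero hM hN
  rw [factoredPart, norm_mul, norm_mul]
  have h0 : 0 ≤ ∑' a : Nat.factoredNumbers (M * N).primeFactors, divBound k σ a :=
    tsum_nonneg fun _ => divBound_nonneg _ _
  have h1 : ‖twistDiv M e.2 (N * a)‖ ≤
      ∑' a : Nat.factoredNumbers (M * N).primeFactors, divBound k σ a := by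
    rw [twistDiv]
    split_ifs with h
    · refine (norm_divFun_le_divBound (fun j => (he.2 j).le) _).trans ?_
      have hmem : N * a / M ∈ Nat.factoredNumbers (M * N).primeFactors :=
        Nat.mem_factoredNumbers_of_dvd (Nat.mul_mem_factoredNumbers
          (dvd_mem_factoredNumbers (dvd_mul_left N M) hL) a.2) (Nat.div_dvd_of_dvd h)
      exact (summable_divBound _ hσ).le_tsum (⟨_, hmem⟩ : Nat.factoredNumbers (M * N).primeFactors)
        fun _ _ => divBound_nonneg _ _
    · rwa [norm_zero]
  refine mul_le_mul (norm_divFun_le_divBound (fun j => (he.1 j).le) _) ?_ (by positivity)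
    (divBound_nonneg _ _)
  exact (mul_le_of_le_one_right (norm_nonneg _) (norm_thetaFun_le _)).trans h1

/-- The sum over the part of `B` that belongs to the primes dividing `M N`. -/
def factoredSum (M N : ℕ) (e : EPoint k) : ℂ :=
  ∑' a : Nat.factoredNumbers (M * N).primeFactors, factoredPart M N e a

lemma differentiableAt_factoredSum (hM : M ≠ 0) (hN : N ≠ 0) {e : EPoint k}
    (he : e ∈ openRegion k 0) : DifferentiableAt ℂ (factoredSum M N) e := by
  obtain ⟨σ, h0, -, h1⟩ := exists_mem_openRegion he one_pos
  exact differentiableAt_tsum_of_dominated (isOpen_openRegion σ)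
    ((summable_divBound _ h0).mul_right _) (fun a => differentiable_factoredPart M N a)
    (fun a e he => norm_factoredPart_le hM hN h0 he a) h1

/-! ### The Euler product -/

lemma summable_divFun (I : Finset (Fin k)) {s : Fin k → ℂ} (hs : ∀ j, 1 < (s j).re) :
    Summable fun n => ‖divFun I s n‖ := by
  have hterm : ∀ f : ArithmeticFunction ℂ, LSeries.term (f ·) 0 = fun n => f n := by
    intro f
    funext n
    rcases eq_or_ne n 0 with rfl | hn
    · simp
    · rw [LSeries.term_of_ne_zero hn, Complex.cpow_zero, div_one]
  have h : LSeriesSummable (divFun I s ·) 0 := by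
    induction I using Finset.induction_on with
    | empty =>
      rw [LSeriesSummable, hterm]
      exact summable_of_ne_finset_zero (s := {1}) fun n hn => by
        simp [divFun, show n ≠ 1 by simpa using hn]
    | insert i I hi ih =>
      rw [divFun_insert hi]
      refine ArithmeticFunction.LSeriesSummable_mul ?_ ih
      rw [LSeriesSummable, hterm]
      exact Summable.of_norm_bounded (Real.summable_nat_rpow.2 (by linarith [hs i] : -(s i).re < -1))
        fun n => norm_powFun_le le_rfl n
  rw [LSeriesSummable, hterm] at h
  exact h.norm

lemma coprimePart_zero {L : ℕ} (e : EPoint k) : coprimePart L e 0 = 0 := by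
  rw [coprimePart]
  simp

lemma summable_coprimePart (L : ℕ) {e : EPoint k} (he : e ∈ openRegion k 1) :
    Summable fun n => ‖coprimePart L e n‖ := by
  have h1 := summable_divFun Finset.univ he.1
  have h2 := summable_divFun Finset.univ he.2
  refine Summable.of_nonneg_of_le (fun _ => norm_nonneg _) (fun n => ?_)
    (h1.mul_right (∑' n, ‖divFun Finset.univ e.2 n‖))
  have h3 : 0 ≤ ∑' n, ‖divFun Finset.univ e.2 n‖ := tsum_nonneg fun _ => norm_nonneg _
  rw [coprimePart]
  split_ifs
  · rw [norm_mul, norm_mul]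
    refine (mul_le_of_le_one_right (by positivity) (norm_thetaFun_le _)).trans ?_
    exact mul_le_mul_of_nonneg_left (h2.le_tsum n fun _ _ => norm_nonneg _) (norm_nonneg _)
  · rw [norm_zero]
    positivity

/-- The Euler factor of the coprime part of `B`. -/
def localSum (L : ℕ) (e : EPoint k) (p : ℕ) : ℂ := ∑' ν : ℕ, coprimePart L e (p ^ ν)

lemma hasProd_localSum (L : ℕ) {e : EPoint k} (he : e ∈ openRegion k 1) :
    HasProd (fun p : Nat.Primes => localSum L e p) (∑' n, coprimePart L e n) := by
  refine EulerProduct.eulerProduct_hasProd (f := coprimePart L e) ?_ ?_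
    (summable_coprimePart L he) (coprimePart_zero e)
  · simp [coprimePart, (isMultiplicative_divFun _ _).1, thetaFun]
  · intro m n hmn
    simp only [coprimePart, Nat.coprime_mul_iff_left]
    by_cases hm : m.Coprime L
    · by_cases hn : n.Coprime L
      · rw [if_pos hm, if_pos hn, if_pos ⟨hm, hn⟩, (isMultiplicative_divFun _ _).2 hmn,
          (isMultiplicative_divFun _ _).2 hmn, thetaFun_mul hmn]
        ring
      · rw [if_neg hn, if_neg fun h => hn h.2, mul_zero]
    · rw [if_neg hm, if_neg fun h => hm h.1, zero_mul]

lemma tsum_factoredPart (hM : M ≠ 0) (hN : N ≠ 0) {e : EPoint k} (he : e ∈ openRegion k 1) :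
    ∑' n, factoredPart M N e n = factoredSum M N e * ∑' n, coprimePart (M * N) e n := by
  have hL := mul_ne_zero hM hN
  have h0 : factoredPart M N e 0 = 0 := by simp [factoredPart]
  have he' : e ∈ openRegion k (1 / 2) :=
    ⟨fun j => by linarith [he.1 j], fun j => by linarith [he.2 j]⟩
  have h1 : Summable fun a : Nat.factoredNumbers (M * N).primeFactors => ‖factoredPart M N e a‖ :=
    Summable.of_nonneg_of_le (fun _ => norm_nonneg _) (norm_factoredPart_le hM hN one_half_pos he')
      ((summable_divBound _ one_half_pos).mul_right _)
  have h2 := summable_coprimePart (M * N) he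
  have hinj : Function.Injective fun b : {b : ℕ // b.Coprime (M * N) ∧ b ≠ 0} => (b : ℕ) :=
    Subtype.val_injective
  rw [tsum_factored_mul_coprime hL h0, factoredSum]
  have h3 : ∑' n, coprimePart (M * N) e n =
      ∑' b : {b : ℕ // b.Coprime (M * N) ∧ b ≠ 0}, coprimePart (M * N) e b := by
    refine (hinj.tsum_eq (f := coprimePart (M * N) e) fun n hn => ?_).symm
    have hn0 : n ≠ 0 := by rintro rfl; exact hn (coprimePart_zero e)
    have hn1 : n.Coprime (M * N) := by
      by_contra h
      exact hn (if_neg h)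
    exact ⟨⟨n, hn1, hn0⟩, rfl⟩
  rw [h3, tsum_mul_tsum_of_summable_norm h1 (h2.comp_injective hinj)]
  exact tsum_congr fun y => factoredPart_mul hM e y.1.2 y.2.2.1

end

end

section

variable {k : ℕ}

/-! ### Euler factors -/

lemma norm_prod_one_sub_sub_le {ι : Type*} (I : Finset ι) {a : ι → ℂ} {b : ℝ} (hb : b ≤ 1)
    (ha : ∀ i, ‖a i‖ ≤ b) : ‖∏ i ∈ I, (1 - a i) - (1 - ∑ i ∈ I, a i)‖ ≤ 4 ^ I.card * b ^ 2 := by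
  classical
  induction I using Finset.induction_on with
  | empty => simp; positivity
  | insert i I hi ih =>
    have hb0 : 0 ≤ b := (norm_nonneg _).trans (ha i)
    rw [Finset.prod_insert hi, Finset.sum_insert hi, Finset.card_insert_of_notMem hi]
    set P := ∏ i ∈ I, (1 - a i)
    set S := ∑ i ∈ I, a i
    have hS : ‖S‖ ≤ I.card * b := by
      refine (norm_sum_le_of_le I fun i _ => ha i).trans ?_
      simp
    have h4 : (I.card : ℝ) ≤ 4 ^ I.card := by
      exact_mod_cast (Nat.lt_pow_self (by norm_num : 1 < 4)).le
    have h1 : (1 - a i) * P - (1 - (a i + S)) = (1 - a i) * (P - (1 - S)) + a i * S := by ring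
    have h2 : ‖1 - a i‖ ≤ 2 := by
      refine (norm_sub_le _ _).trans ?_
      rw [norm_one]
      linarith [ha i]
    rw [h1]
    calc _ ≤ 2 * (4 ^ I.card * b ^ 2) + b * (I.card * b) := by
          refine (norm_add_le _ _).trans (add_le_add ?_ ?_)
          · rw [norm_mul]
            exact mul_le_mul h2 ih (norm_nonneg _) (by norm_num)
          · rw [norm_mul]
            exact mul_le_mul (ha i) hS (norm_nonneg _) hb0
      _ ≤ _ := by
        rw [pow_succ (4 : ℝ)]
        nlinarith [sq_nonneg b, pow_pos (by norm_num : (0 : ℝ) < 4) I.card, mul_le_mul_of_nonneg_right h4 (sq_nonneg b)]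

/-- The inverse of the Euler factor of `∏ ζ(s_i + z_j)`. -/
def zetaFactor (e : EPoint k) (p : ℕ) : ℂ :=
  ∏ x : Fin k × Fin k, (1 - powFun (e.1 x.1) p * powFun (e.2 x.2) p)

lemma differentiable_zetaFactor (p : ℕ) : Differentiable ℂ fun e : EPoint k => zetaFactor e p := by
  intro e
  refine differentiableAt_prod _ fun x _ => ?_
  have h1 := (differentiable_powFun p (e.1 x.1)).comp e
    (by fun_prop : DifferentiableAt ℂ (fun e : EPoint k => e.1 x.1) e)
  have h2 := (differentiable_powFun p (e.2 x.2)).comp e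
    (by fun_prop : DifferentiableAt ℂ (fun e : EPoint k => e.2 x.2) e)
  exact (differentiableAt_const _).sub (h1.mul h2)

section

variable {L : ℕ} {p : ℕ} {e : EPoint k} {σ : ℝ}

lemma coprimePart_one : coprimePart L e 1 = 1 := by
  simp [coprimePart, (isMultiplicative_divFun _ _).1, thetaFun]

lemma norm_coprimePart_prime_pow_le (hp : p.Prime)
    (he : e ∈ openRegion k σ) (ν : ℕ) :
    ‖coprimePart L e (p ^ ν)‖ ≤ ((ν : ℝ) + 1) ^ (2 * k) * (((p : ℝ) ^ (-σ)) ^ 2) ^ ν := by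
  have h0 : 0 ≤ ((ν : ℝ) + 1) ^ (2 * k) * (((p : ℝ) ^ (-σ)) ^ 2) ^ ν := by positivity
  rw [coprimePart]
  split_ifs
  · rw [norm_mul, norm_mul]
    refine (mul_le_of_le_one_right (by positivity) (norm_thetaFun_le _)).trans ?_
    refine (mul_le_mul (norm_divFun_prime_pow_le (fun j => (he.1 j).le) hp ν)
      (norm_divFun_prime_pow_le (fun j => (he.2 j).le) hp ν) (norm_nonneg _)
      (by positivity)).trans (le_of_eq ?_)
    ring
  · rwa [norm_zero]

lemma sq_rpow_neg_lt_one (hp : p.Prime) (hσ : 0 < σ) : ((p : ℝ) ^ (-σ)) ^ 2 < 1 :=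
  pow_lt_one₀ (by positivity) (prime_rpow_neg_lt_one hp hσ) two_ne_zero

lemma differentiable_coprimePart (L n : ℕ) : Differentiable ℂ fun e : EPoint k => coprimePart L e n := by
  simp only [coprimePart]
  split_ifs
  · have h1 := (differentiable_divFun (k := k) Finset.univ n).comp (differentiable_fst
      (E := Fin k → ℂ) (F := Fin k → ℂ) (𝕜 := ℂ))
    have h2 := (differentiable_divFun (k := k) Finset.univ n).comp (differentiable_snd
      (E := Fin k → ℂ) (F := Fin k → ℂ) (𝕜 := ℂ))
    exact (h1.mul h2).mul_const _
  · exact differentiable_const 0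

lemma differentiableAt_localSum (L : ℕ) (hp : p.Prime) (he : e ∈ openRegion k 0) :
    DifferentiableAt ℂ (fun e : EPoint k => localSum L e p) e := by
  obtain ⟨σ, h0, -, h1⟩ := exists_mem_openRegion he one_pos
  exact differentiableAt_tsum_of_dominated (isOpen_openRegion σ)
    (summable_pow_mul_geometric (2 * k) (b := ((p : ℝ) ^ (-σ)) ^ 2) (by positivity)
      (sq_rpow_neg_lt_one hp h0)) (fun ν => differentiable_coprimePart L (p ^ ν))
    (fun ν e he => norm_coprimePart_prime_pow_le hp he ν) h1

/-- The constant in the estimate for the Euler factors. -/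
def eulerTail (k : ℕ) : ℝ := ∑' ν : ℕ, ((ν : ℝ) + 3) ^ (2 * k) * (3 / 4 : ℝ) ^ ν

lemma summable_eulerTail (k : ℕ) :
    Summable fun ν : ℕ => ((ν : ℝ) + 3) ^ (2 * k) * (3 / 4 : ℝ) ^ ν := by
  have h := (summable_pow_mul_geometric (2 * k) (b := 3 / 4) (by norm_num) (by norm_num))
  have h2 := ((summable_nat_add_iff 2).2 h).mul_left (16 / 9)
  refine h2.congr fun ν => ?_
  push_cast
  rw [pow_add (3 / 4 : ℝ), show (ν : ℝ) + 2 + 1 = ν + 3 by ring]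
  ring

lemma norm_localSum_sub_le (hp : p.Prime) (hpL : p.Coprime L) (hσ : 0 < σ)
    (hb : ((p : ℝ) ^ (-σ)) ^ 2 ≤ 3 / 4) (he : e ∈ openRegion k σ) :
    ‖localSum L e p - (1 + primeTheta p * (divFun Finset.univ e.1 p * divFun Finset.univ e.2 p))‖ ≤
      eulerTail k * (((p : ℝ) ^ (-σ)) ^ 2) ^ 2 := by
  set b := ((p : ℝ) ^ (-σ)) ^ 2
  have hb0 : 0 ≤ b := by positivity
  have hs : Summable fun ν => coprimePart L e (p ^ ν) :=
    Summable.of_norm_bounded (summable_pow_mul_geometric (2 * k) hb0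
      (sq_rpow_neg_lt_one hp hσ)) fun ν => norm_coprimePart_prime_pow_le hp he ν
  rw [localSum, ← hs.sum_add_tsum_nat_add 2]
  have h1 : ∑ ν ∈ Finset.range 2, coprimePart L e (p ^ ν) =
      1 + primeTheta p * (divFun Finset.univ e.1 p * divFun Finset.univ e.2 p) := by
    have h2 : thetaFun p = primeTheta p := by
      simpa using thetaFun_prime_pow hp one_ne_zero
    rw [Finset.sum_range_succ, Finset.sum_range_one, pow_zero, pow_one, coprimePart_one,
      coprimePart, if_pos hpL, h2]
    ring
  rw [h1, add_sub_cancel_left]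
  refine tsum_of_norm_bounded ((summable_eulerTail k).hasSum.mul_right (b ^ 2)) fun ν => ?_
  refine (norm_coprimePart_prime_pow_le hp he _).trans ?_
  push_cast
  rw [pow_add _ ν 2, show (ν : ℝ) + 2 + 1 = ν + 3 by ring, ← mul_assoc]
  gcongr

/-- The Euler factors of the quotient of `B` by `∏ ζ(s_i + z_j)` are close to `1`. -/
lemma exists_norm_localSum_mul_zetaFactor_sub_le (k : ℕ) :
    ∃ C : ℝ, ∀ (L p : ℕ) (e : EPoint k) (σ : ℝ), p.Prime → p.Coprime L → 1 / 4 < σ → σ ≤ 1 / 2 →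
      e ∈ openRegion k σ →
      ‖localSum L e p * zetaFactor e p - 1‖ ≤ C * (p : ℝ) ^ (-(4 * σ)) := by
  set T := eulerTail k
  have hT0 : 0 ≤ T := tsum_nonneg fun _ => by positivity
  set A : ℝ := (k : ℝ) ^ 2
  set W : ℝ := 4 ^ (k * k)
  have hA0 : 0 ≤ A := by positivity
  have hW0 : 0 ≤ W := by positivity
  refine ⟨A + T + W + A ^ 2 + A * W + T * A + T * W, fun L p e σ hp hpL h1 h2 he => ?_⟩
  have hp2 : (2 : ℝ) ≤ p := by exact_mod_cast hp.two_le
  have hp1 : (1 : ℝ) ≤ p := by linarith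
  set a := (p : ℝ) ^ (-σ) with ha
  set b := a ^ 2 with hb
  have ha0 : 0 ≤ a := by positivity
  have hb0 : 0 ≤ b := by positivity
  have hbp : b = (p : ℝ) ^ (-(2 * σ)) := by
    rw [hb, ha, ← Real.rpow_natCast, ← Real.rpow_mul (by positivity)]
    congr 1
    push_cast
    ring
  have hb2 : b ^ 2 = (p : ℝ) ^ (-(4 * σ)) := by
    rw [hbp, ← Real.rpow_natCast, ← Real.rpow_mul (by positivity)]
    congr 1
    push_cast
    ring
  have hbp1 : 1 / (p : ℝ) ≤ b := by
    rw [hbp, one_div, ← Real.rpow_neg_one]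
    exact Real.rpow_le_rpow_of_exponent_le hp1 (by linarith)
  have hb34 : b ≤ 3 / 4 := by
    have h3 : b ^ 2 ≤ 1 / 2 := by
      rw [hb2]
      calc (p : ℝ) ^ (-(4 * σ)) ≤ (p : ℝ) ^ (-1 : ℝ) :=
            Real.rpow_le_rpow_of_exponent_le hp1 (by linarith)
        _ = 1 / p := by rw [Real.rpow_neg_one, one_div]
        _ ≤ 1 / 2 := one_div_le_one_div_of_le (by norm_num) hp2
    nlinarith
  have hb1 : b ≤ 1 := by linarith
  have hpw1 : ∀ i, ‖powFun (e.1 i) p‖ ≤ a := fun i => norm_powFun_le (he.1 i).le p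
  have hpw2 : ∀ i, ‖powFun (e.2 i) p‖ ≤ a := fun i => norm_powFun_le (he.2 i).le p
  have hX0 : divFun Finset.univ e.1 p * divFun Finset.univ e.2 p =
      ∑ x : Fin k × Fin k, powFun (e.1 x.1) p * powFun (e.2 x.2) p := by
    rw [divFun_apply_prime _ _ hp, divFun_apply_prime _ _ hp, Finset.sum_mul_sum,
      ← Finset.univ_product_univ, Finset.sum_product]
  have hxb : ∀ x : Fin k × Fin k, ‖powFun (e.1 x.1) p * powFun (e.2 x.2) p‖ ≤ b := fun x => by
    rw [norm_mul, hb, sq]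
    exact mul_le_mul (hpw1 _) (hpw2 _) (norm_nonneg _) ha0
  have hE := norm_localSum_sub_le hp hpL (by linarith) hb34 he
  have hZ := norm_prod_one_sub_sub_le Finset.univ hb1 hxb
  rw [← hX0] at hZ
  set X := divFun Finset.univ e.1 p * divFun Finset.univ e.2 p with hX
  have hXb : ‖X‖ ≤ A * b := by
    rw [hX0]
    refine (norm_sum_le_of_le _ fun x _ => hxb x).trans (le_of_eq ?_)
    simp [A, sq]
  obtain ⟨hθ1, hθ2⟩ := primeTheta_bounds hp
  set θ := primeTheta p
  set t := localSum L e p - (1 + θ * X) with ht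
  set w := zetaFactor e p - (1 - X) with hw
  have hwW : ‖w‖ ≤ W * b ^ 2 := by
    refine hZ.trans (le_of_eq ?_)
    simp [W]
  have key : localSum L e p * zetaFactor e p - 1 =
      (θ - 1) * X + t + w - θ * X ^ 2 + θ * X * w - t * X + t * w := by
    rw [ht, hw]
    ring
  have b1 : ‖(θ - 1) * X‖ ≤ A * b ^ 2 := by
    rw [norm_mul]
    calc _ ≤ b * (A * b) := mul_le_mul (hθ2.trans hbp1) hXb (norm_nonneg _) hb0
      _ = _ := by ring
  have b2 : ‖θ * X ^ 2‖ ≤ A ^ 2 * b ^ 2 := by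
    rw [norm_mul, norm_pow]
    calc _ ≤ 1 * (A * b) ^ 2 := by gcongr
      _ = _ := by ring
  have hX1 : ‖X‖ ≤ A := hXb.trans (mul_le_of_le_one_right hA0 hb1)
  have b3 : ‖θ * X * w‖ ≤ A * W * b ^ 2 := by
    rw [norm_mul, norm_mul]
    calc _ ≤ 1 * A * (W * b ^ 2) := by gcongr
      _ = _ := by ring
  have b4 : ‖t * X‖ ≤ T * A * b ^ 2 := by
    rw [norm_mul]
    calc _ ≤ T * b ^ 2 * A := by gcongr
      _ = _ := by ring
  have b5 : ‖t * w‖ ≤ T * W * b ^ 2 := by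
    rw [norm_mul]
    calc _ ≤ T * b ^ 2 * (W * b ^ 2) := by gcongr
      _ ≤ T * b ^ 2 * (W * 1) := by
        gcongr
        exact pow_le_one₀ hb0 hb1
      _ = _ := by ring
  rw [key, ← hb2]
  have n1 := norm_add_le ((θ - 1) * X + t + w - θ * X ^ 2 + θ * X * w - t * X) (t * w)
  have n2 := norm_sub_le ((θ - 1) * X + t + w - θ * X ^ 2 + θ * X * w) (t * X)
  have n3 := norm_add_le ((θ - 1) * X + t + w - θ * X ^ 2) (θ * X * w)
  have n4 := norm_sub_le ((θ - 1) * X + t + w) (θ * X ^ 2)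
  have n5 := norm_add_le ((θ - 1) * X + t) w
  have n6 := norm_add_le ((θ - 1) * X) t
  linarith

/-- The quotient of the coprime part of `B` by `∏ ζ(s_i + z_j)`. -/
def eulerQuotient (L : ℕ) (e : EPoint k) : ℂ :=
  ∏' p : Nat.Primes, (1 + (localSum L e p * zetaFactor e p - 1))

lemma differentiableAt_eulerQuotient_and_hasProd (hL : L ≠ 0) (he : e ∈ openRegion k (1 / 4)) :
    DifferentiableAt ℂ (eulerQuotient L) e ∧
      HasProd (fun p : Nat.Primes => localSum L e p * zetaFactor e p) (eulerQuotient L e) := by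
  obtain ⟨C, hC⟩ := exists_norm_localSum_mul_zetaFactor_sub_le k
  obtain ⟨σ, h1, h2, h3⟩ := exists_mem_openRegion he (by norm_num : (1 / 4 : ℝ) < 1 / 2)
  obtain ⟨ρ, hρ, hsub⟩ := Metric.isOpen_iff.1 (isOpen_openRegion σ) e h3
  have hsub' : closedBall e (ρ / 2) ⊆ openRegion k σ :=
    (closedBall_subset_ball (by linarith)).trans hsub
  have hd : ∀ p : Nat.Primes, ∀ x ∈ closedBall e (ρ / 2), DifferentiableAt ℂ
      (fun e : EPoint k => localSum L e p * zetaFactor e p) x := by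
    intro p x hx
    have hx' := hsub' hx
    exact (differentiableAt_localSum L p.2 ⟨fun j => by linarith [hx'.1 j],
      fun j => by linarith [hx'.2 j]⟩).mul (differentiable_zetaFactor _ _)
  have hprod : HasProdUniformlyOn
      (fun (p : Nat.Primes) (e : EPoint k) => 1 + (localSum L e p * zetaFactor e p - 1))
      (eulerQuotient L) (closedBall e (ρ / 2)) := by
    refine Summable.hasProdUniformlyOn_one_add (isCompact_closedBall e (ρ / 2))
      (u := fun p : Nat.Primes => C * (p : ℝ) ^ (-(4 * σ))) ?_ ?_ ?_
    · exact ((Nat.Primes.summable_rpow).2 (by linarith)).mul_left C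
    · have hfin : {p : Nat.Primes | ¬(p : ℕ).Coprime L}.Finite := by
        refine Set.Finite.of_finite_image (f := fun p : Nat.Primes => (p : ℕ))
          ((Finset.finite_toSet L.primeFactors).subset ?_) Subtype.val_injective.injOn
        rintro _ ⟨p, hp, rfl⟩
        refine Nat.mem_primeFactors.2 ⟨p.2, ?_, hL⟩
        have hp : ¬(p : ℕ).Coprime L := hp
        rwa [Nat.Prime.coprime_iff_not_dvd p.2, not_not] at hp
      filter_upwards [hfin.compl_mem_cofinite] with p hp x hx
      exact hC L p x σ p.2 (not_not.1 hp) h1 h2 (hsub' hx)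
    · exact fun p x hx => ((hd p x hx).sub_const 1).continuousAt.continuousWithinAt
  rw [hasProdUniformlyOn_iff_tendstoUniformlyOn] at hprod
  constructor
  · refine differentiableAt_of_tendstoUniformlyOn_ball (by positivity : 0 < ρ / 2) (fun I => ?_)
      (hprod.mono ball_subset_closedBall)
    intro x hx
    refine (differentiableAt_prod _ fun p _ => ?_).differentiableWithinAt
    exact ((hd p x (ball_subset_closedBall hx)).sub_const 1).const_add 1
  · have h4 := hprod.tendsto_at (mem_closedBall_self (by positivity : 0 ≤ ρ / 2))
    simp only [add_sub_cancel] at h4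
    exact h4

/-! ### The continuation of `B` -/

lemma hasProd_zetaFactor_inv (he : e ∈ openRegion k 1) :
    HasProd (fun p : Nat.Primes => (zetaFactor e p)⁻¹)
      (∏ x : Fin k × Fin k, riemannZeta (e.1 x.1 + e.2 x.2)) := by
  simp only [zetaFactor, ← Finset.prod_inv_distrib]
  refine hasProd_prod fun x _ => ?_
  have h1 : 1 < (e.1 x.1 + e.2 x.2).re := by
    rw [Complex.add_re]
    linarith [he.1 x.1, he.2 x.2]
  refine (riemannZeta_eulerProduct_hasProd h1).congr_fun fun p => ?_
  have hp : (p : ℂ) ≠ 0 := Nat.cast_ne_zero.2 p.2.ne_zero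
  rw [powFun_apply p.2.ne_zero, powFun_apply p.2.ne_zero, one_div_mul_one_div,
    ← Complex.cpow_add _ _ hp, Complex.cpow_neg, one_div]

lemma zetaFactor_ne_zero (hp : p.Prime) (he : e ∈ openRegion k 1) : zetaFactor e p ≠ 0 := by
  refine Finset.prod_ne_zero_iff.2 fun x _ h => ?_
  have h1 := norm_powFun_le (he.1 x.1).le p
  have h2 := norm_powFun_le (he.2 x.2).le p
  have h3 := prime_rpow_neg_lt_one hp one_pos
  have h4 : ‖powFun (e.1 x.1) p * powFun (e.2 x.2) p‖ = 1 := by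
    rw [← sub_eq_zero.1 h, norm_one]
  rw [norm_mul] at h4
  nlinarith [norm_nonneg (powFun (e.1 x.1) p), norm_nonneg (powFun (e.2 x.2) p)]

lemma tsum_coprimePart (hL : L ≠ 0) (he : e ∈ openRegion k 1) :
    ∑' n, coprimePart L e n =
      eulerQuotient L e * ∏ x : Fin k × Fin k, riemannZeta (e.1 x.1 + e.2 x.2) := by
  have he' : e ∈ openRegion k (1 / 4) :=
    ⟨fun j => by linarith [he.1 j], fun j => by linarith [he.2 j]⟩
  refine HasProd.unique (hasProd_localSum L he) ?_
  refine ((differentiableAt_eulerQuotient_and_hasProd hL he').2.mul (hasProd_zetaFactor_inv he)).congr_fun fun p => ?_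
  rw [mul_assoc, mul_inv_cancel₀ (zetaFactor_ne_zero p.2 he), mul_one]

/-- The holomorphic function `B ∏ (s_i + z_j - 1)` on `Re s_i, Re z_j > 1/4`. -/
def bNumerator (M N : ℕ) (e : EPoint k) : ℂ :=
  1 / (2 * riemannZeta 2 ^ 2) * (factoredSum M N e * (eulerQuotient (M * N) e *
    ∏ x : Fin k × Fin k, zetaOne (e.1 x.1 + e.2 x.2)))

variable {M N : ℕ}

lemma differentiableOn_bNumerator (hM : M ≠ 0) (hN : N ≠ 0) :
    DifferentiableOn ℂ (bNumerator (k := k) M N) (openRegion k (1 / 4)) := by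
  intro e he
  have he' : e ∈ openRegion k 0 :=
    ⟨fun j => by linarith [he.1 j], fun j => by linarith [he.2 j]⟩
  refine (DifferentiableAt.const_mul ((differentiableAt_factoredSum hM hN he').mul
    ((differentiableAt_eulerQuotient_and_hasProd (mul_ne_zero hM hN) he).1.mul ?_)) _).differentiableWithinAt
  refine differentiableAt_prod _ fun x _ => ?_
  exact (differentiable_zetaOne _).comp e
    (by fun_prop : DifferentiableAt ℂ (fun e : EPoint k => e.1 x.1 + e.2 x.2) e)

lemma bNumerator_eq (hM : M ≠ 0) (hN : N ≠ 0) (he : e ∈ openRegion k 1) :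
    bNumerator M N e = bSeries M N e.1 e.2 * crossProd e := by
  have h1 : ∏ x : Fin k × Fin k, zetaOne (e.1 x.1 + e.2 x.2) =
      (∏ x : Fin k × Fin k, riemannZeta (e.1 x.1 + e.2 x.2)) * crossProd e := by
    rw [crossProd, ← Finset.prod_product' (f := fun i j => e.1 i + e.2 j - 1),
      Finset.univ_product_univ, ← Finset.prod_mul_distrib]
    refine Finset.prod_congr rfl fun x _ => ?_
    have h2 : e.1 x.1 + e.2 x.2 ≠ 1 := fun h => by
      have := congrArg Complex.re h
      rw [Complex.add_re, Complex.one_re] at this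
      linarith [he.1 x.1, he.2 x.2]
    rw [zetaOne_of_ne h2, mul_comm]
  have h3 : ∑' n, divFun Finset.univ e.1 n * (twistDiv M e.2 (N * n) * thetaFun (N * n)) =
      factoredSum M N e * (eulerQuotient (M * N) e *
        ∏ x : Fin k × Fin k, riemannZeta (e.1 x.1 + e.2 x.2)) := by
    rw [← tsum_coprimePart (mul_ne_zero hM hN) he, ← tsum_factoredPart hM hN he]
    rfl
  rw [bNumerator, bSeries_eq_tsum hM he.1 he.2, h3, h1]
  ring

end

end

section

variable {k : ℕ}

/-! ### Test functions in the multiplicative variable -/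

lemma exists_iteratedDeriv_comp_exp {g : ℝ → ℂ} (hs : ContDiff ℝ ∞ g) (hc : HasCompactSupport g)
    (c : ℝ) (j : ℕ) : ∃ h : ℝ → ℂ, ContDiff ℝ ∞ h ∧ HasCompactSupport h ∧
      iteratedDeriv j (fun u => g (c * Real.exp u)) = fun u => h (c * Real.exp u) := by
  induction j with
  | zero => exact ⟨g, hs, hc, by simp⟩
  | succ j ih =>
    obtain ⟨h, h1, h2, h3⟩ := ih
    refine ⟨fun x => (x : ℂ) * deriv h x, ?_, h2.deriv.mul_left, ?_⟩
    · exact (Complex.ofRealCLM.contDiff).mul (contDiff_infty_iff_deriv.1 h1).2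
    · rw [iteratedDeriv_succ, h3]
      funext u
      have hd : HasDerivAt h (deriv h (c * Real.exp u)) (c * Real.exp u) :=
        (h1.differentiable (by simp) _).hasDerivAt
      have := hd.scomp u ((Real.hasDerivAt_exp u).const_mul c)
      rw [show (fun u => h (c * Real.exp u)) = h ∘ fun u => c * Real.exp u from rfl, this.deriv]
      simp

lemma tame_comp_exp {g : ℝ → ℂ} (hs : ContDiff ℝ ∞ g) (hc : HasCompactSupport g) {c : ℝ}
    (hc0 : 0 < c) : Tame 0 fun u => g (c * Real.exp u) where
  smooth := hs.comp (contDiff_const.mul Real.contDiff_exp)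
  vanish := by
    obtain ⟨U, hU⟩ := (Tame.of_hasCompactSupport hs hc 0).vanish
    refine ⟨U / c, fun u hu => hU _ ?_⟩
    have h1 := Real.add_one_le_exp u
    rw [div_lt_iff₀ hc0] at hu
    nlinarith
  bound j := by
    obtain ⟨h, h1, h2, h3⟩ := exists_iteratedDeriv_comp_exp hs hc c j
    obtain ⟨C, hC⟩ := h2.exists_bound_of_continuous h1.continuous
    exact ⟨C, fun u => by simpa [h3] using hC (c * Real.exp u)⟩

/-- The test function `u ↦ g(e^u / Q)`. -/
def expTest (g : ℝ → ℂ) (Q : ℝ) (u : ℝ) : ℂ := g (Q⁻¹ * Real.exp u)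

lemma tame_expTest {g : ℝ → ℂ} (hs : ContDiff ℝ ∞ g) (hc : HasCompactSupport g) {Q : ℝ}
    (hQ : 0 < Q) : Tame 0 (expTest g Q) :=
  tame_comp_exp hs hc (inv_pos.2 hQ)

lemma laplace_expTest_one (g : ℝ → ℂ) (w : ℂ) : laplace (expTest g 1) w = mellin g w := by
  have h := integral_image_eq_integral_abs_deriv_smul MeasurableSet.univ
    (fun u _ => (Real.hasDerivAt_exp u).hasDerivWithinAt) Real.exp_injective.injOn
    (fun x => (x : ℂ) ^ (w - 1) • g x)
  rw [image_univ, Real.range_exp] at h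
  rw [mellin, h, setIntegral_univ, laplace]
  refine integral_congr_ae (ae_of_all _ fun u => ?_)
  have h1 : (Real.exp u : ℂ) ≠ 0 := by exact_mod_cast (Real.exp_pos u).ne'
  simp only [expTest, inv_one, one_mul, abs_of_pos (Real.exp_pos u), smul_eq_mul, Complex.real_smul]
  rw [Complex.cpow_sub _ _ h1, Complex.cpow_one, Complex.cpow_def_of_ne_zero h1,
    Complex.ofReal_exp, Complex.log_exp (by simpa using Real.pi_pos) (by simpa using Real.pi_pos.le),
    mul_comm w]
  rw [← Complex.ofReal_exp]
  field_simp

lemma laplace_expTest {g : ℝ → ℂ} {Q : ℝ} (hQ : 0 < Q) (w : ℂ) :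
    laplace (expTest g Q) w = laplace (expTest g 1) w * Complex.exp (-(w * (-Real.log Q : ℝ))) := by
  rw [← laplace_comp_add]
  congr 1
  funext u
  rw [expTest, expTest, Real.exp_add, Real.exp_neg, Real.exp_log hQ, inv_one, one_mul, mul_comm]

lemma laplace_expTest_eq_mellin {g : ℝ → ℂ} {Q : ℝ} (hQ : 0 < Q) (w : ℂ) :
    laplace (expTest g Q) w = (Q : ℂ) ^ w * mellin g w := by
  have h1 : (Q : ℂ) ≠ 0 := by exact_mod_cast hQ.ne'
  rw [laplace_expTest hQ, laplace_expTest_one, Complex.cpow_def_of_ne_zero h1,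
    Complex.ofReal_neg, Complex.ofReal_log hQ.le]
  ring_nf

section

variable {M N : ℕ} {V : Set (RPoint k)} {F : CPoint k → ℂ} {r : ℝ}

/-! ### The line integral to the left of the poles -/

lemma norm_polarFactor_ge (hr : CentralBox V r) {e : EPoint k}
    (he : e ∈ centralTube k (etaOf k r)) {w : ℂ} (hw : w.re = 2 - r) :
    (r / 2) ^ Fintype.card (EqPair k) ≤ ‖polarFactor e.1 e.2 w‖ := by
  rw [polarFactor_eq, norm_prod, ← Finset.card_univ, ← Finset.prod_const]
  refine Finset.prod_le_prod (fun _ _ => by linarith [hr.pos]) fun p _ => ?_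
  have h1 := (hr.polePt_bounds he p).1
  have h2 := Complex.abs_re_le_norm (w - polePt p e.1 e.2)
  rw [Complex.sub_re, hw] at h2
  have h3 := neg_le_abs (2 - r - (polePt p e.1 e.2).re)
  linarith

/-- Uniform decay of the integrand on the line `Re w = 2 - r`. -/
lemma exists_norm_integrand_le (hF : IsMDSContinuation k M N V F) (hr : CentralBox V r)
    {b : ℝ} {h : ℝ → ℂ} (hh : Tame b h) (hb : b < 2 - r) (B : ℝ) :
    ∃ K : ℝ, ∀ e ∈ centralTube k (etaOf k r), ‖e‖ ≤ B → ∀ t : ℝ,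
      ‖F (e.1, e.2, ((2 - r : ℝ) : ℂ) + t * Complex.I) *
        laplace h (((2 - r : ℝ) : ℂ) + t * Complex.I) /
          polarFactor e.1 e.2 (((2 - r : ℝ) : ℂ) + t * Complex.I)‖ ≤ K * (1 + t ^ 2)⁻¹ := by
  obtain ⟨C, n, hC, hbd⟩ := hF.polyBounded.exists_bound hr.subset
  obtain ⟨D, hD, hdec⟩ := hh.laplace_decay hb (2 - r) (n + 2)
  have hr2 : 0 < (r / 2) ^ Fintype.card (EqPair k) := pow_pos (by linarith [hr.pos]) _
  refine ⟨C * (1 + |B|) ^ n * D / (r / 2) ^ Fintype.card (EqPair k), fun e he hB t => ?_⟩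
  have hre : (((2 - r : ℝ) : ℂ) + t * Complex.I).re = 2 - r := by simp
  have him : (((2 - r : ℝ) : ℂ) + t * Complex.I).im = t := by simp
  have h1 := hbd e (((2 - r : ℝ) : ℂ) + t * Complex.I)
    (hr.rePt_mem he hre.ge (by rw [hre]; linarith [hr.pos]))
  have h2 := hdec (((2 - r : ℝ) : ℂ) + t * Complex.I) hre.ge hre.le
  rw [him] at h1 h2
  have h3 : ‖F (e.1, e.2, ((2 - r : ℝ) : ℂ) + t * Complex.I)‖ ≤
      C * (1 + |B|) ^ n * (1 + |t|) ^ n := by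
    refine h1.trans ?_
    gcongr
    exact hB.trans (le_abs_self B)
  have h4 := mul_laplace_le (by positivity) h3 h2
  rw [norm_div, div_le_iff₀ (hr2.trans_le (norm_polarFactor_ge hr he hre))]
  calc _ ≤ _ := h4
    _ = C * (1 + |B|) ^ n * D / (r / 2) ^ Fintype.card (EqPair k) * (1 + t ^ 2)⁻¹ *
        (r / 2) ^ Fintype.card (EqPair k) := by field_simp
    _ ≤ _ := by
      gcongr
      exact norm_polarFactor_ge hr he hre

/-- The line integral over `Re w = 2 - r`. -/
def tailInt (F : CPoint k → ℂ) (r : ℝ) (h : ℝ → ℂ) (e : EPoint k) : ℂ :=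
  vline (2 - r) fun w => F (e.1, e.2, w) * laplace h w / polarFactor e.1 e.2 w

lemma differentiable_polarFactor (w : ℂ) :
    Differentiable ℂ fun e : EPoint k => polarFactor e.1 e.2 w := by
  intro e
  simp only [polarFactor_eq]
  exact differentiableAt_prod _ fun p _ =>
    (differentiableAt_const w).sub (differentiable_polePt p e)

lemma differentiable_polarFactor_snd (e : EPoint k) :
    Differentiable ℂ fun w => polarFactor e.1 e.2 w := by
  intro w
  simp only [polarFactor_eq]
  exact differentiableAt_prod _ fun p _ => by fun_prop

lemma differentiableAt_tailInt (hF : IsMDSContinuation k M N V F) (hr : CentralBox V r)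
    {b : ℝ} {h : ℝ → ℂ} (hh : Tame b h) (hb : b < 2 - r) {e : EPoint k}
    (he : e ∈ centralTube k (etaOf k r)) : DifferentiableAt ℂ (tailInt F r h) e := by
  obtain ⟨ρ, hρ, hsub⟩ := Metric.isOpen_iff.1 (isOpen_centralTube k (etaOf k r)) e he
  obtain ⟨K, hK⟩ := exists_norm_integrand_le hF hr hh hb (‖e‖ + ρ)
  refine differentiableAt_vline hρ (fun w hw e' he' => ?_) (fun e' he' => ?_) (C := K)
    fun e' he' t => hK e' (hsub he') ?_ t
  · have h1 := differentiableAt_fst hF.isOpen hF.holomorphic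
      (hr.subset (hr.rePt_mem (hsub he') hw.ge (by linarith [hr.pos])))
    have h2 : polarFactor e'.1 e'.2 w ≠ 0 :=
      prod_sub_polePt_ne_zero hr (hsub he') (Or.inl (by linarith [hr.pos]))
    simp only [div_eq_mul_inv]
    exact ((h1.mul_const _).mul
      ((differentiable_polarFactor w e').inv h2)).differentiableWithinAt
  · have h1 := (hr.strip hF (hsub he') hh hb).1
    have h2 : StripHolo (2 - r) (2 - r)
        (fun w => F (e'.1, e'.2, w) * laplace h w / polarFactor e'.1 e'.2 w) := fun w hw hw' =>
      (h1 w hw (by linarith [hr.pos])).div (differentiable_polarFactor_snd e' w)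
        (prod_sub_polePt_ne_zero hr (hsub he') (Or.inl (by linarith [hr.pos])))
    exact h2.continuous_line le_rfl le_rfl
  · have := norm_add_le (e' - e) e
    rw [sub_add_cancel] at this
    linarith [mem_ball_iff_norm.1 he']

/-- The power saving in the line integral. -/
lemma exists_norm_tailInt_le (hF : IsMDSContinuation k M N V F) (hr : CentralBox V r)
    {g : ℝ → ℂ} (hs : ContDiff ℝ ∞ g) (hc : HasCompactSupport g) (B : ℝ) :
    ∃ K : ℝ, ∀ e ∈ centralTube k (etaOf k r), ‖e‖ ≤ B → ∀ Q : ℝ, 0 < Q →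
      ‖tailInt F r (expTest g Q) e‖ ≤ K * Q ^ (2 - r) := by
  obtain ⟨K, hK⟩ := exists_norm_integrand_le hF hr (tame_expTest hs hc one_pos)
    (by linarith [hr.le]) B
  refine ⟨K, fun e he hB Q hQ => ?_⟩
  have h1 : tailInt F r (expTest g Q) e = vline (2 - r) fun w =>
      (F (e.1, e.2, w) * laplace (expTest g 1) w / polarFactor e.1 e.2 w) *
        Complex.exp (-(w * (-Real.log Q : ℝ))) := by
    rw [tailInt]
    congr 1
    funext w
    rw [laplace_expTest hQ]
    ring
  rw [h1]
  refine (norm_vline_exp_le _ _ _).trans ?_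
  rw [mul_neg, neg_neg, Real.rpow_def_of_pos hQ, mul_comm (Real.log Q), mul_comm]
  gcongr
  exact vmass_le (hK e he hB)

/-! ### The moment as a coefficient sum -/

lemma moment_eq {g : ℝ → ℂ} (hs : ContDiff ℝ ∞ g) (hc : HasCompactSupport g) {Q : ℝ}
    (hQ : 0 < Q) (e : EPoint k) :
    moment M N g Q e.1 e.2 =
      g (1 / Q) * zetaProduct e.1 e.2 + coeffSum (coeffA M N e) (expTest g Q) := by
  obtain ⟨U, hU⟩ := (Tame.of_hasCompactSupport hs hc 0).vanish
  obtain ⟨n, hn⟩ := exists_nat_gt (U * Q)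
  have hsum : Summable fun q : ℕ+ => g ((q : ℝ) / Q) *
      ∑ χ ∈ evenPrimitive q, twistedProduct M N e.1 e.2 χ := by
    refine summable_of_ne_finset_zero (s := Finset.Icc 1 n.toPNat') fun q hq => ?_
    have h1 : n < q := by
      by_contra h
      refine hq (Finset.mem_Icc.2 ⟨one_le, ?_⟩)
      rw [← PNat.coe_le_coe, Nat.toPNat'_coe, if_pos (q.pos.trans_le (not_lt.1 h))]
      exact not_lt.1 h
    have h2 : (n : ℝ) < q := by exact_mod_cast h1
    rw [hU _ (by rw [lt_div_iff₀ hQ]; linarith), zero_mul]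
  rw [moment, hsum.tsum_eq_add_tsum_ite 1, sum_evenPrimitive_one, coeffSum]
  congr 1
  · simp
  · refine tsum_congr fun q => ?_
    rw [coeffA, expTest, Real.exp_log (by exact_mod_cast q.pos)]
    split_ifs
    · rw [zero_mul]
    · rw [mul_comm, div_eq_inv_mul]

end

end

section

variable {k : ℕ}

/-! ### The continuation of `B` and the recipe terms -/

/-- The meromorphic continuation of `B`. -/
def bCont (M N : ℕ) (s z : Fin k → ℂ) : ℂ := bNumerator M N (s, z) / crossProd (s, z)

lemma crossProd_ne_zero {e : EPoint k} (h : ∀ i j, e.1 i + e.2 j ≠ 1) : crossProd e ≠ 0 :=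
  Finset.prod_ne_zero_iff.2 fun i _ => Finset.prod_ne_zero_iff.2 fun j _ => sub_ne_zero.2 (h i j)

lemma isBContinuation_bCont {M N : ℕ} (hM : M ≠ 0) (hN : N ≠ 0) :
    IsBContinuation k M N (bCont M N) := by
  refine ⟨⟨bNumerator M N, differentiableOn_bNumerator hM hN, fun s z _ _ _ => rfl⟩,
    fun s z hs hz => ?_⟩
  have h : crossProd (s, z) ≠ 0 := crossProd_ne_zero fun i j h => by
    have := congrArg Complex.re h
    rw [Complex.add_re, Complex.one_re] at this
    linarith [hs i, hz j]
  rw [bCont, bNumerator_eq hM hN ⟨hs, hz⟩, mul_div_cancel_right₀ _ h]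

lemma recipeTerm_eq (B : (Fin k → ℂ) → (Fin k → ℂ) → ℂ) {g : ℝ → ℂ} {Q : ℝ} (hQ : 0 < Q)
    (e : EPoint k) (p : EqPair k) :
    recipeTerm B g Q e.1 e.2 p = laplace (expTest g Q) (polePt p e.1 e.2) * chiProd p e *
      B (swapE p e).1 (swapE p e).2 := by
  rw [laplace_expTest_eq_mellin hQ]
  rfl

section

variable {M N : ℕ} {V : Set (RPoint k)} {F : CPoint k → ℂ} {r : ℝ}

/-- The value of `F` at an isolated pole. -/
lemma apply_polePt_div (hF : IsMDSContinuation k M N V F) (hr : CentralBox V r) (hM : M ≠ 0)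
    (hN : N ≠ 0) {e : EPoint k} (he : e ∈ centralTube k (etaOf k r)) {p : EqPair k}
    (hp : ∀ p', p' ≠ p → polePt p' e.1 e.2 ≠ polePt p e.1 e.2) :
    F (e.1, e.2, polePt p e.1 e.2) /
        ∏ p' ∈ Finset.univ.erase p, (polePt p e.1 e.2 - polePt p' e.1 e.2) =
      chiProd p e * bCont M N (swapE p e).1 (swapE p e).2 := by
  have he' := swapE_mem_centralTube he p
  have hD : ∏ p' ∈ Finset.univ.erase p, (polePt p e.1 e.2 - polePt p' e.1 e.2) ≠ 0 :=
    Finset.prod_ne_zero_iff.2 fun p' h => sub_ne_zero.2 (hp p' (Finset.ne_of_mem_erase h)).symm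
  rw [← prod_erase_polePt_swapE] at hD ⊢
  have h2 := apply_two_mul_crossProd hF hr hM hN (differentiableOn_bNumerator hM hN)
    (fun e h1 h2 => bNumerator_eq hM hN ⟨h1, h2⟩) he'
  rw [reducedPolar] at h2
  have hcross : crossProd (swapE p e) ≠ 0 := crossProd_ne_zero fun i j hij => by
    set q : EqPair k := ⟨({i}, {j}), by simp⟩ with hq
    have hq0 : q ≠ emptyPair k := fun h => by
      have := congrArg (fun p : EqPair k => p.1.1) h
      simp [hq, emptyPair] at this
    refine hD (Finset.prod_eq_zero (i := q) (Finset.mem_erase.2 ⟨hq0, Finset.mem_univ _⟩) ?_)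
    simp only [polePt, hq, Finset.card_singleton, Finset.sum_singleton, Nat.cast_one]
    linear_combination hij
  rw [apply_polePt_eq hF hr he p, bCont, mul_div_assoc]
  congr 1
  rw [div_eq_div_iff hD hcross, h2]

lemma differentiableAt_mellin {g : ℝ → ℂ} (hs : ContDiff ℝ ∞ g) (hc : HasCompactSupport g) {w : ℂ}
    (hw : 0 < w.re) : DifferentiableAt ℂ (mellin g) w := by
  rw [← funext fun w => laplace_expTest_one g w]
  exact (tame_expTest hs hc one_pos).differentiableAt_laplace hw

/-- The residues of the continued integrand at isolated poles. -/
theorem tendsto_continuedIntegrand (hF : IsMDSContinuation k M N V F) (hr : CentralBox V r)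
    (hM : M ≠ 0) (hN : N ≠ 0) {g : ℝ → ℂ} (hs : ContDiff ℝ ∞ g) (hc : HasCompactSupport g)
    {Q : ℝ} (hQ : 0 < Q) {e : EPoint k} (he : e ∈ centralTube k (etaOf k r)) {p : EqPair k}
    (hp : ∀ p', p' ≠ p → polePt p' e.1 e.2 ≠ polePt p e.1 e.2) :
    Tendsto (fun w => (w - polePt p e.1 e.2) * continuedIntegrand F g Q e.1 e.2 w)
      (𝓝[≠] (polePt p e.1 e.2)) (𝓝 (recipeTerm (bCont M N) g Q e.1 e.2 p)) := by
  set w₀ := polePt p e.1 e.2 with hw₀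
  obtain ⟨hb1, hb2⟩ := hr.polePt_bounds he p
  set D : ℂ → ℂ := fun w => ∏ p' ∈ Finset.univ.erase p, (w - polePt p' e.1 e.2) with hD
  have hD0 : D w₀ ≠ 0 := Finset.prod_ne_zero_iff.2 fun p' h =>
    sub_ne_zero.2 (hp p' (Finset.ne_of_mem_erase h)).symm
  have hDc : ContinuousAt D w₀ :=
    (differentiableAt_prod (E := ℂ) _ fun p' _ => by fun_prop).continuousAt
  have hFc : ContinuousAt (fun w => F (e.1, e.2, w)) w₀ :=
    (differentiableAt_snd hF.isOpen hF.holomorphic (hr.subset (hr.rePt_mem he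
      (by linarith [hr.pos]) (by linarith [hr.pos])))).continuousAt
  have hmc : ContinuousAt (mellin g) w₀ :=
    (differentiableAt_mellin hs hc (by linarith [hr.le])).continuousAt
  have hQ0 : (Q : ℂ) ≠ 0 := by exact_mod_cast hQ.ne'
  have hQc : ContinuousAt (fun w => (Q : ℂ) ^ w) w₀ :=
    (differentiableAt_id.const_cpow (Or.inl hQ0)).continuousAt
  have hzc : ContinuousAt (fun w => (w - w₀) * zetaProduct e.1 e.2) w₀ := by fun_prop
  have hcont : ContinuousAt (fun w => (F (e.1, e.2, w) / D w + (w - w₀) * zetaProduct e.1 e.2) *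
      mellin g w * (Q : ℂ) ^ w) w₀ := (((hFc.div hDc hD0).add hzc).mul hmc).mul hQc
  have hval : (F (e.1, e.2, w₀) / D w₀ + (w₀ - w₀) * zetaProduct e.1 e.2) *
      mellin g w₀ * (Q : ℂ) ^ w₀ = recipeTerm (bCont M N) g Q e.1 e.2 p := by
    rw [hD, hw₀, apply_polePt_div hF hr hM hN he hp, recipeTerm_eq _ hQ,
      laplace_expTest_eq_mellin hQ]
    ring
  rw [← hval]
  refine (hcont.tendsto.mono_left nhdsWithin_le_nhds).congr' ?_
  filter_upwards [self_mem_nhdsWithin] with w hw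
  have hw' : w - w₀ ≠ 0 := sub_ne_zero.2 hw
  rw [continuedIntegrand, polarFactor_eq, ← Finset.mul_prod_erase _ _ (Finset.mem_univ p)]
  change _ = (w - w₀) * ((F (e.1, e.2, w) / ((w - w₀) * D w) + zetaProduct e.1 e.2) *
    mellin g w * (Q : ℂ) ^ w)
  have h1 : F (e.1, e.2, w) / D w = (w - w₀) * (F (e.1, e.2, w) / ((w - w₀) * D w)) := by
    rw [← mul_div_assoc, mul_div_mul_left _ _ hw']
  rw [h1]
  ring

/-! ### The sum of the recipe terms -/

/-- The holomorphic sum of all recipe terms. -/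
def recipeSum (M N : ℕ) (F : CPoint k → ℂ) (r : ℝ) (g : ℝ → ℂ) (Q : ℝ) (e : EPoint k) : ℂ :=
  coeffSum (coeffA M N e) (expTest g Q) - tailInt F r (expTest g Q) e

lemma recipeSum_eq_of_injective (hF : IsMDSContinuation k M N V F) (hr : CentralBox V r)
    (hM : M ≠ 0) (hN : N ≠ 0) {g : ℝ → ℂ} (hs : ContDiff ℝ ∞ g) (hc : HasCompactSupport g)
    {Q : ℝ} (hQ : 0 < Q) {e : EPoint k} (he : e ∈ centralTube k (etaOf k r))
    (hinj : Function.Injective fun p : EqPair k => polePt p e.1 e.2) :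
    recipeSum M N F r g Q e = ∑ p, recipeTerm (bCont M N) g Q e.1 e.2 p := by
  rw [recipeSum, tailInt, coeffSum_eq_sum_residues hF hr he (tame_expTest hs hc hQ)
    (by linarith [hr.le]) hinj]
  refine Finset.sum_congr rfl fun p _ => ?_
  rw [recipeTerm_eq _ hQ, mul_div_right_comm,
    apply_polePt_div hF hr hM hN he fun p' h => hinj.ne h]
  ring

lemma differentiableAt_recipeSum (hF : IsMDSContinuation k M N V F) (hr : CentralBox V r)
    {g : ℝ → ℂ} (hs : ContDiff ℝ ∞ g) (hc : HasCompactSupport g)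
    {Q : ℝ} (hQ : 0 < Q) {e : EPoint k} (he : e ∈ centralTube k (etaOf k r)) :
    DifferentiableAt ℂ (recipeSum M N F r g Q) e := by
  have ht := tame_expTest hs hc hQ
  obtain ⟨U, hU⟩ := ht.vanish
  exact (differentiable_coeffSum M N hU e).sub
    (differentiableAt_tailInt hF hr ht (by linarith [hr.le]) he)

/-- A direction along which the poles separate. -/
def sepDir (k : ℕ) : EPoint k := (fun j => (2 : ℂ) ^ (j : ℕ), fun j => (2 : ℂ) ^ (k + j : ℕ))

/-- The exponents in the separating direction. -/
def sepSet (p : EqPair k) : Finset ℕ :=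
  p.1.1.image (fun j : Fin k => (j : ℕ)) ∪ p.1.2.image (fun j : Fin k => k + (j : ℕ))

lemma sepSet_injective : Function.Injective (sepSet (k := k)) := by
  have h1 : ∀ (p : EqPair k) (j : Fin k), (j : ℕ) ∈ sepSet p ↔ j ∈ p.1.1 := by
    intro p j
    simp only [sepSet, Finset.mem_union, Finset.mem_image, Fin.val_inj, exists_eq_right]
    refine or_iff_left ?_
    rintro ⟨h, -, hh⟩
    omega
  have h2 : ∀ (p : EqPair k) (j : Fin k), k + (j : ℕ) ∈ sepSet p ↔ j ∈ p.1.2 := by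
    intro p j
    simp only [sepSet, Finset.mem_union, Finset.mem_image, add_right_inj, Fin.val_inj,
      exists_eq_right]
    refine or_iff_right ?_
    rintro ⟨h, -, hh⟩
    omega
  intro p q hpq
  refine Subtype.ext (Prod.ext ?_ ?_)
  · ext j
    rw [← h1, hpq, h1]
  · ext j
    rw [← h2, hpq, h2]

lemma polePt_add_smul_sepDir (p : EqPair k) (e : EPoint k) (t : ℂ) :
    polePt p (e + t • sepDir k).1 (e + t • sepDir k).2 =
      polePt p e.1 e.2 - t * ((∑ i ∈ sepSet p, 2 ^ i : ℕ) : ℂ) := by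
  have h : ((∑ i ∈ sepSet p, 2 ^ i : ℕ) : ℂ) =
      ∑ j ∈ p.1.1, (sepDir k).1 j + ∑ j ∈ p.1.2, (sepDir k).2 j := by
    rw [sepSet, Finset.sum_union, Finset.sum_image (fun _ _ _ _ h => Fin.val_injective h),
      Finset.sum_image (fun _ _ _ _ h => Fin.val_injective (Nat.add_left_cancel h))]
    · simp [sepDir]
    · rw [Finset.disjoint_left]
      intro a ha hb
      obtain ⟨i, -, rfl⟩ := Finset.mem_image.1 ha
      obtain ⟨j, -, hj⟩ := Finset.mem_image.1 hb
      omega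
  rw [h]
  simp only [polePt, Prod.fst_add, Prod.snd_add, Prod.smul_fst, Prod.smul_snd, Pi.add_apply,
    Pi.smul_apply, smul_eq_mul, Finset.sum_add_distrib, ← Finset.mul_sum]
  ring

lemma eventually_injective_polePt (e : EPoint k) : ∀ᶠ t in 𝓝[≠] (0 : ℂ),
    Function.Injective fun p => polePt p (e + t • sepDir k).1 (e + t • sepDir k).2 := by
  have h : ∀ p q : EqPair k, ∀ᶠ t in 𝓝[≠] (0 : ℂ), p ≠ q →
      polePt p (e + t • sepDir k).1 (e + t • sepDir k).2 ≠
        polePt q (e + t • sepDir k).1 (e + t • sepDir k).2 := by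
    intro p q
    by_cases hpq : p = q
    · exact Eventually.of_forall fun t h => absurd hpq h
    set A : ℂ := ((∑ i ∈ sepSet p, 2 ^ i : ℕ) : ℂ) with hA
    set B : ℂ := ((∑ i ∈ sepSet q, 2 ^ i : ℕ) : ℂ) with hB
    have hne : A - B ≠ 0 := by
      rw [sub_ne_zero, hA, hB]
      exact_mod_cast fun h => hpq (sepSet_injective (Finset.geomSum_injective le_rfl h))
    have hc : ∀ᶠ t in 𝓝[≠] (0 : ℂ), t ≠ (polePt p e.1 e.2 - polePt q e.1 e.2) / (A - B) := by
      by_cases h0 : (polePt p e.1 e.2 - polePt q e.1 e.2) / (A - B) = 0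
      · rw [h0]
        exact self_mem_nhdsWithin
      · exact Eventually.filter_mono nhdsWithin_le_nhds (eventually_ne_nhds (Ne.symm h0))
    filter_upwards [hc] with t ht _ heq
    rw [polePt_add_smul_sepDir, polePt_add_smul_sepDir] at heq
    refine ht ?_
    rw [eq_div_iff hne]
    linear_combination -heq
  filter_upwards [eventually_all.2 fun p => eventually_all.2 (h p)] with t ht p q hpq
  by_contra hne
  exact ht p q hne hpq

lemma differentiable_swapE (p : EqPair k) : Differentiable ℂ (swapE p : EPoint k → EPoint k) := by
  refine Differentiable.prodMk ?_ ?_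
  · refine differentiable_pi.2 fun i => ?_
    simp only [swapS]
    split_ifs
    · exact (differentiable_const 1).sub (differentiable_coord_snd _)
    · exact differentiable_coord_fst i
  · refine differentiable_pi.2 fun i => ?_
    simp only [swapZ]
    split_ifs
    · exact (differentiable_const 1).sub (differentiable_coord_fst _)
    · exact differentiable_coord_snd i

lemma swapE_add_ne_one {e : EPoint k} (he : NoPolarTerm e.1 e.2) (p : EqPair k) (i j : Fin k) :
    (swapE p e).1 i + (swapE p e).2 j ≠ 1 := by
  obtain ⟨h1, h2, h3⟩ := he
  simp only [swapE, swapS, swapZ]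
  split_ifs with hi hj hj
  · intro h
    exact h1 ((pairing p).symm ⟨j, hj⟩) (pairing p ⟨i, hi⟩) (by linear_combination -h)
  · intro h
    refine hj ?_
    rw [h3 (show e.2 j = e.2 (pairing p ⟨i, hi⟩) by linear_combination h)]
    exact (pairing p ⟨i, hi⟩).2
  · intro h
    refine hi ?_
    rw [h2 (show e.1 i = e.1 ((pairing p).symm ⟨j, hj⟩) by linear_combination h)]
    exact ((pairing p).symm ⟨j, hj⟩).2
  · exact h1 i j

lemma differentiableAt_chiFactor {s : ℂ} (h₀ : 0 < s.re) (h₁ : s.re < 1) :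
    DifferentiableAt ℂ chiFactor s := by
  have hpi : (Real.pi : ℂ) ≠ 0 := by exact_mod_cast Real.pi_ne_zero
  have hG : ∀ {s : ℂ}, 0 < s.re → DifferentiableAt ℂ Complex.Gamma s := fun {s} hs =>
    Complex.differentiableAt_Gamma s fun m h => by
      rw [h] at hs
      simp at hs
      linarith [(Nat.cast_nonneg m : (0 : ℝ) ≤ m)]
  have h2 : 0 < (s / 2).re := by rw [Complex.div_ofNat_re]; linarith
  have h3 : 0 < ((1 - s) / 2).re := by
    rw [Complex.div_ofNat_re, Complex.sub_re, Complex.one_re]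
    linarith
  unfold chiFactor
  refine DifferentiableAt.div (DifferentiableAt.mul ?_ ?_) ?_ (Complex.Gamma_ne_zero_of_re_pos h2)
  · exact DifferentiableAt.const_cpow (by fun_prop) (Or.inl hpi)
  · exact (hG h3).comp s (by fun_prop)
  · exact (hG h2).comp s (by fun_prop)

lemma continuousAt_recipeTerm (hr : CentralBox V r) (hM : M ≠ 0) (hN : N ≠ 0) {g : ℝ → ℂ}
    (hs : ContDiff ℝ ∞ g) (hc : HasCompactSupport g) {Q : ℝ} (hQ : 0 < Q) {e : EPoint k}
    (he : e ∈ centralTube k (etaOf k r)) (hn : NoPolarTerm e.1 e.2) (p : EqPair k) :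
    ContinuousAt (fun e : EPoint k => recipeTerm (bCont M N) g Q e.1 e.2 p) e := by
  have hη : etaOf k r ≤ 1 / 4 := by linarith [hr.etaOf_le, hr.le, hr.pos]
  have hre : ∀ {e : EPoint k}, e ∈ centralTube k (etaOf k r) → ∀ j,
      (1 / 4 < (e.1 j).re ∧ (e.1 j).re < 1) ∧ 1 / 4 < (e.2 j).re ∧ (e.2 j).re < 1 := by
    intro e he j
    have h1 := abs_lt.1 (he.1 j)
    have h2 := abs_lt.1 (he.2 j)
    exact ⟨⟨by linarith, by linarith⟩, by linarith, by linarith⟩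
  have he' := swapE_mem_centralTube he p
  simp only [recipeTerm_eq _ hQ]
  refine ContinuousAt.mul (ContinuousAt.mul ?_ ?_) ?_
  · have h1 := (tame_expTest hs hc hQ).differentiableAt_laplace (w := polePt p e.1 e.2)
      (by linarith [(hr.polePt_bounds he p).1, hr.le])
    exact ContinuousAt.comp (f := fun e : EPoint k => polePt p e.1 e.2) h1.continuousAt
      (differentiable_polePt p e).continuousAt
  · unfold chiProd
    refine DifferentiableAt.continuousAt (𝕜 := ℂ) (DifferentiableAt.mul ?_ ?_)
    · refine differentiableAt_prod _ fun j _ => ?_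
      obtain ⟨⟨h1, h2⟩, -⟩ := hre he j
      exact (differentiableAt_chiFactor (by linarith) h2).comp e (differentiable_coord_fst j e)
    · refine differentiableAt_prod _ fun j _ => ?_
      obtain ⟨-, h1, h2⟩ := hre he j
      exact (differentiableAt_chiFactor (by linarith) h2).comp e (differentiable_coord_snd j e)
  · have hmem : swapE p e ∈ openRegion k (1 / 4) :=
      ⟨fun j => (hre he' j).1.1, fun j => (hre he' j).2.1⟩
    have h1 := ((differentiableOn_bNumerator hM hN).differentiableAt
      ((isOpen_openRegion (1 / 4)).mem_nhds hmem)).continuousAt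
    have h2 : ContinuousAt (crossProd : EPoint k → ℂ) (swapE p e) :=
      (differentiable_crossProd _).continuousAt
    have h3 := h1.div h2 (crossProd_ne_zero (swapE_add_ne_one hn p))
    exact ContinuousAt.comp (f := fun e : EPoint k => swapE p e) h3
      (differentiable_swapE p e).continuousAt

theorem isRecipeSum_recipeSum (hF : IsMDSContinuation k M N V F) (hr : CentralBox V r)
    (hM : M ≠ 0) (hN : N ≠ 0) {g : ℝ → ℂ} (hs : ContDiff ℝ ∞ g) (hc : HasCompactSupport g) :
    IsRecipeSum (bCont M N) g (etaOf k r) (recipeSum M N F r g) := by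
  refine fun Q hQ => ⟨fun e he =>
    (differentiableAt_recipeSum hF hr hs hc hQ he).differentiableWithinAt, fun s z he hn => ?_⟩
  set e : EPoint k := (s, z)
  have hpath : Tendsto (fun t : ℂ => e + t • sepDir k) (𝓝[≠] 0) (𝓝 e) := by
    have : Continuous fun t : ℂ => e + t • sepDir k := by fun_prop
    have h := (this.tendsto 0).mono_left (nhdsWithin_le_nhds (s := {0}ᶜ))
    simpa using h
  have h1 := (differentiableAt_recipeSum (M := M) (N := N) hF hr hs hc hQ he).continuousAt.tendsto.comp
    hpath
  have h2 : Tendsto (fun e : EPoint k => ∑ p, recipeTerm (bCont M N) g Q e.1 e.2 p) (𝓝 e)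
      (𝓝 (∑ p, recipeTerm (bCont M N) g Q e.1 e.2 p)) :=
    tendsto_finsetSum _ fun p _ => continuousAt_recipeTerm hr hM hN hs hc hQ he hn p
  refine tendsto_nhds_unique h1 ((h2.comp hpath).congr' ?_)
  filter_upwards [eventually_injective_polePt e,
    hpath ((isOpen_centralTube k (etaOf k r)).mem_nhds he)] with t ht hmem
  exact (recipeSum_eq_of_injective hF hr hM hN hs hc hQ hmem ht).symm

/-! ### The asymptotic formula -/

lemma exists_norm_zetaProduct_le (T : ℝ) : ∃ Z : ℝ, ∀ e : EPoint k,
    (∀ j, |(e.1 j).re - 1 / 2| ≤ 1 / 4 ∧ |(e.1 j).im| ≤ T) →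
    (∀ j, |(e.2 j).re - 1 / 2| ≤ 1 / 4 ∧ |(e.2 j).im| ≤ T) → ‖zetaProduct e.1 e.2‖ ≤ Z := by
  have hcomp : IsCompact (Icc (1 / 4 : ℝ) (3 / 4) ×ℂ Icc (-T) T) :=
    isCompact_Icc.reProdIm isCompact_Icc
  have hcont : ContinuousOn riemannZeta (Icc (1 / 4 : ℝ) (3 / 4) ×ℂ Icc (-T) T) := by
    intro s hs
    refine (differentiableAt_riemannZeta fun h => ?_).continuousAt.continuousWithinAt
    have := hs.1.2
    rw [h, Complex.one_re] at this
    norm_num at this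
  obtain ⟨Z, hZ⟩ := hcomp.exists_bound_of_continuousOn hcont
  have hb : ∀ s : ℂ, |s.re - 1 / 2| ≤ 1 / 4 ∧ |s.im| ≤ T → ‖riemannZeta s‖ ≤ |Z| := by
    rintro s ⟨h1, h2⟩
    rw [abs_le] at h1 h2
    exact (hZ s ⟨⟨by linarith, by linarith⟩, h2.1, h2.2⟩).trans (le_abs_self Z)
  refine ⟨∏ _j : Fin k, |Z| * |Z|, fun e h1 h2 => ?_⟩
  rw [zetaProduct, norm_prod]
  refine Finset.prod_le_prod (fun _ _ => norm_nonneg _) fun j _ => ?_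
  rw [norm_mul]
  exact mul_le_mul (hb _ (h1 j)) (hb _ (h2 j)) (norm_nonneg _) (abs_nonneg _)

theorem exists_norm_moment_sub_le (hF : IsMDSContinuation k M N V F) (hr : CentralBox V r)
    {g : ℝ → ℂ} (hs : ContDiff ℝ ∞ g) (hc : HasCompactSupport g) (t u : Fin k → ℝ) (C : ℝ) :
    ∃ K Q₀ : ℝ, ∀ Q : ℝ, Q₀ ≤ Q → ∀ s z : Fin k → ℂ,
      (∀ j, (s j).im = t j ∧ |(s j).re - 1 / 2| ≤ C / Real.log Q) →
      (∀ j, (z j).im = u j ∧ |(z j).re - 1 / 2| ≤ C / Real.log Q) →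
      ‖moment M N g Q s z - recipeSum M N F r g Q (s, z)‖ ≤ K * Q ^ (2 - r) := by
  set T : ℝ := ‖t‖ + ‖u‖
  have htT : ∀ j, |t j| ≤ T := fun j => (norm_le_pi_norm t j).trans (by simp [T])
  have huT : ∀ j, |u j| ≤ T := fun j => (norm_le_pi_norm u j).trans (by simp [T])
  have hT0 : 0 ≤ T := by positivity
  have hη := hr.etaOf_pos
  have hη4 : etaOf k r ≤ 1 / 4 := by linarith [hr.etaOf_le, hr.le, hr.pos]
  obtain ⟨K, hK⟩ := exists_norm_tailInt_le hF hr hs hc (1 + T)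
  obtain ⟨Z, hZ⟩ := exists_norm_zetaProduct_le (k := k) T
  obtain ⟨G, hG⟩ := hc.exists_bound_of_continuous hs.continuous
  refine ⟨|G| * |Z| + K, Real.exp (|C| / etaOf k r + 1), fun Q hQ s z h1 h2 => ?_⟩
  have hQ0 : 0 < Q := (Real.exp_pos _).trans_le hQ
  have hlog : |C| / etaOf k r + 1 ≤ Real.log Q := (Real.le_log_iff_exp_le hQ0).2 hQ
  have hlog1 : 1 ≤ Real.log Q := le_trans (le_add_of_nonneg_left (by positivity)) hlog
  have hQ1 : 1 ≤ Q := by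
    by_contra h
    linarith [Real.log_nonpos hQ0.le (not_le.1 h).le]
  have hClt : C / Real.log Q < etaOf k r := by
    rw [div_lt_iff₀ (by linarith)]
    have h3 : |C| / etaOf k r < Real.log Q := by linarith
    rw [div_lt_iff₀ hη] at h3
    linarith [le_abs_self C]
  have he : ((s, z) : EPoint k) ∈ centralTube k (etaOf k r) :=
    ⟨fun j => (h1 j).2.trans_lt hClt, fun j => (h2 j).2.trans_lt hClt⟩
  have hz := hZ (s, z) (fun j => ⟨((h1 j).2.trans_lt hClt).le.trans hη4, by rw [(h1 j).1]; exact htT j⟩)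
    (fun j => ⟨((h2 j).2.trans_lt hClt).le.trans hη4, by rw [(h2 j).1]; exact huT j⟩)
  have hcoord : ∀ w : ℂ, |w.re - 1 / 2| < etaOf k r → |w.im| ≤ T → ‖w‖ ≤ 1 + T := by
    intro w h3 h4
    rw [abs_lt] at h3
    have h5 : |w.re| ≤ 1 := abs_le.2 ⟨by linarith, by linarith⟩
    linarith [Complex.norm_le_abs_re_add_abs_im w]
  have hB : ‖((s, z) : EPoint k)‖ ≤ 1 + T := by
    rw [Prod.norm_def, max_le_iff, pi_norm_le_iff_of_nonneg (by positivity),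
      pi_norm_le_iff_of_nonneg (by positivity)]
    exact ⟨fun j => hcoord _ (he.1 j) (by rw [(h1 j).1]; exact htT j),
      fun j => hcoord _ (he.2 j) (by rw [(h2 j).1]; exact huT j)⟩
  have hm := moment_eq (M := M) (N := N) hs hc hQ0 (s, z)
  have hQr : 1 ≤ Q ^ (2 - r) := Real.one_le_rpow hQ1 (by linarith [hr.le])
  rw [hm, recipeSum, add_sub_assoc, sub_sub_cancel]
  refine (norm_add_le _ _).trans ?_
  rw [add_mul]
  refine add_le_add ?_ (hK _ he hB Q hQ0)
  rw [norm_mul]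
  refine (mul_le_mul ((hG _).trans (le_abs_self G)) (hz.trans (le_abs_self Z)) (norm_nonneg _)
    (abs_nonneg _)).trans ?_
  exact le_mul_of_one_le_right (by positivity) hQr

end

end

end UnitaryMDS

end

theorem mainTheorem2 (k M N : ℕ) (hk : 1 ≤ k) (hM : 1 ≤ M) (hN : 1 ≤ N)
    (V : Set (UnitaryMDS.RPoint k)) (F : UnitaryMDS.CPoint k → ℂ)
    (hF : UnitaryMDS.IsMDSContinuation k M N V F) :
    ∃ B : (Fin k → ℂ) → (Fin k → ℂ) → ℂ, UnitaryMDS.IsBContinuation k M N B ∧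
    ∃ η : ℝ, 0 < η ∧ ∃ δ : ℝ, 0 < δ ∧
    ∀ g : ℝ → ℂ, ContDiff ℝ ∞ g → HasCompactSupport g →
      -- the residues at the simple poles are the recipe terms
      (∀ Q : ℝ, 0 < Q → ∀ s z : Fin k → ℂ, (s, z) ∈ UnitaryMDS.centralTube k η →
        ∀ p : UnitaryMDS.EqPair k,
          (∀ p' : UnitaryMDS.EqPair k, p' ≠ p →
            UnitaryMDS.polePt p' s z ≠ UnitaryMDS.polePt p s z) →
          Filter.Tendsto
            (fun w : ℂ => (w - UnitaryMDS.polePt p s z) *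
              UnitaryMDS.continuedIntegrand F g Q s z w)
            (nhdsWithin (UnitaryMDS.polePt p s z) {UnitaryMDS.polePt p s z}ᶜ)
            (nhds (UnitaryMDS.recipeTerm B g Q s z p))) ∧
      -- the recipe prediction with a power-saving error term
      ∃ R : ℝ → (Fin k → ℂ) × (Fin k → ℂ) → ℂ, UnitaryMDS.IsRecipeSum B g η R ∧
        ∀ (t u : Fin k → ℝ) (C : ℝ), ∃ K Q₀ : ℝ, ∀ Q : ℝ, Q₀ ≤ Q → ∀ s z : Fin k → ℂ,
          (∀ j, (s j).im = t j ∧ |(s j).re - 1 / 2| ≤ C / Real.log Q) →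
          (∀ j, (z j).im = u j ∧ |(z j).re - 1 / 2| ≤ C / Real.log Q) →
          ‖UnitaryMDS.moment M N g Q s z - R Q (s, z)‖ ≤ K * Q ^ (2 - δ) := by
  have hM0 : M ≠ 0 := by omega
  have hN0 : N ≠ 0 := by omega
  obtain ⟨r, hr⟩ := UnitaryMDS.exists_centralBox hF.isOpen hF.central_mem
  refine ⟨UnitaryMDS.bCont M N, UnitaryMDS.isBContinuation_bCont hM0 hN0, UnitaryMDS.etaOf k r,
    hr.etaOf_pos, r, hr.pos, fun g hs hc => ⟨fun Q hQ s z he p hp => ?_,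
      UnitaryMDS.recipeSum M N F r g, UnitaryMDS.isRecipeSum_recipeSum hF hr hM0 hN0 hs hc,
      UnitaryMDS.exists_norm_moment_sub_le hF hr hs hc⟩⟩
  exact UnitaryMDS.tendsto_continuedIntegrand hF hr hM0 hN0 hs hc hQ he hp
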